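/- Throughout, $\mathfrak g_N$ is $\mathfrak{gl}_N$, $\mathfrak o_N$ or $\mathfrak{sp}_N$ with $N\ge 2$ ($N$ even for $\mathfrak{sp}_N$). Put $i'=N-i+1$; $\varepsilon_i=1$, except that $\varepsilon_i=-1$ for $i>N/2$ if $\mathfrak g_N=\mathfrak{sp}_N$; $\varepsilon=2$ for $\mathfrak{sp}_N$ and $\varepsilon=1$ otherwise; $\kappa=N/2-1$ for $\mathfrak o_N$ and $\kappa=N/2+1$ for $\mathfrak{sp}_N$. Let $P=\sum e_{ij}\otimes e_{ji}$, $Q=\sum\varepsilon_i\varepsilon_j e_{ij}\otimes e_{i'j'}$, and $$R(u)=1-\tfrac hu P\ \ (\mathfrak{gl}_N),\qquad R(u)=1-\tfrac hu P+\tfrac{h}{u-h\kappa}Q\ \ (\mathfrak o_N,\mathfrak{sp}_N),\qquad \overline R(u)=f(u/h)R(u),$$ where $f$ is the unique series in $1+u^{-1}\mathbb C[[u^{-1}]]$ with $f(u)f(u+N)^{-1}=f(u)f(-u)=(1-u^{-2})^{-1}$ for $\mathfrak{gl}_N$, respectively in $1+u^{-2}\mathbb C[[u^{-1}]]$ with $f(u)f(u+\kappa)=f(u)f(-u)=(1-u^{-2})^{-1}$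 for $\mathfrak o_N,\mathfrak{sp}_N$. For $c\in\mathbb C$ let $\mathrm{DY}_c(\mathfrak g_N)$ be the double Yangian at level $c$: the $h$-adically completed, topologically free $\mathbb C[[h]]$-algebra generated by $t_{ij}^{(\pm r)}$ ($1\le i,j\le N$, $r\ge1$), with $T^{\pm}(u)=\sum e_{ij}\otimes t^\pm_{ij}(u)$, $t^-_{ij}(u)=\delta_{ij}+h\sum_{r\ge1}t_{ij}^{(r)}u^{-r}$, $t^+_{ij}(u)=\delta_{ij}-h\sum_{r\ge1}t_{ij}^{(-r)}u^{r-1}$, subject to the relations (with the powers of $h$ dividing them cancelled) $$R(u-v)T_1^\pm(u)T_2^\pm(v)=T_2^\pm(v)T_1^\pm(u)R(u-v),$$ $$\overline R(u-v+h\varepsilon c/2)T_1^-(u)T_2^+(v)=T_2^+(v)T_1^-(u)\overline R(u-v-h\varepsilon c/2),$$ and, for $\mathfrak o_N,\mathfrak{sp}_N$, also $T^\pm(u)T^\pm(u+h\kappa)'=1$, where $(a_{ij})'=(\varepsilon_i\varepsilon_ja_{j'i'})$. Let $\mathcal V^c(\mathfrak g_N)$, with vacuum vector $\mathbf 1$,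 be the quotient of $\mathrm{DY}_c(\mathfrak g_N)$ by the closed left ideal generated by all $t_{ij}^{(r)}$, $r\ge1$. The critical level is $c_{\rm crit}=-N$, $-N+2$, $-\frac N2-1$ for $\mathfrak{gl}_N,\mathfrak o_N,\mathfrak{sp}_N$, respectively, and $\mathcal V^{\rm crit}(\mathfrak g_N)=\mathcal V^{c_{\rm crit}}(\mathfrak g_N)$. Tensor products are $h$-adically completed, and negative powers of $z+\cdots$ are expanded in negative powers of $z$. With $T^+_{[n]}(u)=T_1^+(u_1)\cdots T_n^+(u_n)$ and $$\overline R_{nm}^{12}(u|v|z)=\prod_{i=1,\dots,n}^{\longrightarrow}\ \prod_{j=n+1,\dots,n+m}^{\longleftarrow}\overline R_{ij}(z+u_i-v_{j-n}),$$ let $\sigma(z)$ and $\rho(z)$ be the $\mathbb C[[h]]$-linear maps from $\mathcal V^c(\mathfrak g_N)\otimes\mathcal V^c(\mathfrak g_N)$ to $\mathcal V^c(\mathfrak g_N)\otimes\mathcal V^c(\mathfrak g_N)\otimes\mathbb C[[h]][z^{-1}]_h$ determined by the identities, for all $n,m$, on $(\mathrm{End}\,\mathbb C^N)^{\otimes n}\otimes(\mathrm{End}\,\mathbb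 C^N)^{\otimes m}\otimes\mathcal V^c(\mathfrak g_N)\otimes\mathcal V^c(\mathfrak g_N)$, $$\sigma(z)\big(T^{+13}_{[n]}(u)T^{+24}_{[m]}(v)(\mathbf 1\otimes\mathbf 1)\big)=\overline R^{12}_{nm}(u|v|z)\,T^{+13}_{[n]}(u)\,T^{+24}_{[m]}(v)\,\overline R^{12}_{nm}(u|v|z)^{-1}(\mathbf 1\otimes\mathbf 1),$$ $$\rho(z)\big(T^{+13}_{[n]}(u)T^{+24}_{[m]}(v)(\mathbf 1\otimes\mathbf 1)\big)=T^{+13}_{[n]}(u)\,\overline R^{12}_{nm}(u|v|z+h\varepsilon c)^{-1}\,T^{+24}_{[m]}(v)\,\overline R^{12}_{nm}(u|v|z)(\mathbf 1\otimes\mathbf 1).$$ (Here $\mathbb C[[h]][z^{-1}]_h$ consists of the series in $z^{-1}$ whose coefficients tend to $0$ $h$-adically.) For $1\le n\le N$ ($\mathfrak{gl}_N,\mathfrak o_N$), respectively $1\le n\le N/2$ ($\mathfrak{sp}_N$), let $\mathcal E_{[n]}$ be the following operator on $(\mathbb C^N)^{\otimes n}$: the anti-symmetrizer for $\mathfrak{gl}_N$;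 for $\mathfrak o_N$ (respectively $\mathfrak{sp}_N$) the image of the idempotent of the Brauer algebra $\mathcal B_n(N)$ (respectively $\mathcal B_n(-N)$) which corresponds to the one-dimensional representation $s_{ij}\mapsto1$, $\varepsilon_{ij}\mapsto0$, under the action $s_{ij}\mapsto P_{ij}$, $\varepsilon_{ij}\mapsto Q_{ij}$ (respectively $s_{ij}\mapsto-P_{ij}$, $\varepsilon_{ij}\mapsto-Q_{ij}$). Let $u_{[n]}=(u,u-h,\dots,u-(n-1)h)$ for $\mathfrak{gl}_N,\mathfrak{sp}_N$, let $u_{[n]}=(u-(n-1)h,\dots,u-h,u)$ for $\mathfrak o_N$, and put $$\mathbb T^+_{[n]}(u)=\mathrm{tr}_{1,\dots,n}\,\mathcal E_{[n]}T^+_{[n]}(u_{[n]})\mathbf 1\in\mathcal V^{\rm crit}(\mathfrak g_N)[[u]].$$ **Lemma.** (a) In $\mathcal V^{\rm crit}(\mathfrak g_N)$, for all $n$ and $m$ in the above range, $$\sigma(z)\big(\mathbb T^+_{[n]}(u)\otimes\mathbb T^+_{[m]}(v)\big)=\rho(z)\big(\mathbb T^+_{[n]}(u)\otimes\mathbb T^+_{[m]}(v)\big)=\mathbb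 T^+_{[n]}(u)\otimes\mathbb T^+_{[m]}(v).$$ (b) In $\mathcal V^{\rm crit}(\mathfrak{gl}_N)$, for all $w\in\mathcal V^{\rm crit}(\mathfrak{gl}_N)$, $$\sigma(z)\big(w\otimes\mathbb T^+_{[N]}(u)\big)=\rho(z)\big(w\otimes\mathbb T^+_{[N]}(u)\big)=w\otimes\mathbb T^+_{[N]}(u).$$ -/

import Mathlib

namespace DYang

open PowerSeries

/-! ## Types and scalars -/

/-- The three families `𝔤𝔩_N`, `𝔬_N`, `𝔰𝔭_N`. -/
inductive ClassicalType where
  | gl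
  | o
  | sp

/-- The standing restriction on the rank: `N ≥ 2`, with `N` even in the symplectic case. -/
def Admissible : ClassicalType → ℕ → Prop
  | .gl, N => 2 ≤ N
  | .o, N => 2 ≤ N
  | .sp, N => 2 ≤ N ∧ Even N

/-- `κ = N/2 - 1` for `𝔬_N` and `κ = N/2 + 1` for `𝔰𝔭_N` (not used for `𝔤𝔩_N`). -/
noncomputable def kappa : ClassicalType → ℕ → ℂ
  | .gl, _ => 0
  | .o, N => (N : ℂ) / 2 - 1
  | .sp, N => (N : ℂ) / 2 + 1

/-- The scalar `ε`, equal to `2` for `𝔰𝔭_N` and to `1` otherwise. -/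
noncomputable def epsilon : ClassicalType → ℂ
  | .gl => 1
  | .o => 1
  | .sp => 2

/-- The critical level. -/
noncomputable def critLevel : ClassicalType → ℕ → ℂ
  | .gl, N => -(N : ℂ)
  | .o, N => -(N : ℂ) + 2
  | .sp, N => -((N : ℂ) / 2) - 1

/-- The signs `ε_i` (indices are counted from zero). -/
noncomputable def sgn (g : ClassicalType) {N : ℕ} (i : Fin N) : ℂ :=
  match g with
  | .gl => 1
  | .o => 1
  | .sp => if (i : ℕ) < N / 2 then 1 else -1

/-- The ring `ℂ[[h]]`. -/
abbrev Kh : Type := PowerSeries ℂ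

/-- The formal parameter `h`. -/
noncomputable abbrev hh : Kh := PowerSeries.X

/-! ## The normalizing series `f(u)` -/


/-- `(u + a)⁻¹` as a power series in `w = u⁻¹`. -/
noncomputable def shiftInv (a : ℂ) : PowerSeries ℂ :=
  X * (1 + C a * X)⁻¹

/-- `f(u + a)` for `f = f(u)` a power series in `w = u⁻¹` (here `X` plays the role of `w`). -/
noncomputable def shiftSeries (a : ℂ) (f : PowerSeries ℂ) : PowerSeries ℂ := f.subst (shiftInv a)

/-- `f(-u)` for `f = f(u)` a power series in `w = u⁻¹`. -/
noncomputable def negSeries (f : PowerSeries ℂ) : PowerSeries ℂ := rescale (-1 : ℂ) f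

theorem shiftInv_hasSubst (a : ℂ) : HasSubst (shiftInv a) :=
  HasSubst.of_constantCoeff_zero' (by simp [shiftInv])

theorem coeff_shift (a : ℂ) (f : PowerSeries ℂ) (n : ℕ) :
    coeff n (shiftSeries a f) = ∑ k ∈ Finset.range (n+1), coeff k f * coeff n (shiftInv a ^ k) := by
  rw [shiftSeries, coeff_subst' (shiftInv_hasSubst a)]
  rw [finsum_eq_sum_of_support_subset (s := Finset.range (n+1))]
  · simp
  · intro k hk
    by_contra hk'
    apply hk
    have h1 : n < k := by simpa [Nat.lt_succ_iff] using hk'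
    have : coeff n (shiftInv a ^ k) = 0 := by
      rw [shiftInv, mul_pow, mul_comm, coeff_mul_X_pow', if_neg (by omega)]
    simp [this]

theorem coeff_shiftInv_pow_self (a : ℂ) (n : ℕ) : coeff n (shiftInv a ^ n) = 1 := by
  rw [shiftInv, mul_pow, mul_comm, coeff_mul_X_pow', if_pos le_rfl]
  simp

theorem coeff_shiftInv_pow_succ (a : ℂ) (n : ℕ) : coeff (n+1) (shiftInv a ^ n) = -(n * a) := by
  have h0 : constantCoeff ((1 + C a * X : PowerSeries ℂ)) ≠ 0 := by simp
  have h1 : coeff 1 ((1 + C a * X : PowerSeries ℂ)⁻¹) = - a := by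
    have := congrArg (coeff 1) (PowerSeries.mul_inv_cancel (1 + C a * X : PowerSeries ℂ) h0)
    rw [coeff_mul] at this
    simp [Finset.Nat.antidiagonal_succ, coeff_one] at this
    linear_combination this
  rw [shiftInv, mul_pow, mul_comm, coeff_mul_X_pow', if_pos (by omega)]
  rw [show n + 1 - n = 1 by omega, coeff_one_pow]
  rw [h1]
  rcases n with _ | n
  · simp
  · simp

theorem one_add_mul_shiftInv (a : ℂ) : shiftInv a * (1 + C a * X) = X := by
  have h0 : constantCoeff ((1 + C a * X : PowerSeries ℂ)) ≠ 0 := by simp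
  rw [shiftInv, mul_assoc, PowerSeries.inv_mul_cancel _ h0, mul_one]

theorem shift_eq_map (a : ℂ) (f : PowerSeries ℂ) :
    shiftSeries a f = substAlgHom (shiftInv_hasSubst a) f := by
  rw [coe_substAlgHom, shiftSeries]

theorem shift_mul (a : ℂ) (f g : PowerSeries ℂ) :
    shiftSeries a (f * g) = shiftSeries a f * shiftSeries a g := by
  simp [shift_eq_map]
theorem shift_one (a : ℂ) : shiftSeries a 1 = 1 := by simp [shift_eq_map]
theorem shift_X (a : ℂ) : shiftSeries a X = shiftInv a := by
  rw [shiftSeries, subst_X (shiftInv_hasSubst a)]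


theorem negSeries_mul (f g : PowerSeries ℂ) : negSeries (f * g) = negSeries f * negSeries g := by
  simp [negSeries]
theorem negSeries_one : negSeries 1 = 1 := by simp [negSeries]
theorem negSeries_X : negSeries X = -X := by simp [negSeries, rescale_X]

theorem neg_shift_neg_shift (a : ℂ) (f : PowerSeries ℂ) :
    shiftSeries a (negSeries (shiftSeries a f)) = negSeries f := by
  have hneg : ∀ g : PowerSeries ℂ, negSeries g = g.subst ((-1 : ℂ) • (X : PowerSeries ℂ)) :=
    fun g => rescale_eq_subst _ _
  have hX : HasSubst ((-1 : ℂ) • (X : PowerSeries ℂ)) := HasSubst.smul_X' _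
  have hs := shiftInv_hasSubst a
  have h0 : HasSubst (negSeries (shiftInv a)) :=
    HasSubst.of_constantCoeff_zero' (by simp [negSeries, shiftInv])
  have key : shiftSeries a (negSeries (shiftInv a)) = (-1 : ℂ) • (X : PowerSeries ℂ) := by
    have h1 : shiftSeries a (negSeries (shiftInv a * (1 + C a * X))) = shiftSeries a (negSeries X) := by
      rw [one_add_mul_shiftInv]
    have hC : C a = a • (1 : PowerSeries ℂ) := by rw [smul_eq_C_mul, mul_one]
    have h2 : shiftSeries a (negSeries (1 + C a * X)) = 1 - C a * shiftInv a := by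
      have h5 : negSeries (1 + C a * X) = 1 - a • (X : PowerSeries ℂ) := by
        rw [hC, smul_one_mul, negSeries, map_add, map_one, smul_eq_C_mul, map_mul, rescale_X]
        have h6 : rescale (-1 : ℂ) (C a) = C a := by
          ext k
          rcases k with _ | k <;> simp [coeff_rescale, coeff_C]
        rw [h6]
        simp [sub_eq_add_neg]
      rw [h5, hC, smul_one_mul, ← shift_X, shift_eq_map, shift_eq_map, map_sub, map_one, map_smul]
    rw [negSeries_mul, shift_mul, h2, negSeries_X] at h1
    have h3 : shiftSeries a (-X) = - shiftInv a := by
      rw [← shift_X]; simp [shift_eq_map]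
    rw [h3] at h1
    have h4 := one_add_mul_shiftInv a
    have hu : (1 - C a * shiftInv a : PowerSeries ℂ) ≠ 0 := by
      intro h
      have := congrArg constantCoeff h
      simp [shiftInv] at this
    apply mul_right_cancel₀ hu
    rw [h1, neg_one_smul]
    linear_combination -h4
  have e1 : negSeries (shiftSeries a f) = f.subst (negSeries (shiftInv a)) := by
    rw [hneg, shiftSeries, subst_comp_subst_apply hs hX, hneg]
  rw [e1, shiftSeries, subst_comp_subst_apply h0 hs]
  rw [shiftSeries] at key
  rw [key, hneg]

/-- Recursive solution of triangular systems. -/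
theorem exists_rec (Φ : ℕ → (ℕ → ℂ) → ℂ)
    (hΦ : ∀ k f g, (∀ j < k, f j = g j) → Φ k f = Φ k g) :
    ∃ f : ℕ → ℂ, ∀ k, f k = Φ k f := by
  let f : ℕ → ℂ := fun k => Nat.strongRec (motive := fun _ => ℂ)
    (fun k ih => Φ k (fun j => if h : j < k then ih j h else 0)) k
  refine ⟨f, fun k => ?_⟩
  have : f k = Φ k (fun j => if h : j < k then f j else 0) := by
    simp only [f]
    rw [Nat.strongRec_eq]
  rw [this]
  exact hΦ _ _ _ (fun j hj => by simp [hj])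

theorem shift_fixed (a : ℂ) (ha : a ≠ 0) (g : PowerSeries ℂ) (h : shiftSeries a g = g)
    (h1 : constantCoeff g = 1) : g = 1 := by
  have : ∀ n, coeff (n+1) g = 0 := by
    intro n
    induction n using Nat.strong_induction_on with
    | _ n ih =>
      have e := congrArg (coeff (n+2)) h
      rw [coeff_shift, Finset.sum_range_succ, Finset.sum_range_succ,
        Finset.sum_eq_zero, coeff_shiftInv_pow_self, coeff_shiftInv_pow_succ] at e
      · have : ((n+1 : ℕ) : ℂ) * a ≠ 0 := mul_ne_zero (by exact_mod_cast Nat.succ_ne_zero n) ha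
        have e' : coeff (n+1) g * (((n+1 : ℕ) : ℂ) * a) = 0 := by linear_combination -e
        exact (mul_eq_zero.mp e').resolve_right this
      · intro k hk
        rcases k with _ | k
        · simp [coeff_one]
        · rw [ih k (by simp at hk; omega)]; simp
  ext n
  rcases n with _ | n
  · simpa using h1
  · simp [this, coeff_one]

theorem const_shift (a : ℂ) (f : PowerSeries ℂ) : constantCoeff (shiftSeries a f) = constantCoeff f := by
  have := coeff_shift a f 0
  simpa using this
theorem const_neg (f : PowerSeries ℂ) : constantCoeff (negSeries f) = constantCoeff f := by
  rw [← coeff_zero_eq_constantCoeff_apply, negSeries, coeff_rescale]; simp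

theorem exists_A (a : ℂ) (ha : a ≠ 0) : ∃ f : PowerSeries ℂ, constantCoeff f = 1 ∧
    f * (1 - X ^ 2) = shiftSeries a f ∧ f * negSeries f * (1 - X ^ 2) = 1 := by
  obtain ⟨c, hc⟩ := exists_rec (fun k f => if k = 0 then 1 else
    (k * a)⁻¹ * (f (k - 1) + ∑ j ∈ Finset.range k, f j * coeff (k+1) (shiftInv a ^ j))) (by
      intro k f g hfg
      by_cases hk : k = 0
      · simp [hk]
      · simp only [hk, if_false]
        rw [hfg (k-1) (by omega), Finset.sum_congr rfl]
        intro j hj; rw [hfg j (by simpa using hj)])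
  have h1 : constantCoeff (PowerSeries.mk c) = 1 := by
    rw [← coeff_zero_eq_constantCoeff_apply, coeff_mk, hc]; simp
  have h2 : PowerSeries.mk c * (1 - X ^ 2) = shiftSeries a (PowerSeries.mk c) := by
    ext n
    rw [mul_sub, mul_one, map_sub, coeff_mul_X_pow', coeff_shift, Finset.sum_range_succ,
      coeff_shiftInv_pow_self]
    rcases n with _ | n
    · simp
    · rw [Finset.sum_range_succ, coeff_shiftInv_pow_succ]
      simp only [coeff_mk]
      rcases n with _ | n
      · simp
      · have := hc (n+1)
        simp only [Nat.succ_ne_zero, if_false, Nat.add_sub_cancel] at this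
        have hne : ((n+1 : ℕ) : ℂ) * a ≠ 0 := mul_ne_zero (by exact_mod_cast Nat.succ_ne_zero n) ha
        rw [eq_inv_mul_iff_mul_eq₀ hne] at this
        rw [if_pos (by omega), show n + 1 + 1 - 2 = n by omega]
        linear_combination this
  refine ⟨_, h1, h2, ?_⟩
  set f := PowerSeries.mk c
  apply shift_fixed a ha
  · rw [shift_mul, shift_mul, ← h2]
    have e := congrArg (fun g => shiftSeries a (negSeries g)) h2
    have e3 : negSeries (1 - X^2) = 1 - X^2 := by simp [negSeries, rescale_X]
    simp only [neg_shift_neg_shift] at e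
    rw [negSeries_mul, shift_mul, e3] at e
    linear_combination (f * (1 - X ^ 2)) * e
  · simp [const_neg, h1]

theorem sq_shift_unique (a : ℂ) (g : PowerSeries ℂ) (h : g * shiftSeries a g = 1)
    (h1 : constantCoeff g = 1) : g = 1 := by
  have : ∀ n, coeff (n+1) g = 0 := by
    intro n
    induction n using Nat.strong_induction_on with
    | _ n ih =>
      have hz : ∀ k ≤ n, k ≠ 0 → coeff k g = 0 := by
        intro k hk h0
        obtain ⟨k, rfl⟩ := Nat.exists_eq_succ_of_ne_zero h0
        exact ih k (by omega)
      have hs : ∀ m ≤ n + 1, m ≠ 0 → coeff m (shiftSeries a g) = coeff m g := by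
        intro m hm hm0
        rw [coeff_shift, Finset.sum_range_succ, coeff_shiftInv_pow_self, Finset.sum_eq_zero]
        · simp
        · intro k hk
          have hk : k < m := by simpa using hk
          rcases eq_or_ne k 0 with rfl | h0
          · simp [coeff_one, hm0]
          · rw [hz k (by omega) h0]; simp
      have e := congrArg (coeff (n+1)) h
      rw [coeff_mul, Finset.Nat.sum_antidiagonal_eq_sum_range_succ_mk, Finset.sum_range_succ,
        Finset.sum_eq_single_of_mem 0 (by simp)] at e
      · simp only [Nat.sub_zero, Nat.sub_self, coeff_zero_eq_constantCoeff_apply, h1, const_shift] at e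
        rw [hs _ le_rfl (by omega)] at e
        simp [coeff_one] at e
        exact e
      · intro k hk h0
        rw [hz k (by simp at hk; omega) h0]; simp
  ext n
  rcases n with _ | n
  · simpa using h1
  · simp [this, coeff_one]

theorem exists_B (a : ℂ) : ∃ f : PowerSeries ℂ, constantCoeff f = 1 ∧ coeff 1 f = 0 ∧
    f * shiftSeries a f * (1 - X ^ 2) = 1 ∧ f * negSeries f * (1 - X ^ 2) = 1 := by
  obtain ⟨c, hc⟩ := exists_rec (fun k f => if k = 0 then 1 else
    2⁻¹ * (coeff k ((1 - X^2 : PowerSeries ℂ)⁻¹)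
      - ∑ j ∈ Finset.range k, f j * coeff k (shiftInv a ^ j)
      - ∑ i ∈ Finset.range k, if i = 0 then 0 else
        f i * ∑ j ∈ Finset.range (k - i + 1), f j * coeff (k-i) (shiftInv a ^ j))) (by
      intro k f g hfg
      by_cases hk : k = 0
      · simp [hk]
      · simp only [hk, if_false]
        congr 2
        · rw [Finset.sum_congr rfl]
          intro j hj; rw [hfg j (by simpa using hj)]
        · apply Finset.sum_congr rfl
          intro i hi
          split_ifs with h0
          · rfl
          · have hi : i < k := by simpa using hi
            rw [hfg i hi, Finset.sum_congr rfl]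
            intro j hj
            have hj : j < k - i + 1 := by simpa using hj
            rw [hfg j (by omega)])
  have hc0 : c 0 = 1 := by rw [hc]; simp
  have h1 : constantCoeff (PowerSeries.mk c) = 1 := by
    rw [← coeff_zero_eq_constantCoeff_apply, coeff_mk, hc0]
  have hX : constantCoeff (1 - X^2 : PowerSeries ℂ) ≠ 0 := by simp
  have h2 : PowerSeries.mk c * shiftSeries a (PowerSeries.mk c) = (1 - X^2)⁻¹ := by
    ext n
    rcases n with _ | n
    · simp [const_shift, hc0]
    · have := hc (n+1)
      simp only [Nat.succ_ne_zero, if_false] at this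
      rw [coeff_mul, Finset.Nat.sum_antidiagonal_eq_sum_range_succ_mk, Finset.sum_range_succ]
      have e : ∀ i, coeff i (shiftSeries a (PowerSeries.mk c)) =
          ∑ j ∈ Finset.range (i + 1), c j * coeff i (shiftInv a ^ j) := by
        intro i; rw [coeff_shift]; simp
      simp only [e, coeff_mk]
      rw [Finset.sum_range_succ' (fun i => if i = 0 then 0 else _)] at this
      rw [Finset.sum_range_succ', Nat.sub_zero, Finset.sum_range_succ _ (n + 1),
        coeff_shiftInv_pow_self, hc0]
      simp only [Nat.succ_ne_zero, if_false, if_true, add_zero] at this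
      simp only [Nat.add_sub_add_right, Nat.sub_self, zero_add, Finset.sum_range_one, hc0] at this ⊢
      simp only [pow_zero, coeff_zero_one, mul_one, one_mul]
      rw [eq_inv_mul_iff_mul_eq₀ two_ne_zero] at this
      linear_combination this
  have h3 : PowerSeries.mk c * shiftSeries a (PowerSeries.mk c) * (1 - X^2) = 1 := by
    rw [h2, PowerSeries.inv_mul_cancel _ hX]
  set f := PowerSeries.mk c
  have e3 : negSeries (1 - X^2) = 1 - X^2 := by simp [negSeries, rescale_X]
  have hmain : negSeries f = shiftSeries a f := by
    have hp := congrArg (shiftSeries a) h3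
    have hq := congrArg (fun g => shiftSeries a (negSeries g)) h3
    rw [shift_mul, shift_mul, shift_one] at hp
    simp only [negSeries_one, shift_one] at hq
    rw [negSeries_mul, negSeries_mul, e3, shift_mul, shift_mul, neg_shift_neg_shift] at hq
    have hne : ∀ g : PowerSeries ℂ, constantCoeff g = 1 → g ≠ 0 := by
      rintro g hg rfl; simp at hg
    have hp1 : constantCoeff (shiftSeries a f) = 1 := by rw [const_shift, h1]
    have hq1 : constantCoeff (negSeries f) = 1 := by rw [const_neg, h1]
    have hpi : shiftSeries a f * (shiftSeries a f)⁻¹ = 1 := PowerSeries.mul_inv_cancel _ (by simp [hp1])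
    have hspi := congrArg (shiftSeries a) hpi
    rw [shift_mul, shift_one] at hspi
    have hr : negSeries f * (shiftSeries a f)⁻¹ = 1 := by
      apply sq_shift_unique a
      · rw [shift_mul]
        have hu : shiftSeries a (1 - X^2) ≠ 0 := hne _ (by rw [const_shift]; simp)
        have hnf := hne _ hp1
        have hnf2 : shiftSeries a (shiftSeries a f) ≠ 0 := hne _ (by rw [const_shift, hp1])
        apply mul_right_cancel₀ (mul_ne_zero (mul_ne_zero hnf hnf2) hu)
        linear_combination (negSeries f * shiftSeries a (negSeries f) * shiftSeries a (shiftSeries a f)⁻¹ * shiftSeries a (shiftSeries a f) * shiftSeries a (1 - X^2)) * hpi + (negSeries f * shiftSeries a (negSeries f) * shiftSeries a (1 - X^2)) * hspi + hq - hp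
      · simp [hq1, hp1]
    calc negSeries f = negSeries f * (shiftSeries a f)⁻¹ * shiftSeries a f := by
          rw [mul_assoc, mul_comm _ (shiftSeries a f), hpi, mul_one]
      _ = _ := by rw [hr, one_mul]
  refine ⟨f, h1, ?_, h3, by rw [hmain]; exact h3⟩
  have e := congrArg (coeff 1) h2
  have e2 : coeff 1 ((1 - X^2 : PowerSeries ℂ)⁻¹) = 0 := by
    have := congrArg (coeff 1) (PowerSeries.mul_inv_cancel _ hX)
    rw [coeff_mul] at this
    simpa [Finset.Nat.antidiagonal_succ, coeff_one, coeff_X_pow] using this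
  rw [e2, coeff_mul] at e
  simp only [Finset.Nat.antidiagonal_succ, coeff_shift, coeff_shiftInv_pow_self,
    Finset.sum_range_succ, Finset.Nat.antidiagonal_zero] at e
  have h1' : coeff 0 f = 1 := by simpa using h1
  have e4 : coeff 1 (shiftInv a ^ 1) = 1 := coeff_shiftInv_pow_self a 1
  simp [h1', coeff_one] at e
  exact e


/-- The conditions which characterize the normalizing series `f(u)`; the variable is `w = u⁻¹`. -/
def IsNormalizing (g : ClassicalType) (N : ℕ) (f : PowerSeries ℂ) : Prop :=
  match g with
  | .gl => constantCoeff f = 1 ∧ f * (shiftSeries N f)⁻¹ = (1 - X ^ 2)⁻¹ ∧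
      f * negSeries f = (1 - X ^ 2)⁻¹
  | .o => constantCoeff f = 1 ∧ coeff 1 f = 0 ∧
      f * shiftSeries (kappa .o N) f = (1 - X ^ 2)⁻¹ ∧ f * negSeries f = (1 - X ^ 2)⁻¹
  | .sp => constantCoeff f = 1 ∧ coeff 1 f = 0 ∧
      f * shiftSeries (kappa .sp N) f = (1 - X ^ 2)⁻¹ ∧ f * negSeries f = (1 - X ^ 2)⁻¹

theorem exists_isNormalizing (g : ClassicalType) (N : ℕ) (hN : N ≠ 0) :
    ∃ f, IsNormalizing g N f := by
  have hX : constantCoeff (1 - X ^ 2 : PowerSeries ℂ) ≠ 0 := by simp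
  cases g with
  | gl =>
    obtain ⟨f, h1, h2, h3⟩ := exists_A (N : ℂ) (by exact_mod_cast hN)
    refine ⟨f, h1, ?_, (PowerSeries.eq_inv_iff_mul_eq_one hX).2 h3⟩
    rw [PowerSeries.eq_inv_iff_mul_eq_one hX, ← h2, mul_right_comm]
    exact PowerSeries.mul_inv_cancel _ (by simp [h1])
  | o =>
    obtain ⟨f, h1, h2, h3, h4⟩ := exists_B (kappa .o N)
    exact ⟨f, h1, h2, (PowerSeries.eq_inv_iff_mul_eq_one hX).2 h3,
      (PowerSeries.eq_inv_iff_mul_eq_one hX).2 h4⟩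
  | sp =>
    obtain ⟨f, h1, h2, h3, h4⟩ := exists_B (kappa .sp N)
    exact ⟨f, h1, h2, (PowerSeries.eq_inv_iff_mul_eq_one hX).2 h3,
      (PowerSeries.eq_inv_iff_mul_eq_one hX).2 h4⟩

/-- The normalizing series `f(u)`, in the variable `w = u⁻¹`. -/
noncomputable def normSeries (g : ClassicalType) (N : ℕ) : PowerSeries ℂ :=
  Classical.epsilon (IsNormalizing g N)

theorem normSeries_spec (g : ClassicalType) (N : ℕ) (hN : N ≠ 0) :
    IsNormalizing g N (normSeries g N) :=
  Classical.epsilon_spec (exists_isNormalizing g N hN)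

/-! ## `R`-matrices

An element of `End ℂ^N ⊗ End ℂ^N` with coefficients in `S` is a matrix indexed by
`Fin N × Fin N`. -/

/-- `P = ∑ e_ij ⊗ e_ji`. -/
def Pmat (N : ℕ) (S : Type) [CommRing S] : Matrix (Fin N × Fin N) (Fin N × Fin N) S :=
  Matrix.of fun a b => if a.1 = b.2 ∧ a.2 = b.1 then 1 else 0

/-- `Q = ∑ ε_i ε_j e_ij ⊗ e_i'j'`, where `i' = N - i + 1`. -/
noncomputable def Qmat (g : ClassicalType) (N : ℕ) (S : Type) [CommRing S] [Algebra ℂ S] :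
    Matrix (Fin N × Fin N) (Fin N × Fin N) S :=
  Matrix.of fun a b =>
    if a.2 = a.1.rev ∧ b.2 = b.1.rev then algebraMap ℂ S (sgn g a.1 * sgn g b.1) else 0

section Rmatrices

variable {τ : Type}

/-- The constants `h` and `hκ` in a ring of formal power series over `ℂ[[h]]`. -/
noncomputable def hS (τ : Type) : MvPowerSeries τ Kh := MvPowerSeries.C hh

/-- A constant of `ℂ` times `h`. -/
noncomputable def hSc (τ : Type) (c : ℂ) : MvPowerSeries τ Kh :=
  MvPowerSeries.C (PowerSeries.C c * hh)

/-- The expansion `x (1 + x y)⁻¹` of `(x⁻¹ + y)⁻¹` in nonnegative powers of `x` and `y`. -/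
noncomputable def invSum (x y : MvPowerSeries τ Kh) : MvPowerSeries τ Kh :=
  x * Ring.inverse (1 + x * y)

/-- The `R`-matrix `R(u)`, as a function of `s = u⁻¹`:
`I - (h/u) P`, with the additional summand `h/(u - hκ) Q` for `𝔬_N` and `𝔰𝔭_N`. -/
noncomputable def Rmat (g : ClassicalType) (N : ℕ) (s : MvPowerSeries τ Kh) :
    Matrix (Fin N × Fin N) (Fin N × Fin N) (MvPowerSeries τ Kh) :=
  match g with
  | .gl => 1 - (hS τ * s) • Pmat N _
  | .o => 1 - (hS τ * s) • Pmat N _ + (hS τ * invSum s (-hSc τ (kappa .o N))) • Qmat .o N _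
  | .sp => 1 - (hS τ * s) • Pmat N _ + (hS τ * invSum s (-hSc τ (kappa .sp N))) • Qmat .sp N _

/-- The normalized `R`-matrix `f(u/h) R(u)`, as a function of `s = u⁻¹`. -/
noncomputable def Rbar (g : ClassicalType) (N : ℕ) (s : MvPowerSeries τ Kh) :
    Matrix (Fin N × Fin N) (Fin N × Fin N) (MvPowerSeries τ Kh) :=
  (PowerSeries.subst (hS τ * s) (normSeries g N)) • Rmat g N s

/-- The `R`-matrix `R(a/b)` with its denominators cleared:
`a R(a/b)` for `𝔤𝔩_N`, and `a (a - hκ b) R(a/b)` for `𝔬_N` and `𝔰𝔭_N`. -/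
noncomputable def Rnum (g : ClassicalType) (N : ℕ) (a b : MvPowerSeries τ Kh) :
    Matrix (Fin N × Fin N) (Fin N × Fin N) (MvPowerSeries τ Kh) :=
  match g with
  | .gl => a • 1 - (hS τ * b) • Pmat N _
  | .o => (a * (a - hSc τ (kappa .o N) * b)) • 1
      - (hS τ * b * (a - hSc τ (kappa .o N) * b)) • Pmat N _ + (hS τ * b * a) • Qmat .o N _
  | .sp => (a * (a - hSc τ (kappa .sp N) * b)) • 1
      - (hS τ * b * (a - hSc τ (kappa .sp N) * b)) • Pmat N _ + (hS τ * b * a) • Qmat .sp N _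

end Rmatrices

/-- The action of an element of `End ℂ^N ⊗ End ℂ^N` on the tensor factors `p` and `q` of a
tensor power of `ℂ^N` whose factors are labelled by `ι`. -/
def place {ι : Type} [Fintype ι] [DecidableEq ι] {N : ℕ} {S : Type} [CommRing S] (p q : ι)
    (M : Matrix (Fin N × Fin N) (Fin N × Fin N) S) : Matrix (ι → Fin N) (ι → Fin N) S :=
  Matrix.of fun a b =>
    if ∀ k, k ≠ p → k ≠ q → a k = b k then M (a p, a q) (b p, b q) else 0

/-! ## The double Yangian at level `c` -/

/-- The generators: `plus r i j` stands for `t_ij^(-(r+1))` and `minus r i j` for `t_ij^(r+1)`. -/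
inductive Gen (N : ℕ) : Type where
  | plus (r : ℕ) (i j : Fin N) : Gen N
  | minus (r : ℕ) (i j : Fin N) : Gen N

/-- The `h`-adically completed free `ℂ[[h]]`-algebra on the generators. -/
abbrev FreeTop (N : ℕ) : Type := PowerSeries (FreeAlgebra ℂ (Gen N))

noncomputable instance instAlgebraFreeTop (N : ℕ) : Algebra Kh (FreeTop N) :=
  (PowerSeries.map (algebraMap ℂ (FreeAlgebra ℂ (Gen N)))).toAlgebra' (by
    intro c x
    ext n
    rw [coeff_mul, coeff_mul, ← Finset.Nat.sum_antidiagonal_swap]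
    refine Finset.sum_congr rfl fun p _ => ?_
    rw [coeff_map, Prod.fst_swap, Prod.snd_swap, coeff_map]
    exact Algebra.commutes _ _)

/-- The series `t_ij^+(u + c h)` in `u`, where
`t_ij^+(u) = δ_ij - h ∑_{r ≥ 1} t_ij^(-r) u^(r-1)`; powers of `u + c h` are expanded binomially. -/
noncomputable def tPlus {N : ℕ} (c : ℂ) (i j : Fin N) : PowerSeries (FreeTop N) :=
  PowerSeries.mk fun a => (if a = 0 ∧ i = j then 1 else 0) -
    PowerSeries.mk fun d => if d = 0 then 0 else
      (((a + d - 1).choose a : ℂ) * c ^ (d - 1)) • FreeAlgebra.ι ℂ (Gen.plus (a + d - 1) i j)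

/-- The series `t_ij^-(u + c h)` in `u⁻¹`, where
`t_ij^-(u) = δ_ij + h ∑_{r ≥ 1} t_ij^(r) u^(-r)`; powers of `u + c h` are expanded in
nonnegative powers of `h`. -/
noncomputable def tMinus {N : ℕ} (c : ℂ) (i j : Fin N) : PowerSeries (FreeTop N) :=
  PowerSeries.mk fun a => (if a = 0 ∧ i = j then 1 else 0) +
    ∑ k ∈ Finset.range a, PowerSeries.monomial (k + 1)
      ((((a - 1).choose k : ℂ) * (-c) ^ k) • FreeAlgebra.ι ℂ (Gen.minus (a - 1 - k) i j))

section Relations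

variable {N : ℕ}

/-- A series in one variable regarded as a series in the variable number `k` of two variables. -/
noncomputable def inVar {A : Type} [Semiring A] (k : Fin 2) (φ : PowerSeries A) : MvPowerSeries (Fin 2) A :=
  fun d => if d = Finsupp.single k (d k) then PowerSeries.coeff (d k) φ else 0

/-- `T_1`, the matrix `T` acting in the first copy of `End ℂ^N`. -/
def leg1 {A : Type} [Zero A] (M : Fin N → Fin N → A) :
    Matrix (Fin N × Fin N) (Fin N × Fin N) A :=
  Matrix.of fun a b => if a.2 = b.2 then M a.1 b.1 else 0

/-- `T_2`, the matrix `T` acting in the second copy of `End ℂ^N`. -/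
def leg2 {A : Type} [Zero A] (M : Fin N → Fin N → A) :
    Matrix (Fin N × Fin N) (Fin N × Fin N) A :=
  Matrix.of fun a b => if a.1 = b.1 then M a.2 b.2 else 0

/-- Extension of the coefficients of a matrix from `ℂ[[h]]` to the free algebra. -/
noncomputable def liftR (M : Matrix (Fin N × Fin N) (Fin N × Fin N) (MvPowerSeries (Fin 2) Kh)) :
    Matrix (Fin N × Fin N) (Fin N × Fin N) (MvPowerSeries (Fin 2) (FreeTop N)) :=
  M.map (MvPowerSeries.map (algebraMap Kh (FreeTop N)))

/-- `T_1^+` with its argument being the first variable. -/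
noncomputable def T1p : Matrix (Fin N × Fin N) (Fin N × Fin N) (MvPowerSeries (Fin 2) (FreeTop N)) :=
  leg1 fun i j => inVar 0 (tPlus 0 i j)

/-- `T_2^+` with its argument being the second variable. -/
noncomputable def T2p : Matrix (Fin N × Fin N) (Fin N × Fin N) (MvPowerSeries (Fin 2) (FreeTop N)) :=
  leg2 fun i j => inVar 1 (tPlus 0 i j)

/-- `T_1^-` with the inverse of its argument being the first variable. -/
noncomputable def T1m : Matrix (Fin N × Fin N) (Fin N × Fin N) (MvPowerSeries (Fin 2) (FreeTop N)) :=
  leg1 fun i j => inVar 0 (tMinus 0 i j)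

/-- `T_2^-` with the inverse of its argument being the second variable. -/
noncomputable def T2m : Matrix (Fin N × Fin N) (Fin N × Fin N) (MvPowerSeries (Fin 2) (FreeTop N)) :=
  leg2 fun i j => inVar 1 (tMinus 0 i j)

/-- `R(u-v) T_1^+(u) T_2^+(v) - T_2^+(v) T_1^+(u) R(u-v)`, denominators cleared;
the variables are `u` and `v`. -/
noncomputable def relPlus (g : ClassicalType) :
    Matrix (Fin N × Fin N) (Fin N × Fin N) (MvPowerSeries (Fin 2) (FreeTop N)) :=
  let R := liftR (Rnum g N (MvPowerSeries.X 0 - MvPowerSeries.X 1) 1)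
  R * T1p * T2p - T2p * T1p * R

/-- `R(u-v) T_1^-(u) T_2^-(v) - T_2^-(v) T_1^-(u) R(u-v)`, denominators cleared;
the variables are `x = u⁻¹` and `y = v⁻¹`, so that `u - v = (y - x)/(x y)`. -/
noncomputable def relMinus (g : ClassicalType) :
    Matrix (Fin N × Fin N) (Fin N × Fin N) (MvPowerSeries (Fin 2) (FreeTop N)) :=
  let R := liftR (Rnum g N (MvPowerSeries.X 1 - MvPowerSeries.X 0)
    (MvPowerSeries.X 0 * MvPowerSeries.X 1))
  R * T1m * T2m - T2m * T1m * R

/-- `R̄(u-v+hεc/2) T_1^-(u) T_2^+(v) - T_2^+(v) T_1^-(u) R̄(u-v-hεc/2)`;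
the variables are `u⁻¹` and `v`. -/
noncomputable def relMixed (g : ClassicalType) (c : ℂ) :
    Matrix (Fin N × Fin N) (Fin N × Fin N) (MvPowerSeries (Fin 2) (FreeTop N)) :=
  liftR (Rbar g N (invSum (MvPowerSeries.X 0) (-MvPowerSeries.X 1 + hSc _ (epsilon g * c / 2))))
      * T1m * T2p -
    T2p * T1m *
      liftR (Rbar g N (invSum (MvPowerSeries.X 0) (-MvPowerSeries.X 1 - hSc _ (epsilon g * c / 2))))

/-- The entry `(i,j)` of `T^+(u) T^+(u+hκ)' - 1`, where `(A')_kj = ε_k ε_j a_j'k'`. -/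
noncomputable def relOrthPlus (g : ClassicalType) (i j : Fin N) : PowerSeries (FreeTop N) :=
  ∑ k : Fin N, (sgn g k * sgn g j) • (tPlus 0 i k * tPlus (kappa g N) j.rev k.rev) -
    if i = j then 1 else 0

/-- The entry `(i,j)` of `T^-(u) T^-(u+hκ)' - 1`. -/
noncomputable def relOrthMinus (g : ClassicalType) (i j : Fin N) : PowerSeries (FreeTop N) :=
  ∑ k : Fin N, (sgn g k * sgn g j) • (tMinus 0 i k * tMinus (kappa g N) j.rev k.rev) -
    if i = j then 1 else 0

/-- The defining relations of the double Yangian, with the central element `C` set to be `c`. -/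
inductive IsRelator (g : ClassicalType) (c : ℂ) : FreeTop N → Prop where
  | plus (a b : Fin N × Fin N) (d : Fin 2 →₀ ℕ) :
      IsRelator g c (MvPowerSeries.coeff d (relPlus g a b))
  | minus (a b : Fin N × Fin N) (d : Fin 2 →₀ ℕ) :
      IsRelator g c (MvPowerSeries.coeff d (relMinus g a b))
  | mixed (a b : Fin N × Fin N) (d : Fin 2 →₀ ℕ) :
      IsRelator g c (MvPowerSeries.coeff d (relMixed g c a b))
  | orthPlus (hg : g ≠ .gl) (i j : Fin N) (r : ℕ) :
      IsRelator g c (PowerSeries.coeff r (relOrthPlus g i j))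
  | orthMinus (hg : g ≠ .gl) (i j : Fin N) (r : ℕ) :
      IsRelator g c (PowerSeries.coeff r (relOrthMinus g i j))

end Relations

/-- A subset which is closed in the `h`-adic topology, and closed under division by `h`. The quotient
by such a submodule is `h`-adically separated and has no `h`-torsion. -/
def IsHClosed {M : Type} [AddCommGroup M] [Module Kh M] (S : Set M) : Prop :=
  (∀ x : M, (∀ n : ℕ, ∃ y ∈ S, ∃ z : M, x = y + hh ^ n • z) → x ∈ S) ∧
    ∀ x : M, hh • x ∈ S → x ∈ S

/-- The closed two-sided ideal generated by the defining relations. Since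
`t_ij^±(u) = δ_ij + O(h)`, these relations are divisible by powers of `h`, which are understood to be
cancelled, so that the double Yangian is topologically free. -/
noncomputable def relationIdeal (g : ClassicalType) (N : ℕ) (c : ℂ) : TwoSidedIdeal (FreeTop N) :=
  sInf {J | (∀ x, IsRelator g c x → x ∈ J) ∧ IsHClosed (J : Set (FreeTop N))}

/-- The double Yangian `DY_c(𝔤_N)` at the level `c`. -/
abbrev DY (g : ClassicalType) (N : ℕ) (c : ℂ) : Type := (relationIdeal g N c).ringCon.Quotient

/-- The projection of the completed free algebra to the double Yangian. -/
noncomputable def toDY (g : ClassicalType) (N : ℕ) (c : ℂ) : FreeTop N →+* DY g N c :=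
  (relationIdeal g N c).ringCon.mk'

/-- The closed left ideal of `DY_c(𝔤_N)` generated by all `t_ij^(r)` with `r ≥ 1`. -/
noncomputable def vacuumIdeal (g : ClassicalType) (N : ℕ) (c : ℂ) : Ideal (DY g N c) :=
  sInf {L | (∀ (r : ℕ) (i j : Fin N),
      toDY g N c (PowerSeries.C (FreeAlgebra.ι ℂ (Gen.minus r i j))) ∈ L) ∧
    IsHClosed (L : Set (DY g N c))}

/-- The vacuum module `𝒱^c(𝔤_N)` at the level `c`. -/
abbrev Vac (g : ClassicalType) (N : ℕ) (c : ℂ) : Type := DY g N c ⧸ vacuumIdeal g N c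

/-- The vector `x 𝟏` of the vacuum module. -/
noncomputable def toVac (g : ClassicalType) (N : ℕ) (c : ℂ) (x : FreeTop N) : Vac g N c :=
  Submodule.Quotient.mk (toDY g N c x)

/-! ## Completed tensor square and the maps `σ` and `ρ` -/

/-- The ideal `(h)` of `ℂ[[h]]`. -/
noncomputable abbrev hIdeal : Ideal Kh := Ideal.span {hh}

/-- The `h`-adically completed tensor square of the vacuum module. -/
abbrev VV (g : ClassicalType) (N : ℕ) (c : ℂ) : Type :=
  AdicCompletion hIdeal (TensorProduct Kh (Vac g N c) (Vac g N c))

/-- The element `x ⊗ y` of the completed tensor square. -/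
noncomputable def tens {g : ClassicalType} {N : ℕ} {c : ℂ} (x y : Vac g N c) : VV g N c :=
  AdicCompletion.of hIdeal _ (x ⊗ₜ[Kh] y)

/-- `W[z⁻¹]_h`: the series `∑_{r ≥ 0} a_r z^(-r)` with `a_r ∈ W` tending to zero in the `h`-adic
topology. For `W` the completed tensor square `V ⊗ V`, this is the completed tensor product
`V ⊗ V ⊗ ℂ[[h]][z⁻¹]_h`. -/
def ZSeries (W : Type) [AddCommGroup W] [Module Kh W] : Submodule Kh (ℕ → W) where
  carrier := {a | ∀ n : ℕ, ∃ r₀ : ℕ, ∀ r ≥ r₀, ∃ y : W, a r = hh ^ n • y}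
  zero_mem' := fun n => ⟨0, fun r _ => ⟨0, by simp⟩⟩
  add_mem' := by
    intro a b ha hb n
    obtain ⟨r₁, h₁⟩ := ha n
    obtain ⟨r₂, h₂⟩ := hb n
    refine ⟨max r₁ r₂, fun r hr => ?_⟩
    obtain ⟨y, hy⟩ := h₁ r (le_trans (le_max_left _ _) hr)
    obtain ⟨y', hy'⟩ := h₂ r (le_trans (le_max_right _ _) hr)
    exact ⟨y + y', by rw [Pi.add_apply, hy, hy', smul_add]⟩
  smul_mem' := by
    intro k a ha n
    obtain ⟨r₀, h₀⟩ := ha n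
    refine ⟨r₀, fun r hr => ?_⟩
    obtain ⟨y, hy⟩ := h₀ r hr
    exact ⟨k • y, by rw [Pi.smul_apply, hy, smul_comm]⟩

/-- The element `x ⊗ 1`, that is, the series which is constant in `z`. -/
def ZSeries.const {W : Type} [AddCommGroup W] [Module Kh W] (x : W) : ZSeries W :=
  ⟨fun r => if r = 0 then x else 0, fun n => ⟨1, fun r hr => ⟨0, by
    simp only [smul_zero]; exact if_neg (by omega)⟩⟩⟩

section Braiding

variable {N n m : ℕ}

/-- The variables: `none` stands for `z⁻¹`, `some (inl i)` for `u_i` and `some (inr j)` for `v_j`. -/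
abbrev Vars (n m : ℕ) : Type := Option (Fin n ⊕ Fin m)

/-- The labels of the tensor factors of `(End ℂ^N)^{⊗n} ⊗ (End ℂ^N)^{⊗m}`, as matrix indices. -/
abbrev Idx (N n m : ℕ) : Type := (Fin n ⊕ Fin m) → Fin N

/-- The inverse `(z + u_i - v_j + a h)⁻¹` of the spectral parameter, expanded in nonnegative powers
of `u_i`, `v_j` and `h`. -/
noncomputable def specInv (n m : ℕ) (a : ℂ) (i : Fin n) (j : Fin m) :
    MvPowerSeries (Vars n m) Kh :=
  invSum (MvPowerSeries.X none)
    (MvPowerSeries.X (some (Sum.inl i)) - MvPowerSeries.X (some (Sum.inr j)) + hSc _ a)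

/-- The product `R̄_nm^12(u|v|z + a h)`: the factors are ordered by increasing `i`, and for each `i` by
decreasing `j`. -/
noncomputable def Rnm (g : ClassicalType) (N n m : ℕ) (a : ℂ) :
    Matrix (Idx N n m) (Idx N n m) (MvPowerSeries (Vars n m) Kh) :=
  (List.ofFn fun i : Fin n => (List.ofFn fun j : Fin m =>
    place (Sum.inl i) (Sum.inr j) (Rbar g N (specInv n m a i j))).reverse.prod).prod

/-- The coefficient of `u_1^(d 1) ⋯ u_n^(d n)` in the matrix entry `(a,b)` of
`T_[n]^+(u) 𝟏 = T_1^+(u_1) ⋯ T_n^+(u_n) 𝟏`. -/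
noncomputable def tVec (g : ClassicalType) (N : ℕ) (c : ℂ) {n : ℕ} (a b : Fin n → Fin N)
    (d : Fin n → ℕ) : Vac g N c :=
  toVac g N c (List.ofFn fun k => PowerSeries.coeff (d k) (tPlus 0 (a k) (b k))).prod

/-- The series in `z⁻¹, u, v` (constant in `z`) with the coefficients in `V ⊗ V`, which is
the matrix entry `(a,b)` of `T_[n]^+(u) 𝟏` (for `a, b` indexing the first group of factors) tensored
with the matrix entry `(a',b')` of `T_[m]^+(v) 𝟏`. -/
noncomputable def tt (g : ClassicalType) (c : ℂ) (a b : Fin n → Fin N)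
    (a' b' : Fin m → Fin N) (d : Vars n m →₀ ℕ) : VV g N c :=
  if d none = 0 then
    tens (tVec g N c a b fun i => d (some (Sum.inl i)))
      (tVec g N c a' b' fun j => d (some (Sum.inr j)))
  else 0

/-- The product of a scalar series and a series with coefficients in a module. -/
noncomputable def serMul {W : Type} [AddCommGroup W] [Module Kh W]
    (φ : MvPowerSeries (Vars n m) Kh) (w : (Vars n m →₀ ℕ) → W) : (Vars n m →₀ ℕ) → W :=
  fun d => ∑ p ∈ Finset.HasAntidiagonal.antidiagonal d, MvPowerSeries.coeff p.1 φ • w p.2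

/-- The matrix entry `(a,b)` of `T_[n]^{+13}(u) T_[m]^{+24}(v) (𝟏 ⊗ 𝟏)`. -/
noncomputable def tTT (g : ClassicalType) (c : ℂ) (a b : Idx N n m) :
    (Vars n m →₀ ℕ) → VV g N c :=
  tt g c (a ∘ Sum.inl) (b ∘ Sum.inl) (a ∘ Sum.inr) (b ∘ Sum.inr)

/-- The matrix entry `(a,b)` of
`R̄_nm^12(u|v|z) T_[n]^{+13}(u) T_[m]^{+24}(v) R̄_nm^12(u|v|z)⁻¹ (𝟏 ⊗ 𝟏)`. -/
noncomputable def sigmaRHS (g : ClassicalType) (c : ℂ) (a b : Idx N n m) :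
    (Vars n m →₀ ℕ) → VV g N c :=
  ∑ a' : Idx N n m, ∑ b' : Idx N n m,
    serMul (Rnm g N n m 0 a a' * (Rnm g N n m 0)⁻¹ b' b) (tTT g c a' b')

/-- The matrix entry `(a,b)` of
`T_[n]^{+13}(u) R̄_nm^12(u|v|z+hεc)⁻¹ T_[m]^{+24}(v) R̄_nm^12(u|v|z) (𝟏 ⊗ 𝟏)`: here `T_[n]^{+13}` maps
the index `a = (a_1,a_2)` to `(k,a_2)`, the inverse of the `R`-matrix maps it to `(k',l)`, next
`T_[m]^{+24}` maps it to `(k',l')`, and the last `R`-matrix maps it to `b`. -/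
noncomputable def rhoRHS (g : ClassicalType) (c : ℂ) (a b : Idx N n m) :
    (Vars n m →₀ ℕ) → VV g N c :=
  ∑ k : Fin n → Fin N, ∑ k' : Fin n → Fin N, ∑ l : Fin m → Fin N, ∑ l' : Fin m → Fin N,
    serMul ((Rnm g N n m (epsilon g * c))⁻¹ (Sum.elim k (a ∘ Sum.inr)) (Sum.elim k' l) *
        Rnm g N n m 0 (Sum.elim k' l') b)
      (tt g c (a ∘ Sum.inl) k l l')

/-- The value at `T_[n]^{+13}(u) T_[m]^{+24}(v) (𝟏 ⊗ 𝟏)` of a map `φ(z)` on `V ⊗ V` (applied to the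
coefficients in `u` and `v`). -/
noncomputable def applyTT {g : ClassicalType} {c : ℂ} (φ : VV g N c →ₗ[Kh] ZSeries (VV g N c))
    (a b : Idx N n m) : (Vars n m →₀ ℕ) → VV g N c :=
  fun d => (φ (tTT g c a b (d.erase none)) : ℕ → VV g N c) (d none)

end Braiding

/-- The identities which define the map `σ(z)`. -/
def IsSigma (g : ClassicalType) (N : ℕ) (c : ℂ)
    (σ : VV g N c →ₗ[Kh] ZSeries (VV g N c)) : Prop :=
  ∀ (n m : ℕ) (a b : Idx N n m), applyTT σ a b = sigmaRHS g c a b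

/-- The identities which define the map `ρ(z)`. -/
def IsRho (g : ClassicalType) (N : ℕ) (c : ℂ)
    (ρ : VV g N c →ₗ[Kh] ZSeries (VV g N c)) : Prop :=
  ∀ (n m : ℕ) (a b : Idx N n m), applyTT ρ a b = rhoRHS g c a b

/-! ## The fused generators -/

/-- The anti-symmetrizer `(1/n!) ∑_p sgn(p) p` on `(ℂ^N)^{⊗n}`. -/
noncomputable def antisymmetrizer (N n : ℕ) : Matrix (Fin n → Fin N) (Fin n → Fin N) ℂ :=
  (n.factorial : ℂ)⁻¹ • ∑ p : Equiv.Perm (Fin n),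
    ((Equiv.Perm.sign p : ℤ) : ℂ) • Matrix.of fun a b => if a = b ∘ p then 1 else 0

/-- The sign with which the Brauer algebra generators `s_ij`, `ε_ij` act by `P_ij`, `Q_ij`:
`1` for the parameter `N` (orthogonal case) and `-1` for the parameter `-N` (symplectic case). -/
def brauerSign : ClassicalType → ℂ
  | .gl => 1
  | .o => 1
  | .sp => -1

/-- The image of `s_ij` on `(ℂ^N)^{⊗n}`. -/
def brauerS (g : ClassicalType) (N : ℕ) {n : ℕ} (i j : Fin n) :
    Matrix (Fin n → Fin N) (Fin n → Fin N) ℂ :=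
  brauerSign g • place i j (Pmat N ℂ)

/-- The image of `ε_ij` on `(ℂ^N)^{⊗n}`. -/
noncomputable def brauerE (g : ClassicalType) (N : ℕ) {n : ℕ} (i j : Fin n) :
    Matrix (Fin n → Fin N) (Fin n → Fin N) ℂ :=
  brauerSign g • place i j (Qmat g N ℂ)

/-- The action on `(ℂ^N)^{⊗n}` of the idempotent of the Brauer algebra corresponding to its
one-dimensional representation `s_ij ↦ 1`, `ε_ij ↦ 0`: the nonzero idempotent `E` in the image of the
Brauer algebra which satisfies `s_ij E = E s_ij = E` and `ε_ij E = E ε_ij = 0`. There is at most one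
such operator, as `x E = χ(x) E = E x` for `x` in the image and a scalar `χ(x)`. -/
def IsBrauerIdempotent (g : ClassicalType) (N n : ℕ)
    (E : Matrix (Fin n → Fin N) (Fin n → Fin N) ℂ) : Prop :=
  E ∈ Algebra.adjoin ℂ {x | ∃ i j : Fin n, i < j ∧ (x = brauerS g N i j ∨ x = brauerE g N i j)} ∧
  E ≠ 0 ∧ E * E = E ∧
  ∀ i j : Fin n, i < j → brauerS g N i j * E = E ∧ E * brauerS g N i j = E ∧
    brauerE g N i j * E = 0 ∧ E * brauerE g N i j = 0

/-- The idempotent `ℰ_[n]`. -/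
noncomputable def fusionIdem (g : ClassicalType) (N n : ℕ) :
    Matrix (Fin n → Fin N) (Fin n → Fin N) ℂ :=
  match g with
  | .gl => antisymmetrizer N n
  | .o => Classical.epsilon (IsBrauerIdempotent .o N n)
  | .sp => Classical.epsilon (IsBrauerIdempotent .sp N n)

/-- The number `a_k` such that the `k`-th entry (`k` counted from zero) of the tuple `u_[n]` is
`u + a_k h`. -/
def fusionShift (g : ClassicalType) {n : ℕ} (k : Fin n) : ℂ :=
  match g with
  | .gl => -(k : ℕ)
  | .o => -((n - 1 - (k : ℕ) : ℕ) : ℂ)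
  | .sp => -(k : ℕ)

/-- The largest `n` for which the fused generators are considered. -/
def maxFusion : ClassicalType → ℕ → ℕ
  | .gl, N => N
  | .o, N => N
  | .sp, N => N / 2

/-- The coefficient of `u^r` in the series
`𝕋_[n]^+(u) = tr_{1,…,n} ℰ_[n] T_[n]^+(u_[n]) 𝟏`. -/
noncomputable def fusedGen (g : ClassicalType) (N : ℕ) (c : ℂ) (n r : ℕ) : Vac g N c :=
  toVac g N c (PowerSeries.coeff r (∑ a : Fin n → Fin N, ∑ b : Fin n → Fin N,
    fusionIdem g N n a b • (List.ofFn fun k => tPlus (fusionShift g k) (b k) (a k)).prod))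

end DYang

set_option linter.unusedSectionVars false

namespace DYang


/-! ## Operators on tensor powers -/

section Legs

variable {ι : Type} [Fintype ι] [DecidableEq ι] {N : ℕ}

/-! Put θ = 1 for 𝔬_N and θ = -1 for 𝔤𝔩_N and 𝔰𝔭_N, so that consecutive entries of u_[n] differ by
θh. Call Y fused if Y P = θY and Y Q = 0 for the operators P, Q in each pair of neighbouring tensor
factors. Then Y absorbs the idempotent, Y ℰ = Y, and ℰ itself is fused (`IsFusedAll.mul_fusionIdem`,
`fusionIdem_isFusedAll`). Two objects preserve the fused condition. For T⁺_[n](u_[n]) this is the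
RTT relation at arguments differing by θh, where the R-matrix becomes a multiple of a projection
(`fuseTwo_mul_tDY`, `isFusedAll_prod_tDY`). For R̄_nm at fused arguments it is a computation with
the Brauer relations of three tensor factors (`isFused_mul_pair`, `isFusedAll_mul_Rnm_left`,
`isFusedAll_mul_Rnm_right`). Hence ℰT = ℰTℰ and ℰR̄ = ℰR̄ℰ: all these matrices are block triangular
with respect to ℰ.

Part (a) for σ. The map σ conjugates by R̄_nm. Conjugation of a block triangular matrix by a block
triangular one does not change the trace of the diagonal block (`trace_block_conj`), and the trace
of that block is 𝕋_[n] ⊗ 𝕋_[m]. The level plays no role here.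

Both parts for ρ. At the critical level the partial transposes of R̄(z) and of R̄(z + hεc)⁻¹ are
inverse to each other (`transposeFirst_Rbar_mul`, `crossed_Rnm`). Under the partial trace over the
fused second group the two R-matrices in ρ may be brought together cyclically, and crossing cancels
them (`trace_sum_crossed`). The first group need not be fused, so ρ fixes t⁺⋯t⁺𝟏 ⊗ 𝕋_[m]. Such
vectors generate a dense submodule (`hClosure_plusVectors`), and so ρ fixes w ⊗ 𝕋_[m] for every w.

Part (b) for σ. On the top exterior power the product of R-matrices telescopes to a scalar, because
N + 1 vectors of ℂ^N are dependent (`onRight_mul_Rnm_top`). Conjugation by a scalar is trivial, and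
density again gives all w.

The substitution u_i ↦ u + a_i h is performed modulo h^K, where the shifts are nilpotent, after a
linear map from the module of coefficients to a commutative algebra (`exists_squareZero`).
Separatedness returns from all K to the original modules. Absence of h-torsion allows division by h.
-/

theorem sum_agree_off_two {β : Type} [AddCommMonoid β] {p q : ι} (hpq : p ≠ q) (a : ι → Fin N)
    (f : (ι → Fin N) → β) :
    (∑ c, if ∀ k, k ≠ p → k ≠ q → a k = c k then f c else 0) =
      ∑ x : Fin N × Fin N, f (Function.update (Function.update a p x.1) q x.2) := by
  rw [← Finset.sum_filter]
  refine Finset.sum_bij' (fun c _ => (c p, c q))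
    (fun x _ => Function.update (Function.update a p x.1) q x.2) ?_ ?_ ?_ ?_ ?_
  · simp
  · intro x _
    simp only [Finset.mem_filter, Finset.mem_univ, true_and]
    intro k hp hq
    simp [hp, hq]
  · intro c hc
    simp only [Finset.mem_filter, Finset.mem_univ, true_and] at hc
    ext k
    by_cases hq : k = q
    · subst hq; simp
    by_cases hp : k = p
    · subst hp; simp [hq]
    simp [hp, hq, hc k hp hq]
  · intro x _
    simp [hpq]
  · intro c hc
    simp only [Finset.mem_filter, Finset.mem_univ, true_and] at hc
    congr 1
    ext k
    by_cases hq : k = q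
    · subst hq; simp
    by_cases hp : k = p
    · subst hp; simp [hq]
    simp [hp, hq, hc k hp hq]

theorem sum_agree_off_one {β : Type} [AddCommMonoid β] (p : ι) (a : ι → Fin N)
    (f : (ι → Fin N) → β) :
    (∑ c, if ∀ k, k ≠ p → a k = c k then f c else 0) =
      ∑ x : Fin N, f (Function.update a p x) := by
  rw [← Finset.sum_filter]
  refine Finset.sum_bij' (fun c _ => c p) (fun x _ => Function.update a p x) ?_ ?_ ?_ ?_ ?_
  · simp
  · intro x _
    simp only [Finset.mem_filter, Finset.mem_univ, true_and]
    intro k hp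
    simp [hp]
  · intro c hc
    simp only [Finset.mem_filter, Finset.mem_univ, true_and] at hc
    ext k
    by_cases hp : k = p
    · subst hp; simp
    simp [hp, hc k hp]
  · simp
  · intro c hc
    simp only [Finset.mem_filter, Finset.mem_univ, true_and] at hc
    congr 1
    ext k
    by_cases hp : k = p
    · subst hp; simp
    simp [hp, hc k hp]

variable {R : Type} [Semiring R]

/-- The operator `place` over a possibly noncommutative ring. -/
def twoLeg (p q : ι) (M : Matrix (Fin N × Fin N) (Fin N × Fin N) R) :
    Matrix (ι → Fin N) (ι → Fin N) R :=
  Matrix.of fun a b =>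
    if ∀ k, k ≠ p → k ≠ q → a k = b k then M (a p, a q) (b p, b q) else 0

/-- The action of a matrix on the tensor factor `p`. -/
def oneLeg (p : ι) (L : Matrix (Fin N) (Fin N) R) : Matrix (ι → Fin N) (ι → Fin N) R :=
  Matrix.of fun a b => if ∀ k, k ≠ p → a k = b k then L (a p) (b p) else 0

theorem place_eq_twoLeg {S : Type} [CommRing S] (p q : ι)
    (M : Matrix (Fin N × Fin N) (Fin N × Fin N) S) : place p q M = twoLeg p q M := rfl

theorem twoLeg_mul_apply {p q : ι} (hpq : p ≠ q)
    (M : Matrix (Fin N × Fin N) (Fin N × Fin N) R) (X : Matrix (ι → Fin N) (ι → Fin N) R)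
    (a b : ι → Fin N) :
    (twoLeg p q M * X) a b = ∑ x : Fin N × Fin N,
      M (a p, a q) x * X (Function.update (Function.update a p x.1) q x.2) b := by
  rw [Matrix.mul_apply]
  simp only [twoLeg, Matrix.of_apply, ite_mul, zero_mul]
  rw [sum_agree_off_two hpq a (fun c => M (a p, a q) (c p, c q) * X c b)]
  refine Finset.sum_congr rfl fun x _ => ?_
  simp [hpq]

theorem oneLeg_mul_apply (p : ι) (L : Matrix (Fin N) (Fin N) R)
    (X : Matrix (ι → Fin N) (ι → Fin N) R) (a b : ι → Fin N) :
    (oneLeg p L * X) a b = ∑ x : Fin N, L (a p) x * X (Function.update a p x) b := by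
  rw [Matrix.mul_apply]
  simp only [oneLeg, Matrix.of_apply, ite_mul, zero_mul]
  rw [sum_agree_off_one p a (fun c => L (a p) (c p) * X c b)]
  refine Finset.sum_congr rfl fun x _ => ?_
  simp

theorem twoLeg_mul {p q : ι} (hpq : p ≠ q) (M M' : Matrix (Fin N × Fin N) (Fin N × Fin N) R) :
    twoLeg p q M * twoLeg p q M' = twoLeg p q (M * M') := by
  ext a b
  rw [twoLeg_mul_apply hpq]
  simp only [twoLeg, Matrix.of_apply]
  by_cases h : ∀ k, k ≠ p → k ≠ q → a k = b k
  · rw [if_pos h, Matrix.mul_apply]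
    refine Finset.sum_congr rfl fun x _ => ?_
    rw [if_pos]
    · simp [hpq]
    · intro k hp hq; simp [hp, hq, h k hp hq]
  · rw [if_neg h]
    refine Finset.sum_eq_zero fun x _ => ?_
    rw [if_neg, mul_zero]
    intro h'
    apply h
    intro k hp hq
    have := h' k hp hq
    simpa [hp, hq] using this

theorem oneLeg_mul (p : ι) (L L' : Matrix (Fin N) (Fin N) R) :
    (oneLeg p L * oneLeg p L' : Matrix (ι → Fin N) (ι → Fin N) R) = oneLeg p (L * L') := by
  ext a b
  rw [oneLeg_mul_apply]
  simp only [oneLeg, Matrix.of_apply]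
  by_cases h : ∀ k, k ≠ p → a k = b k
  · rw [if_pos h, Matrix.mul_apply]
    refine Finset.sum_congr rfl fun x _ => ?_
    rw [if_pos]
    · simp
    · intro k hp; simp [hp, h k hp]
  · rw [if_neg h]
    refine Finset.sum_eq_zero fun x _ => ?_
    rw [if_neg, mul_zero]
    intro h'
    apply h
    intro k hp
    simpa [hp] using h' k hp

theorem twoLeg_one (p q : ι) :
    twoLeg p q (1 : Matrix (Fin N × Fin N) (Fin N × Fin N) R) = 1 := by
  ext a b
  simp only [twoLeg, Matrix.of_apply, Matrix.one_apply, Prod.mk.injEq]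
  by_cases h : a = b
  · subst h; simp
  · rw [if_neg h]
    split_ifs with h1 h2
    · exfalso; apply h; ext k
      by_cases hp : k = p
      · rw [hp, h2.1]
      by_cases hq : k = q
      · rw [hq, h2.2]
      rw [h1 k hp hq]
    · rfl
    · rfl

theorem twoLeg_add (p q : ι) (M M' : Matrix (Fin N × Fin N) (Fin N × Fin N) R) :
    twoLeg p q (M + M') = twoLeg p q M + twoLeg p q M' := by
  ext a b
  simp only [twoLeg, Matrix.of_apply, Matrix.add_apply]
  split_ifs <;> simp

theorem twoLeg_smul {S : Type} [Monoid S] [DistribMulAction S R] (p q : ι) (c : S)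
    (M : Matrix (Fin N × Fin N) (Fin N × Fin N) R) :
    twoLeg p q (c • M) = c • twoLeg p q M := by
  ext a b
  simp only [twoLeg, Matrix.of_apply, Matrix.smul_apply]
  split_ifs <;> simp

theorem twoLeg_zero (p q : ι) :
    twoLeg p q (0 : Matrix (Fin N × Fin N) (Fin N × Fin N) R) = 0 := by
  ext a b
  simp [twoLeg]

theorem twoLeg_map {R' : Type} [Semiring R'] (f : R →+* R') (p q : ι)
    (M : Matrix (Fin N × Fin N) (Fin N × Fin N) R) :
    (twoLeg p q M).map f = twoLeg p q (M.map f) := by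
  ext a b
  simp only [twoLeg, Matrix.of_apply, Matrix.map_apply]
  split_ifs <;> simp

theorem twoLeg_leg1 {p q : ι} (hpq : p ≠ q) (L : Matrix (Fin N) (Fin N) R) :
    twoLeg p q (leg1 L) = oneLeg p L := by
  ext a b
  simp only [twoLeg, oneLeg, leg1, Matrix.of_apply]
  by_cases h : ∀ k, k ≠ p → a k = b k
  · rw [if_pos h, if_pos (fun k hp _ => h k hp), if_pos (h q hpq.symm)]
  · rw [if_neg h]
    split_ifs with h1 h2
    · exfalso; apply h
      intro k hp
      by_cases hq : k = q
      · rw [hq, h2]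
      · exact h1 k hp hq
    · rfl
    · rfl

theorem twoLeg_leg2 {p q : ι} (hpq : p ≠ q) (L : Matrix (Fin N) (Fin N) R) :
    twoLeg p q (leg2 L) = oneLeg q L := by
  ext a b
  simp only [twoLeg, oneLeg, leg2, Matrix.of_apply]
  by_cases h : ∀ k, k ≠ q → a k = b k
  · rw [if_pos h, if_pos (fun k _ hq => h k hq), if_pos (h p hpq)]
  · rw [if_neg h]
    split_ifs with h1 h2
    · exfalso; apply h
      intro k hq
      by_cases hp : k = p
      · rw [hp, h2]
      · exact h1 k hp hq
    · rfl
    · rfl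

/-- A product of operators on different tensor factors. -/
theorem list_prod_oneLeg (T : ι → Matrix (Fin N) (Fin N) R) (l : List ι) (hl : l.Nodup)
    (a b : ι → Fin N) :
    (l.map fun k => oneLeg k (T k)).prod a b =
      if ∀ k, k ∉ l → a k = b k then (l.map fun k => T k (a k) (b k)).prod else 0 := by
  induction l generalizing a with
  | nil =>
    simp only [List.map_nil, List.prod_nil, Matrix.one_apply, List.not_mem_nil, not_false_eq_true,
      true_implies, funext_iff]
  | cons k l ih =>
    rw [List.nodup_cons] at hl
    rw [List.map_cons, List.prod_cons, oneLeg_mul_apply]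
    simp_rw [ih hl.2]
    by_cases h : ∀ j, j ∉ k :: l → a j = b j
    · rw [if_pos h, Finset.sum_eq_single (b k)]
      · rw [if_pos, List.map_cons, List.prod_cons]
        · congr 2
          refine List.map_congr_left fun j hj => ?_
          have : j ≠ k := by rintro rfl; exact hl.1 hj
          simp [this]
        · intro j hj
          by_cases hjk : j = k
          · subst hjk; simp
          · simp [hjk, h j (by simp [hjk, hj])]
      · intro x _ hx
        rw [if_neg, mul_zero]
        intro h'
        exact hx (by simpa using h' k hl.1)
      · simp
    · rw [if_neg h]
      refine Finset.sum_eq_zero fun x _ => ?_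
      rw [if_neg, mul_zero]
      intro h'
      apply h
      intro j hj
      rw [List.mem_cons, not_or] at hj
      simpa [hj.1] using h' j hj.2

theorem prod_oneLeg_apply {n : ℕ} (T : Fin n → Matrix (Fin N) (Fin N) R) (a b : Fin n → Fin N) :
    (List.ofFn fun k => oneLeg k (T k)).prod a b =
      (List.ofFn fun k => T k (a k) (b k)).prod := by
  rw [List.ofFn_eq_map, list_prod_oneLeg T _ (List.nodup_finRange n), if_pos (by simp),
    List.ofFn_eq_map]

theorem mul_twoLeg_apply {p q : ι} (hpq : p ≠ q)
    (M : Matrix (Fin N × Fin N) (Fin N × Fin N) R) (X : Matrix (ι → Fin N) (ι → Fin N) R)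
    (a b : ι → Fin N) :
    (X * twoLeg p q M) a b = ∑ x : Fin N × Fin N,
      X a (Function.update (Function.update b p x.1) q x.2) * M x (b p, b q) := by
  rw [Matrix.mul_apply]
  simp only [twoLeg, Matrix.of_apply, mul_ite, mul_zero]
  have := sum_agree_off_two hpq b (fun c => X a c * M (c p, c q) (b p, b q))
  simp only [eq_comm (a := b _)] at this
  rw [this]
  refine Finset.sum_congr rfl fun x _ => ?_
  simp [hpq]

/-- Operators with commuting entries on disjoint tensor factors commute. -/
theorem twoLeg_oneLeg_comm {p q r : ι} (hpq : p ≠ q) (hp : r ≠ p) (hq : r ≠ q)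
    (M : Matrix (Fin N × Fin N) (Fin N × Fin N) R) (L : Matrix (Fin N) (Fin N) R)
    (hc : ∀ x y i j, Commute (M x y) (L i j)) :
    Commute (twoLeg p q M) (oneLeg r L) := by
  show _ = _
  ext a b
  rw [twoLeg_mul_apply hpq, mul_twoLeg_apply hpq]
  simp only [oneLeg, Matrix.of_apply]
  by_cases h : ∀ k, k ≠ p → k ≠ q → k ≠ r → a k = b k
  · rw [Finset.sum_eq_single (b p, b q), Finset.sum_eq_single (a p, a q), if_pos, if_pos]
    · simp only [Function.update_of_ne hp, Function.update_of_ne hq]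
      exact hc _ _ _ _
    · intro k hk
      by_cases h1 : k = q
      · subst h1; simp
      by_cases h2 : k = p
      · subst h2; simp [h1]
      simp [h1, h2, h k h2 h1 hk]
    · intro k hk
      by_cases h1 : k = q
      · subst h1; simp
      by_cases h2 : k = p
      · subst h2; simp [h1]
      simp [h1, h2, h k h2 h1 hk]
    · intro x _ hx
      rw [if_neg, zero_mul]
      intro h'
      apply hx
      have e1 := h' p (Ne.symm hp)
      have e2 := h' q (Ne.symm hq)
      rw [Function.update_of_ne hpq, Function.update_self] at e1
      rw [Function.update_self] at e2
      rw [e1, e2]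
    · simp
    · intro x _ hx
      rw [if_neg, mul_zero]
      intro h'
      apply hx
      have e1 := h' p (Ne.symm hp)
      have e2 := h' q (Ne.symm hq)
      rw [Function.update_of_ne hpq, Function.update_self] at e1
      rw [Function.update_self] at e2
      rw [← e1, ← e2]
    · simp
  · rw [Finset.sum_eq_zero, Finset.sum_eq_zero]
    · intro x _
      rw [if_neg, zero_mul]
      intro h'
      apply h
      intro k h1 h2 h3
      simpa [h1, h2] using h' k h3
    · intro x _
      rw [if_neg, mul_zero]
      intro h'
      apply h
      intro k h1 h2 h3
      simpa [h1, h2] using h' k h3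

/-- The operator permuting the tensor factors. -/
def permMat (N : ℕ) (R : Type) [Semiring R] (σ : Equiv.Perm ι) :
    Matrix (ι → Fin N) (ι → Fin N) R :=
  Matrix.of fun a b => if a = b ∘ σ then 1 else 0

theorem permMat_mul_apply (σ : Equiv.Perm ι) (X : Matrix (ι → Fin N) (ι → Fin N) R)
    (a b : ι → Fin N) : (permMat N R σ * X) a b = X (a ∘ σ.symm) b := by
  rw [Matrix.mul_apply, Finset.sum_eq_single (a ∘ σ.symm)]
  · rw [permMat, Matrix.of_apply, if_pos, one_mul]
    ext k; simp
  · intro c _ hc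
    rw [permMat, Matrix.of_apply, if_neg, zero_mul]
    rintro rfl
    apply hc
    ext k; simp
  · simp

theorem mul_permMat_apply (σ : Equiv.Perm ι) (X : Matrix (ι → Fin N) (ι → Fin N) R)
    (a b : ι → Fin N) : (X * permMat N R σ) a b = X a (b ∘ σ) := by
  rw [Matrix.mul_apply, Finset.sum_eq_single (b ∘ σ)]
  · rw [permMat, Matrix.of_apply, if_pos rfl, mul_one]
  · intro c _ hc
    rw [permMat, Matrix.of_apply, if_neg hc, mul_zero]
  · simp

theorem permMat_mul (σ τ : Equiv.Perm ι) :
    permMat N R σ * permMat N R τ = permMat N R (τ * σ) := by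
  ext a b
  rw [mul_permMat_apply]
  simp only [permMat, Matrix.of_apply, Equiv.Perm.coe_mul]
  congr 1

theorem permMat_one : permMat N R (1 : Equiv.Perm ι) = 1 := by
  ext a b
  simp [permMat, Matrix.one_apply]

/-- Conjugation by a permutation only relabels the tensor factors. Most of the Brauer relations
below are instances of this. -/
theorem permMat_twoLeg (σ : Equiv.Perm ι) (r s : ι)
    (M : Matrix (Fin N × Fin N) (Fin N × Fin N) R) :
    permMat N R σ * twoLeg r s M = twoLeg (σ.symm r) (σ.symm s) M * permMat N R σ := by
  ext a b
  rw [permMat_mul_apply, mul_permMat_apply]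
  simp only [twoLeg, Matrix.of_apply, Function.comp_apply, Equiv.apply_symm_apply]
  congr 1
  apply propext
  constructor
  · intro h k h1 h2
    have := h (σ k) (fun e => h1 (by simp [← e])) (fun e => h2 (by simp [← e]))
    simpa using this
  · intro h k h1 h2
    have := h (σ.symm k) (by simpa using h1) (by simpa using h2)
    simpa using this

end Legs

/-! ### Relations between the operators `P` and `Q` -/

section Brauer

variable {ι : Type} [Fintype ι] [DecidableEq ι] {N : ℕ} {S : Type} [CommRing S]

theorem twoLeg_Pmat {p q : ι} (hpq : p ≠ q) :
    twoLeg p q (Pmat N S) = permMat N S (Equiv.swap p q) := by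
  ext a b
  simp only [twoLeg, permMat, Pmat, Matrix.of_apply, ← ite_and]
  congr 1
  apply propext
  constructor
  · rintro ⟨h, h1, h2⟩
    ext k
    by_cases hp : k = p
    · subst hp; simp [h1]
    by_cases hq : k = q
    · subst hq; simp [h2]
    simp [Equiv.swap_apply_of_ne_of_ne hp hq, h k hp hq]
  · rintro rfl
    simp only [Function.comp_apply, Equiv.swap_apply_left, Equiv.swap_apply_right, and_self,
      and_true]
    intro k hp hq
    rw [Equiv.swap_apply_of_ne_of_ne hp hq]

theorem sgn_mul_self (g : ClassicalType) {N : ℕ} (i : Fin N) : sgn g i * sgn g i = 1 := by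
  cases g <;> simp [sgn]
  split_ifs <;> simp

/-- The sign by which the permutation operator acts on the fused subspace. -/
def theta : ClassicalType → ℤ
  | .gl => -1
  | .o => 1
  | .sp => -1

theorem theta_mul_self (g : ClassicalType) : theta g * theta g = 1 := by
  cases g <;> simp [theta]

/-- The operator `Q`, taken to be zero for `𝔤𝔩_N`. -/
noncomputable def Qop (g : ClassicalType) (N : ℕ) (S : Type) [CommRing S] [Algebra ℂ S] :
    Matrix (Fin N × Fin N) (Fin N × Fin N) S :=
  match g with
  | .gl => 0
  | .o => Qmat .o N S
  | .sp => Qmat .sp N S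

/-- The bilinear form behind Q is symmetric for 𝔬_N and skew for 𝔰𝔭_N: reversal interchanges the two
halves of the index range, where the signs differ in the second case. -/
theorem sgn_rev {g : ClassicalType} {N : ℕ} (hN : Admissible g N) (hg : g ≠ .gl) (i : Fin N) :
    sgn g i.rev = theta g * sgn g i := by
  cases g with
  | gl => exact absurd rfl hg
  | o => simp [sgn, theta]
  | sp =>
    obtain ⟨-, k, hk⟩ := hN
    have hi := i.2
    simp only [sgn, theta, Fin.val_rev]
    by_cases h : (i : ℕ) < N / 2
    · rw [if_pos h, if_neg (by omega)]; simp
    · rw [if_neg h, if_pos (by omega)]; simp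

variable [Algebra ℂ S]

theorem twoLeg_Qop_symm {g : ClassicalType} (hN : Admissible g N) (p q : ι) :
    twoLeg p q (Qop g N S) = twoLeg q p (Qop g N S) := by
  have key : ∀ g', g' ≠ .gl → Admissible g' N →
      (twoLeg p q (Qmat g' N S) : Matrix (ι → Fin N) (ι → Fin N) S) = twoLeg q p (Qmat g' N S) := by
    intro g' hg hN
    ext a b
    simp only [twoLeg, Matrix.of_apply, Qmat]
    have e : (∀ k, k ≠ p → k ≠ q → a k = b k) ↔ ∀ k, k ≠ q → k ≠ p → a k = b k :=
      ⟨fun h k h1 h2 => h k h2 h1, fun h k h1 h2 => h k h2 h1⟩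
    have e2 : (a q = (a p).rev ∧ b q = (b p).rev) ↔ (a p = (a q).rev ∧ b p = (b q).rev) := by
      constructor <;> rintro ⟨h1, h2⟩ <;> simp [h1, h2]
    simp only [e, e2]
    split_ifs with h1 h2
    · rw [h2.1, h2.2, sgn_rev hN hg, sgn_rev hN hg]
      have := theta_mul_self g'
      have : ((theta g' : ℤ) : ℂ) * theta g' = 1 := by exact_mod_cast this
      congr 1
      linear_combination (sgn g' (a q) * sgn g' (b q)) * this
    · rfl
    · rfl
  cases g with
  | gl => simp [Qop, twoLeg_zero]
  | o => exact key _ (by simp) hN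
  | sp => exact key _ (by simp) hN

theorem Qop_mul_Qop (g : ClassicalType) :
    Qop g N S * Qop g N S = (N : S) • Qop g N S := by
  have key : ∀ g', Qmat g' N S * Qmat g' N S = (N : S) • Qmat g' N S := by
    intro g'
    ext ⟨a1, a2⟩ ⟨b1, b2⟩
    rw [Matrix.mul_apply, Matrix.smul_apply]
    simp only [Qmat, Matrix.of_apply, Fintype.sum_prod_type]
    by_cases ha : a2 = a1.rev
    · by_cases hb : b2 = b1.rev
      · have : ∀ x y : Fin N, ((if a2 = a1.rev ∧ y = x.rev then
            algebraMap ℂ S (sgn g' a1 * sgn g' x) else 0) *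
            if y = x.rev ∧ b2 = b1.rev then algebraMap ℂ S (sgn g' x * sgn g' b1) else 0)
            = if y = x.rev then algebraMap ℂ S (sgn g' a1 * sgn g' b1) else 0 := by
          intro x y
          simp only [ha, hb, true_and, and_true]
          split_ifs
          · rw [← map_mul]
            congr 1
            linear_combination (sgn g' a1 * sgn g' b1) * sgn_mul_self g' x
          · simp
        simp only [this]
        simp [ha, hb]
      · simp [hb]
    · simp [ha]
  cases g with
  | gl => simp [Qop]
  | o => exact key _
  | sp => exact key _

theorem Qop_mul_Pmat {g : ClassicalType} (hN : Admissible g N) :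
    Qop g N S * Pmat N S = theta g • Qop g N S := by
  have key : ∀ g', g' ≠ .gl → Admissible g' N →
      Qmat g' N S * Pmat N S = theta g' • Qmat g' N S := by
    intro g' hg hN
    ext ⟨a1, a2⟩ ⟨b1, b2⟩
    rw [Matrix.mul_apply, Matrix.smul_apply, Finset.sum_eq_single (b2, b1)]
    · simp only [Qmat, Pmat, Matrix.of_apply, and_self, if_true, mul_one]
      have : b1 = b2.rev ↔ b2 = b1.rev := by constructor <;> rintro rfl <;> simp
      simp only [this]
      split_ifs with h
      · rw [h.2, sgn_rev hN hg, ← Int.cast_smul_eq_zsmul ℂ, Algebra.smul_def, ← map_mul]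
        congr 1; ring
      · simp
    · rintro ⟨x, y⟩ _ h
      simp only [Pmat, Matrix.of_apply]
      rw [if_neg, mul_zero]
      rintro ⟨rfl, rfl⟩
      exact h rfl
    · simp
  cases g with
  | gl => simp [Qop]
  | o => exact key _ (by simp) hN
  | sp => exact key _ (by simp) hN

/-- Both sides are the same Brauer diagram. Together with conjugation by permutations, this is the
only relation in three tensor factors that is verified on matrix entries. -/
theorem twoLeg_Qop_mul_Pmat (g : ClassicalType) {p q r : ι} (hpq : p ≠ q) (hpr : p ≠ r)
    (hqr : q ≠ r) :
    twoLeg p q (Qop g N S) * twoLeg q r (Pmat N S) =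
      twoLeg p q (Qop g N S) * twoLeg p r (Qop g N S) := by
  have key : ∀ g', (twoLeg p q (Qmat g' N S) * twoLeg q r (Pmat N S) :
      Matrix (ι → Fin N) (ι → Fin N) S) =
      twoLeg p q (Qmat g' N S) * twoLeg p r (Qmat g' N S) := by
    intro g'
    ext a b
    -- Since Q_pr leaves the factor q alone, the intermediate index at q is b q, and Q_pq forces its
    -- reversal at p.
    rw [twoLeg_Pmat hqr, mul_permMat_apply, twoLeg_mul_apply hpq, Finset.sum_eq_single ((b q).rev, b q)]
    · simp only [twoLeg, Matrix.of_apply, Qmat, Function.comp_apply, Equiv.swap_apply_left,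
        Equiv.swap_apply_of_ne_of_ne hpq hpr, ite_mul, zero_mul, mul_ite, mul_zero, ← ite_and,
        ne_eq, hpq, hpr.symm, hqr.symm, not_false_eq_true, Function.update_of_ne,
        Function.update_self, Fin.rev_rev, and_true, ← map_mul]
      congr 1
      · apply propext
        constructor
        · rintro ⟨h, h1, h2⟩
          refine ⟨⟨?_, ?_, h2⟩, h1⟩
          · intro k hp hr
            by_cases hq : k = q
            · subst hq; simp
            · rw [Function.update_of_ne hq, Function.update_of_ne hp, h k hp hq,
                Equiv.swap_apply_of_ne_of_ne hq hr]
          · have := h r hpr.symm hqr.symm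
            simpa using this
        · rintro ⟨⟨h, h2, h3⟩, h1⟩
          refine ⟨?_, h1, h3⟩
          intro k hp hq
          by_cases hr : k = r
          · subst hr; simp [h2]
          · have := h k hp hr
            rw [Function.update_of_ne hq, Function.update_of_ne hp] at this
            rw [this, Equiv.swap_apply_of_ne_of_ne hq hr]
      · congr 1
        linear_combination (-sgn g' (a p) * sgn g' (b p)) * sgn_mul_self g' (b q).rev
    · rintro ⟨x, y⟩ _ h
      simp only [twoLeg, Matrix.of_apply, Qmat]
      by_cases h1 : y = x.rev
      · rw [mul_ite, mul_zero, if_neg]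
        intro h2
        have := h2 q hpq.symm hqr
        rw [Function.update_self] at this
        apply h
        rw [← this, h1]; simp
      · simp [h1]
    · simp
  cases g with
  | gl => simp [Qop, twoLeg_zero]
  | o => exact key _
  | sp => exact key _

end Brauer


/-! ## Stability of the fused subspace under products of `R`-matrices -/

section Abstract

variable {S M : Type} [CommRing S] [Ring M] [Algebra S M]

/-- The two conditions on the right action of a transposition and a contraction on `Y`. -/
def IsFused (θ : S) (p q Y : M) : Prop := Y * p = θ • Y ∧ Y * q = 0

theorem IsFused.mul_right {θ : S} {p q Y X : M} (h : IsFused θ p q Y) (hp : Commute p X)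
    (hq : Commute q X) : IsFused θ p q (Y * X) :=
  ⟨by rw [mul_assoc, ← hp.eq, ← mul_assoc, h.1, smul_mul_assoc],
    by rw [mul_assoc, ← hq.eq, ← mul_assoc, h.2, zero_mul]⟩

theorem IsFused.smul {θ : S} {p q Y : M} (h : IsFused θ p q Y) (c : S) :
    IsFused θ p q (c • Y) :=
  ⟨by rw [smul_mul_assoc, h.1, smul_comm], by rw [smul_mul_assoc, h.2, smul_zero]⟩

/-- The condition on the coefficients of the two factors. -/
def CoeffCond (θ n : S) (qzero : Prop) (a b a' b' : S) : Prop :=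
  θ * (a - a') = a * a' ∧ θ * (b - b') = b * b' ∧
    (qzero ∨ -2 * a' + 2 * b - n * b * a' = 0)

/-- Behind Y every product of one of P₁₃, Q₁₃ with one of P₂₃, Q₂₃ reduces, by Y P₁₂ = θY and Y Q₁₂
= 0, to zero or to a multiple of Y P₁₃, Y Q₂₃ or Y P₂₃ Q₁₂. Right multiplication by P₁₂ interchanges
the labels 13 and 23 up to θ, so the first two coefficient equations give the condition for P₁₂. The
third one is needed for Q₁₂. The Yang–Baxter equation is not used. -/
theorem isFused_mul_pair {θ n : S} (hθ : θ * θ = 1) {p12 p13 p23 q12 q13 q23 Y : M}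
    (hpp : p12 * p13 = p23 * p12) (hpp' : p13 * p12 = p12 * p23) (hpp'' : p13 * p23 = p12 * p13)
    (hpq : p13 * q23 = q12 * p13) (hqp : q13 * p23 = p23 * q12)
    (hqp1 : q13 * p12 = p12 * q23) (hqp2 : q23 * p12 = p12 * q13)
    (hqq : q13 * p12 = q13 * q23) (hqq1 : q13 * p23 = q13 * q12)
    (hqq2 : q23 * p13 = q23 * q12) (hc : p13 * q12 = q23 * p13)
    (hqθ : q12 * p12 = θ • q12) (hq2 : q12 * q12 = n • q12) (hpq12 : p12 * q12 = q12 * p12)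
    (hY : IsFused θ p12 q12 Y) {a b a' b' : S} (h : CoeffCond θ n (q12 = 0) a b a' b') :
    IsFused θ p12 q12 (Y * (1 - a • p13 + b • q13) * (1 - a' • p23 + b' • q23)) := by
  obtain ⟨hYp, hYq⟩ := hY
  obtain ⟨h1, h2, h3⟩ := h
  have e1 : Y * p13 * p12 = θ • (Y * p23) := by
    rw [mul_assoc, hpp', ← mul_assoc, hYp, smul_mul_assoc]
  have e2 : Y * p23 * p12 = θ • (Y * p13) := by
    rw [mul_assoc, ← hpp, ← mul_assoc, hYp, smul_mul_assoc]
  have e3 : Y * q13 * p12 = θ • (Y * q23) := by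
    rw [mul_assoc, hqp1, ← mul_assoc, hYp, smul_mul_assoc]
  have e4 : Y * q23 * p12 = θ • (Y * q13) := by
    rw [mul_assoc, hqp2, ← mul_assoc, hYp, smul_mul_assoc]
  have e5 : Y * p13 * p23 = θ • (Y * p13) := by
    rw [mul_assoc, hpp'', ← mul_assoc, hYp, smul_mul_assoc]
  have e6 : Y * p13 * q23 = 0 := by rw [mul_assoc, hpq, ← mul_assoc, hYq, zero_mul]
  have e7 : Y * q13 * p23 = Y * p23 * q12 := by rw [mul_assoc, hqp, ← mul_assoc]
  have e8 : Y * q13 * q23 = θ • (Y * q23) := by rw [mul_assoc, ← hqq, ← mul_assoc, e3]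
  have e9 : Y * p23 * q12 * p12 = θ • (Y * p23 * q12) := by
    rw [mul_assoc, hqθ, mul_smul_comm]
  have e10 : Y * p23 * q12 * q12 = n • (Y * p23 * q12) := by
    rw [mul_assoc, hq2, mul_smul_comm]
  have e11 : Y * p13 * q12 = Y * p23 * q12 := by
    have : q12 = θ • (p12 * q12) := by rw [hpq12, hqθ, smul_smul, hθ, one_smul]
    calc Y * p13 * q12 = θ • (Y * p13 * p12 * q12) := by
          rw [mul_assoc _ p12, ← mul_smul_comm, ← this]
      _ = _ := by rw [e1, smul_mul_assoc, smul_smul, hθ, one_smul]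
  have e12 : Y * q13 * q12 = Y * p23 * q12 := by rw [mul_assoc, ← hqq1, ← mul_assoc, e7]
  have e13 : Y * q23 * q12 = Y * p23 * q12 := by
    rw [mul_assoc, ← hqq2, ← hc, ← mul_assoc, e11]
  have key : Y * (1 - a • p13 + b • q13) * (1 - a' • p23 + b' • q23) =
      Y - a • (Y * p13) + b • (Y * q13) - a' • (Y * p23) + b' • (Y * q23)
        + (a * a' * θ) • (Y * p13) - (b * a') • (Y * p23 * q12) + (b * b' * θ) • (Y * q23) := by
    simp only [mul_add, mul_sub, add_mul, sub_mul, mul_one, mul_smul_comm, smul_mul_assoc, e5, e6,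
      e7, e8]
    module
  rw [key]
  constructor
  · simp only [add_mul, sub_mul, smul_mul_assoc, e1, e2, e3, e4, e9, hYp]
    have t1 : -(a' * θ) + a * θ = a * a' := by linear_combination h1
    have t2 : b * θ - b' * θ = b * b' := by linear_combination h2
    linear_combination (norm := module) (t1) • (Y * p13) + (-hθ * a * a') • (Y * p13)
      - (t1) • (Y * p23) + (hθ * a * a') • (Y * p23)
      + t2 • (Y * q23) - t2 • (Y * q13) + (b * b' * hθ) • (Y * q13) - (b * b' * hθ) • (Y * q23)
  · simp only [add_mul, sub_mul, smul_mul_assoc, e10, e11, e12, e13, hYq]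
    rcases h3 with h3 | h3
    · simp [h3]
    -- Multiplied by Q₁₂, all surviving monomials become Y P₂₃ Q₁₂, so only the sum of their
    -- coefficients matters.
    · have t : -a + b - a' + b' + a * a' * θ - b * a' * n + b * b' * θ = 0 := by
        linear_combination h3 - θ * h1 - θ * h2 + (a - a' + b - b') * hθ
      linear_combination (norm := module) t • (Y * p23 * q12)

/-- A product of factors, two neighbours of which form a pair preserving the fused subspace, while
the other factors commute with the transposition and the contraction. -/
theorem isFused_list_prod {θ : S} {p q E : M} (hE : IsFused θ p q E) (l₁ l₂ : List M) (A B : M)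
    (h₁ : ∀ x ∈ l₁, Commute p x ∧ Commute q x) (h₂ : ∀ x ∈ l₂, Commute p x ∧ Commute q x)
    (hAB : ∀ Y, IsFused θ p q Y → IsFused θ p q (Y * A * B)) :
    IsFused θ p q (E * (l₁ ++ A :: B :: l₂).prod) := by
  have hl : ∀ (l : List M), (∀ x ∈ l, Commute p x ∧ Commute q x) →
      Commute p l.prod ∧ Commute q l.prod := fun l hl =>
    ⟨Commute.list_prod_right _ _ fun x hx => (hl x hx).1,
      Commute.list_prod_right _ _ fun x hx => (hl x hx).2⟩
  rw [List.prod_append, List.prod_cons, List.prod_cons, ← mul_assoc, ← mul_assoc, ← mul_assoc]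
  exact (hAB _ (hE.mul_right (hl _ h₁).1 (hl _ h₁).2)).mul_right (hl _ h₂).1 (hl _ h₂).2

theorem ofFn_split {n : ℕ} (f : Fin n → M) (k : ℕ) (hk : k + 1 < n) :
    List.ofFn f = (List.ofFn f).take k ++ f ⟨k, by omega⟩ :: f ⟨k + 1, hk⟩ ::
      (List.ofFn f).drop (k + 2) := by
  conv_lhs => rw [← List.take_append_drop k (List.ofFn f)]
  congr 1
  rw [List.drop_eq_getElem_cons (by simp; omega), List.drop_eq_getElem_cons (by simp; omega)]
  simp

theorem mem_take_ofFn {n : ℕ} {f : Fin n → M} {k : ℕ} {x : M}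
    (hx : x ∈ (List.ofFn f).take k) : ∃ i : Fin n, (i : ℕ) < k ∧ f i = x := by
  rw [List.mem_iff_getElem] at hx
  obtain ⟨i, hi, rfl⟩ := hx
  simp at hi
  exact ⟨⟨i, hi.2⟩, hi.1, by simp⟩

theorem mem_drop_ofFn {n : ℕ} {f : Fin n → M} {k : ℕ} {x : M}
    (hx : x ∈ (List.ofFn f).drop k) : ∃ i : Fin n, k ≤ (i : ℕ) ∧ f i = x := by
  rw [List.mem_iff_getElem] at hx
  obtain ⟨i, hi, rfl⟩ := hx
  simp at hi
  exact ⟨⟨k + i, by omega⟩, by simp, by simp⟩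

theorem isFused_prod_ofFn {θ : S} {p q E : M} (hE : IsFused θ p q E) {n : ℕ} (f : Fin n → M)
    (k : ℕ) (hk : k + 1 < n)
    (hc : ∀ i : Fin n, (i : ℕ) ≠ k → (i : ℕ) ≠ k + 1 → Commute p (f i) ∧ Commute q (f i))
    (hAB : ∀ Y, IsFused θ p q Y → IsFused θ p q (Y * f ⟨k, by omega⟩ * f ⟨k + 1, hk⟩)) :
    IsFused θ p q (E * (List.ofFn f).prod) := by
  rw [ofFn_split f k hk]
  refine isFused_list_prod hE _ _ _ _ ?_ ?_ hAB
  · intro x hx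
    obtain ⟨i, hi, rfl⟩ := mem_take_ofFn hx
    exact hc i (by omega) (by omega)
  · intro x hx
    obtain ⟨i, hi, rfl⟩ := mem_drop_ofFn hx
    exact hc i (by omega) (by omega)

/-- For factors in decreasing order, as those of R̄_nm are in the second group; the neighbouring
pair then appears as k + 1, k. -/
theorem isFused_prod_reverse_ofFn {θ : S} {p q E : M} (hE : IsFused θ p q E) {n : ℕ}
    (f : Fin n → M) (k : ℕ) (hk : k + 1 < n)
    (hc : ∀ i : Fin n, (i : ℕ) ≠ k → (i : ℕ) ≠ k + 1 → Commute p (f i) ∧ Commute q (f i))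
    (hAB : ∀ Y, IsFused θ p q Y → IsFused θ p q (Y * f ⟨k + 1, hk⟩ * f ⟨k, by omega⟩)) :
    IsFused θ p q (E * (List.ofFn f).reverse.prod) := by
  rw [ofFn_split f k hk]
  simp only [List.reverse_append, List.reverse_cons, List.append_assoc,
    List.cons_append, List.nil_append]
  refine isFused_list_prod hE _ _ _ _ ?_ ?_ hAB
  · intro x hx
    obtain ⟨i, hi, rfl⟩ := mem_drop_ofFn (List.mem_reverse.mp hx)
    exact hc i (by omega) (by omega)
  · intro x hx
    obtain ⟨i, hi, rfl⟩ := mem_take_ofFn (List.mem_reverse.mp hx)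
    exact hc i (by omega) (by omega)

end Abstract

section Concrete

variable {ι : Type} [Fintype ι] [DecidableEq ι] {N : ℕ} {S : Type} [CommRing S] [Algebra ℂ S]

/-- The operators `P_pq`, `Q_pq` on a tensor power of `ℂ^N`. -/
noncomputable def Pleg (N : ℕ) (S : Type) [CommRing S] (p q : ι) :
    Matrix (ι → Fin N) (ι → Fin N) S := twoLeg p q (Pmat N S)

/-- The operator `Q_pq` (zero for `𝔤𝔩_N`). -/
noncomputable def Qleg (g : ClassicalType) (N : ℕ) (S : Type) [CommRing S] [Algebra ℂ S] (p q : ι) :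
    Matrix (ι → Fin N) (ι → Fin N) S := twoLeg p q (Qop g N S)

theorem Pleg_symm (p q : ι) (hpq : p ≠ q) : Pleg N S p q = Pleg N S q p := by
  rw [Pleg, Pleg, twoLeg_Pmat hpq, twoLeg_Pmat hpq.symm, Equiv.swap_comm]

theorem Qleg_symm {g : ClassicalType} (hN : Admissible g N) (p q : ι) :
    Qleg g N S p q = Qleg g N S q p := twoLeg_Qop_symm hN p q

theorem Pleg_mul_twoLeg {p q : ι} (hpq : p ≠ q) (r s : ι)
    (M : Matrix (Fin N × Fin N) (Fin N × Fin N) S) :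
    Pleg N S p q * twoLeg r s M =
      twoLeg (Equiv.swap p q r) (Equiv.swap p q s) M * Pleg N S p q := by
  rw [Pleg, twoLeg_Pmat hpq, permMat_twoLeg]
  simp

/-- The three-factor relations which `isFused_mul_pair` requires are conjugations by transpositions,
except for the three which merge two contractions; those come from `twoLeg_Qop_mul_Pmat`. -/
theorem isFused_mul_Rpair {g : ClassicalType} (hN : Admissible g N) {u v w : ι} (huv : u ≠ v)
    (huw : u ≠ w) (hvw : v ≠ w) {Y : Matrix (ι → Fin N) (ι → Fin N) S}
    (hY : IsFused (theta g : S) (Pleg N S u v) (Qleg g N S u v) Y) {a b a' b' : S}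
    (h : CoeffCond (theta g : S) (N : S) (g = .gl) a b a' b') :
    IsFused (theta g : S) (Pleg N S u v) (Qleg g N S u v)
      (Y * (1 - a • Pleg N S u w + b • Qleg g N S u w) *
        (1 - a' • Pleg N S v w + b' • Qleg g N S v w)) := by
  have hθ : (theta g : S) * theta g = 1 := by exact_mod_cast congrArg (Int.cast : ℤ → S) (theta_mul_self g)
  have s1 := Equiv.swap_apply_of_ne_of_ne huw.symm hvw.symm
  have s2 := Equiv.swap_apply_of_ne_of_ne huv.symm hvw
  refine isFused_mul_pair (n := (N : S)) hθ ?_ ?_ ?_ ?_ ?_ ?_ ?_ ?_ ?_ ?_ ?_ ?_ ?_ ?_ hY ?_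
  · have := Pleg_mul_twoLeg huv u w (Pmat N S)
    rwa [Equiv.swap_apply_left, s1] at this
  · have := Pleg_mul_twoLeg huv v w (Pmat N S)
    rw [Equiv.swap_apply_right, s1] at this
    exact this.symm
  · have := Pleg_mul_twoLeg huw v w (Pmat N S)
    rw [Equiv.swap_apply_right, s2, ← Pleg, ← Pleg, Pleg_symm v u huv.symm] at this
    exact this
  · have := Pleg_mul_twoLeg huw v w (Qop g N S)
    rw [Equiv.swap_apply_right, s2, ← Qleg, ← Qleg, Qleg_symm hN v u] at this
    exact this
  · have := Pleg_mul_twoLeg hvw u v (Qop g N S)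
    rw [Equiv.swap_apply_left, Equiv.swap_apply_of_ne_of_ne huv huw] at this
    exact this.symm
  · have := Pleg_mul_twoLeg huv v w (Qop g N S)
    rw [Equiv.swap_apply_right, s1] at this
    exact this.symm
  · have := Pleg_mul_twoLeg huv u w (Qop g N S)
    rw [Equiv.swap_apply_left, s1] at this
    exact this.symm
  · rw [Qleg_symm hN u w, Qleg_symm hN v w]
    exact twoLeg_Qop_mul_Pmat g huw.symm hvw.symm huv
  · rw [Pleg_symm v w hvw]
    exact twoLeg_Qop_mul_Pmat g huw huv hvw.symm
  · rw [Pleg_symm u w huw, Qleg_symm hN u v]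
    exact twoLeg_Qop_mul_Pmat g hvw huv.symm huw.symm
  · have := Pleg_mul_twoLeg huw u v (Qop g N S)
    rw [Equiv.swap_apply_left, s2, ← Qleg, ← Qleg, Qleg_symm hN w v] at this
    exact this
  · rw [Qleg, Pleg, twoLeg_mul huv, Qop_mul_Pmat hN, ← twoLeg_smul, Int.cast_smul_eq_zsmul]
  · rw [Qleg, twoLeg_mul huv, Qop_mul_Qop, twoLeg_smul]
  · have := Pleg_mul_twoLeg huv u v (Qop g N S)
    rw [Equiv.swap_apply_left, Equiv.swap_apply_right, ← Qleg, ← Qleg, Qleg_symm hN v u] at this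
    exact this
  · refine ⟨h.1, h.2.1, h.2.2.imp ?_ id⟩
    rintro rfl
    simp [Qleg, Qop, twoLeg_zero]

end Concrete


/-! ## The idempotents `ℰ_[n]` -/

section KernelProjection

open scoped ComplexOrder

variable {m : Type} [Fintype m] [DecidableEq m]

/-- Powers of a Hermitian matrix can be lowered by positivity: if A^(k+2) M = 0, then X = A^(k+1) M
has X*X = M* A^k A^(k+2) M = 0. -/
theorem isHermitian_mul_eq_zero_of_pow {A M : Matrix m m ℂ} (hA : A.IsHermitian) (k : ℕ)
    (h : A ^ k * M = 0) : A * M = 0 := by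
  induction k with
  | zero => simp only [pow_zero, one_mul] at h; simp [h]
  | succ k ih =>
    rcases k with _ | k
    · simpa using h
    · apply ih
      rw [← Matrix.conjTranspose_mul_self_eq_zero, Matrix.conjTranspose_mul, (hA.pow _).eq,
        mul_assoc, ← mul_assoc (A ^ (k + 1)) (A ^ (k + 1)), ← pow_add,
        show k + 1 + (k + 1) = k + (k + 1 + 1) by ring, pow_add, mul_assoc, h, mul_zero, mul_zero]

/-- The traces of (B_i M)*(B_i M) are nonnegative and add up to zero. -/
theorem mul_eq_zero_of_sum_sq {ι : Type} (s : Finset ι) {B : ι → Matrix m m ℂ}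
    (hB : ∀ i ∈ s, (B i).IsHermitian) {M : Matrix m m ℂ} (h : (∑ i ∈ s, B i * B i) * M = 0) :
    ∀ i ∈ s, B i * M = 0 := by
  have h1 : ∑ i ∈ s, ((B i * M).conjTranspose * (B i * M)).trace = 0 := by
    rw [← Matrix.trace_sum]
    have : ∑ i ∈ s, (B i * M).conjTranspose * (B i * M) =
        M.conjTranspose * ((∑ i ∈ s, B i * B i) * M) := by
      rw [Finset.sum_mul, Finset.mul_sum]
      refine Finset.sum_congr rfl fun i hi => ?_
      rw [Matrix.conjTranspose_mul, (hB i hi).eq]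
      simp only [mul_assoc]
    rw [this, h, mul_zero, Matrix.trace_zero]
  rw [Finset.sum_eq_zero_iff_of_nonneg
    (fun i _ => (Matrix.posSemidef_conjTranspose_mul_self _).trace_nonneg)] at h1
  intro i hi
  exact Matrix.trace_conjTranspose_mul_self_eq_zero_iff.mp (h1 i hi)

/-- The projection onto the common kernel of Hermitian matrices belongs to any algebra containing
them. -/
theorem exists_kernel_idempotent (𝒜 : Subalgebra ℂ (Matrix m m ℂ)) {ι : Type} (s : Finset ι)
    (B : ι → Matrix m m ℂ) (hB : ∀ i ∈ s, (B i).IsHermitian) (hA : ∀ i ∈ s, B i ∈ 𝒜) :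
    ∃ E ∈ 𝒜, E * E = E ∧ (∀ i ∈ s, B i * E = 0 ∧ E * B i = 0) ∧
      ∀ v : m → ℂ, (∀ i ∈ s, (B i).mulVec v = 0) → E.mulVec v = v := by
  set A := ∑ i ∈ s, B i * B i with hAdef
  have hAH : A.IsHermitian := by
    rw [Matrix.IsHermitian, hAdef, Matrix.conjTranspose_sum]
    refine Finset.sum_congr rfl fun i hi => ?_
    rw [Matrix.conjTranspose_mul, (hB i hi).eq]
  have hAm : A ∈ 𝒜 := Subalgebra.sum_mem _ fun i hi => 𝒜.mul_mem (hA i hi) (hA i hi)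
  -- The characteristic polynomial is X^k q with q(0) ≠ 0. By Cayley–Hamilton A^k q(A) = 0, hence A
  -- q(A) = 0 as A is Hermitian. So E = q(A)/q(0) is the projection onto ker A, and it is a
  -- polynomial in A.
  obtain ⟨q, hq, hq0⟩ := Polynomial.exists_eq_pow_rootMultiplicity_mul_and_not_dvd A.charpoly
    (Matrix.charpoly_monic A).ne_zero 0
  rw [map_zero, sub_zero] at hq hq0
  rw [Polynomial.X_dvd_iff] at hq0
  have hc := Matrix.aeval_self_charpoly A
  rw [hq, map_mul, map_pow, Polynomial.aeval_X] at hc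
  have hAq := isHermitian_mul_eq_zero_of_pow hAH _ hc
  set c := q.coeff 0
  set E : Matrix m m ℂ := c⁻¹ • Polynomial.aeval A q with hE
  have hAE : A * E = 0 := by rw [hE, mul_smul_comm, hAq, smul_zero]
  have hEeq : E = 1 + c⁻¹ • (Polynomial.aeval A q.divX * A) := by
    rw [hE]
    conv_lhs => rw [← Polynomial.divX_mul_X_add q]
    rw [map_add, map_mul, Polynomial.aeval_X, Polynomial.aeval_C, smul_add,
      Algebra.algebraMap_eq_smul_one, smul_smul, inv_mul_cancel₀ hq0, one_smul, add_comm]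
  have hcomm : E * A = A * E := by
    have : Commute (Polynomial.aeval A q) A := by
      have := Polynomial.aeval_X (R := ℂ) A
      conv_rhs => rw [← this]
      exact (Commute.all q Polynomial.X).map (Polynomial.aeval A)
    rw [hE, smul_mul_assoc, this.eq, mul_smul_comm]
  have hBE : ∀ i ∈ s, B i * E = 0 := mul_eq_zero_of_sum_sq s hB hAE
  -- The adjoint of E is also killed by A, because E commutes with A. Taking adjoints again will
  -- give E B_i = 0.
  have hBE' : ∀ i ∈ s, B i * E.conjTranspose = 0 := by
    apply mul_eq_zero_of_sum_sq s hB
    rw [← hAdef]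
    nth_rw 1 [← hAH.eq]
    rw [← Matrix.conjTranspose_mul, hcomm, hAE, Matrix.conjTranspose_zero]
  refine ⟨E, 𝒜.smul_mem (Algebra.adjoin_le (Set.singleton_subset_iff.mpr hAm)
    (Polynomial.aeval_mem_adjoin_singleton ℂ A)) _, ?_, ?_, ?_⟩
  · nth_rw 1 [hEeq]
    rw [add_mul, one_mul, smul_mul_assoc, mul_assoc, hAE, mul_zero, smul_zero, add_zero]
  · intro i hi
    refine ⟨hBE i hi, ?_⟩
    have := congrArg Matrix.conjTranspose (hBE' i hi)
    rwa [Matrix.conjTranspose_mul, Matrix.conjTranspose_conjTranspose, (hB i hi).eq,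
      Matrix.conjTranspose_zero] at this
  · intro v hv
    have : A.mulVec v = 0 := by
      rw [hAdef, Matrix.sum_mulVec]
      refine Finset.sum_eq_zero fun i hi => ?_
      rw [← Matrix.mulVec_mulVec, hv i hi, Matrix.mulVec_zero]
    rw [hEeq, Matrix.add_mulVec, Matrix.one_mulVec, Matrix.smul_mulVec, ← Matrix.mulVec_mulVec,
      this, Matrix.mulVec_zero, smul_zero, add_zero]

end KernelProjection

section Idempotents

variable {N n : ℕ}

/-- The one-dimensional representation of the symmetric group on the fused subspace. -/
noncomputable def thetaChar (g : ClassicalType) (n : ℕ) : Equiv.Perm (Fin n) →* ℂ :=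
  match g with
  | .o => 1
  | _ => ((Int.castRingHom ℂ : ℤ →* ℂ).comp (Units.coeHom ℤ)).comp Equiv.Perm.sign

theorem thetaChar_swap (g : ClassicalType) {i j : Fin n} (h : i ≠ j) :
    thetaChar g n (Equiv.swap i j) = theta g := by
  cases g <;> simp [thetaChar, theta, Equiv.Perm.sign_swap h]

theorem thetaChar_mul_self (g : ClassicalType) (σ : Equiv.Perm (Fin n)) :
    thetaChar g n σ * thetaChar g n σ = 1 := by
  rcases Int.units_eq_one_or (Equiv.Perm.sign σ) with h | h <;> cases g <;> simp [thetaChar, h]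

section Completeness

variable {M : Type} [Ring M] [Algebra ℂ M]
  (φ : Matrix (Fin n → Fin N) (Fin n → Fin N) ℂ →ₐ[ℂ] M) {g : ClassicalType} {Y : M}

/-- The condition that `Y` is fused for all pairs of neighbouring tensor factors. -/
def IsFusedAll (g : ClassicalType) (Y : M) : Prop :=
  ∀ (k : ℕ) (hk : k + 1 < n), IsFused (theta g : ℂ)
    (φ (Pleg N ℂ ⟨k, by omega⟩ ⟨k + 1, hk⟩)) (φ (Qleg g N ℂ ⟨k, by omega⟩ ⟨k + 1, hk⟩)) Y

variable {φ}

theorem IsFusedAll.mul_permMat (hY : IsFusedAll φ g Y) (σ : Equiv.Perm (Fin n)) :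
    Y * φ (permMat N ℂ σ) = thetaChar g n σ • Y := by
  rcases n with _ | n
  · have : σ = 1 := Subsingleton.elim _ _
    subst this
    rw [permMat_one, map_one, map_one, one_smul, mul_one]
  · have hσ : σ ∈ Submonoid.closure (Set.range fun i : Fin n =>
        Equiv.swap i.castSucc i.succ) := by
      rw [Equiv.Perm.mclosure_swap_castSucc_succ]; trivial
    induction hσ using Submonoid.closure_induction with
    | mem x hx =>
      obtain ⟨i, rfl⟩ := hx
      have hi : i.castSucc ≠ i.succ := (Fin.castSucc_lt_succ).ne
      rw [thetaChar_swap g hi, ← twoLeg_Pmat hi]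
      exact (hY i (by omega)).1
    | one => rw [permMat_one, map_one, map_one, one_smul, mul_one]
    | mul x y _ _ hx hy =>
      rw [← permMat_mul, map_mul, ← mul_assoc, hy, smul_mul_assoc, hx, smul_smul, map_mul,
        mul_comm]

theorem exists_perm_pair {i j i' j' : Fin n} (hij : i ≠ j) (hij' : i' ≠ j') :
    ∃ σ : Equiv.Perm (Fin n), σ.symm i = i' ∧ σ.symm j = j' := by
  refine ⟨(Equiv.swap (Equiv.swap i i' j) j' * Equiv.swap i i').symm, ?_, ?_⟩
  · simp only [Equiv.symm_symm, Equiv.Perm.mul_apply, Equiv.swap_apply_left]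
    rw [Equiv.swap_apply_of_ne_of_ne _ hij']
    intro h
    have := congrArg (Equiv.swap i i') h
    simp at this
    exact hij this
  · simp

/-- Permutations act on Y by signs, so Q_ij may be conjugated to the contraction of the first two
factors, where the hypothesis applies. -/
theorem IsFusedAll.mul_Qleg (hY : IsFusedAll φ g Y) {i j : Fin n} (hij : i ≠ j) :
    Y * φ (Qleg g N ℂ i j) = 0 := by
  have hn : 0 + 1 < n := by
    have := i.2; have := j.2; have : (i : ℕ) ≠ j := fun h => hij (Fin.ext h)
    omega
  obtain ⟨σ, h1, h2⟩ := exists_perm_pair hij (i' := ⟨0, by omega⟩) (j' := ⟨0 + 1, hn⟩) (by simp)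
  have e := hY.mul_permMat σ
  have : Y = thetaChar g n σ • (Y * φ (permMat N ℂ σ)) := by
    rw [e, smul_smul, thetaChar_mul_self, one_smul]
  rw [this, smul_mul_assoc, mul_assoc, ← map_mul, Qleg, permMat_twoLeg, h1, h2, map_mul,
    ← mul_assoc]
  rw [show Y * φ (twoLeg ⟨0, by omega⟩ ⟨0 + 1, hn⟩ (Qop g N ℂ)) = 0 from (hY 0 hn).2, zero_mul, smul_zero]

theorem IsFusedAll.mul_Pleg (hY : IsFusedAll φ g Y) {i j : Fin n} (hij : i ≠ j) :
    Y * φ (Pleg N ℂ i j) = (theta g : ℂ) • Y := by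
  rw [Pleg, twoLeg_Pmat hij, hY.mul_permMat, thetaChar_swap g hij]

end Completeness

theorem brauerS_eq (hg : g ≠ .gl) (i j : Fin n) :
    brauerS g N i j = (theta g : ℂ) • Pleg N ℂ i j := by
  cases g <;> simp_all [brauerS, brauerSign, theta, Pleg, place_eq_twoLeg]

theorem brauerE_eq (hg : g ≠ .gl) (i j : Fin n) :
    brauerE g N i j = (theta g : ℂ) • Qleg g N ℂ i j := by
  cases g <;> simp_all [brauerE, brauerSign, theta, Qleg, Qop, place_eq_twoLeg]

theorem theta_mul_self_complex (g : ClassicalType) : (theta g : ℂ) * theta g = 1 := by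
  exact_mod_cast theta_mul_self g

/-- Each element of the Brauer image acts on Y and on E by one and the same scalar, as is seen on
the generators. For E itself the scalar is 1, since E E = E ≠ 0. -/
theorem IsBrauerIdempotent.mul_eq {M : Type} [Ring M] [Algebra ℂ M]
    {φ : Matrix (Fin n → Fin N) (Fin n → Fin N) ℂ →ₐ[ℂ] M} {g : ClassicalType} (hg : g ≠ .gl)
    {Y : M} (hY : IsFusedAll φ g Y) {E : Matrix (Fin n → Fin N) (Fin n → Fin N) ℂ}
    (hE : IsBrauerIdempotent g N n E) : Y * φ E = Y := by
  obtain ⟨hmem, hne, hEE, hrel⟩ := hE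
  have key : ∀ x ∈ Algebra.adjoin ℂ {x | ∃ i j : Fin n, i < j ∧
      (x = brauerS g N i j ∨ x = brauerE g N i j)}, ∃ c : ℂ, Y * φ x = c • Y ∧ E * x = c • E := by
    intro x hx
    induction hx using Algebra.adjoin_induction with
    | mem x hx =>
      obtain ⟨i, j, hij, rfl | rfl⟩ := hx
      · refine ⟨1, ?_, by rw [(hrel i j hij).2.1, one_smul]⟩
        rw [brauerS_eq hg, map_smul, mul_smul_comm, hY.mul_Pleg hij.ne, smul_smul,
          theta_mul_self_complex]
      · refine ⟨0, ?_, by rw [(hrel i j hij).2.2.2, zero_smul]⟩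
        rw [brauerE_eq hg, map_smul, mul_smul_comm, hY.mul_Qleg hij.ne, smul_zero, zero_smul]
    | algebraMap r =>
      refine ⟨r, ?_, ?_⟩
      · rw [AlgHom.commutes, Algebra.algebraMap_eq_smul_one, mul_smul_comm, mul_one]
      · rw [Algebra.algebraMap_eq_smul_one, mul_smul_comm, mul_one]
    | add x y _ _ hx hy =>
      obtain ⟨c, h1, h2⟩ := hx
      obtain ⟨d, h3, h4⟩ := hy
      exact ⟨c + d, by rw [map_add, mul_add, h1, h3, add_smul], by rw [mul_add, h2, h4, add_smul]⟩
    | mul x y _ _ hx hy =>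
      obtain ⟨c, h1, h2⟩ := hx
      obtain ⟨d, h3, h4⟩ := hy
      refine ⟨c * d, ?_, ?_⟩
      · rw [map_mul, ← mul_assoc, h1, smul_mul_assoc, h3, smul_smul]
      · rw [← mul_assoc, h2, smul_mul_assoc, h4, smul_smul]
  obtain ⟨c, h1, h2⟩ := key E hmem
  rw [hEE] at h2
  have hc : c = 1 := by
    have : (c - 1) • E = 0 := by rw [sub_smul, one_smul, ← h2, sub_self]
    rcases smul_eq_zero.mp this with h | h
    · linear_combination h
    · exact absurd h hne
  rw [h1, hc, one_smul]

theorem twoLeg_isHermitian {p q : Fin n} {M : Matrix (Fin N × Fin N) (Fin N × Fin N) ℂ}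
    (hM : M.IsHermitian) : (twoLeg p q M).IsHermitian := by
  ext a b
  simp only [Matrix.conjTranspose_apply, twoLeg, Matrix.of_apply]
  have : (∀ k, k ≠ p → k ≠ q → b k = a k) ↔ (∀ k, k ≠ p → k ≠ q → a k = b k) := by
    simp only [eq_comm]
  simp only [this]
  split_ifs
  · exact hM.apply _ _
  · simp

theorem Pmat_isHermitian : (Pmat N ℂ).IsHermitian := by
  ext a b
  simp only [Matrix.conjTranspose_apply, Pmat, Matrix.of_apply]
  have : (b.1 = a.2 ∧ b.2 = a.1) ↔ (a.1 = b.2 ∧ a.2 = b.1) := by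
    constructor <;> rintro ⟨h1, h2⟩ <;> simp [h1, h2]
  simp only [this]
  split_ifs <;> simp

theorem Qop_isHermitian (g : ClassicalType) : (Qop g N ℂ).IsHermitian := by
  have hs : ∀ (g') (i : Fin N), star (sgn g' i) = sgn g' i := by
    intro g' i
    cases g' <;> simp [sgn]
    split_ifs <;> simp
  have key : ∀ g', (Qmat g' N ℂ).IsHermitian := by
    intro g'
    ext a b
    simp only [Matrix.conjTranspose_apply, Qmat, Matrix.of_apply]
    simp only [and_comm (a := b.2 = b.1.rev)]
    split_ifs
    · simp only [Algebra.algebraMap_self, RingHom.id_apply, star_mul', hs]; ring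
    · simp
  cases g with
  | gl => exact Matrix.isHermitian_zero
  | o => exact key _
  | sp => exact key _

/-- A common eigenvector. -/
theorem exists_fused_vector {g : ClassicalType} (hg : g ≠ .gl) (hN : Admissible g N)
    (hn : n ≤ maxFusion g N) : ∃ v : (Fin n → Fin N) → ℂ, v ≠ 0 ∧ ∀ i j : Fin n, i ≠ j →
      (Pleg N ℂ i j).mulVec v = (theta g : ℂ) • v ∧ (Qleg g N ℂ i j).mulVec v = 0 := by
  -- Symmetrize the basis vector with index f by the character θ. If f never takes two values i and
  -- i' at different places, every contraction kills each term; the displayed sum is the coefficient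
  -- at f itself, so its nonvanishing makes the vector nonzero.
  have main : ∀ f : Fin n → Fin N, (∀ i j, i ≠ j → f j ≠ (f i).rev) →
      (∑ σ : Equiv.Perm (Fin n), (if f = f ∘ σ then thetaChar g n σ else 0)) ≠ 0 →
      ∃ v : (Fin n → Fin N) → ℂ, v ≠ 0 ∧ ∀ i j : Fin n, i ≠ j →
      (Pleg N ℂ i j).mulVec v = (theta g : ℂ) • v ∧ (Qleg g N ℂ i j).mulVec v = 0 := by
    intro f hf hne
    refine ⟨fun b => ∑ σ : Equiv.Perm (Fin n), (if b = f ∘ σ then thetaChar g n σ else 0),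
      fun h => hne (congrFun h f), fun i j hij => ⟨?_, ?_⟩⟩
    · ext a
      rw [Pleg, twoLeg_Pmat hij, Matrix.mulVec, dotProduct,
        Finset.sum_eq_single (a ∘ Equiv.swap i j)]
      · rw [permMat, Matrix.of_apply, if_pos (by ext k; simp), one_mul, Pi.smul_apply, smul_eq_mul,
          Finset.mul_sum]
        refine Fintype.sum_equiv (Equiv.mulRight (Equiv.swap i j)) _ _ fun σ => ?_
        simp only [Equiv.coe_mulRight, map_mul, thetaChar_swap g hij, Equiv.Perm.coe_mul]
        have : (a ∘ Equiv.swap i j = f ∘ σ) ↔ (a = f ∘ σ ∘ Equiv.swap i j) := by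
          constructor
          · intro h
            rw [← Function.comp_assoc, ← h]; ext k; simp
          · rintro rfl
            ext k; simp
        simp only [this]
        split_ifs
        · linear_combination (-thetaChar g n σ) * theta_mul_self_complex g
        · simp
      · intro b _ hb
        rw [permMat, Matrix.of_apply, if_neg, zero_mul]
        rintro rfl
        apply hb
        ext k; simp
      · simp
    · ext a
      rw [Matrix.mulVec, dotProduct]
      refine Finset.sum_eq_zero fun b _ => ?_
      by_cases hb : b j = (b i).rev
      · rw [Finset.sum_eq_zero, mul_zero]
        intro σ _
        rw [if_neg]
        rintro rfl
        exact hf (σ i) (σ j) (fun h => hij (σ.injective h)) hb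
      · cases g <;> simp [Qleg, Qop, Qmat, twoLeg, hb]
  have h2 : 2 ≤ N := by cases g <;> first | exact hN | exact hN.1
  cases g with
  | gl => exact absurd rfl hg
  | o =>
    -- A power of the first basis vector, which is isotropic because N ≥ 2.
    refine main (fun _ => ⟨0, by omega⟩) ?_ ?_
    · intro i j _ h
      have := congrArg Fin.val h
      simp [Fin.val_rev] at this
      omega
    · have : (fun _ : Fin n => (⟨0, by omega⟩ : Fin N)) = fun _ => ⟨0, by omega⟩ := rfl
      simp only [Function.comp_def, if_true, thetaChar, MonoidHom.one_apply]
      simp [Fintype.card_perm, Nat.factorial_ne_zero]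
  | sp =>
    have hn' : n ≤ N / 2 := hn
    -- The exterior product of the first n basis vectors; n ≤ N/2 keeps them in an isotropic
    -- subspace.
    refine main (fun k => ⟨k, by omega⟩) ?_ ?_
    · intro i j _ h
      have := congrArg Fin.val h
      simp [Fin.val_rev] at this
      omega
    · rw [Finset.sum_eq_single 1]
      · simp
      · intro σ _ hσ
        rw [if_neg]
        intro h
        apply hσ
        ext k
        have := congrArg Fin.val (congrFun h k)
        simpa using this.symm
      · simp

/-- The matrices 1 - s_ij and ε_ij are Hermitian, so the projection onto their common kernel lies in
the Brauer image. A fused vector shows that it is nonzero. This makes the choice in `fusionIdem`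
meaningful. -/
theorem exists_isBrauerIdempotent {g : ClassicalType} (hg : g ≠ .gl) (hN : Admissible g N)
    (hn : n ≤ maxFusion g N) : ∃ E, IsBrauerIdempotent g N n E := by
  set 𝒜 := Algebra.adjoin ℂ {x | ∃ i j : Fin n, i < j ∧
      (x = brauerS g N i j ∨ x = brauerE g N i j)} with h𝒜
  have hS : ∀ i j : Fin n, i < j → brauerS g N i j ∈ 𝒜 := fun i j h =>
    Algebra.subset_adjoin ⟨i, j, h, Or.inl rfl⟩
  have hQ : ∀ i j : Fin n, i < j → brauerE g N i j ∈ 𝒜 := fun i j h =>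
    Algebra.subset_adjoin ⟨i, j, h, Or.inr rfl⟩
  have hθ : IsSelfAdjoint ((theta g : ℤ) : ℂ) := by cases g <;> simp [theta, isSelfAdjoint_iff]
  obtain ⟨E, hE, hEE, hB, hv⟩ := exists_kernel_idempotent 𝒜
    (Finset.univ.filter fun p : (Fin n × Fin n) × Bool => p.1.1 < p.1.2)
    (fun p => if p.2 then 1 - brauerS g N p.1.1 p.1.2 else brauerE g N p.1.1 p.1.2) (by
      rintro ⟨⟨i, j⟩, b⟩ _
      dsimp only
      split_ifs
      · rw [brauerS_eq hg]
        exact Matrix.isHermitian_one.sub ((twoLeg_isHermitian Pmat_isHermitian).smul hθ)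
      · rw [brauerE_eq hg]
        exact (twoLeg_isHermitian (Qop_isHermitian g)).smul hθ) (by
      rintro ⟨⟨i, j⟩, b⟩ h
      rw [Finset.mem_filter] at h
      dsimp only at h ⊢
      split_ifs
      · exact 𝒜.sub_mem 𝒜.one_mem (hS i j h.2)
      · exact hQ i j h.2)
  obtain ⟨v, hv0, hv'⟩ := exists_fused_vector hg hN hn
  refine ⟨E, hE, ?_, hEE, ?_⟩
  · rintro rfl
    apply hv0
    rw [← hv v, Matrix.zero_mulVec]
    rintro ⟨⟨i, j⟩, b⟩ h
    rw [Finset.mem_filter] at h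
    have h' := hv' i j h.2.ne
    dsimp only
    split_ifs
    · rw [brauerS_eq hg, Matrix.sub_mulVec, Matrix.one_mulVec, Matrix.smul_mulVec, h'.1, smul_smul,
        theta_mul_self_complex, one_smul, sub_self]
    · rw [brauerE_eq hg, Matrix.smul_mulVec, h'.2, smul_zero]
  · intro i j hij
    have h1 := hB ⟨⟨i, j⟩, true⟩ (by simp [hij])
    have h2 := hB ⟨⟨i, j⟩, false⟩ (by simp [hij])
    simp only [if_true, sub_mul, mul_sub, one_mul, mul_one, sub_eq_zero] at h1
    simp only [Bool.false_eq_true, if_false] at h2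
    exact ⟨h1.1.symm, h1.2.symm, h2.1, h2.2⟩

theorem fusionIdem_isBrauerIdempotent {g : ClassicalType} (hg : g ≠ .gl) (hN : Admissible g N)
    (hn : n ≤ maxFusion g N) : IsBrauerIdempotent g N n (fusionIdem g N n) := by
  cases g with
  | gl => exact absurd rfl hg
  | o => exact Classical.epsilon_spec (exists_isBrauerIdempotent hg hN hn)
  | sp => exact Classical.epsilon_spec (exists_isBrauerIdempotent hg hN hn)

theorem antisymmetrizer_eq : antisymmetrizer N n =
    (n.factorial : ℂ)⁻¹ • ∑ σ : Equiv.Perm (Fin n), thetaChar .gl n σ • permMat N ℂ σ := rfl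

/-- This turns the local conditions at neighbouring factors into absorption of ℰ_[n]. Apart from
`fusionIdem_isFusedAll`, it is the only property of ℰ_[n] used below. -/
theorem IsFusedAll.mul_fusionIdem {M : Type} [Ring M] [Algebra ℂ M]
    {φ : Matrix (Fin n → Fin N) (Fin n → Fin N) ℂ →ₐ[ℂ] M} {g : ClassicalType}
    (hN : Admissible g N) (hn : n ≤ maxFusion g N) {Y : M} (hY : IsFusedAll φ g Y) :
    Y * φ (fusionIdem g N n) = Y := by
  by_cases hg : g = .gl
  · subst hg
    rw [fusionIdem, antisymmetrizer_eq, map_smul, map_sum, mul_smul_comm, Finset.mul_sum]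
    have : ∀ σ : Equiv.Perm (Fin n), Y * φ (thetaChar .gl n σ • permMat N ℂ σ) = Y := by
      intro σ
      rw [map_smul, mul_smul_comm, hY.mul_permMat, smul_smul, thetaChar_mul_self, one_smul]
    simp only [this]
    rw [Finset.sum_const, Finset.card_univ, Fintype.card_perm, Fintype.card_fin,
      ← Nat.cast_smul_eq_nsmul ℂ, smul_smul,
      inv_mul_cancel₀ (by exact_mod_cast Nat.factorial_ne_zero n), one_smul]
  · exact (fusionIdem_isBrauerIdempotent hg hN hn).mul_eq hg hY

theorem fusionIdem_isFusedAll {g : ClassicalType} (hN : Admissible g N)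
    (hn : n ≤ maxFusion g N) : IsFusedAll (AlgHom.id ℂ (Matrix (Fin n → Fin N) (Fin n → Fin N) ℂ)) g
      (fusionIdem g N n) := by
  intro k hk
  have hne : (⟨k, by omega⟩ : Fin n) ≠ ⟨k + 1, hk⟩ := by simp
  by_cases hg : g = .gl
  · subst hg
    refine ⟨?_, by simp [Qleg, Qop, twoLeg_zero]⟩
    have key : (∑ σ : Equiv.Perm (Fin n), thetaChar .gl n σ • permMat N ℂ σ) *
        permMat N ℂ (Equiv.swap ⟨k, by omega⟩ ⟨k + 1, hk⟩) = (theta .gl : ℂ) •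
        ∑ σ : Equiv.Perm (Fin n), thetaChar .gl n σ • permMat N ℂ σ := by
      rw [Finset.sum_mul, Finset.smul_sum]
      refine Fintype.sum_equiv (Equiv.mulLeft (Equiv.swap ⟨k, by omega⟩ ⟨k + 1, hk⟩)) _ _
        fun σ => ?_
      rw [smul_mul_assoc, permMat_mul, Equiv.coe_mulLeft, map_mul, thetaChar_swap _ hne, smul_smul,
        ← mul_assoc, theta_mul_self_complex, one_mul]
    rw [AlgHom.id_apply, fusionIdem, antisymmetrizer_eq, Pleg, twoLeg_Pmat hne, smul_mul_assoc,
      key, smul_comm]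
  · have h := (fusionIdem_isBrauerIdempotent hg hN hn).2.2.2 ⟨k, by omega⟩ ⟨k + 1, hk⟩ (by simp)
    rw [brauerS_eq hg, brauerE_eq hg, mul_smul_comm, mul_smul_comm] at h
    have hθ : ∀ X : Matrix (Fin n → Fin N) (Fin n → Fin N) ℂ,
        (theta g : ℂ) • (theta g : ℂ) • X = X := fun X => by
      rw [smul_smul, theta_mul_self_complex, one_smul]
    constructor
    · rw [AlgHom.id_apply]
      conv_rhs => rw [← h.2.1]
      rw [hθ]
    · rw [AlgHom.id_apply, ← hθ (_ * _), h.2.2.2, smul_zero]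

end Idempotents


/-! ## Specialization of variables -/

/-- A `ℂ[[h]]`-module modulo `h^K` embeds into a commutative algebra in which `h` is nilpotent. -/
theorem exists_squareZero (M : Type) [AddCommGroup M] [Module Kh M] (K : ℕ) :
    ∃ (A : Type) (_ : CommRing A) (_ : Algebra Kh A) (j : M →ₗ[Kh] A),
      (algebraMap Kh A hh) ^ K = 0 ∧ ∀ x, j x = 0 → ∃ y, x = hh ^ K • y := by
  -- The algebra is the trivial square-zero extension of ℂ[[h]]/h^K by M/h^K M. Commutativity makes
  -- substitution into power series available even if the coefficients come from a noncommutative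
  -- algebra or from a mere module.
  let I : Ideal Kh := Ideal.span {hh ^ K}
  let R := Kh ⧸ I
  let W := M ⧸ (I • (⊤ : Submodule Kh M))
  let _ : Module Rᵐᵒᵖ W :=
    Module.compHom W (RingHom.fromOpposite (RingHom.id R) fun _ _ => Commute.all _ _)
  have : IsCentralScalar R W := ⟨fun r w => rfl⟩
  have : IsScalarTower Kh Rᵐᵒᵖ W := ⟨fun c r w => by
    obtain ⟨r⟩ := r
    exact smul_assoc c r w⟩
  refine ⟨TrivSqZeroExt R W, inferInstance, inferInstance,
    (TrivSqZeroExt.inrHom R W).restrictScalars Kh ∘ₗ Submodule.mkQ _, ?_, ?_⟩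
  · rw [← map_pow, TrivSqZeroExt.algebraMap_eq_inl']
    have : algebraMap Kh R (hh ^ K) = 0 :=
      Ideal.Quotient.eq_zero_iff_mem.mpr (Ideal.mem_span_singleton_self _)
    rw [this, TrivSqZeroExt.inl_zero]
  · intro x hx
    have h1 : (Submodule.Quotient.mk x : W) = 0 := by
      exact congrArg TrivSqZeroExt.snd hx
    rw [Submodule.Quotient.mk_eq_zero, Submodule.ideal_span_singleton_smul] at h1
    obtain ⟨y, -, hy⟩ := h1
    exact ⟨y, hy.symm⟩

section SubstCoeff

variable {A V τ : Type} [CommRing A] [Fintype V] [DecidableEq V] [DecidableEq τ]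

/-- The substitution `x_v ↦ x_{π v} + γ_v`. -/
noncomputable def shiftVar (π : V → τ) (γ : V → A) (v : V) : MvPowerSeries τ A :=
  MvPowerSeries.X (π v) + MvPowerSeries.C (γ v)

/-- Adding a constant to a variable of a formal power series is legitimate only because the constant
is nilpotent; this is why everything is reduced modulo h^K. -/
theorem shiftVar_hasSubst (π : V → τ) {γ : V → A} {K : ℕ} (hγ : ∀ v, γ v ^ K = 0) :
    MvPowerSeries.HasSubst (shiftVar π γ) :=
  MvPowerSeries.hasSubst_of_constantCoeff_nilpotent fun v => ⟨K, by simp [shiftVar, hγ]⟩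

theorem coeff_prod_shiftVar (π : V → τ) (γ : V → A) (d : V → ℕ) (e : τ →₀ ℕ) {M : ℕ}
    (hM : ∀ v, d v ≤ M) :
    MvPowerSeries.coeff e (∏ v, shiftVar π γ v ^ d v) = ∑ k : V → Fin (M + 1),
      if ∑ v, Finsupp.single (π v) (k v : ℕ) = e then
        ∏ v, ((d v).choose (k v) : A) * γ v ^ (d v - k v) else 0 := by
  have h1 : ∀ v, shiftVar π γ v ^ d v = ∑ j : Fin (M + 1),
      MvPowerSeries.monomial (Finsupp.single (π v) (j : ℕ))
        (((d v).choose j : A) * γ v ^ (d v - j)) := by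
    intro v
    rw [Fin.sum_univ_eq_sum_range (fun j => MvPowerSeries.monomial (Finsupp.single (π v) j)
        (((d v).choose j : A) * γ v ^ (d v - j))) (M + 1), shiftVar, add_pow]
    rw [← Finset.sum_subset (Finset.range_subset_range.mpr (Nat.succ_le_succ (hM v)))]
    · refine Finset.sum_congr rfl fun j _ => ?_
      rw [MvPowerSeries.X_pow_eq, ← map_pow, ← MvPowerSeries.monomial_zero_eq_C_apply,
        MvPowerSeries.monomial_mul_monomial, one_mul, add_zero, ← map_natCast
          (MvPowerSeries.C (σ := τ) (R := A)), ← MvPowerSeries.monomial_zero_eq_C_apply,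
        MvPowerSeries.monomial_mul_monomial, add_zero, mul_comm]
    · intro j _ hj
      rw [Finset.mem_range, not_lt] at hj
      rw [Nat.choose_eq_zero_of_lt (by omega), Nat.cast_zero, zero_mul, map_zero]
  simp only [h1]
  rw [Finset.prod_univ_sum, map_sum, Fintype.piFinset_univ]
  refine Finset.sum_congr rfl fun k _ => ?_
  rw [MvPowerSeries.prod_monomial, MvPowerSeries.coeff_monomial]
  simp only [eq_comm]

/-- An exponent d_v contributes to k_v only if d_v - k_v < K, because the shifts have vanishing K-th
power. So the sum may be cut off at M. -/
theorem coeff_subst_shiftVar (π : V → τ) {γ : V → A} {K : ℕ} (hγ : ∀ v, γ v ^ K = 0)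
    (F : MvPowerSeries V A) (e : τ →₀ ℕ) {M : ℕ} (hM : ∀ t, e t + K ≤ M) :
    MvPowerSeries.coeff e (MvPowerSeries.subst (shiftVar π γ) F) =
      ∑ k : V → Fin (M + 1), if ∑ v, Finsupp.single (π v) (k v : ℕ) = e then
        ∑ d : V → Fin (M + 1), (∏ v, ((d v : ℕ).choose (k v) : A) * γ v ^ ((d v : ℕ) - k v)) *
          MvPowerSeries.coeff (Finsupp.equivFunOnFinite.symm fun v => (d v : ℕ)) F else 0 := by
  rw [MvPowerSeries.coeff_subst (shiftVar_hasSubst π hγ)]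
  let emb : (V → Fin (M + 1)) ↪ (V →₀ ℕ) :=
    ⟨fun d => Finsupp.equivFunOnFinite.symm fun v => (d v : ℕ), fun d d' h => by
      ext v
      have := congrFun (Finsupp.equivFunOnFinite.symm.injective h) v
      exact this⟩
  have hprod : ∀ d : V →₀ ℕ, (d.prod fun s e => shiftVar π γ s ^ e) =
      ∏ v, shiftVar π γ v ^ d v := fun d => Finsupp.prod_fintype _ _ fun v => pow_zero _
  rw [finsum_eq_sum_of_support_subset (s := Finset.univ.map emb)]
  · rw [Finset.sum_map]
    have : ∀ d : V → Fin (M + 1), MvPowerSeries.coeff (emb d) F • MvPowerSeries.coeff e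
        ((emb d).prod fun s e => shiftVar π γ s ^ e) =
        ∑ k : V → Fin (M + 1), if ∑ v, Finsupp.single (π v) (k v : ℕ) = e then
          (∏ v, ((d v : ℕ).choose (k v) : A) * γ v ^ ((d v : ℕ) - k v)) *
          MvPowerSeries.coeff (emb d) F else 0 := by
      intro d
      have he : ∀ v, emb d v = d v := fun _ => rfl
      rw [hprod]
      simp only [he]
      rw [coeff_prod_shiftVar π γ _ e (M := M) (fun v => Nat.lt_succ_iff.mp (d v).2), smul_eq_mul, Finset.mul_sum]
      refine Finset.sum_congr rfl fun k _ => ?_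
      rw [mul_ite, mul_zero, mul_comm]
    simp only [this]
    rw [Finset.sum_comm]
    refine Finset.sum_congr rfl fun k _ => ?_
    split_ifs
    · rfl
    · simp
  · intro d hd
    by_contra hd'
    apply hd
    have hv : ∃ v, M < d v := by
      by_contra h
      push Not at h
      apply hd'
      simp only [Finset.coe_map, Set.mem_image, Finset.mem_coe, Finset.mem_univ, true_and]
      exact ⟨fun v => ⟨d v, Nat.lt_succ_iff.mpr (h v)⟩, by ext v; rfl⟩
    obtain ⟨v, hv⟩ := hv
    show _ • _ = _
    rw [hprod, coeff_prod_shiftVar π γ _ e (M := ∑ v, d v)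
      (fun v => Finset.single_le_sum (fun _ _ => Nat.zero_le _) (Finset.mem_univ v)),
      Finset.sum_eq_zero, smul_zero]
    intro k _
    split_ifs with h
    · refine Finset.prod_eq_zero (Finset.mem_univ v) ?_
      have h1 : (k v : ℕ) ≤ e (π v) := by
        rw [← h, Finsupp.finsetSum_apply]
        refine le_trans ?_ (Finset.single_le_sum (fun _ _ => Nat.zero_le _) (Finset.mem_univ v))
        simp
      have h2 := hM (π v)
      rw [show d v - k v = K + (d v - k v - K) by omega, pow_add, hγ, zero_mul, mul_zero]
    · rfl

/-- The coefficients after specialization, in terms of those after a shift of the variables. -/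
theorem coeff_subst_shiftVar_eq (π : V → τ) {γ : V → A} {K : ℕ} (hγ : ∀ v, γ v ^ K = 0)
    (F : MvPowerSeries V A) (e : τ →₀ ℕ) {M : ℕ} (hM : ∀ t, e t + K ≤ M) (G : (V → ℕ) → A)
    (hG : ∀ k : V → ℕ, (∀ v, k v + K ≤ M) → ∑ d : V → Fin (M + 1),
      (∏ v, ((d v : ℕ).choose (k v) : A) * γ v ^ ((d v : ℕ) - k v)) *
          MvPowerSeries.coeff (Finsupp.equivFunOnFinite.symm fun v => (d v : ℕ)) F = G k) :
    MvPowerSeries.coeff e (MvPowerSeries.subst (shiftVar π γ) F) =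
      ∑ k : V → Fin (M + 1), if ∑ v, Finsupp.single (π v) (k v : ℕ) = e then
        G (fun v => (k v : ℕ)) else 0 := by
  rw [coeff_subst_shiftVar π hγ F e hM]
  refine Finset.sum_congr rfl fun k _ => ?_
  split_ifs with h
  · apply hG
    intro v
    have h1 : (k v : ℕ) ≤ e (π v) := by
      rw [← h, Finsupp.finsetSum_apply]
      refine le_trans ?_ (Finset.single_le_sum (fun _ _ => Nat.zero_le _) (Finset.mem_univ v))
      simp
    have h2 := hM (π v)
    omega
  · rfl

end SubstCoeff

/-! ### Shifted arguments of `T⁺` -/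

section ShiftGenerators

variable {N : ℕ}

theorem algebraMap_FreeTop_mul (c : Kh) (x : FreeTop N) :
    c • x = PowerSeries.map (algebraMap ℂ (FreeAlgebra ℂ (Gen N))) c * x := rfl

theorem hh_pow_smul (K : ℕ) (x : FreeTop N) : hh ^ K • x = PowerSeries.X ^ K * x := by
  rw [algebraMap_FreeTop_mul, map_pow, PowerSeries.map_X]

/-- Congruence modulo `h^K`. -/
def HCongr {W : Type} [AddCommGroup W] [Module Kh W] (K : ℕ) (x y : W) : Prop :=
  ∃ z : W, x = y + hh ^ K • z

theorem HCongr.refl {W : Type} [AddCommGroup W] [Module Kh W] (K : ℕ) (x : W) : HCongr K x x :=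
  ⟨0, by simp⟩

theorem HCongr.mul {B : Type} [Ring B] [Algebra Kh B] {K : ℕ} {x y x' y' : B}
    (h : HCongr K x y) (h' : HCongr K x' y') : HCongr K (x * x') (y * y') := by
  obtain ⟨z, rfl⟩ := h
  obtain ⟨z', rfl⟩ := h'
  exact ⟨y * z' + z * y' + hh ^ K • (z * z'), by
    simp only [mul_add, add_mul, smul_add, mul_smul_comm, smul_mul_assoc]; abel⟩

theorem HCongr.prod_ofFn {B : Type} [Ring B] [Algebra Kh B] {K n : ℕ} {x y : Fin n → B}
    (h : ∀ i, HCongr K (x i) (y i)) : HCongr K (List.ofFn x).prod (List.ofFn y).prod := by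
  induction n with
  | zero => simpa using HCongr.refl K (1 : B)
  | succ n ih =>
    rw [List.ofFn_succ, List.ofFn_succ, List.prod_cons, List.prod_cons]
    exact (h 0).mul (ih fun i => h i.succ)

theorem HCongr.map {A W : Type} [AddCommGroup W] [Module Kh W] [CommRing A] [Algebra Kh A] {K : ℕ}
    (hK : algebraMap Kh A hh ^ K = 0) (f : W →ₗ[Kh] A) {x y : W} (h : HCongr K x y) :
    f x = f y := by
  obtain ⟨z, rfl⟩ := h
  rw [map_add, map_smul, Algebra.smul_def, map_pow, hK, zero_mul, add_zero]

theorem coeff_shift_smul (q : ℕ) (c : ℂ) (m e : ℕ) (x : FreeTop N) :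
    PowerSeries.coeff e (((q : Kh) * (PowerSeries.C c * hh) ^ m) • x) =
      if m ≤ e then ((q : ℂ) * c ^ m) • PowerSeries.coeff (e - m) x else 0 := by
  have : (q : Kh) * (PowerSeries.C c * hh) ^ m = PowerSeries.C ((q : ℂ) * c ^ m) * hh ^ m := by
    rw [map_mul, map_natCast, mul_pow, map_pow]; ring
  rw [algebraMap_FreeTop_mul, this, map_mul (PowerSeries.map _), map_pow, PowerSeries.map_C, PowerSeries.map_X,
    mul_assoc, PowerSeries.coeff_C_mul, PowerSeries.coeff_X_pow_mul', Algebra.smul_def]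
  split_ifs
  · rfl
  · simp

theorem coeff_coeff_tPlus (c : ℂ) (i j : Fin N) (k e : ℕ) :
    PowerSeries.coeff e (PowerSeries.coeff k (tPlus c i j)) =
      (if e = 0 ∧ k = 0 ∧ i = j then 1 else 0) - if e = 0 then 0 else
        (((k + e - 1).choose k : ℂ) * c ^ (e - 1)) •
          FreeAlgebra.ι ℂ (Gen.plus (k + e - 1) i j) := by
  rw [tPlus, PowerSeries.coeff_mk, map_sub, PowerSeries.coeff_mk]
  congr 1
  by_cases h : k = 0 ∧ i = j
  · simp [h, PowerSeries.coeff_one]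
  · rw [if_neg h, if_neg (fun h' => h h'.2), map_zero]

/-- This is the binomial expansion of t⁺(u + ch), compared power by power in h. A generator carries
one factor h of its own, so that only d = k + e - 1 contributes to the generator term of h^e. -/
theorem tPlus_shift (c : ℂ) (i j : Fin N) {k K M : ℕ} (hM : k + K ≤ M) :
    HCongr K (∑ d : Fin (M + 1), (((d : ℕ).choose k : Kh) *
      (PowerSeries.C c * hh) ^ ((d : ℕ) - k)) • PowerSeries.coeff (d : ℕ) (tPlus 0 i j))
      (PowerSeries.coeff k (tPlus c i j)) := by
  suffices h : ∀ e < K, PowerSeries.coeff e (∑ d : Fin (M + 1), (((d : ℕ).choose k : Kh) *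
      (PowerSeries.C c * hh) ^ ((d : ℕ) - k)) • PowerSeries.coeff (d : ℕ) (tPlus 0 i j)) =
      PowerSeries.coeff e (PowerSeries.coeff k (tPlus c i j)) by
    have h' : (PowerSeries.X : FreeTop N) ^ K ∣ (∑ d : Fin (M + 1), (((d : ℕ).choose k : Kh) *
      (PowerSeries.C c * hh) ^ ((d : ℕ) - k)) • PowerSeries.coeff (d : ℕ) (tPlus 0 i j)) -
      PowerSeries.coeff k (tPlus c i j) := by
      rw [PowerSeries.X_pow_dvd_iff]
      intro e he
      rw [map_sub, h e he, sub_self]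
    obtain ⟨z, hz⟩ := h'
    exact ⟨z, by rw [hh_pow_smul, ← hz]; abel⟩
  intro e he
  rw [map_sum]
  simp only [coeff_shift_smul, coeff_coeff_tPlus]
  rw [Fin.sum_univ_eq_sum_range (fun d => if d - k ≤ e then ((d.choose k : ℂ) * c ^ (d - k)) •
    ((if e - (d - k) = 0 ∧ d = 0 ∧ i = j then (1 : FreeAlgebra ℂ (Gen N)) else 0) -
      if e - (d - k) = 0 then 0 else (((d + (e - (d - k)) - 1).choose d : ℂ) *
        0 ^ (e - (d - k) - 1)) • FreeAlgebra.ι ℂ (Gen.plus (d + (e - (d - k)) - 1) i j))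
      else 0) (M + 1)]
  have hterm : ∀ d, (if d - k ≤ e then ((d.choose k : ℂ) * c ^ (d - k)) •
    ((if e - (d - k) = 0 ∧ d = 0 ∧ i = j then (1 : FreeAlgebra ℂ (Gen N)) else 0) -
      if e - (d - k) = 0 then 0 else (((d + (e - (d - k)) - 1).choose d : ℂ) *
        0 ^ (e - (d - k) - 1)) • FreeAlgebra.ι ℂ (Gen.plus (d + (e - (d - k)) - 1) i j))
      else 0) = (if d = 0 then if e = 0 ∧ k = 0 ∧ i = j then 1 else 0 else 0) -
        if d + 1 = k + e then if e = 0 then 0 else (((k + e - 1).choose k : ℂ) * c ^ (e - 1)) •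
          FreeAlgebra.ι ℂ (Gen.plus (k + e - 1) i j) else 0 := by
    intro d
    rcases Nat.lt_or_ge d k with hdk | hdk
    · rw [Nat.choose_eq_zero_of_lt hdk]
      have h1 : ¬ (e = 0 ∧ k = 0 ∧ i = j) := by omega
      have h2 : d + 1 = k + e → e = 0 := by omega
      simp only [Nat.cast_zero, zero_mul, zero_smul, h1, if_false, ite_self]
      split_ifs <;> simp_all
    · obtain ⟨t, rfl⟩ := Nat.exists_eq_add_of_le hdk
      rw [Nat.add_sub_cancel_left]
      -- With d = k + t, the shift supplies h^t. The generator term requires t + 1 = e, whereas the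
      -- constant δ_ij is seen only for t = e and d = 0.
      rcases Nat.lt_trichotomy (t + 1) e with h | h | h
      · rw [if_pos (by omega), if_neg (by omega), if_neg (by omega), zero_pow (by omega),
          if_neg (show ¬ k + t + 1 = k + e by omega)]
        simp
        omega
      · subst h
        simp [show t + 1 - t = 1 by omega, show k + (t + 1) - 1 = k + t by omega, add_assoc]
      · rw [if_neg (show ¬ k + t + 1 = k + e by omega), sub_zero]
        by_cases hte : t = e
        · subst hte
          simp only [le_refl, Nat.sub_self, true_and, if_true, sub_zero]
          by_cases hk : k + t = 0
          · have hk0 : k = 0 := by omega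
            have ht0 : t = 0 := by omega
            subst hk0; subst ht0
            simp
          · simp only [hk, false_and, if_false, smul_zero]
        · have h1 : ¬ (e = 0 ∧ k = 0 ∧ i = j) ∨ k + t ≠ 0 := by omega
          rw [if_neg (show ¬ t ≤ e by omega)]
          rcases h1 with h1 | h1
          · simp [h1]
          · rw [if_neg h1]
  simp only [hterm]
  rw [Finset.sum_sub_distrib, Finset.sum_ite_eq' (Finset.range (M + 1)) 0]
  congr 1
  · simp
  · by_cases he0 : e = 0
    · simp [he0]
    · rw [Finset.sum_eq_single (k + e - 1)]
      · rw [if_pos (by omega)]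
      · intro d _ hd
        rw [if_neg (by omega)]
      · intro h
        rw [Finset.mem_range] at h
        omega

theorem coeff_prod_ofFn {B : Type} [Ring B] {n : ℕ} (f : Fin n → PowerSeries B) {r M : ℕ}
    (hM : r ≤ M) : PowerSeries.coeff r (List.ofFn f).prod = ∑ k : Fin n → Fin (M + 1),
      if ∑ i, (k i : ℕ) = r then (List.ofFn fun i => PowerSeries.coeff (k i : ℕ) (f i)).prod
      else 0 := by
  induction n generalizing r with
  | zero =>
    simp only [List.ofFn_zero, List.prod_nil, PowerSeries.coeff_one, Finset.univ_unique,
      Finset.sum_singleton, Finset.univ_eq_empty, Finset.sum_empty]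
    simp only [eq_comm]
  | succ n ih =>
    rw [List.ofFn_succ, List.prod_cons, PowerSeries.coeff_mul,
      Finset.Nat.sum_antidiagonal_eq_sum_range_succ_mk,
      ← (Fin.consEquiv fun _ : Fin (n + 1) => Fin (M + 1)).sum_comp, Fintype.sum_prod_type]
    have h1 : ∀ k0 : Fin (M + 1), (∑ y : Fin n → Fin (M + 1),
        if ∑ i, ((Fin.consEquiv fun _ : Fin (n + 1) => Fin (M + 1)) (k0, y) i : ℕ) = r then
          (List.ofFn fun i => PowerSeries.coeff
            ((Fin.consEquiv fun _ : Fin (n + 1) => Fin (M + 1)) (k0, y) i : ℕ) (f i)).prod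
        else 0) = if (k0 : ℕ) ≤ r then PowerSeries.coeff (k0 : ℕ) (f 0) *
          PowerSeries.coeff (r - k0) (List.ofFn fun i : Fin n => f i.succ).prod else 0 := by
      intro k0
      simp only [Fin.consEquiv_apply, Fin.sum_univ_succ, Fin.cons_zero, Fin.cons_succ,
        List.ofFn_succ, List.prod_cons]
      split_ifs with h
      · rw [ih _ (by omega), Finset.mul_sum]
        refine Finset.sum_congr rfl fun y _ => ?_
        rw [mul_ite, mul_zero]
        congr 1
        apply propext
        omega
      · refine Finset.sum_eq_zero fun y _ => ?_
        rw [if_neg (by omega)]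
    simp only [h1]
    rw [Fin.sum_univ_eq_sum_range (fun k0 => if k0 ≤ r then PowerSeries.coeff k0 (f 0) *
          PowerSeries.coeff (r - k0) (List.ofFn fun i : Fin n => f i.succ).prod else 0) (M + 1),
      ← Finset.sum_subset (Finset.range_subset_range.mpr (Nat.succ_le_succ hM))]
    · refine Finset.sum_congr rfl fun k hk => ?_
      rw [if_pos (Nat.lt_succ_iff.mp (Finset.mem_range.mp hk))]
    · intro k _ hk
      rw [if_neg]
      simpa using hk

theorem prod_tPlus_shift {n : ℕ} (c : Fin n → ℂ) (a b : Fin n → Fin N) {K M : ℕ} (k : Fin n → ℕ)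
    (hM : ∀ i, k i + K ≤ M) :
    HCongr K (∑ d : Fin n → Fin (M + 1), (∏ i, ((d i : ℕ).choose (k i) : Kh) *
      (PowerSeries.C (c i) * hh) ^ ((d i : ℕ) - k i)) •
        (List.ofFn fun i => PowerSeries.coeff (d i : ℕ) (tPlus 0 (a i) (b i))).prod)
      (List.ofFn fun i => PowerSeries.coeff (k i) (tPlus (c i) (a i) (b i))).prod := by
  have := HCongr.prod_ofFn fun i => tPlus_shift (c i) (a i) (b i) (hM i)
  have e := MultilinearMap.map_sum_finset (MultilinearMap.mkPiAlgebraFin Kh n (FreeTop N))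
    (fun i (d : Fin (M + 1)) => (((d : ℕ).choose (k i) : Kh) *
      (PowerSeries.C (c i) * hh) ^ ((d : ℕ) - k i)) •
      PowerSeries.coeff (d : ℕ) (tPlus 0 (a i) (b i))) (fun _ => Finset.univ)
  rw [MultilinearMap.mkPiAlgebraFin_apply] at e
  rw [e, Fintype.piFinset_univ] at this
  simp only [MultilinearMap.map_smul_univ, MultilinearMap.mkPiAlgebraFin_apply] at this
  exact this

end ShiftGenerators


/-! ## Separation and torsion -/

section Separated

variable (g : ClassicalType) (N : ℕ) (c : ℂ)

theorem toDY_smul (k : Kh) (x : FreeTop N) : toDY g N c (k • x) = k • toDY g N c x := rfl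

theorem toDY_eq_zero_iff (x : FreeTop N) : toDY g N c x = 0 ↔ x ∈ relationIdeal g N c := by
  rw [← map_zero (toDY g N c)]
  exact (RingCon.eq _).trans (TwoSidedIdeal.mem_iff _ _).symm

theorem toDY_surjective : Function.Surjective (toDY g N c) := RingCon.mk'_surjective _

/-- An intersection of h-closed ideals is h-closed. The first closure condition makes the double
Yangian separated, the second one makes it torsion-free. -/
theorem relationIdeal_isHClosed : IsHClosed (relationIdeal g N c : Set (FreeTop N)) := by
  constructor
  · intro x hx
    rw [SetLike.mem_coe, relationIdeal, TwoSidedIdeal.mem_sInf]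
    intro J hJ
    refine hJ.2.1 x fun n => ?_
    obtain ⟨y, hy, z, hz⟩ := hx n
    rw [SetLike.mem_coe, relationIdeal, TwoSidedIdeal.mem_sInf] at hy
    exact ⟨y, hy J hJ, z, hz⟩
  · intro x hx
    rw [SetLike.mem_coe, relationIdeal, TwoSidedIdeal.mem_sInf] at hx ⊢
    exact fun J hJ => hJ.2.2 x (hx J hJ)

theorem toDY_relator {x : FreeTop N} (hx : IsRelator g c x) : toDY g N c x = 0 := by
  rw [toDY_eq_zero_iff, relationIdeal, TwoSidedIdeal.mem_sInf]
  exact fun J hJ => hJ.1 x hx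

theorem DY_separated (x : DY g N c) (hx : ∀ K : ℕ, ∃ y, x = hh ^ K • y) : x = 0 := by
  obtain ⟨x, rfl⟩ := toDY_surjective g N c x
  rw [toDY_eq_zero_iff]
  refine (relationIdeal_isHClosed g N c).1 x fun K => ?_
  obtain ⟨y, hy⟩ := hx K
  obtain ⟨y, rfl⟩ := toDY_surjective g N c y
  refine ⟨x - hh ^ K • y, ?_, y, by abel⟩
  rw [SetLike.mem_coe, ← toDY_eq_zero_iff, map_sub, toDY_smul, hy, sub_self]

theorem DY_torsionFree (x : DY g N c) (hx : hh • x = 0) : x = 0 := by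
  obtain ⟨x, rfl⟩ := toDY_surjective g N c x
  rw [← toDY_smul, toDY_eq_zero_iff] at hx
  rw [toDY_eq_zero_iff]
  exact (relationIdeal_isHClosed g N c).2 x hx

theorem C_smul_FreeTop (a : ℂ) (x : FreeTop N) : (PowerSeries.C a : Kh) • x = a • x := by
  ext n
  rw [algebraMap_FreeTop_mul, PowerSeries.map_C, PowerSeries.coeff_C_mul, PowerSeries.coeff_smul,
    Algebra.smul_def]

theorem C_smul_DY (a : ℂ) (x : DY g N c) : (PowerSeries.C a : Kh) • x = a • x := by
  obtain ⟨x, rfl⟩ := toDY_surjective g N c x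
  rw [← toDY_smul, C_smul_FreeTop]
  rfl

end Separated

/-! ## The specialized `RTT` relation -/

section RTT

variable {N : ℕ}

theorem coeff_inVar_mul {A : Type} [Ring A] (f f' : PowerSeries A) (d : Fin 2 →₀ ℕ) :
    MvPowerSeries.coeff d (inVar 0 f * inVar 1 f') =
      PowerSeries.coeff (d 0) f * PowerSeries.coeff (d 1) f' := by
  classical
  rw [MvPowerSeries.coeff_mul, Finset.sum_eq_single (Finsupp.single 0 (d 0), Finsupp.single 1 (d 1))]
  · simp [inVar, MvPowerSeries.coeff_apply]
  · rintro ⟨p, q⟩ hpq hne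
    rw [Finset.HasAntidiagonal.mem_antidiagonal] at hpq
    simp only [inVar, MvPowerSeries.coeff_apply]
    by_cases hp : p = Finsupp.single 0 (p 0)
    · by_cases hq : q = Finsupp.single 1 (q 1)
      · exfalso
        apply hne
        have h0 : d 0 = p 0 := by
          rw [← hpq]
          have : q 0 = 0 := by rw [hq]; simp
          simp [this]
        have h1 : d 1 = q 1 := by
          rw [← hpq]
          have : p 1 = 0 := by rw [hp]; simp
          simp [this]
        rw [h0, h1, ← hp, ← hq]
      · rw [if_neg hq, mul_zero]
    · rw [if_neg hp, zero_mul]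
  · intro h
    exfalso
    apply h
    rw [Finset.HasAntidiagonal.mem_antidiagonal]
    ext i
    fin_cases i <;> simp

theorem coeff_inVar_mul' {A : Type} [Ring A] (f f' : PowerSeries A) (d : Fin 2 →₀ ℕ) :
    MvPowerSeries.coeff d (inVar 1 f' * inVar 0 f) =
      PowerSeries.coeff (d 1) f' * PowerSeries.coeff (d 0) f := by
  classical
  rw [MvPowerSeries.coeff_mul, Finset.sum_eq_single (Finsupp.single 1 (d 1), Finsupp.single 0 (d 0))]
  · simp [inVar, MvPowerSeries.coeff_apply]
  · rintro ⟨q, p⟩ hpq hne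
    rw [Finset.HasAntidiagonal.mem_antidiagonal] at hpq
    simp only [inVar, MvPowerSeries.coeff_apply]
    by_cases hp : p = Finsupp.single 0 (p 0)
    · by_cases hq : q = Finsupp.single 1 (q 1)
      · exfalso
        apply hne
        have h0 : d 0 = p 0 := by
          rw [← hpq]
          have : q 0 = 0 := by rw [hq]; simp
          simp [this]
        have h1 : d 1 = q 1 := by
          rw [← hpq]
          have : p 1 = 0 := by rw [hp]; simp
          simp [this]
        rw [h0, h1, ← hp, ← hq]
      · rw [if_neg hq, zero_mul]
    · rw [if_neg hp, mul_zero]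
  · intro h
    exfalso
    apply h
    rw [Finset.HasAntidiagonal.mem_antidiagonal]
    ext i
    fin_cases i <;> simp

theorem leg1_mul_leg2 {A : Type} [Ring A] (L L' : Fin N → Fin N → A) (x y : Fin N × Fin N) :
    (leg1 L * leg2 L') x y = L x.1 y.1 * L' x.2 y.2 := by
  rw [Matrix.mul_apply, Finset.sum_eq_single (y.1, x.2)]
  · simp [leg1, leg2]
  · rintro ⟨z1, z2⟩ _ h
    simp only [leg1, leg2, Matrix.of_apply]
    by_cases h1 : x.2 = z2
    · rw [if_neg (show ¬ z1 = y.1 from fun h2 => h (by rw [h1, h2])), mul_zero]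
    · rw [if_neg h1, zero_mul]
  · simp

theorem leg2_mul_leg1 {A : Type} [Ring A] (L L' : Fin N → Fin N → A) (x y : Fin N × Fin N) :
    (leg2 L' * leg1 L) x y = L' x.2 y.2 * L x.1 y.1 := by
  rw [Matrix.mul_apply, Finset.sum_eq_single (x.1, y.2)]
  · simp [leg1, leg2]
  · rintro ⟨z1, z2⟩ _ h
    simp only [leg1, leg2, Matrix.of_apply]
    by_cases h1 : x.1 = z1
    · rw [if_neg (show ¬ z2 = y.2 from fun h2 => h (by rw [h1, h2])), mul_zero]
    · rw [if_neg h1, zero_mul]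
  · simp

/-- Application of a linear map to the coefficients. -/
noncomputable def coeffwise {σ A B : Type} [Ring B] [CommRing A] (l : B →+ A) :
    MvPowerSeries σ B →+ MvPowerSeries σ A where
  toFun F := fun d => l (MvPowerSeries.coeff d F)
  map_zero' := by ext d; show l _ = _; simp
  map_add' F G := by ext d; show l _ = l _ + l _; simp

theorem coeff_coeffwise {σ A B : Type} [Ring B] [CommRing A] (l : B →+ A) (F : MvPowerSeries σ B)
    (d : σ →₀ ℕ) : MvPowerSeries.coeff d (coeffwise l F) = l (MvPowerSeries.coeff d F) := rfl

theorem coeffwise_map_mul {σ A B : Type} [Ring B] [Algebra Kh B] [CommRing A] [Algebra Kh A]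
    (l : B →ₗ[Kh] A) (f : MvPowerSeries σ Kh) (F : MvPowerSeries σ B) :
    coeffwise l.toAddMonoidHom (MvPowerSeries.map (algebraMap Kh B) f * F) =
      MvPowerSeries.map (algebraMap Kh A) f * coeffwise l.toAddMonoidHom F := by
  classical
  ext d
  rw [coeff_coeffwise, MvPowerSeries.coeff_mul, MvPowerSeries.coeff_mul, map_sum]
  refine Finset.sum_congr rfl fun p _ => ?_
  rw [MvPowerSeries.coeff_map, MvPowerSeries.coeff_map, ← Algebra.smul_def, ← Algebra.smul_def,
    coeff_coeffwise]
  exact l.map_smul _ _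

theorem coeffwise_mul_map {σ A B : Type} [Ring B] [Algebra Kh B] [CommRing A] [Algebra Kh A]
    (l : B →ₗ[Kh] A) (f : MvPowerSeries σ Kh) (F : MvPowerSeries σ B) :
    coeffwise l.toAddMonoidHom (F * MvPowerSeries.map (algebraMap Kh B) f) =
      coeffwise l.toAddMonoidHom F * MvPowerSeries.map (algebraMap Kh A) f := by
  classical
  ext d
  rw [coeff_coeffwise, MvPowerSeries.coeff_mul, MvPowerSeries.coeff_mul, map_sum]
  refine Finset.sum_congr rfl fun p _ => ?_
  rw [MvPowerSeries.coeff_map, MvPowerSeries.coeff_map, ← Algebra.commutes, ← Algebra.smul_def,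
    ← Algebra.commutes, ← Algebra.smul_def, coeff_coeffwise]
  exact l.map_smul _ _

/-- Twice the projection onto the fused subspace for two tensor factors. -/
noncomputable def fuseTwo (g : ClassicalType) (N : ℕ) : Matrix (Fin N × Fin N) (Fin N × Fin N) ℂ :=
  1 + (theta g : ℂ) • Pmat N ℂ - (2 / N : ℂ) • Qop g N ℂ

/-- The scalar by which the specialized numerator of the `R`-matrix differs from `fuseTwo`. -/
noncomputable def fuseScalar (g : ClassicalType) (N : ℕ) : ℂ × ℕ :=
  match g with
  | .gl => (1, 1)
  | .o => (1 + kappa .o N, 2)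
  | .sp => (1 - kappa .sp N, 2)

theorem fuseScalar_ne_zero {g : ClassicalType} (hN : Admissible g N) : (fuseScalar g N).1 ≠ 0 := by
  have h2 : N ≠ 0 := by cases g <;> first | (have := hN.1; omega) | (have : 2 ≤ N := hN; omega)
  have h2' : (N : ℂ) ≠ 0 := by exact_mod_cast h2
  cases g with
  | gl => simp [fuseScalar]
  | o => simp [fuseScalar, kappa, h2]
  | sp =>
    have : (fuseScalar .sp N).1 = -(N : ℂ) / 2 := by simp only [fuseScalar, kappa]; ring
    rw [this]
    simp [h2]

/-- At u = -θh the numerator u(u - hκ)R(u) has the coefficients h²(1 + θκ), θh²(1 + θκ) and -θh² at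
1, P and Q. Since 1 + θκ = θN/2, it is proportional to 1 + θP - (2/N)Q. For 𝔤𝔩_N the numerator is
simply h(1 - P). -/
theorem Rnum_map {g : ClassicalType} (hN : Admissible g N) {τ S : Type} [CommRing S]
    [Algebra Kh S] (Ψ : MvPowerSeries τ Kh →+* S) (hΨ : ∀ k, Ψ (MvPowerSeries.C k) = algebraMap Kh S k)
    (x : MvPowerSeries τ Kh) (hx : Ψ x = -algebraMap Kh S ((theta g : Kh) * hh))
    (a b : Fin N × Fin N) :
    Ψ (Rnum g N x 1 a b) = algebraMap Kh S (PowerSeries.C (fuseScalar g N).1 *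
      hh ^ (fuseScalar g N).2 * PowerSeries.C (fuseTwo g N a b)) := by
  have h2 : N ≠ 0 := by cases g <;> first | (have := hN.1; omega) | (have : 2 ≤ N := hN; omega)
  have h2' : (N : ℂ) ≠ 0 := by exact_mod_cast h2
  have hQ : ∀ g', Ψ (Qmat g' N (MvPowerSeries τ Kh) a b) =
      algebraMap Kh S (PowerSeries.C (Qmat g' N ℂ a b)) := by
    intro g'
    simp only [Qmat, Matrix.of_apply]
    split_ifs
    · rw [MvPowerSeries.algebraMap_apply, hΨ]
      rfl
    · simp
  have hP : Ψ (Pmat N (MvPowerSeries τ Kh) a b) = algebraMap Kh S (PowerSeries.C (Pmat N ℂ a b)) := by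
    simp only [Pmat, Matrix.of_apply]
    split_ifs <;> simp
  have h1 : Ψ ((1 : Matrix (Fin N × Fin N) (Fin N × Fin N) (MvPowerSeries τ Kh)) a b) =
      algebraMap Kh S (PowerSeries.C ((1 : Matrix (Fin N × Fin N) (Fin N × Fin N) ℂ) a b)) := by
    simp only [Matrix.one_apply]
    split_ifs <;> simp
  cases g with
  | gl =>
    simp only [Rnum, Matrix.sub_apply, Matrix.smul_apply, smul_eq_mul, map_sub, map_mul, hx, hP, h1,
      hS, hΨ, map_one, mul_one, fuseScalar, fuseTwo, theta, Qop, Matrix.add_apply, Matrix.zero_apply,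
      map_add, one_mul, pow_one, mul_zero, sub_zero, Int.cast_neg, Int.cast_one, map_neg]
    ring
  | o =>
    have e : (1 + kappa .o N) * (2 / N) = 1 := by simp only [kappa]; field_simp; ring
    have e' : algebraMap Kh S (PowerSeries.C (1 + kappa .o N)) * algebraMap Kh S (PowerSeries.C (2 / N)) = 1 := by
      rw [← map_mul, ← map_mul, e, map_one, map_one]
    simp only [Rnum, Matrix.sub_apply, Matrix.smul_apply, smul_eq_mul, map_sub, map_mul, hx, hP, h1,
      hS, hSc, hΨ, map_one, mul_one, fuseScalar, fuseTwo, theta, Qop, Matrix.add_apply, hQ,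
      map_add, one_mul, map_pow, Int.cast_one] at e' ⊢
    linear_combination (-algebraMap Kh S hh ^ 2 *
      algebraMap Kh S (PowerSeries.C (Qmat .o N ℂ a b))) * (- e')
  | sp =>
    have e : (1 - kappa .sp N) * (2 / N) = -1 := by simp only [kappa]; field_simp; ring
    have e' : algebraMap Kh S (PowerSeries.C (1 - kappa .sp N)) * algebraMap Kh S (PowerSeries.C (2 / N)) = -1 := by
      rw [← map_mul, ← map_mul, e, map_neg, map_one, map_neg, map_one]
    simp only [Rnum, Matrix.sub_apply, Matrix.smul_apply, smul_eq_mul, map_sub, map_mul, hx, hP, h1,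
      hS, hSc, hΨ, map_one, mul_one, fuseScalar, fuseTwo, theta, Qop, Matrix.add_apply, hQ,
      map_add, map_pow, Int.cast_one, map_neg, Int.cast_neg] at e' ⊢
    linear_combination (algebraMap Kh S hh ^ 2 *
      algebraMap Kh S (PowerSeries.C (Qmat .sp N ℂ a b))) * e'

end RTT


section SpecializedRTT

variable {N : ℕ}

/-- Both variables are sent to shifts of a single one. The form B will be the product of the free
algebra, in either order, followed by a linear map to A. -/
theorem coeff_subst_pair {A : Type} [CommRing A] [Algebra Kh A] {K : ℕ}
    (hK : algebraMap Kh A hh ^ K = 0) (B : FreeTop N →ₗ[Kh] FreeTop N →ₗ[Kh] A) (c : Fin 2 → ℂ)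
    (i j i' j' : Fin N) (F : MvPowerSeries (Fin 2) A)
    (hF : ∀ d, MvPowerSeries.coeff d F = B (PowerSeries.coeff (d 0) (tPlus 0 i j))
      (PowerSeries.coeff (d 1) (tPlus 0 i' j'))) (r : ℕ) :
    MvPowerSeries.coeff (Finsupp.single () r) (MvPowerSeries.subst (shiftVar (fun _ => ())
      (fun v => algebraMap Kh A (PowerSeries.C (c v) * hh))) F) =
      ∑ p ∈ Finset.HasAntidiagonal.antidiagonal r, B (PowerSeries.coeff p.1 (tPlus (c 0) i j))
        (PowerSeries.coeff p.2 (tPlus (c 1) i' j')) := by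
  have hγ : ∀ v, (algebraMap Kh A (PowerSeries.C (c v) * hh)) ^ K = 0 := by
    intro v
    rw [map_mul, mul_pow, hK, mul_zero]
  rw [coeff_subst_shiftVar_eq (M := r + K) _ hγ F _ (by intro t; simp)
    (fun k => B (PowerSeries.coeff (k 0) (tPlus (c 0) i j))
      (PowerSeries.coeff (k 1) (tPlus (c 1) i' j')))]
  · rw [← (finTwoArrowEquiv _).symm.sum_comp, Fintype.sum_prod_type,
      Finset.Nat.sum_antidiagonal_eq_sum_range_succ_mk]
    simp only [finTwoArrowEquiv_symm_apply, Fin.sum_univ_two, Matrix.cons_val_zero,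
      Matrix.cons_val_one, ← Finsupp.single_add]
    have h1 : ∀ x : Fin (r + K + 1), (∑ y : Fin (r + K + 1),
        if Finsupp.single () ((x : ℕ) + y) = Finsupp.single () r then
          B (PowerSeries.coeff (x : ℕ) (tPlus (c 0) i j))
            (PowerSeries.coeff (y : ℕ) (tPlus (c 1) i' j')) else 0) =
        if (x : ℕ) ≤ r then B (PowerSeries.coeff (x : ℕ) (tPlus (c 0) i j))
            (PowerSeries.coeff (r - x) (tPlus (c 1) i' j')) else 0 := by
      intro x
      split_ifs with hx
      · rw [Finset.sum_eq_single (⟨r - x, by omega⟩ : Fin (r + K + 1))]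
        · rw [if_pos]
          rw [Nat.add_sub_of_le hx]
        · intro y _ hy
          rw [if_neg]
          intro h
          apply hy
          have := Finsupp.single_injective _ h
          ext
          simp only
          omega
        · simp
      · refine Finset.sum_eq_zero fun y _ => ?_
        rw [if_neg]
        intro h
        have := Finsupp.single_injective _ h
        omega
    simp only [h1]
    rw [Fin.sum_univ_eq_sum_range (fun x => if x ≤ r then
        B (PowerSeries.coeff x (tPlus (c 0) i j))
            (PowerSeries.coeff (r - x) (tPlus (c 1) i' j')) else 0) (r + K + 1),
      ← Finset.sum_subset (Finset.range_subset_range.mpr (show r + 1 ≤ r + K + 1 by omega))]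
    · refine Finset.sum_congr rfl fun k hk => ?_
      rw [if_pos (Nat.lt_succ_iff.mp (Finset.mem_range.mp hk))]
    · intro k _ hk
      rw [if_neg]
      simpa using hk
  · intro k hk
    simp only [hF]
    have e0 := HCongr.map hK (B.flip (PowerSeries.coeff (k 1) (tPlus (c 1) i' j')))
      (tPlus_shift (c 0) i j (hk 0))
    rw [LinearMap.flip_apply, LinearMap.flip_apply] at e0
    rw [← e0, map_sum, LinearMap.sum_apply, ← (finTwoArrowEquiv _).symm.sum_comp,
      Fintype.sum_prod_type]
    refine Finset.sum_congr rfl fun x _ => ?_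
    have e1 := HCongr.map hK (B (PowerSeries.coeff (x : ℕ) (tPlus 0 i j)))
      (tPlus_shift (c 1) i' j' (hk 1))
    rw [map_smul, LinearMap.smul_apply, ← e1, map_sum, Finset.smul_sum]
    refine Finset.sum_congr rfl fun y _ => ?_
    rw [map_smul, Algebra.smul_def, Algebra.smul_def]
    simp only [finTwoArrowEquiv_symm_apply, Fin.prod_univ_two, Matrix.cons_val_zero,
      Matrix.cons_val_one, map_mul, map_pow, map_natCast, Finsupp.equivFunOnFinite_symm_apply_apply]
    ring

/-- The series `t_ij^+(u + a h)` with coefficients in the double Yangian. -/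
noncomputable def tDY (g : ClassicalType) (N : ℕ) (c a : ℂ) :
    Matrix (Fin N) (Fin N) (PowerSeries (DY g N c)) :=
  Matrix.of fun i j => PowerSeries.map (toDY g N c) (tPlus a i j)

/-- The `RTT` relation for arguments which differ by `h` up to sign. -/
theorem fuseTwo_mul_tDY {g : ClassicalType} (hN : Admissible g N) (c a : ℂ) :
    (fuseTwo g N).map (algebraMap ℂ (PowerSeries (DY g N c))) * (leg1 (tDY g N c a) *
      leg2 (tDY g N c (a + theta g))) =
    leg2 (tDY g N c (a + theta g)) * leg1 (tDY g N c a) *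
      (fuseTwo g N).map (algebraMap ℂ (PowerSeries (DY g N c))) := by
  have hmat : ∀ (x y : Fin N × Fin N) (r : ℕ),
      (∑ z, fuseTwo g N x z • toDY g N c (PowerSeries.coeff r (tPlus a z.1 y.1 *
        tPlus (a + theta g) z.2 y.2))) -
      (∑ z, fuseTwo g N z y • toDY g N c (PowerSeries.coeff r (tPlus (a + theta g) x.2 z.2 *
        tPlus a x.1 z.1))) = 0 := by
    intro x y r
    set D := (∑ z, fuseTwo g N x z • toDY g N c (PowerSeries.coeff r (tPlus a z.1 y.1 *
        tPlus (a + theta g) z.2 y.2))) -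
      (∑ z, fuseTwo g N z y • toDY g N c (PowerSeries.coeff r (tPlus (a + theta g) x.2 z.2 *
        tPlus a x.1 z.1))) with hD
    set ρ : Kh := PowerSeries.C (fuseScalar g N).1 * hh ^ (fuseScalar g N).2 with hρ
    have hsep : ρ • D = 0 := by
      apply DY_separated
      intro K
      -- The relation is linear in the quadratic monomials, with scalar coefficients, so a linear
      -- map to a commutative algebra suffices for the specialization.
      obtain ⟨A, _, _, jj, hK, hj⟩ := exists_squareZero (DY g N c) K
      apply hj
      let lam : FreeTop N →ₗ[Kh] A := jj ∘ₗ
        { toFun := toDY g N c, map_add' := map_add _, map_smul' := toDY_smul g N c }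
      let cc : Fin 2 → ℂ := ![a, a + theta g]
      have hγ : ∀ v, (algebraMap Kh A (PowerSeries.C (cc v) * hh)) ^ K = 0 := by
        intro v
        rw [map_mul, mul_pow, hK, mul_zero]
      let Ψ := (MvPowerSeries.substAlgHom (R := A) (shiftVar_hasSubst (fun _ : Fin 2 => ()) hγ)).toRingHom
      have hΨ : ∀ F, Ψ F = MvPowerSeries.subst (shiftVar (fun _ => ())
        (fun v => algebraMap Kh A (PowerSeries.C (cc v) * hh))) F := fun F =>
        MvPowerSeries.substAlgHom_apply (R := A) (shiftVar_hasSubst (fun _ : Fin 2 => ()) hγ) F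
      have hΨC : ∀ k, Ψ (MvPowerSeries.C k) = MvPowerSeries.C k := fun k =>
        AlgHom.commutes (MvPowerSeries.substAlgHom (R := A) (shiftVar_hasSubst (fun _ : Fin 2 => ()) hγ)) k
      have hΨX : ∀ v, Ψ (MvPowerSeries.X v) = shiftVar (fun _ => ())
        (fun v => algebraMap Kh A (PowerSeries.C (cc v) * hh)) v := fun v => by
        rw [hΨ, MvPowerSeries.subst_X (shiftVar_hasSubst (fun _ : Fin 2 => ()) hγ)]
      let Φ := Ψ.comp (MvPowerSeries.map (σ := Fin 2) (algebraMap Kh A))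
      have hΦC : ∀ k, Φ (MvPowerSeries.C k) = algebraMap Kh (MvPowerSeries Unit A) k := by
        intro k
        simp only [Φ, RingHom.comp_apply, MvPowerSeries.map_C, hΨC]
        rw [MvPowerSeries.algebraMap_apply]
      have hR : ∀ p q, Φ (Rnum g N (MvPowerSeries.X 0 - MvPowerSeries.X 1) 1 p q) =
          algebraMap Kh (MvPowerSeries Unit A) (ρ * PowerSeries.C (fuseTwo g N p q)) := by
        intro p q
        refine Rnum_map hN Φ hΦC _ ?_ p q
        rw [map_sub]
        simp only [Φ, RingHom.comp_apply, MvPowerSeries.map_X, hΨX, shiftVar, cc]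
        rw [MvPowerSeries.algebraMap_apply, add_sub_add_left_eq_sub, ← map_sub, ← map_neg]
        congr 1
        rw [← map_sub, ← map_neg]
        congr 1
        simp only [Matrix.cons_val_zero, Matrix.cons_val_one, map_add, map_intCast]
        ring
      have hrel : coeffwise lam.toAddMonoidHom (relPlus g x y) = 0 := by
        ext d
        rw [coeff_coeffwise]
        show jj (toDY g N c _) = 0
        rw [toDY_relator g N c (IsRelator.plus x y d), map_zero]
      have hexp : coeffwise lam.toAddMonoidHom (relPlus g x y) =
          (∑ z, MvPowerSeries.map (algebraMap Kh A) (Rnum g N (MvPowerSeries.X 0 - MvPowerSeries.X 1) 1 x z) *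
            coeffwise lam.toAddMonoidHom ((T1p * T2p : Matrix _ _ _) z y)) -
          ∑ z, coeffwise lam.toAddMonoidHom ((T2p * T1p : Matrix _ _ _) x z) *
            MvPowerSeries.map (algebraMap Kh A) (Rnum g N (MvPowerSeries.X 0 - MvPowerSeries.X 1) 1 z y) := by
        simp only [relPlus]
        rw [mul_assoc, Matrix.sub_apply, Matrix.mul_apply, Matrix.mul_apply (M := T2p * T1p), map_sub,
          map_sum, map_sum]
        simp only [liftR, Matrix.map_apply, coeffwise_map_mul, coeffwise_mul_map]
      rw [hrel] at hexp
      have e1 : ∀ z : Fin N × Fin N, MvPowerSeries.coeff (Finsupp.single () r)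
          (Ψ (coeffwise lam.toAddMonoidHom ((T1p * T2p : Matrix _ _ _) z y))) =
          lam (PowerSeries.coeff r (tPlus a z.1 y.1 * tPlus (a + theta g) z.2 y.2)) := by
        intro z
        rw [hΨ, coeff_subst_pair hK ((LinearMap.mul Kh (FreeTop N)).compr₂ lam) cc z.1 y.1 z.2 y.2,
          PowerSeries.coeff_mul, map_sum]
        · rfl
        · intro d
          rw [coeff_coeffwise, T1p, T2p, leg1_mul_leg2, coeff_inVar_mul]
          rfl
      have e2 : ∀ z : Fin N × Fin N, MvPowerSeries.coeff (Finsupp.single () r)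
          (Ψ (coeffwise lam.toAddMonoidHom ((T2p * T1p : Matrix _ _ _) x z))) =
          lam (PowerSeries.coeff r (tPlus (a + theta g) x.2 z.2 * tPlus a x.1 z.1)) := by
        intro z
        rw [hΨ, coeff_subst_pair hK ((LinearMap.mul Kh (FreeTop N)).flip.compr₂ lam) cc x.1 z.1 x.2 z.2,
          PowerSeries.coeff_mul, map_sum, ← Finset.Nat.sum_antidiagonal_swap]
        · rfl
        · intro d
          rw [coeff_coeffwise, T1p, T2p, leg2_mul_leg1, coeff_inVar_mul']
          rfl
      have hfin := congrArg (fun F => MvPowerSeries.coeff (Finsupp.single () r) (Ψ F)) hexp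
      simp only [map_zero, map_sub, map_sum, map_mul] at hfin
      have hR' : ∀ p q, Ψ (MvPowerSeries.map (algebraMap Kh A)
          (Rnum g N (MvPowerSeries.X 0 - MvPowerSeries.X 1) 1 p q)) =
          MvPowerSeries.C (algebraMap Kh A (ρ * PowerSeries.C (fuseTwo g N p q))) := by
        intro p q
        rw [← MvPowerSeries.algebraMap_apply]
        exact hR p q
      simp only [hR', mul_comm _ (MvPowerSeries.C _), MvPowerSeries.coeff_C_mul, e1, e2,
        ← Algebra.smul_def, ← map_smul] at hfin
      rw [← map_sum, ← map_sum, ← map_sub] at hfin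
      refine Eq.trans ?_ hfin.symm
      show jj _ = jj (toDY g N c _)
      congr 1
      rw [hD, smul_sub, Finset.smul_sum, Finset.smul_sum, map_sub, map_sum, map_sum]
      simp only [toDY_smul, mul_smul, C_smul_DY]
    have h1 : ∀ (m : ℕ) (z : DY g N c), hh ^ m • z = 0 → z = 0 := by
      intro m
      induction m with
      | zero => intro z hz; simpa using hz
      | succ m ih =>
        intro z hz
        rw [pow_succ, mul_smul] at hz
        exact DY_torsionFree g N c z (ih _ hz)
    -- Clearing the denominators of the R-matrix has introduced powers of h and a nonzero scalar;
    -- the powers of h are cancelled by torsion-freeness.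
    rw [hρ, mul_comm, mul_smul, C_smul_DY] at hsep
    have h2 := h1 _ _ hsep
    exact (smul_eq_zero_iff_right (fuseScalar_ne_zero hN)).mp h2
  ext x y r
  have := hmat x y r
  rw [sub_eq_zero] at this
  rw [Matrix.mul_apply, Matrix.mul_apply (N := Matrix.map _ _), map_sum, map_sum]
  have l1 := fun z => leg1_mul_leg2 (tDY g N c a) (tDY g N c (a + theta g)) z y
  have l2 := fun z => leg2_mul_leg1 (tDY g N c a) (tDY g N c (a + theta g)) x z
  simp only [l1, l2, Matrix.map_apply, ← Algebra.commutes, ← Algebra.smul_def,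
    PowerSeries.coeff_smul]
  simp only [tDY, Matrix.of_apply, ← map_mul, PowerSeries.coeff_map]
  exact this

end SpecializedRTT


/-! ### Fusion of the generators -/

section FusedT

variable {N n : ℕ}

theorem Pmat_mul_self {S : Type} [CommRing S] : Pmat N S * Pmat N S = 1 := by
  ext ⟨a1, a2⟩ ⟨b1, b2⟩
  rw [Matrix.mul_apply, Finset.sum_eq_single (a2, a1)]
  · simp only [Pmat, Matrix.of_apply, and_self, if_true, one_mul, Matrix.one_apply, Prod.mk.injEq]
    simp only [and_comm]
  · rintro ⟨x, y⟩ _ h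
    simp only [Pmat, Matrix.of_apply]
    rw [if_neg, zero_mul]
    rintro ⟨rfl, rfl⟩
    exact h rfl
  · simp

theorem Pmat_mul_Qop {g : ClassicalType} (hN : Admissible g N) :
    Pmat N ℂ * Qop g N ℂ = theta g • Qop g N ℂ := by
  have := congrArg Matrix.conjTranspose (Qop_mul_Pmat (S := ℂ) hN)
  rw [Matrix.conjTranspose_mul, Pmat_isHermitian.eq, (Qop_isHermitian g).eq,
    Matrix.conjTranspose_smul, (Qop_isHermitian g).eq] at this
  simpa using this

theorem Admissible.cast_ne_zero {g : ClassicalType} (hN : Admissible g N) : (N : ℂ) ≠ 0 := by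
  have h2 : N ≠ 0 := by cases g <;> first | (have := hN.1; omega) | (have : 2 ≤ N := hN; omega)
  exact_mod_cast h2

theorem fuseTwo_mul_Pmat {g : ClassicalType} (hN : Admissible g N) :
    fuseTwo g N * Pmat N ℂ = (theta g : ℂ) • fuseTwo g N := by
  rw [fuseTwo, sub_mul, add_mul, one_mul, smul_mul_assoc, Pmat_mul_self, smul_mul_assoc,
    Qop_mul_Pmat hN, ← Int.cast_smul_eq_zsmul ℂ]
  have := theta_mul_self_complex g
  linear_combination (norm := module) (-this) • Pmat N ℂ

theorem fuseTwo_mul_Qop {g : ClassicalType} (hN : Admissible g N) :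
    fuseTwo g N * Qop g N ℂ = 0 := by
  rw [fuseTwo, sub_mul, add_mul, one_mul, smul_mul_assoc, Pmat_mul_Qop hN, smul_mul_assoc,
    Qop_mul_Qop, ← Int.cast_smul_eq_zsmul ℂ]
  have h1 := theta_mul_self_complex g
  have h2 : (2 / N : ℂ) * N = 2 := div_mul_cancel₀ _ hN.cast_ne_zero
  linear_combination (norm := module) h1 • Qop g N ℂ - h2 • Qop g N ℂ

theorem fusionShift_succ (g : ClassicalType) (k : ℕ) (hk : k + 1 < n) :
    fusionShift g (⟨k + 1, hk⟩ : Fin n) = fusionShift g (⟨k, by omega⟩ : Fin n) + theta g := by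
  cases g with
  | gl => simp [fusionShift, theta]; ring
  | o =>
    simp only [fusionShift, theta]
    rw [show n - 1 - k = (n - 1 - (k + 1)) + 1 by omega]
    push_cast; ring
  | sp => simp [fusionShift, theta]; ring

theorem twoLeg_fuseTwo (g : ClassicalType) (p q : Fin n) :
    twoLeg p q (fuseTwo g N) = 1 + (theta g : ℂ) • Pleg N ℂ p q - (2 / N : ℂ) • Qleg g N ℂ p q := by
  rw [fuseTwo, sub_eq_add_neg, ← neg_smul, twoLeg_add, twoLeg_add, twoLeg_one, twoLeg_smul,
    twoLeg_smul, Pleg, Qleg, neg_smul, ← sub_eq_add_neg]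

/-- Extension of scalars for operators on the tensor power. -/
noncomputable abbrev extendScalars (n N : ℕ) (B : Type) [Ring B] [Algebra ℂ B] :
    Matrix (Fin n → Fin N) (Fin n → Fin N) ℂ →ₐ[ℂ] Matrix (Fin n → Fin N) (Fin n → Fin N) B :=
  (Algebra.ofId ℂ B).mapMatrix

theorem extendScalars_twoLeg {B : Type} [Ring B] [Algebra ℂ B] (p q : Fin n)
    (M : Matrix (Fin N × Fin N) (Fin N × Fin N) ℂ) :
    extendScalars n N B (twoLeg p q M) = twoLeg p q (M.map (algebraMap ℂ B)) :=
  twoLeg_map (algebraMap ℂ B) p q M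

theorem extendScalars_twoLeg_comm {B : Type} [Ring B] [Algebra ℂ B] {p q r : Fin n} (hpq : p ≠ q)
    (hp : r ≠ p) (hq : r ≠ q) (M : Matrix (Fin N × Fin N) (Fin N × Fin N) ℂ)
    (L : Matrix (Fin N) (Fin N) B) : Commute (extendScalars n N B (twoLeg p q M)) (oneLeg r L) := by
  rw [extendScalars_twoLeg]
  exact twoLeg_oneLeg_comm hpq hp hq _ _ fun x y i j => Algebra.commutes _ _

/-- The fusion property of `T_[n]^+(u_[n])`. -/
theorem isFusedAll_prod_tDY {g : ClassicalType} (hN : Admissible g N) (hn : n ≤ maxFusion g N)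
    (c : ℂ) : IsFusedAll (extendScalars n N (PowerSeries (DY g N c))) g
      (extendScalars n N (PowerSeries (DY g N c)) (fusionIdem g N n) *
        (List.ofFn fun k : Fin n => oneLeg k (tDY g N c (fusionShift g k))).prod) := by
  intro k hk
  have hne : (⟨k, by omega⟩ : Fin n) ≠ ⟨k + 1, hk⟩ := by simp
  have hE := fusionIdem_isFusedAll hN hn k hk
  rw [AlgHom.id_apply, AlgHom.id_apply] at hE
  refine isFused_prod_ofFn (S := ℂ) ?_ _ k hk ?_ ?_
  · constructor
    · rw [← map_mul, hE.1, map_smul]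
    · rw [← map_mul, hE.2, map_zero]
  · intro i h1 h2
    have e1 : i ≠ ⟨k, by omega⟩ := fun h => h1 (congrArg Fin.val h)
    have e2 : i ≠ ⟨k + 1, hk⟩ := fun h => h2 (congrArg Fin.val h)
    exact ⟨extendScalars_twoLeg_comm hne e1 e2 _ _, extendScalars_twoLeg_comm hne e1 e2 _ _⟩
  · intro Y hY
    set φ := extendScalars n N (PowerSeries (DY g N c)) with hφ
    -- Behind a fused Y the operator 1 + θP - (2/N)Q acts by 1 + θ² = 2. It can therefore be
    -- inserted behind Y and carried to the right end by the RTT relation, where it makes the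
    -- product fused.
    have hG : Y * φ (twoLeg ⟨k, by omega⟩ ⟨k + 1, hk⟩ (fuseTwo g N)) = (2 : ℂ) • Y := by
      rw [twoLeg_fuseTwo, map_sub, map_add, map_smul, map_smul, map_one, mul_sub, mul_add, mul_one,
        mul_smul_comm, mul_smul_comm, hY.1, hY.2]
      linear_combination (norm := module) (theta_mul_self_complex g) • Y
    have hrtt : φ (twoLeg ⟨k, by omega⟩ ⟨k + 1, hk⟩ (fuseTwo g N)) *
        (oneLeg ⟨k, by omega⟩ (tDY g N c (fusionShift g (⟨k, by omega⟩ : Fin n))) *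
          oneLeg ⟨k + 1, hk⟩ (tDY g N c (fusionShift g (⟨k + 1, hk⟩ : Fin n)))) =
        oneLeg ⟨k + 1, hk⟩ (tDY g N c (fusionShift g (⟨k + 1, hk⟩ : Fin n))) *
        oneLeg ⟨k, by omega⟩ (tDY g N c (fusionShift g (⟨k, by omega⟩ : Fin n))) *
        φ (twoLeg ⟨k, by omega⟩ ⟨k + 1, hk⟩ (fuseTwo g N)) := by
      have := congrArg (twoLeg (⟨k, by omega⟩ : Fin n) ⟨k + 1, hk⟩)
        (fuseTwo_mul_tDY hN c (fusionShift g (⟨k, by omega⟩ : Fin n)))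
      rw [← twoLeg_mul hne, ← twoLeg_mul hne, ← twoLeg_mul hne, ← twoLeg_mul hne, twoLeg_leg1 hne,
        twoLeg_leg2 hne, ← extendScalars_twoLeg, ← fusionShift_succ g k hk] at this
      exact this
    have hYAB : ∀ Z, Z = Y * oneLeg ⟨k, by omega⟩ (tDY g N c (fusionShift g (⟨k, by omega⟩ : Fin n))) *
        oneLeg ⟨k + 1, hk⟩ (tDY g N c (fusionShift g (⟨k + 1, hk⟩ : Fin n))) →
        (2 : ℂ) • Z = Y * (oneLeg ⟨k + 1, hk⟩ (tDY g N c (fusionShift g (⟨k + 1, hk⟩ : Fin n))) *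
        oneLeg ⟨k, by omega⟩ (tDY g N c (fusionShift g (⟨k, by omega⟩ : Fin n)))) *
        φ (twoLeg ⟨k, by omega⟩ ⟨k + 1, hk⟩ (fuseTwo g N)) := by
      rintro Z rfl
      rw [mul_assoc, ← smul_mul_assoc, ← hG, mul_assoc, hrtt]
      simp only [mul_assoc]
    have h2 := hYAB _ rfl
    set Z := Y * oneLeg ⟨k, by omega⟩ (tDY g N c (fusionShift g (⟨k, by omega⟩ : Fin n))) *
        oneLeg ⟨k + 1, hk⟩ (tDY g N c (fusionShift g (⟨k + 1, hk⟩ : Fin n)))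
    have h3 : Z = (2 : ℂ)⁻¹ • ((2 : ℂ) • Z) := by rw [smul_smul]; norm_num
    constructor
    · rw [h3, smul_mul_assoc, h2, mul_assoc, ← map_mul, Pleg, twoLeg_mul hne, fuseTwo_mul_Pmat hN,
        twoLeg_smul, map_smul, mul_smul_comm, smul_comm]
    · rw [h3, smul_mul_assoc, h2, mul_assoc, ← map_mul, Qleg, twoLeg_mul hne, fuseTwo_mul_Qop hN,
        twoLeg_zero, map_zero, mul_zero, smul_zero]

theorem fusionIdem_mul_prod_tDY {g : ClassicalType} (hN : Admissible g N) (hn : n ≤ maxFusion g N)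
    (c : ℂ) :
    extendScalars n N (PowerSeries (DY g N c)) (fusionIdem g N n) *
        (List.ofFn fun k : Fin n => oneLeg k (tDY g N c (fusionShift g k))).prod *
        extendScalars n N (PowerSeries (DY g N c)) (fusionIdem g N n) =
    extendScalars n N (PowerSeries (DY g N c)) (fusionIdem g N n) *
        (List.ofFn fun k : Fin n => oneLeg k (tDY g N c (fusionShift g k))).prod :=
  (isFusedAll_prod_tDY hN hn c).mul_fusionIdem hN hn

/-- The coefficient of `u^r` in the matrix entry `(a,b)` of `T_1^+(u + c_1 h) ⋯ T_n^+(u + c_n h) 𝟏`. -/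
noncomputable def tVecShift (g : ClassicalType) (N : ℕ) (c : ℂ) (s : Fin n → ℂ)
    (a b : Fin n → Fin N) (r : ℕ) : Vac g N c :=
  toVac g N c (PowerSeries.coeff r (List.ofFn fun k => tPlus (s k) (a k) (b k)).prod)

/-- The linear map `x ↦ x 𝟏`. -/
noncomputable def toVacLinear (g : ClassicalType) (N : ℕ) (c : ℂ) : FreeTop N →ₗ[Kh] Vac g N c where
  toFun := toVac g N c
  map_add' x y := by rw [toVac, map_add, Submodule.Quotient.mk_add]; rfl
  map_smul' k x := by
    rw [toVac, toDY_smul]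
    rfl

theorem toVac_smul_complex (g : ClassicalType) (N : ℕ) (c k : ℂ) (x : FreeTop N) :
    toVac g N c (k • x) = (PowerSeries.C k : Kh) • toVac g N c x := by
  rw [← C_smul_FreeTop]
  exact (toVacLinear g N c).map_smul _ _

/-- The absorption ℰTℰ = ℰT applied to the vacuum and read on coefficients. In this form it passes
through linear maps into commutative rings. -/
theorem fusionIdem_mul_tVecShift {g : ClassicalType} (hN : Admissible g N)
    (hn : n ≤ maxFusion g N) (c : ℂ) (a b : Fin n → Fin N) (r : ℕ) :
    ∑ x, ∑ y, (PowerSeries.C (fusionIdem g N n a x * fusionIdem g N n y b) : Kh) •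
      tVecShift g N c (fusionShift g) x y r =
    ∑ x, (PowerSeries.C (fusionIdem g N n a x) : Kh) • tVecShift g N c (fusionShift g) x b r := by
  have h := congrFun (congrFun (fusionIdem_mul_prod_tDY hN hn c) a) b
  have hent : ∀ x y : Fin n → Fin N,
      (List.ofFn fun k : Fin n => oneLeg k (tDY g N c (fusionShift g k))).prod x y =
      PowerSeries.map (toDY g N c) (List.ofFn fun k => tPlus (fusionShift g k) (x k) (y k)).prod := by
    intro x y
    rw [prod_oneLeg_apply (fun k => tDY g N c (fusionShift g k)), map_list_prod, List.map_ofFn]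
    rfl
  rw [Matrix.mul_apply, Matrix.mul_apply] at h
  simp only [Matrix.mul_apply, hent, AlgHom.mapMatrix_apply, Matrix.map_apply] at h
  have h' := congrArg (fun f => (Submodule.Quotient.mk (PowerSeries.coeff r f) : Vac g N c)) h
  have hq : ∀ (k : ℂ) (f : PowerSeries (FreeTop N)),
      (Submodule.Quotient.mk (PowerSeries.coeff r
        (Algebra.ofId ℂ (PowerSeries (DY g N c)) k * PowerSeries.map (toDY g N c) f)) : Vac g N c) =
      (PowerSeries.C k : Kh) • toVac g N c (PowerSeries.coeff r f) := by
    intro k f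
    rw [← toVac_smul_complex, Algebra.ofId_apply, ← Algebra.smul_def, PowerSeries.coeff_smul,
      PowerSeries.coeff_map]
    rfl
  have hq2 : ∀ (k k' : ℂ) (f : PowerSeries (DY g N c)),
      Algebra.ofId ℂ (PowerSeries (DY g N c)) k * f * Algebra.ofId ℂ (PowerSeries (DY g N c)) k' =
      Algebra.ofId ℂ (PowerSeries (DY g N c)) (k * k') * f := by
    intro k k' f
    rw [Algebra.ofId_apply, Algebra.ofId_apply, Algebra.ofId_apply, mul_assoc,
      ← Algebra.commutes k' f, ← mul_assoc, ← map_mul]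
  have hmk : ∀ f : (Fin n → Fin N) → PowerSeries (DY g N c),
      (Submodule.Quotient.mk (PowerSeries.coeff r (∑ x, f x)) : Vac g N c) =
      ∑ x, Submodule.Quotient.mk (PowerSeries.coeff r (f x)) := by
    intro f
    rw [map_sum]
    exact map_sum (Submodule.mkQ (vacuumIdeal g N c)) _ _
  simp only [Finset.sum_mul, hq2, hmk, hq] at h'
  rw [Finset.sum_comm]
  exact h'

end FusedT


/-! ### Substitution of the fused arguments -/

section Specialization

variable {N n m : ℕ} {α : Type}

/-- The variables after specialization: `u_i` is replaced by `x_{π i}`, and all the `v_j` by `v`. -/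
def mergeVar (π : Fin n → α) : Vars n m → Option (α ⊕ Unit)
  | none => none
  | some (.inl i) => some (.inl (π i))
  | some (.inr _) => some (.inr ())

/-- The multiples of `h` by which the variables are shifted. -/
noncomputable def shiftAmount (c : Fin n → ℂ) (d : Fin m → ℂ) : Vars n m → Kh
  | none => 0
  | some (.inl i) => PowerSeries.C (c i) * hh
  | some (.inr j) => PowerSeries.C (d j) * hh

/-- Functions on the variables in terms of their restrictions. -/
def varsEquiv (n m : ℕ) (X : Type) : (Vars n m → X) ≃ X × (Fin n → X) × (Fin m → X) where
  toFun f := (f none, fun i => f (some (.inl i)), fun j => f (some (.inr j)))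
  invFun p := fun v => match v with
    | none => p.1
    | some (.inl i) => p.2.1 i
    | some (.inr j) => p.2.2 j
  left_inv f := by
    funext v
    rcases v with _ | i | j <;> rfl
  right_inv p := rfl

variable {A : Type} [CommRing A] [Algebra Kh A]

theorem sum_choose_zero_pow {M k : ℕ} (hk : k ≤ M) (f : ℕ → A) :
    ∑ d : Fin (M + 1), (((d : ℕ).choose k : A) * 0 ^ ((d : ℕ) - k)) * f d = f k := by
  rw [Fin.sum_univ_eq_sum_range (fun d => ((d.choose k : A) * 0 ^ (d - k)) * f d) (M + 1),
    Finset.sum_eq_single k]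
  · simp
  · intro d _ hd
    rcases Nat.lt_or_ge d k with h | h
    · simp [Nat.choose_eq_zero_of_lt h]
    · rw [zero_pow (by omega)]; simp
  · intro h
    rw [Finset.mem_range] at h
    omega

variable [Fintype α] [DecidableEq α]

/-- The substitution of the fused arguments. -/
noncomputable def specialize (A : Type) [CommRing A] [Algebra Kh A] (π : Fin n → α)
    (c : Fin n → ℂ) (d : Fin m → ℂ) (F : MvPowerSeries (Vars n m) A) :
    MvPowerSeries (Option (α ⊕ Unit)) A :=
  MvPowerSeries.subst (shiftVar (mergeVar π) (fun v => algebraMap Kh A (shiftAmount c d v))) F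

theorem shiftAmount_pow {K : ℕ} (hK : algebraMap Kh A hh ^ K = 0) (hK0 : K ≠ 0) (c : Fin n → ℂ)
    (d : Fin m → ℂ) (v : Vars n m) : algebraMap Kh A (shiftAmount c d v) ^ K = 0 := by
  rcases v with _ | i | j
  · simp [shiftAmount, hK0]
  · rw [shiftAmount, map_mul, mul_pow, hK, mul_zero]
  · rw [shiftAmount, map_mul, mul_pow, hK, mul_zero]

theorem bilin_prod_shift {K : ℕ} (hK : algebraMap Kh A hh ^ K = 0)
    (B : FreeTop N →ₗ[Kh] FreeTop N →ₗ[Kh] A) (c : Fin n → ℂ) (d : Fin m → ℂ)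
    (a b : Fin n → Fin N) (a' b' : Fin m → Fin N) {M : ℕ} (k : Fin n → ℕ) (l : Fin m → ℕ)
    (hk : ∀ i, k i + K ≤ M) (hl : ∀ j, l j + K ≤ M) :
    ∑ x : Fin n → Fin (M + 1), ∑ y : Fin m → Fin (M + 1),
      (∏ i, ((x i : ℕ).choose (k i) : A) * algebraMap Kh A (PowerSeries.C (c i) * hh) ^ ((x i : ℕ) - k i)) *
      (∏ j, ((y j : ℕ).choose (l j) : A) * algebraMap Kh A (PowerSeries.C (d j) * hh) ^ ((y j : ℕ) - l j)) *
      B (List.ofFn fun i => PowerSeries.coeff (x i : ℕ) (tPlus 0 (a i) (b i))).prod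
        (List.ofFn fun j => PowerSeries.coeff (y j : ℕ) (tPlus 0 (a' j) (b' j))).prod =
    B (List.ofFn fun i => PowerSeries.coeff (k i) (tPlus (c i) (a i) (b i))).prod
      (List.ofFn fun j => PowerSeries.coeff (l j) (tPlus (d j) (a' j) (b' j))).prod := by
  have h1 := prod_tPlus_shift c a b k hk
  have h2 := prod_tPlus_shift d a' b' l hl
  rw [← HCongr.map hK (B _) h2, ← LinearMap.flip_apply B, ← HCongr.map hK _ h1,
    map_sum, Finset.sum_congr rfl]
  intro x _
  rw [map_smul, LinearMap.flip_apply, map_sum, Finset.smul_sum]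
  refine Finset.sum_congr rfl fun y _ => ?_
  rw [map_smul, Algebra.smul_def, Algebra.smul_def]
  simp only [map_prod, map_mul, map_natCast, map_pow]
  ring

/-- Applied with constant π, when both groups of variables are fused, and with π the identity, when
the variables u_i stay independent. The cutoff M is left free so that each case can enlarge it. -/
theorem coeff_specialize {K : ℕ} (hK : algebraMap Kh A hh ^ K = 0)
    (B : ℕ → FreeTop N →ₗ[Kh] FreeTop N →ₗ[Kh] A) (π : Fin n → α) (c : Fin n → ℂ) (d : Fin m → ℂ)
    (a b : Fin n → Fin N) (a' b' : Fin m → Fin N) (F : MvPowerSeries (Vars n m) A)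
    (hF : ∀ f, MvPowerSeries.coeff f F = B (f none)
      (List.ofFn fun i => PowerSeries.coeff (f (some (.inl i))) (tPlus 0 (a i) (b i))).prod
      (List.ofFn fun j => PowerSeries.coeff (f (some (.inr j))) (tPlus 0 (a' j) (b' j))).prod)
    (e : Option (α ⊕ Unit) →₀ ℕ) : ∃ M₀, ∀ M ≥ M₀,
    MvPowerSeries.coeff e (specialize A π c d F) =
      ∑ k : Fin n → Fin (M + 1),
        if ∀ t, (∑ i, if π i = t then (k i : ℕ) else 0) = e (some (.inl t)) then
        B (e none) (List.ofFn fun i => PowerSeries.coeff (k i : ℕ) (tPlus (c i) (a i) (b i))).prod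
          (PowerSeries.coeff (e (some (.inr ())))
            (List.ofFn fun j => tPlus (d j) (a' j) (b' j)).prod) else 0 := by
  -- The variable z⁻¹ is shifted by 0, and 0^K = 0 needs K ≠ 0.
  wlog hK0 : K ≠ 0
  · refine this (K := K + 1) ?_ B π c d a b a' b' F hF e (by omega)
    rw [pow_succ, hK, zero_mul]
  obtain ⟨M₀, hM₀⟩ : ∃ M₀, ∀ t, e t + K ≤ M₀ :=
    ⟨(e.support.sup e) + K, fun t => by
      by_cases ht : t ∈ e.support
      · have := Finset.le_sup (f := e) ht
        omega
      · rw [Finsupp.notMem_support_iff.mp ht]; omega⟩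
  refine ⟨M₀, fun M hMM => ?_⟩
  have hM : ∀ t, e t + K ≤ M := fun t => (hM₀ t).trans hMM
  rw [specialize, coeff_subst_shiftVar_eq (mergeVar π) (shiftAmount_pow hK hK0 c d) F e hM
    (fun k => B (k none)
      (List.ofFn fun i => PowerSeries.coeff (k (some (.inl i))) (tPlus (c i) (a i) (b i))).prod
      (List.ofFn fun j => PowerSeries.coeff (k (some (.inr j))) (tPlus (d j) (a' j) (b' j))).prod)]
  · rw [← (varsEquiv n m (Fin (M + 1))).symm.sum_comp, Fintype.sum_prod_type]
    simp only [Fintype.sum_prod_type]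
    have hcond : ∀ (k0 : Fin (M + 1)) (k : Fin n → Fin (M + 1)) (l : Fin m → Fin (M + 1)),
        (∑ v, Finsupp.single (mergeVar π v)
          ((varsEquiv n m (Fin (M + 1))).symm (k0, k, l) v : ℕ) = e) ↔
        (k0 : ℕ) = e none ∧ (∀ t, (∑ i, if π i = t then (k i : ℕ) else 0) = e (some (.inl t))) ∧
          ∑ j, (l j : ℕ) = e (some (.inr ())) := by
      intro k0 k l
      rw [Fintype.sum_option, Fintype.sum_sum_type, Finsupp.ext_iff, Option.forall, Sum.forall]
      simp only [Finsupp.add_apply, Finsupp.finsetSum_apply, mergeVar, varsEquiv, Equiv.coe_fn_symm_mk,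
        Finsupp.single_apply, reduceCtorEq, if_false, Option.some.injEq, Sum.inl.injEq, if_true,
        Finset.sum_const_zero, add_zero, zero_add]
      simp
      exact fun _ _ => ⟨fun h => h (), fun h _ => h⟩
    simp only [hcond]
    rw [Finset.sum_eq_single (⟨e none, by have := hM none; omega⟩ : Fin (M + 1))]
    · refine Finset.sum_congr rfl fun k _ => ?_
      split_ifs with h
      · rw [coeff_prod_ofFn _ (M := M) (by have := hM (some (.inr ())); omega), map_sum]
        refine Finset.sum_congr rfl fun l _ => ?_
        by_cases hl : ∑ j, (l j : ℕ) = e (some (.inr ()))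
        · rw [if_pos ⟨rfl, h, hl⟩, if_pos hl]
          rfl
        · rw [if_neg (fun h' => hl h'.2.2), if_neg hl, map_zero]
      · exact Finset.sum_eq_zero fun l _ => if_neg fun h' => h h'.2.1
    · intro k0 _ hk0
      refine Finset.sum_eq_zero fun k _ => Finset.sum_eq_zero fun l _ => if_neg fun h' => hk0 ?_
      exact Fin.ext h'.1
    · simp
  · intro k hk
    rw [← (varsEquiv n m (Fin (M + 1))).symm.sum_comp, Fintype.sum_prod_type]
    simp only [Fintype.sum_prod_type, hF]
    rw [← sum_choose_zero_pow (A := A) (M := M) (k := k none) (by have := hk none; omega) (fun z => B z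
      (List.ofFn fun i => PowerSeries.coeff (k (some (.inl i))) (tPlus (c i) (a i) (b i))).prod
      (List.ofFn fun j => PowerSeries.coeff (k (some (.inr j))) (tPlus (d j) (a' j) (b' j))).prod)]
    refine Finset.sum_congr rfl fun d0 _ => ?_
    rw [← bilin_prod_shift hK _ c d a b a' b' (fun i => k (some (.inl i)))
      (fun j => k (some (.inr j))) (fun i => hk _) (fun j => hk _)]
    simp only [Finset.mul_sum]
    refine Finset.sum_congr rfl fun x _ => Finset.sum_congr rfl fun y _ => ?_
    rw [Fintype.prod_option, Fintype.prod_sum_type]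
    simp only [varsEquiv, Equiv.coe_fn_symm_mk, shiftAmount, map_zero, Finsupp.equivFunOnFinite_symm_apply_apply]
    ring

theorem coeff_specialize_const {K : ℕ} (hK : algebraMap Kh A hh ^ K = 0)
    (B : ℕ → FreeTop N →ₗ[Kh] FreeTop N →ₗ[Kh] A) (c : Fin n → ℂ) (d : Fin m → ℂ)
    (a b : Fin n → Fin N) (a' b' : Fin m → Fin N) (F : MvPowerSeries (Vars n m) A)
    (hF : ∀ f, MvPowerSeries.coeff f F = B (f none)
      (List.ofFn fun i => PowerSeries.coeff (f (some (.inl i))) (tPlus 0 (a i) (b i))).prod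
      (List.ofFn fun j => PowerSeries.coeff (f (some (.inr j))) (tPlus 0 (a' j) (b' j))).prod)
    (e : Option (Unit ⊕ Unit) →₀ ℕ) :
    MvPowerSeries.coeff e (specialize A (fun _ => ()) c d F) =
      B (e none) (PowerSeries.coeff (e (some (.inl ())))
          (List.ofFn fun i => tPlus (c i) (a i) (b i)).prod)
        (PowerSeries.coeff (e (some (.inr ()))) (List.ofFn fun j => tPlus (d j) (a' j) (b' j)).prod) := by
  obtain ⟨M₀, h⟩ := coeff_specialize hK B (fun _ => ()) c d a b a' b' F hF e
  rw [h (max M₀ (e (some (.inl ())))) (le_max_left _ _),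
    coeff_prod_ofFn (fun i => tPlus (c i) (a i) (b i)) (le_max_right M₀ (e (some (.inl ())))),
    map_sum, LinearMap.sum_apply]
  refine Finset.sum_congr rfl fun k _ => ?_
  by_cases hk : ∑ i, (k i : ℕ) = e (some (.inl ()))
  · rw [if_pos (fun _ => by simpa using hk), if_pos hk]
  · rw [if_neg (fun h' => hk (by simpa using h' ())), if_neg hk, map_zero, LinearMap.zero_apply]

theorem coeff_specialize_id {K : ℕ} (hK : algebraMap Kh A hh ^ K = 0)
    (B : ℕ → FreeTop N →ₗ[Kh] FreeTop N →ₗ[Kh] A) (c : Fin n → ℂ) (d : Fin m → ℂ)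
    (a b : Fin n → Fin N) (a' b' : Fin m → Fin N) (F : MvPowerSeries (Vars n m) A)
    (hF : ∀ f, MvPowerSeries.coeff f F = B (f none)
      (List.ofFn fun i => PowerSeries.coeff (f (some (.inl i))) (tPlus 0 (a i) (b i))).prod
      (List.ofFn fun j => PowerSeries.coeff (f (some (.inr j))) (tPlus 0 (a' j) (b' j))).prod)
    (e : Option (Fin n ⊕ Unit) →₀ ℕ) :
    MvPowerSeries.coeff e (specialize A id c d F) =
      B (e none) (List.ofFn fun i => PowerSeries.coeff (e (some (.inl i))) (tPlus (c i) (a i) (b i))).prod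
        (PowerSeries.coeff (e (some (.inr ()))) (List.ofFn fun j => tPlus (d j) (a' j) (b' j)).prod) := by
  obtain ⟨M₀, h⟩ := coeff_specialize hK B id c d a b a' b' F hF e
  have hle : ∀ i, e (some (.inl i)) ≤ ∑ i, e (some (.inl i)) := fun i =>
    Finset.single_le_sum (f := fun i => e (some (.inl i))) (fun _ _ => Nat.zero_le _) (Finset.mem_univ i)
  rw [h (M₀ + ∑ i, e (some (.inl i))) (by omega), Finset.sum_eq_single
    (fun i => ⟨e (some (.inl i)), by have := hle i; omega⟩)]
  · rw [if_pos (by simp)]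
  · intro k _ hk
    rw [if_neg]
    intro h'
    apply hk
    funext i
    have := h' i
    simp only [id, Finset.sum_ite_eq', Finset.mem_univ, if_true] at this
    exact Fin.ext this
  · simp

end Specialization


/-! ### Coefficients of the `R`-matrix at fused arguments -/

section RCoefficients

variable {τ : Type}

/-- The coefficient of `Q` in `R(u)`, as a function of `s = u⁻¹` (zero for `𝔤𝔩_N`). -/
noncomputable def Qcoeff (g : ClassicalType) (N : ℕ) (s : MvPowerSeries τ Kh) : MvPowerSeries τ Kh :=
  match g with
  | .gl => 0
  | .o => hS τ * invSum s (-hSc τ (kappa .o N))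
  | .sp => hS τ * invSum s (-hSc τ (kappa .sp N))

theorem Rmat_eq (g : ClassicalType) (N : ℕ) (s : MvPowerSeries τ Kh) :
    Rmat g N s = 1 - (hS τ * s) • Pmat N _ + Qcoeff g N s • Qop g N _ := by
  cases g with
  | gl => simp [Rmat, Qcoeff]
  | o => rfl
  | sp => rfl

theorem isUnit_one_add_mul {s : MvPowerSeries τ Kh} (hs : MvPowerSeries.constantCoeff s = 0)
    (y : MvPowerSeries τ Kh) : IsUnit (1 + s * y) := by
  rw [MvPowerSeries.isUnit_iff_constantCoeff]
  simp [hs]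

theorem invSum_mul {s : MvPowerSeries τ Kh} (hs : MvPowerSeries.constantCoeff s = 0)
    (y : MvPowerSeries τ Kh) : invSum s y * (1 + s * y) = s := by
  rw [invSum, mul_assoc, Ring.inverse_mul_cancel _ (isUnit_one_add_mul hs y), mul_one]

theorem constantCoeff_invSum {s : MvPowerSeries τ Kh} (hs : MvPowerSeries.constantCoeff s = 0)
    (y : MvPowerSeries τ Kh) : MvPowerSeries.constantCoeff (invSum s y) = 0 := by
  rw [invSum, map_mul, hs, zero_mul]

theorem hSc_eq (c : ℂ) : hSc τ c = algebraMap ℂ _ c * hS τ := by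
  rw [hSc, map_mul, MvPowerSeries.algebraMap_apply, PowerSeries.algebraMap_apply]
  rfl

theorem Qcoeff_mul {g : ClassicalType} (hg : g ≠ .gl) (N : ℕ) {s : MvPowerSeries τ Kh}
    (hs : MvPowerSeries.constantCoeff s = 0) :
    Qcoeff g N s * (1 - algebraMap ℂ _ (kappa g N) * (hS τ * s)) = hS τ * s := by
  have h : ∀ k : ℂ, hS τ * invSum s (-hSc τ k) * (1 - algebraMap ℂ _ k * (hS τ * s)) = hS τ * s := by
    intro k
    have := invSum_mul hs (-hSc τ k)
    rw [hSc_eq] at this ⊢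
    linear_combination hS τ * this
  cases g with
  | gl => exact absurd rfl hg
  | o => exact h _
  | sp => exact h _

theorem isUnit_one_sub_kappa (k : ℂ) {s : MvPowerSeries τ Kh}
    (hs : MvPowerSeries.constantCoeff s = 0) :
    IsUnit (1 - algebraMap ℂ _ k * (hS τ * s) : MvPowerSeries τ Kh) := by
  have := isUnit_one_add_mul hs (-hSc τ k)
  rw [hSc_eq] at this
  convert this using 1
  ring

theorem two_theta_add_kappa {g : ClassicalType} (hg : g ≠ .gl) (N : ℕ) :
    2 * ((theta g : ℂ) + kappa g N) = N := by
  cases g with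
  | gl => exact absurd rfl hg
  | o => simp only [theta, kappa]; push_cast; ring
  | sp => simp only [theta, kappa]; push_cast; ring

/-- In terms of inverses: 1/a' = 1/a + θ and 1/b = 1/a - κ, hence 1/b' = 1/b + θ and 2/a' - 2/b =
2(θ + κ) = n. The units 1 - κa and 1 - κa' serve to clear denominators. -/
theorem coeffCond_of_sub {S : Type} [CommRing S] {θ κ n : S} (hθ : θ * θ = 1) {a a' b b' : S}
    {qzero : Prop} (ha : a - a' = θ * (a * a'))
    (hb : qzero ∧ b = 0 ∧ b' = 0 ∨ b * (1 - κ * a) = a ∧ b' * (1 - κ * a') = a' ∧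
      IsUnit (1 - κ * a) ∧ IsUnit (1 - κ * a') ∧ 2 * (θ + κ) = n) :
    CoeffCond θ n qzero a b a' b' := by
  refine ⟨by linear_combination θ * ha + a * a' * hθ, ?_⟩
  rcases hb with ⟨hq, rfl, rfl⟩ | ⟨h1, h2, hu, hu', hn⟩
  · exact ⟨by simp, Or.inl hq⟩
  · constructor
    · rw [← hu.mul_left_inj, ← hu'.mul_left_inj]
      linear_combination (θ * (1 - κ * a') - b' * (1 - κ * a')) * h1 -
        (θ * (1 - κ * a) + a) * h2 + θ * ha + a * a' * hθ
    · right
      rw [← hu.mul_left_inj]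
      linear_combination (2 - n * a') * h1 + 2 * ha + a * a' * hn

variable {S : Type} [CommRing S] [Algebra ℂ S]

/-- Two consecutive fused arguments satisfy the fusion condition. -/
theorem coeffCond_map {g : ClassicalType} (N : ℕ) (Ψ : MvPowerSeries τ Kh →ₐ[ℂ] S)
    {x y y' : MvPowerSeries τ Kh} (hx : MvPowerSeries.constantCoeff x = 0)
    (hy : Ψ y' = Ψ y + theta g * Ψ (hS τ)) :
    CoeffCond (theta g : S) (N : S) (g = .gl) (Ψ (hS τ * invSum x y)) (Ψ (Qcoeff g N (invSum x y)))
      (Ψ (hS τ * invSum x y')) (Ψ (Qcoeff g N (invSum x y'))) := by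
  have hθ : (theta g : S) * theta g = 1 := by exact_mod_cast congrArg (Int.cast : ℤ → S) (theta_mul_self g)
  have hcst := fun y => constantCoeff_invSum hx y
  refine coeffCond_of_sub (κ := algebraMap ℂ S (kappa g N)) hθ ?_ ?_
  · have h1 := congrArg Ψ (invSum_mul hx y)
    have h2 := congrArg Ψ (invSum_mul hx y')
    have hu := (isUnit_one_add_mul hx y).map Ψ
    have hu' := (isUnit_one_add_mul hx y').map Ψ
    simp only [map_mul, map_add, map_one] at h1 h2 hu hu' ⊢
    rw [hy] at h2 hu'
    rw [← hu.mul_left_inj, ← hu'.mul_left_inj]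
    linear_combination (Ψ (hS τ) * (1 + Ψ x * (Ψ y + theta g * Ψ (hS τ))) -
      theta g * Ψ (hS τ) ^ 2 * Ψ (invSum x y') * (1 + Ψ x * (Ψ y + theta g * Ψ (hS τ)))) * h1 -
      (Ψ (hS τ) * (1 + Ψ x * Ψ y) + theta g * Ψ (hS τ) ^ 2 * Ψ x) * h2
  · by_cases hg : g = .gl
    · subst hg
      exact Or.inl ⟨rfl, map_zero Ψ, map_zero Ψ⟩
    · right
      have hk : ∀ y, Ψ (Qcoeff g N (invSum x y)) *
          (1 - algebraMap ℂ S (kappa g N) * Ψ (hS τ * invSum x y)) = Ψ (hS τ * invSum x y) := by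
        intro y
        have := congrArg Ψ (Qcoeff_mul hg N (hcst y))
        rwa [map_mul, map_sub, map_one, map_mul, AlgHom.commutes] at this
      have hu : ∀ y, IsUnit (1 - algebraMap ℂ S (kappa g N) * Ψ (hS τ * invSum x y)) := by
        intro y
        have := (isUnit_one_sub_kappa (kappa g N) (hcst y)).map Ψ
        rwa [map_sub, map_one, map_mul, AlgHom.commutes] at this
      refine ⟨hk y, hk y', hu y, hu y', ?_⟩
      have := congrArg (algebraMap ℂ S) (two_theta_add_kappa hg N)
      rwa [map_mul, map_ofNat, map_add, map_natCast, map_intCast] at this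

end RCoefficients

/-! ### Operators on disjoint tensor factors -/

section LegsCommute

variable {ι : Type} [Fintype ι] [DecidableEq ι] {N : ℕ} {R : Type} [CommRing R]

theorem twoLeg_mul_twoLeg_apply {p q r s : ι} (hpq : p ≠ q) (hpr : p ≠ r) (hps : p ≠ s) (hqr : q ≠ r)
    (hqs : q ≠ s) (M M' : Matrix (Fin N × Fin N) (Fin N × Fin N) R) (a b : ι → Fin N) :
    (twoLeg p q M * twoLeg r s M') a b =
      if ∀ k, k ≠ p → k ≠ q → k ≠ r → k ≠ s → a k = b k then
        M (a p, a q) (b p, b q) * M' (a r, a s) (b r, b s) else 0 := by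
  rw [twoLeg_mul_apply hpq, Finset.sum_eq_single (b p, b q)]
  · simp only [twoLeg, Matrix.of_apply]
    rw [Function.update_of_ne hqr.symm, Function.update_of_ne hpr.symm, Function.update_of_ne hqs.symm,
      Function.update_of_ne hps.symm, mul_ite, mul_zero]
    congr 1
    apply propext
    constructor
    · intro h k h1 h2 h3 h4
      have := h k h3 h4
      rwa [Function.update_of_ne h2, Function.update_of_ne h1] at this
    · intro h k h3 h4
      by_cases h2 : k = q
      · subst h2; simp
      · rw [Function.update_of_ne h2]
        by_cases h1 : k = p
        · subst h1; simp
        · rw [Function.update_of_ne h1]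
          exact h k h1 h2 h3 h4
  · rintro ⟨x, y⟩ _ hxy
    simp only [twoLeg, Matrix.of_apply]
    rw [if_neg, mul_zero]
    intro h
    apply hxy
    have h1 := h p hpr hps
    have h2 := h q hqr hqs
    rw [Function.update_of_ne hpq, Function.update_self] at h1
    rw [Function.update_self] at h2
    rw [h1, h2]
  · simp

theorem twoLeg_comm {p q r s : ι} (hpq : p ≠ q) (hrs : r ≠ s) (hpr : p ≠ r) (hps : p ≠ s)
    (hqr : q ≠ r) (hqs : q ≠ s) (M M' : Matrix (Fin N × Fin N) (Fin N × Fin N) R) :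
    Commute (twoLeg p q M : Matrix (ι → Fin N) (ι → Fin N) R) (twoLeg r s M') := by
  ext a b
  rw [twoLeg_mul_twoLeg_apply hpq hpr hps hqr hqs,
    twoLeg_mul_twoLeg_apply hrs hpr.symm hqr.symm hps.symm hqs.symm]
  rw [mul_comm]
  congr 1
  apply propext
  exact ⟨fun h k h1 h2 h3 h4 => h k h3 h4 h1 h2, fun h k h1 h2 h3 h4 => h k h3 h4 h1 h2⟩

end LegsCommute

/-! ### Operators on each of the two groups of factors -/

section ExtendLegs

variable {N n m : ℕ} {S : Type} [CommRing S] [Algebra ℂ S]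

/-- Summation over the indices of the two groups of tensor factors. -/
theorem sum_idx {β : Type} [AddCommMonoid β] (f : Idx N n m → β) :
    ∑ c, f c = ∑ x : Fin n → Fin N, ∑ y : Fin m → Fin N, f (Sum.elim x y) := by
  rw [← (Equiv.sumArrowEquivProdArrow (Fin n) (Fin m) (Fin N)).symm.sum_comp, Fintype.sum_prod_type]
  rfl

theorem idx_ext {a b : Idx N n m} (h1 : a ∘ Sum.inl = b ∘ Sum.inl) (h2 : a ∘ Sum.inr = b ∘ Sum.inr) :
    a = b := by
  funext k
  rcases k with i | j
  · exact congrFun h1 i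
  · exact congrFun h2 j

theorem sum_agree_right {β : Type} [AddCommMonoid β] (a : Idx N n m) (f : Idx N n m → β) :
    (∑ c, if a ∘ Sum.inr = c ∘ Sum.inr then f c else 0) = ∑ x, f (Sum.elim x (a ∘ Sum.inr)) := by
  rw [sum_idx]
  refine Finset.sum_congr rfl fun x _ => ?_
  rw [Finset.sum_eq_single (a ∘ Sum.inr)]
  · exact if_pos rfl
  · intro y _ hy
    exact if_neg fun h => hy h.symm
  · simp

theorem sum_agree_left {β : Type} [AddCommMonoid β] (a : Idx N n m) (f : Idx N n m → β) :
    (∑ c, if a ∘ Sum.inl = c ∘ Sum.inl then f c else 0) = ∑ y, f (Sum.elim (a ∘ Sum.inl) y) := by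
  rw [sum_idx, Finset.sum_comm]
  refine Finset.sum_congr rfl fun y _ => ?_
  rw [Finset.sum_eq_single (a ∘ Sum.inl)]
  · exact if_pos rfl
  · intro x _ hx
    exact if_neg fun h => hx h.symm
  · simp

/-- An operator on the first group of tensor factors. -/
noncomputable def onLeft (N n m : ℕ) (S : Type) [CommRing S] [Algebra ℂ S] :
    Matrix (Fin n → Fin N) (Fin n → Fin N) ℂ →ₐ[ℂ] Matrix (Idx N n m) (Idx N n m) S :=
  AlgHom.ofLinearMap
    { toFun := fun X => Matrix.of fun a b => if a ∘ Sum.inr = b ∘ Sum.inr then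
        algebraMap ℂ S (X (a ∘ Sum.inl) (b ∘ Sum.inl)) else 0
      map_add' := fun X Y => by
        ext a b
        simp only [Matrix.of_apply, Matrix.add_apply, map_add]
        split_ifs <;> simp
      map_smul' := fun k X => by
        ext a b
        simp only [Matrix.of_apply, Matrix.smul_apply, RingHom.id_apply, smul_eq_mul, map_mul]
        split_ifs <;> simp [Algebra.smul_def] }
    (by
      ext a b
      simp only [LinearMap.coe_mk, AddHom.coe_mk, Matrix.of_apply, Matrix.one_apply]
      by_cases h : a = b
      · subst h; simp
      · rw [if_neg h]
        split_ifs with h1 h2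
        · exact absurd (idx_ext h2 h1) h
        · simp
        · rfl)
    (fun X Y => by
      ext a b
      simp only [LinearMap.coe_mk, AddHom.coe_mk, Matrix.of_apply, Matrix.mul_apply, ite_mul, zero_mul]
      rw [sum_agree_right]
      by_cases h : a ∘ Sum.inr = b ∘ Sum.inr
      · rw [if_pos h, map_sum]
        refine Finset.sum_congr rfl fun x _ => ?_
        have h' : (Sum.elim x (a ∘ Sum.inr)) ∘ Sum.inr = b ∘ Sum.inr := h
        rw [if_pos h', map_mul]
        rfl
      · rw [if_neg h]
        exact (Finset.sum_eq_zero fun x _ => by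
          have h' : ¬ (Sum.elim x (a ∘ Sum.inr)) ∘ Sum.inr = b ∘ Sum.inr := h
          rw [if_neg h', mul_zero]).symm)

/-- An operator on the second group of tensor factors. -/
noncomputable def onRight (N n m : ℕ) (S : Type) [CommRing S] [Algebra ℂ S] :
    Matrix (Fin m → Fin N) (Fin m → Fin N) ℂ →ₐ[ℂ] Matrix (Idx N n m) (Idx N n m) S :=
  AlgHom.ofLinearMap
    { toFun := fun X => Matrix.of fun a b => if a ∘ Sum.inl = b ∘ Sum.inl then
        algebraMap ℂ S (X (a ∘ Sum.inr) (b ∘ Sum.inr)) else 0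
      map_add' := fun X Y => by
        ext a b
        simp only [Matrix.of_apply, Matrix.add_apply, map_add]
        split_ifs <;> simp
      map_smul' := fun k X => by
        ext a b
        simp only [Matrix.of_apply, Matrix.smul_apply, RingHom.id_apply, smul_eq_mul, map_mul]
        split_ifs <;> simp [Algebra.smul_def] }
    (by
      ext a b
      simp only [LinearMap.coe_mk, AddHom.coe_mk, Matrix.of_apply, Matrix.one_apply]
      by_cases h : a = b
      · subst h; simp
      · rw [if_neg h]
        split_ifs with h1 h2
        · exact absurd (idx_ext h1 h2) h
        · simp
        · rfl)
    (fun X Y => by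
      ext a b
      simp only [LinearMap.coe_mk, AddHom.coe_mk, Matrix.of_apply, Matrix.mul_apply, ite_mul, zero_mul]
      rw [sum_agree_left]
      by_cases h : a ∘ Sum.inl = b ∘ Sum.inl
      · rw [if_pos h, map_sum]
        refine Finset.sum_congr rfl fun x _ => ?_
        have h' : (Sum.elim (a ∘ Sum.inl) x) ∘ Sum.inl = b ∘ Sum.inl := h
        rw [if_pos h', map_mul]
        rfl
      · rw [if_neg h]
        exact (Finset.sum_eq_zero fun x _ => by
          have h' : ¬ (Sum.elim (a ∘ Sum.inl) x) ∘ Sum.inl = b ∘ Sum.inl := h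
          rw [if_neg h', mul_zero]).symm)

theorem onLeft_apply (X : Matrix (Fin n → Fin N) (Fin n → Fin N) ℂ) (a b : Idx N n m) :
    onLeft N n m S X a b = if a ∘ Sum.inr = b ∘ Sum.inr then
        algebraMap ℂ S (X (a ∘ Sum.inl) (b ∘ Sum.inl)) else 0 := rfl

theorem onRight_apply (X : Matrix (Fin m → Fin N) (Fin m → Fin N) ℂ) (a b : Idx N n m) :
    onRight N n m S X a b = if a ∘ Sum.inl = b ∘ Sum.inl then
        algebraMap ℂ S (X (a ∘ Sum.inr) (b ∘ Sum.inr)) else 0 := rfl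

theorem onLeft_twoLeg (p q : Fin n) (M : Matrix (Fin N × Fin N) (Fin N × Fin N) ℂ) :
    onLeft N n m S (twoLeg p q M) = twoLeg (.inl p) (.inl q) (M.map (algebraMap ℂ S)) := by
  ext a b
  rw [onLeft_apply]
  simp only [twoLeg, Matrix.of_apply, Matrix.map_apply, Function.comp_apply, Sum.forall, ne_eq,
    Sum.inl.injEq, reduceCtorEq, not_false_eq_true, true_imp_iff, funext_iff]
  by_cases h1 : ∀ j, a (Sum.inr j) = b (Sum.inr j)
  · by_cases h2 : ∀ k, ¬ k = p → ¬ k = q → a (Sum.inl k) = b (Sum.inl k)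
    · rw [if_pos h1, if_pos h2, if_pos ⟨h2, h1⟩]
    · rw [if_pos h1, if_neg h2, if_neg fun h => h2 h.1, map_zero]
  · rw [if_neg h1, if_neg fun h => h1 h.2]

theorem onRight_twoLeg (p q : Fin m) (M : Matrix (Fin N × Fin N) (Fin N × Fin N) ℂ) :
    onRight N n m S (twoLeg p q M) = twoLeg (.inr p) (.inr q) (M.map (algebraMap ℂ S)) := by
  ext a b
  rw [onRight_apply]
  simp only [twoLeg, Matrix.of_apply, Matrix.map_apply, Function.comp_apply, Sum.forall, ne_eq,
    Sum.inr.injEq, reduceCtorEq, not_false_eq_true, true_imp_iff, funext_iff]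
  by_cases h1 : ∀ j, a (Sum.inl j) = b (Sum.inl j)
  · by_cases h2 : ∀ k, ¬ k = p → ¬ k = q → a (Sum.inr k) = b (Sum.inr k)
    · rw [if_pos h1, if_pos h2, if_pos ⟨h1, h2⟩]
    · rw [if_pos h1, if_neg h2, if_neg fun h => h2 h.2, map_zero]
  · rw [if_neg h1, if_neg fun h => h1 h.1]

theorem onLeft_mul_apply (X : Matrix (Fin n → Fin N) (Fin n → Fin N) ℂ)
    (Z : Matrix (Idx N n m) (Idx N n m) S) (a b : Idx N n m) :
    (onLeft N n m S X * Z) a b = ∑ x, algebraMap ℂ S (X (a ∘ Sum.inl) x) *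
      Z (Sum.elim x (a ∘ Sum.inr)) b := by
  simp only [Matrix.mul_apply, onLeft_apply, ite_mul, zero_mul]
  exact sum_agree_right a _

theorem onRight_mul_apply (X : Matrix (Fin m → Fin N) (Fin m → Fin N) ℂ)
    (Z : Matrix (Idx N n m) (Idx N n m) S) (a b : Idx N n m) :
    (onRight N n m S X * Z) a b = ∑ y, algebraMap ℂ S (X (a ∘ Sum.inr) y) *
      Z (Sum.elim (a ∘ Sum.inl) y) b := by
  simp only [Matrix.mul_apply, onRight_apply, ite_mul, zero_mul]
  exact sum_agree_left a _

theorem mul_onLeft_apply (X : Matrix (Fin n → Fin N) (Fin n → Fin N) ℂ)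
    (Z : Matrix (Idx N n m) (Idx N n m) S) (a b : Idx N n m) :
    (Z * onLeft N n m S X) a b = ∑ x, Z a (Sum.elim x (b ∘ Sum.inr)) *
      algebraMap ℂ S (X x (b ∘ Sum.inl)) := by
  simp only [Matrix.mul_apply, onLeft_apply, mul_ite, mul_zero]
  simp only [eq_comm (b := b ∘ Sum.inr)]
  exact sum_agree_right b fun c => Z a c * algebraMap ℂ S (X (c ∘ Sum.inl) (b ∘ Sum.inl))

theorem mul_onRight_apply (X : Matrix (Fin m → Fin N) (Fin m → Fin N) ℂ)
    (Z : Matrix (Idx N n m) (Idx N n m) S) (a b : Idx N n m) :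
    (Z * onRight N n m S X) a b = ∑ y, Z a (Sum.elim (b ∘ Sum.inl) y) *
      algebraMap ℂ S (X y (b ∘ Sum.inr)) := by
  simp only [Matrix.mul_apply, onRight_apply, mul_ite, mul_zero]
  simp only [eq_comm (b := b ∘ Sum.inl)]
  exact sum_agree_left b fun c => Z a c * algebraMap ℂ S (X (c ∘ Sum.inr) (b ∘ Sum.inr))

theorem onLeft_comm_onRight (X : Matrix (Fin n → Fin N) (Fin n → Fin N) ℂ)
    (Y : Matrix (Fin m → Fin N) (Fin m → Fin N) ℂ) :
    onLeft N n m S X * onRight N n m S Y = onRight N n m S Y * onLeft N n m S X := by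
  ext a b
  rw [onLeft_mul_apply, mul_onLeft_apply, Finset.sum_eq_single (b ∘ Sum.inl),
    Finset.sum_eq_single (a ∘ Sum.inl)]
  · rw [onRight_apply, onRight_apply, Sum.elim_comp_inl, Sum.elim_comp_inr, Sum.elim_comp_inl,
      Sum.elim_comp_inr, if_pos rfl, if_pos rfl, mul_comm]
  · intro x _ hx
    rw [onRight_apply, if_neg (fun h => hx (by simpa using h.symm)), zero_mul]
  · simp
  · intro x _ hx
    rw [onRight_apply, if_neg (fun h => hx (by simpa using h)), mul_zero]
  · simp

theorem Pmat_map {S' : Type} [CommRing S'] (f : S →+* S') : (Pmat N S).map f = Pmat N S' := by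
  ext a b
  simp only [Pmat, Matrix.map_apply, Matrix.of_apply]
  split_ifs <;> simp

theorem Qop_map {S' : Type} [CommRing S'] [Algebra ℂ S'] (g : ClassicalType) (f : S →ₐ[ℂ] S') :
    (Qop g N S).map f = Qop g N S' := by
  have h : ∀ g', (Qmat g' N S).map f = Qmat g' N S' := by
    intro g'
    ext a b
    simp only [Qmat, Matrix.map_apply, Matrix.of_apply]
    split_ifs <;> simp
  cases g with
  | gl => ext a b; simp [Qop]
  | o => exact h _
  | sp => exact h _

theorem onLeft_Pleg (p q : Fin n) : onLeft N n m S (Pleg N ℂ p q) = Pleg N S (.inl p) (.inl q) := by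
  rw [Pleg, onLeft_twoLeg, Pmat_map, Pleg]

theorem onLeft_Qleg (g : ClassicalType) (p q : Fin n) :
    onLeft N n m S (Qleg g N ℂ p q) = Qleg g N S (.inl p) (.inl q) := by
  rw [Qleg, onLeft_twoLeg, Qleg]
  exact congrArg _ (Qop_map g (Algebra.ofId ℂ S))

theorem onRight_Pleg (p q : Fin m) : onRight N n m S (Pleg N ℂ p q) = Pleg N S (.inr p) (.inr q) := by
  rw [Pleg, onRight_twoLeg, Pmat_map, Pleg]

theorem onRight_Qleg (g : ClassicalType) (p q : Fin m) :
    onRight N n m S (Qleg g N ℂ p q) = Qleg g N S (.inr p) (.inr q) := by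
  rw [Qleg, onRight_twoLeg, Qleg]
  exact congrArg _ (Qop_map g (Algebra.ofId ℂ S))

end ExtendLegs


/-! ### Rearrangement of ordered products -/

section ProductLists

variable {M ι : Type} [Ring M]

theorem list_prod_map_mul (A B : ι → M) (l : List ι) (hl : l.Nodup)
    (h : ∀ j j', j ≠ j' → Commute (A j) (B j')) :
    (l.map A).prod * (l.map B).prod = (l.map fun j => A j * B j).prod := by
  induction l with
  | nil => simp
  | cons x l ih =>
    rw [List.nodup_cons] at hl
    have hc : Commute (l.map A).prod (B x) := by
      refine Commute.list_prod_left _ _ fun y hy => ?_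
      obtain ⟨j, hj, rfl⟩ := List.mem_map.mp hy
      exact h _ _ fun e => hl.1 (e ▸ hj)
    rw [List.map_cons, List.map_cons, List.map_cons, List.prod_cons, List.prod_cons, List.prod_cons,
      ← ih hl.2, mul_assoc, mul_assoc, ← mul_assoc _ (B x), hc.eq, mul_assoc]

theorem ofFn_reverse_prod {m : ℕ} (A : Fin m → M) :
    (List.ofFn A).reverse.prod = ((List.finRange m).reverse.map A).prod := by
  rw [List.ofFn_eq_map, List.map_reverse]

variable {S : Type} [CommRing S] [Algebra S M]

theorem isFused_mul_list_prod {θ : S} {p q : M} (l : List M)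
    (h : ∀ x ∈ l, ∀ Y, IsFused θ p q Y → IsFused θ p q (Y * x)) {Y : M} (hY : IsFused θ p q Y) :
    IsFused θ p q (Y * l.prod) := by
  induction l generalizing Y with
  | nil => simpa using hY
  | cons x l ih =>
    rw [List.prod_cons, ← mul_assoc]
    exact ih (fun y hy => h y (List.mem_cons_of_mem _ hy)) (h x List.mem_cons_self _ hY)

end ProductLists

/-! ### The product `R̄_nm` preserves the fused condition -/

section FusedRnm

variable {N n m : ℕ} {S : Type} [CommRing S] [Algebra ℂ S]

theorem isFused_intCast_iff {κ : Type} [Fintype κ] [DecidableEq κ] (k : ℤ) (p q Y : Matrix κ κ S) :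
    IsFused (k : ℂ) p q Y ↔ IsFused (k : S) p q Y := by
  rw [IsFused, IsFused, Int.cast_smul_eq_zsmul, Int.cast_smul_eq_zsmul]

theorem map_smul_matrix {R κ : Type} [CommRing R] (f : R →+* S) (c : R) (X : Matrix κ κ R) :
    (c • X).map f = f c • X.map f := by
  ext a b
  simp

theorem twoLeg_Rbar_map {τ ι : Type} [Fintype ι] [DecidableEq ι] (g : ClassicalType)
    (Ψ : MvPowerSeries τ Kh →ₐ[ℂ] S) (s : MvPowerSeries τ Kh) (p q : ι) :
    (twoLeg p q (Rbar g N s)).map Ψ = Ψ (PowerSeries.subst (hS τ * s) (normSeries g N)) •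
      (1 - Ψ (hS τ * s) • Pleg N S p q + Ψ (Qcoeff g N s) • Qleg g N S p q) := by
  have h1 : (Rbar g N s).map Ψ = Ψ (PowerSeries.subst (hS τ * s) (normSeries g N)) •
      (1 - Ψ (hS τ * s) • Pmat N S + Ψ (Qcoeff g N s) • Qop g N S) := by
    have hP := Pmat_map (N := N) (Ψ : MvPowerSeries τ Kh →+* S)
    have hQ := Qop_map (N := N) g Ψ
    have h := map_smul_matrix (Ψ : MvPowerSeries τ Kh →+* S)
      (PowerSeries.subst (hS τ * s) (normSeries g N)) (Rmat g N s)
    refine h.trans (congrArg _ ?_)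
    rw [← hP, ← hQ, Rmat_eq]
    have h3 : ∀ c : MvPowerSeries τ Kh, ∀ X : Matrix (Fin N × Fin N) (Fin N × Fin N) _,
      (Ψ : MvPowerSeries τ Kh →+* S).mapMatrix (c • X) = Ψ c •
        (Ψ : MvPowerSeries τ Kh →+* S).mapMatrix X := map_smul_matrix _
    have h4 := (Ψ : MvPowerSeries τ Kh →+* S).mapMatrix.map_add
      (1 - (hS τ * s) • Pmat N _) (Qcoeff g N s • Qop g N _)
    rw [map_sub, map_one, h3, h3] at h4
    exact h4
  have h2 := twoLeg_map (Ψ : MvPowerSeries τ Kh →+* S) p q (Rbar g N s)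
  refine h2.trans (Eq.trans (congrArg _ h1) ?_)
  rw [twoLeg_smul, twoLeg_add, twoLeg_smul, sub_eq_add_neg, twoLeg_add, twoLeg_one, ← neg_smul,
    twoLeg_smul, neg_smul, ← sub_eq_add_neg, Pleg, Qleg]

/-- For fusion in the second group, where the common factor of a neighbouring pair is the first leg
rather than the second one. -/
theorem twoLeg_Rbar_map_symm {τ ι : Type} [Fintype ι] [DecidableEq ι] {g : ClassicalType}
    (hN : Admissible g N) (Ψ : MvPowerSeries τ Kh →ₐ[ℂ] S) (s : MvPowerSeries τ Kh) {p q : ι}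
    (hpq : p ≠ q) :
    (twoLeg p q (Rbar g N s)).map Ψ = Ψ (PowerSeries.subst (hS τ * s) (normSeries g N)) •
      (1 - Ψ (hS τ * s) • Pleg N S q p + Ψ (Qcoeff g N s) • Qleg g N S q p) := by
  rw [twoLeg_Rbar_map, Pleg_symm _ _ hpq, Qleg_symm hN]

/-- The factor of `R̄_nm` in the positions `i` and `j`, after a homomorphism. -/
noncomputable def Rleg (g : ClassicalType) (a : ℂ) (Ψ : MvPowerSeries (Vars n m) Kh →ₐ[ℂ] S)
    (i : Fin n) (j : Fin m) : Matrix (Idx N n m) (Idx N n m) S :=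
  (twoLeg (Sum.inl i) (Sum.inr j) (Rbar g N (specInv n m a i j))).map Ψ

theorem Rnm_map (g : ClassicalType) (a : ℂ) (Ψ : MvPowerSeries (Vars n m) Kh →ₐ[ℂ] S) :
    (Rnm g N n m a).map Ψ =
      (List.ofFn fun i => (List.ofFn fun j => Rleg (N := N) g a Ψ i j).reverse.prod).prod := by
  have h : ∀ l : List (Matrix (Idx N n m) (Idx N n m) (MvPowerSeries (Vars n m) Kh)),
      l.prod.map Ψ = (l.map fun x => x.map Ψ).prod := fun l =>
    map_list_prod (Ψ : MvPowerSeries (Vars n m) Kh →+* S).mapMatrix l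
  rw [Rnm, h, List.map_ofFn]
  congr 2
  funext i
  rw [Function.comp_apply, h, List.map_reverse, List.map_ofFn]
  rfl

theorem Rleg_eq_twoLeg (g : ClassicalType) (a : ℂ) (Ψ : MvPowerSeries (Vars n m) Kh →ₐ[ℂ] S)
    (i : Fin n) (j : Fin m) : Rleg (N := N) g a Ψ i j =
      twoLeg (Sum.inl i) (Sum.inr j) ((Rbar g N (specInv n m a i j)).map Ψ) :=
  twoLeg_map (Ψ : MvPowerSeries (Vars n m) Kh →+* S) _ _ _

theorem Rleg_comm (g : ClassicalType) (a : ℂ) (Ψ : MvPowerSeries (Vars n m) Kh →ₐ[ℂ] S)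
    {i i' : Fin n} {j j' : Fin m} (hi : i ≠ i') (hj : j ≠ j') :
    Commute (Rleg (N := N) g a Ψ i j) (Rleg g a Ψ i' j') := by
  rw [Rleg_eq_twoLeg, Rleg_eq_twoLeg]
  exact twoLeg_comm (by simp) (by simp) (by simpa using hi) (by simp) (by simp) (by simpa using hj) _ _

theorem isFused_mul_Rleg_pair {g : ClassicalType} (hN : Admissible g N)
    (Ψ : MvPowerSeries (Vars n m) Kh →ₐ[ℂ] S) {u v w : Fin n ⊕ Fin m} (huv : u ≠ v) (huw : u ≠ w)
    (hvw : v ≠ w) {y y' : MvPowerSeries (Vars n m) Kh} (hy : Ψ y' = Ψ y + theta g * Ψ (hS _))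
    {Y X X' : Matrix (Idx N n m) (Idx N n m) S} {f f' : S}
    (hX : X = f • (1 - Ψ (hS _ * invSum (MvPowerSeries.X none) y) • Pleg N S u w +
      Ψ (Qcoeff g N (invSum (MvPowerSeries.X none) y)) • Qleg g N S u w))
    (hX' : X' = f' • (1 - Ψ (hS _ * invSum (MvPowerSeries.X none) y') • Pleg N S v w +
      Ψ (Qcoeff g N (invSum (MvPowerSeries.X none) y')) • Qleg g N S v w))
    (hY : IsFused (theta g : S) (Pleg N S u v) (Qleg g N S u v) Y) :
    IsFused (theta g : S) (Pleg N S u v) (Qleg g N S u v) (Y * X * X') := by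
  rw [hX, hX', mul_smul_comm, mul_smul_comm, smul_mul_assoc]
  exact ((isFused_mul_Rpair hN huv huw hvw hY (coeffCond_map N Ψ (by simp) hy)).smul _).smul _

theorem twoLeg_fused_comm (g : ClassicalType) {u v p q : Fin n ⊕ Fin m} (huv : u ≠ v) (hpq : p ≠ q)
    (hup : u ≠ p) (huq : u ≠ q) (hvp : v ≠ p) (hvq : v ≠ q) (M) :
    Commute (Pleg N S u v) (twoLeg p q M) ∧ Commute (Qleg g N S u v) (twoLeg p q M) :=
  ⟨twoLeg_comm huv hpq hup huq hvp hvq _ _, twoLeg_comm huv hpq hup huq hvp hvq _ _⟩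

/-- Factors of the rows k and k + 1 with different j commute, so the two rows interleave into a
product of pairs R̄_kj R̄_(k+1)j. Each pair preserves the fused condition, and all other rows
commute with P and Q at k, k + 1. -/
theorem isFusedAll_mul_Rnm_left {g : ClassicalType} (hN : Admissible g N) (a : ℂ)
    (Ψ : MvPowerSeries (Vars n m) Kh →ₐ[ℂ] S)
    (hΨ : ∀ (k : ℕ) (hk : k + 1 < n), Ψ (MvPowerSeries.X (some (.inl ⟨k + 1, hk⟩))) =
      Ψ (MvPowerSeries.X (some (.inl ⟨k, by omega⟩))) + theta g * Ψ (hS _))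
    {Y : Matrix (Idx N n m) (Idx N n m) S} (hY : IsFusedAll (onLeft N n m S) g Y) :
    IsFusedAll (onLeft N n m S) g (Y * (Rnm g N n m a).map Ψ) := by
  intro k hk
  have hYk := hY k hk
  rw [onLeft_Pleg, onLeft_Qleg, isFused_intCast_iff] at hYk ⊢
  have hne : (Sum.inl ⟨k, by omega⟩ : Fin n ⊕ Fin m) ≠ Sum.inl ⟨k + 1, hk⟩ := by simp
  rw [Rnm_map]
  refine isFused_prod_ofFn hYk _ k hk ?_ ?_
  · intro i h1 h2
    have e1 : (⟨k, by omega⟩ : Fin n) ≠ i := fun h => h1 (congrArg Fin.val h).symm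
    have e2 : (⟨k + 1, hk⟩ : Fin n) ≠ i := fun h => h2 (congrArg Fin.val h).symm
    constructor <;> refine Commute.list_prod_right _ _ fun x hx => ?_ <;>
      rw [List.mem_reverse, List.mem_ofFn] at hx <;> obtain ⟨j, rfl⟩ := hx <;> rw [Rleg_eq_twoLeg]
    · exact (twoLeg_fused_comm g hne (by simp) (by simpa using e1) (by simp) (by simpa using e2)
        (by simp) _).1
    · exact (twoLeg_fused_comm g hne (by simp) (by simpa using e1) (by simp) (by simpa using e2)
        (by simp) _).2
  · intro Z hZ
    rw [mul_assoc, ofFn_reverse_prod, ofFn_reverse_prod, list_prod_map_mul]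
    · refine isFused_mul_list_prod _ (fun x hx W hW => ?_) hZ
      obtain ⟨j, -, rfl⟩ := List.mem_map.mp hx
      rw [← mul_assoc]
      refine isFused_mul_Rleg_pair hN Ψ hne (by simp) (by simp) ?_ (twoLeg_Rbar_map g Ψ _ _ _)
        (twoLeg_Rbar_map g Ψ _ _ _) hW
      rw [map_add, map_sub, map_add, map_sub, hΨ k hk]
      ring
    · exact List.nodup_reverse.mpr (List.nodup_finRange m)
    · intro j j' hj
      exact Rleg_comm g a Ψ (by simp) hj

/-- Each row preserves the condition separately. The decreasing order puts R̄_i(k+1) directly before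
R̄_ik. Since v_j enters the spectral parameter with a minus sign, the argument again grows by θh
from one factor to the next. -/
theorem isFusedAll_mul_Rnm_right {g : ClassicalType} (hN : Admissible g N) (a : ℂ)
    (Ψ : MvPowerSeries (Vars n m) Kh →ₐ[ℂ] S)
    (hΨ : ∀ (k : ℕ) (hk : k + 1 < m), Ψ (MvPowerSeries.X (some (.inr ⟨k + 1, hk⟩))) =
      Ψ (MvPowerSeries.X (some (.inr ⟨k, by omega⟩))) + theta g * Ψ (hS _))
    {Y : Matrix (Idx N n m) (Idx N n m) S} (hY : IsFusedAll (onRight N n m S) g Y) :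
    IsFusedAll (onRight N n m S) g (Y * (Rnm g N n m a).map Ψ) := by
  intro k hk
  have hYk := hY k hk
  rw [onRight_Pleg, onRight_Qleg, isFused_intCast_iff] at hYk ⊢
  have hne : (Sum.inr ⟨k, by omega⟩ : Fin n ⊕ Fin m) ≠ Sum.inr ⟨k + 1, hk⟩ := by simp
  rw [Rnm_map]
  refine isFused_mul_list_prod _ (fun x hx W hW => ?_) hYk
  obtain ⟨i, rfl⟩ := List.mem_ofFn.mp hx
  refine isFused_prod_reverse_ofFn hW _ k hk ?_ ?_
  · intro j h1 h2
    have e1 : (⟨k, by omega⟩ : Fin m) ≠ j := fun h => h1 (congrArg Fin.val h).symm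
    have e2 : (⟨k + 1, hk⟩ : Fin m) ≠ j := fun h => h2 (congrArg Fin.val h).symm
    rw [Rleg_eq_twoLeg]
    exact twoLeg_fused_comm g hne (by simp) (by simp) (by simpa using e1) (by simp) (by simpa using e2) _
  · intro Z hZ
    -- The pair is met in the order k + 1, k, so the labels in P and Q are interchanged first.
    rw [Pleg_symm _ _ hne, Qleg_symm hN] at hZ ⊢
    refine isFused_mul_Rleg_pair hN Ψ (w := Sum.inl i) hne.symm (by simp) (by simp)
      ?_ (twoLeg_Rbar_map_symm hN Ψ (specInv n m a i ⟨k + 1, hk⟩) (by simp))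
        (twoLeg_Rbar_map_symm hN Ψ (specInv n m a i ⟨k, by omega⟩) (by simp)) hZ
    rw [map_add, map_sub, map_add, map_sub, hΨ k hk]
    ring

end FusedRnm


/-! ### Traces and block triangular matrices -/

section BlockTriangular

variable {κ S : Type} [Fintype κ] [DecidableEq κ] [CommRing S]

/-- By triangularity E R' E is a right inverse of E R E in the corner. Adding 1 - E gives honest
square matrices over a commutative ring, for which a right inverse is also a left inverse. -/
theorem corner_inverse {E R R' : Matrix κ κ S} (hE : E * E = E) (hR : E * R = E * R * E)
    (hRR : R * R' = 1) : (E * R' * E) * (E * R * E) = E := by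
  have h1 : (E * R * E) * (E * R' * E) = E := by
    rw [← hR, show E * R * (E * R' * E) = (E * R * E) * R' * E by simp only [mul_assoc], ← hR, mul_assoc E,
      hRR, mul_one, hE]
  have h2 : (E * R * E + (1 - E)) * (E * R' * E + (1 - E)) = 1 := by
    have e1 : E * R * E * (1 - E) = 0 := by rw [mul_sub, mul_one, mul_assoc (E * R), hE, sub_self]
    have e2 : (1 - E) * (E * R' * E) = 0 := by
      rw [sub_mul, one_mul, ← mul_assoc, ← mul_assoc, hE, sub_self]
    have e3 : (1 - E) * (1 - E) = 1 - E := by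
      rw [mul_sub, mul_one, sub_mul, one_mul, hE, sub_self, sub_zero]
    rw [mul_add, add_mul, add_mul, h1, e1, e2, e3]
    abel
  have h3 := mul_eq_one_comm.mp h2
  have h4 := congrArg (fun X => E * X * E) h3
  have e1 : E * (1 - E) = 0 := by rw [mul_sub, mul_one, hE, sub_self]
  have e2 : (1 - E) * E = 0 := by rw [sub_mul, one_mul, hE, sub_self]
  beta_reduce at h4
  rw [← mul_assoc, mul_add E, e1, add_zero, mul_assoc, add_mul _ _ E, e2, add_zero, mul_one] at h4
  have f1 : E * (E * R' * E) = E * R' * E := by rw [← mul_assoc, ← mul_assoc, hE]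
  have f2 : E * R * E * E = E * R * E := by rw [mul_assoc, hE]
  rwa [f1, f2, hE] at h4

/-- A conjugation which is block triangular for an idempotent preserves the trace of the block. -/
theorem trace_block_conj {E R R' t : Matrix κ κ S} (hE : E * E = E) (hR : E * R = E * R * E)
    (hRR : R * R' = 1) (ht : E * t = E * t * E) : (E * (R * t * R')).trace = (E * t).trace := by
  -- Triangularity of R and t lets E be inserted before t and before R', so that E R', after cyclic
  -- rotation, enters only through its corner.
  have h1 : E * (R * t * R') = E * R * (E * t) * (E * R') := by
    rw [show E * (R * t * R') = E * R * t * R' by simp only [mul_assoc], hR,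
      show E * R * E * t * R' = E * R * (E * t) * R' by simp only [mul_assoc], ht]
    simp only [mul_assoc]
    rw [← mul_assoc E E R', hE, ← mul_assoc E E, hE]
  have h2 : (E * R * (E * t) * (E * R')).trace = (E * t * ((E * R' * E) * (E * R * E))).trace := by
    rw [mul_assoc, Matrix.trace_mul_comm, ht, hR]
    simp only [mul_assoc]
    rw [← mul_assoc E E (R' * _), hE, ← mul_assoc E E (R * _), hE, ← mul_assoc E E (R' * _), hE, ]
  rw [h1, h2, corner_inverse hE hR hRR, ← ht]

end BlockTriangular

/-! ### Reduction to bilinear forms with values in commutative algebras -/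

section Series

variable {g : ClassicalType} {N n m : ℕ} {c : ℂ} {A : Type} [CommRing A] [Algebra Kh A]

/-- A family of bilinear forms, evaluated at the coefficients of `T_[n]^+(u) 𝟏 ⊗ T_[m]^+(v) 𝟏`. -/
noncomputable def tSeries (B : ℕ → Vac g N c →ₗ[Kh] Vac g N c →ₗ[Kh] A) (a b : Idx N n m) :
    MvPowerSeries (Vars n m) A := fun d =>
  B (d none) (tVec g N c (a ∘ Sum.inl) (b ∘ Sum.inl) fun i => d (some (Sum.inl i)))
    (tVec g N c (a ∘ Sum.inr) (b ∘ Sum.inr) fun j => d (some (Sum.inr j)))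

/-- The coefficient of `z^(-r)`. -/
def zCoeff (W : Type) [AddCommGroup W] [Module Kh W] (r : ℕ) : ZSeries W →ₗ[Kh] W where
  toFun a := (a : ℕ → W) r
  map_add' _ _ := rfl
  map_smul' _ _ := rfl

/-- The coefficients of a map `V ⊗ V → V ⊗ V ⊗ ℂ[[h]][z⁻¹]_h`, as bilinear forms. -/
noncomputable def zForm (φ : VV g N c →ₗ[Kh] ZSeries (VV g N c)) (j : VV g N c →ₗ[Kh] A) (z : ℕ) :
    Vac g N c →ₗ[Kh] Vac g N c →ₗ[Kh] A :=
  (TensorProduct.mk Kh (Vac g N c) (Vac g N c)).compr₂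
    (j ∘ₗ zCoeff _ z ∘ₗ φ ∘ₗ AdicCompletion.of hIdeal _)

/-- The coefficients of the map `x ⊗ y ↦ x ⊗ y`, as bilinear forms. -/
noncomputable def constForm (j : VV g N c →ₗ[Kh] A) (z : ℕ) :
    Vac g N c →ₗ[Kh] Vac g N c →ₗ[Kh] A :=
  if z = 0 then (TensorProduct.mk Kh (Vac g N c) (Vac g N c)).compr₂ (j ∘ₗ AdicCompletion.of hIdeal _)
    else 0

theorem zForm_apply (φ : VV g N c →ₗ[Kh] ZSeries (VV g N c)) (j : VV g N c →ₗ[Kh] A) (z : ℕ)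
    (x y : Vac g N c) : zForm φ j z x y = j ((φ (tens x y) : ℕ → VV g N c) z) := rfl

theorem constForm_apply (j : VV g N c →ₗ[Kh] A) (z : ℕ) (x y : Vac g N c) :
    constForm j z x y = j ((ZSeries.const (tens x y) : ℕ → VV g N c) z) := by
  rw [constForm, ZSeries.const]
  split_ifs with h
  · simp only [h, if_true]
    rfl
  · simp only [h, if_false]
    rw [map_zero]
    rfl

theorem zForm_applyTT (φ : VV g N c →ₗ[Kh] ZSeries (VV g N c)) (j : VV g N c →ₗ[Kh] A)
    (a b : Idx N n m) (d : Vars n m →₀ ℕ) :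
    MvPowerSeries.coeff d (tSeries (zForm φ j) a b) = j (applyTT φ a b d) := by
  have h : tTT g c a b (d.erase none) = tens
      (tVec g N c (a ∘ Sum.inl) (b ∘ Sum.inl) fun i => d (some (Sum.inl i)))
      (tVec g N c (a ∘ Sum.inr) (b ∘ Sum.inr) fun j => d (some (Sum.inr j))) := by
    rw [tTT, tt, if_pos Finsupp.erase_same]
    simp only [Finsupp.erase_ne (Option.some_ne_none _)]
  rw [applyTT, h]
  rfl

theorem coeff_tSeries_constForm (j : VV g N c →ₗ[Kh] A) (a b : Idx N n m) (d : Vars n m →₀ ℕ) :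
    MvPowerSeries.coeff d (tSeries (constForm j) a b) = j (tTT g c a b d) := by
  have : MvPowerSeries.coeff d (tSeries (constForm j) a b) = constForm j (d none) _ _ := rfl
  rw [this, constForm_apply, tTT, tt, ZSeries.const]

theorem map_serMul (j : VV g N c →ₗ[Kh] A) (φ : MvPowerSeries (Vars n m) Kh)
    (w : (Vars n m →₀ ℕ) → VV g N c) (F : MvPowerSeries (Vars n m) A)
    (hF : ∀ d, MvPowerSeries.coeff d F = j (w d)) (d : Vars n m →₀ ℕ) :
    j (serMul φ w d) = MvPowerSeries.coeff d (MvPowerSeries.map (algebraMap Kh A) φ * F) := by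
  rw [serMul, map_sum, MvPowerSeries.coeff_mul]
  refine Finset.sum_congr rfl fun p _ => ?_
  rw [map_smul, Algebra.smul_def, MvPowerSeries.coeff_map, hF]

theorem tSeries_of_isSigma {σ : VV g N c →ₗ[Kh] ZSeries (VV g N c)} (hσ : IsSigma g N c σ)
    (j : VV g N c →ₗ[Kh] A) (a b : Idx N n m) :
    tSeries (zForm σ j) a b = ∑ a', ∑ b', MvPowerSeries.map (algebraMap Kh A)
      (Rnm g N n m 0 a a' * (Rnm g N n m 0)⁻¹ b' b) * tSeries (constForm j) a' b' := by
  ext d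
  rw [zForm_applyTT, hσ n m a b, sigmaRHS, Finset.sum_apply, map_sum, map_sum]
  refine Finset.sum_congr rfl fun a' _ => ?_
  rw [Finset.sum_apply, map_sum, map_sum]
  refine Finset.sum_congr rfl fun b' _ => ?_
  exact map_serMul j _ _ _ (coeff_tSeries_constForm j a' b') d

theorem tSeries_of_isRho {ρ : VV g N c →ₗ[Kh] ZSeries (VV g N c)} (hρ : IsRho g N c ρ)
    (j : VV g N c →ₗ[Kh] A) (a b : Idx N n m) :
    tSeries (zForm ρ j) a b = ∑ k, ∑ k', ∑ l, ∑ l', MvPowerSeries.map (algebraMap Kh A)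
      ((Rnm g N n m (epsilon g * c))⁻¹ (Sum.elim k (a ∘ Sum.inr)) (Sum.elim k' l) *
        Rnm g N n m 0 (Sum.elim k' l') b) *
        tSeries (constForm j) (Sum.elim (a ∘ Sum.inl) l) (Sum.elim k l') := by
  ext d
  rw [zForm_applyTT, hρ n m a b, rhoRHS]
  rw [Finset.sum_apply, map_sum, map_sum]
  refine Finset.sum_congr rfl fun k _ => ?_
  rw [Finset.sum_apply, map_sum, map_sum]
  refine Finset.sum_congr rfl fun k' _ => ?_
  rw [Finset.sum_apply, map_sum, map_sum]
  refine Finset.sum_congr rfl fun l _ => ?_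
  rw [Finset.sum_apply, map_sum, map_sum]
  refine Finset.sum_congr rfl fun l' _ => ?_
  refine map_serMul j _ _ _ (fun d => ?_) d
  rw [coeff_tSeries_constForm, tTT, Sum.elim_comp_inl, Sum.elim_comp_inl, Sum.elim_comp_inr,
    Sum.elim_comp_inr]

theorem VV_separated (x : VV g N c) (hx : ∀ K : ℕ, ∃ y, x = hh ^ K • y) : x = 0 := by
  refine IsHausdorff.haus (I := hIdeal) inferInstance x fun K => ?_
  obtain ⟨y, rfl⟩ := hx K
  rw [SModEq.zero, Ideal.span_singleton_pow]
  exact Submodule.smul_mem_smul (Ideal.mem_span_singleton_self _) trivial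

/-- An identity in `V ⊗ V ⊗ ℂ[[h]][z⁻¹]_h` may be checked modulo the powers of `h`. -/
theorem eq_const_of_forms {φ : VV g N c →ₗ[Kh] ZSeries (VV g N c)} {x y : Vac g N c}
    (h : ∀ (A : Type) (_ : CommRing A) (_ : Algebra Kh A) (K : ℕ) (_ : algebraMap Kh A hh ^ K = 0)
      (j : VV g N c →ₗ[Kh] A) (z : ℕ), zForm φ j z x y = constForm j z x y) :
    φ (tens x y) = ZSeries.const (tens x y) := by
  apply Subtype.ext
  funext z
  rw [← sub_eq_zero]
  refine VV_separated _ fun K => ?_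
  obtain ⟨A, iA, iK, j, hK, hj⟩ := exists_squareZero (VV g N c) K
  apply hj
  rw [map_sub, sub_eq_zero, ← zForm_apply, ← constForm_apply]
  exact h A iA iK K hK j z

end Series


/-! ### Specialized matrices of generators -/

section SpecHom

variable {g : ClassicalType} {N n m : ℕ} {c : ℂ} {α A : Type} [Fintype α] [DecidableEq α] [CommRing A]
  [Algebra Kh A] [Algebra ℂ A] [IsScalarTower ℂ Kh A]

theorem specialize_hasSubst {K : ℕ} (hK : algebraMap Kh A hh ^ K = 0) (π : Fin n → α) (s : Fin n → ℂ)
    (s' : Fin m → ℂ) : MvPowerSeries.HasSubst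
      (shiftVar (mergeVar π) fun v => algebraMap Kh A (shiftAmount s s' v)) :=
  shiftVar_hasSubst (K := K + 1) _ (shiftAmount_pow (by rw [pow_succ, hK, zero_mul]) (by omega) s s')

/-- Specialization as a homomorphism. -/
noncomputable def specHom {K : ℕ} (hK : algebraMap Kh A hh ^ K = 0) (π : Fin n → α) (s : Fin n → ℂ)
    (s' : Fin m → ℂ) : MvPowerSeries (Vars n m) A →ₐ[A] MvPowerSeries (Option (α ⊕ Unit)) A :=
  MvPowerSeries.substAlgHom (specialize_hasSubst hK π s s')

theorem specHom_apply {K : ℕ} (hK : algebraMap Kh A hh ^ K = 0) (π : Fin n → α) (s : Fin n → ℂ)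
    (s' : Fin m → ℂ) (F : MvPowerSeries (Vars n m) A) :
    specHom hK π s s' F = specialize A π s s' F := by
  rw [specHom, MvPowerSeries.coe_substAlgHom]
  rfl

/-- Specialization of the scalars. -/
noncomputable def specScalar {K : ℕ} (hK : algebraMap Kh A hh ^ K = 0) (π : Fin n → α) (s : Fin n → ℂ)
    (s' : Fin m → ℂ) : MvPowerSeries (Vars n m) Kh →ₐ[ℂ] MvPowerSeries (Option (α ⊕ Unit)) A :=
  ((specHom hK π s s').restrictScalars ℂ).comp
    (MvPowerSeries.mapAlgHom (IsScalarTower.toAlgHom ℂ Kh A))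

theorem specScalar_apply {K : ℕ} (hK : algebraMap Kh A hh ^ K = 0) (π : Fin n → α) (s : Fin n → ℂ)
    (s' : Fin m → ℂ) (F : MvPowerSeries (Vars n m) Kh) :
    specScalar hK π s s' F = specHom hK π s s' (MvPowerSeries.map (algebraMap Kh A) F) := rfl

theorem specScalar_hS {K : ℕ} (hK : algebraMap Kh A hh ^ K = 0) (π : Fin n → α) (s : Fin n → ℂ)
    (s' : Fin m → ℂ) : specScalar hK π s s' (hS _) = MvPowerSeries.C (algebraMap Kh A hh) := by
  rw [specScalar_apply, hS, MvPowerSeries.map_C]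
  exact (specHom hK π s s').commutes _

theorem specScalar_X {K : ℕ} (hK : algebraMap Kh A hh ^ K = 0) (π : Fin n → α) (s : Fin n → ℂ)
    (s' : Fin m → ℂ) (v : Vars n m) : specScalar hK π s s' (MvPowerSeries.X v) =
      MvPowerSeries.X (mergeVar π v) + MvPowerSeries.C (algebraMap Kh A (shiftAmount s s' v)) := by
  rw [specScalar_apply, MvPowerSeries.map_X, specHom_apply, specialize,
    MvPowerSeries.subst_X (specialize_hasSubst hK π s s')]
  rfl

theorem algebraMap_C_mul_hh (k : ℤ) :
    algebraMap Kh A (PowerSeries.C (k : ℂ) * hh) = k * algebraMap Kh A hh := by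
  rw [map_mul, map_intCast, map_intCast]

/-- This is the relation between consecutive variables on which fusion of R̄_nm rests: after
specialization they differ by θh. -/
theorem specScalar_X_right {K : ℕ} (hK : algebraMap Kh A hh ^ K = 0) (π : Fin n → α) (s : Fin n → ℂ)
    (k : ℕ) (hk : k + 1 < m) :
    specScalar hK π s (fusionShift g) (MvPowerSeries.X (some (.inr ⟨k + 1, hk⟩))) =
      specScalar hK π s (fusionShift g) (MvPowerSeries.X (some (.inr ⟨k, Nat.lt_of_succ_lt hk⟩))) +
        theta g * specScalar hK π s (fusionShift g : Fin m → ℂ) (hS _) := by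
  rw [specScalar_X, specScalar_X, specScalar_hS, mergeVar, mergeVar, shiftAmount, shiftAmount,
    fusionShift_succ g k hk, map_add, add_mul, map_add, algebraMap_C_mul_hh, map_add]
  simp only [map_mul, map_intCast, add_assoc]

theorem specScalar_X_left {K : ℕ} (hK : algebraMap Kh A hh ^ K = 0) (s' : Fin m → ℂ)
    (k : ℕ) (hk : k + 1 < n) :
    specScalar hK (fun _ => ()) (fusionShift g) s' (MvPowerSeries.X (some (.inl ⟨k + 1, hk⟩))) =
      specScalar hK (fun _ => ()) (fusionShift g) s' (MvPowerSeries.X (some (.inl ⟨k, Nat.lt_of_succ_lt hk⟩))) +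
        theta g * specScalar hK (fun _ => ()) (fusionShift g : Fin n → ℂ) s' (hS _) := by
  rw [specScalar_X, specScalar_X, specScalar_hS, mergeVar, mergeVar, shiftAmount, shiftAmount,
    fusionShift_succ g k hk, map_add, add_mul, map_add, algebraMap_C_mul_hh, map_add]
  simp only [map_mul, map_intCast, add_assoc]

theorem coeff_algebraMap_mul {τ : Type} (k : ℂ) (F : MvPowerSeries τ A) (e : τ →₀ ℕ) :
    MvPowerSeries.coeff e (algebraMap ℂ (MvPowerSeries τ A) k * F) =
      algebraMap Kh A (PowerSeries.C k) * MvPowerSeries.coeff e F := by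
  rw [MvPowerSeries.algebraMap_apply, MvPowerSeries.coeff_C_mul, IsScalarTower.algebraMap_apply ℂ Kh A]
  rfl

/-- The matrix `T_[n]^+(u) 𝟏 ⊗ T_[m]^+(v) 𝟏` after specialization and a family of bilinear forms. -/
noncomputable def tSpec (π : Fin n → α) (s : Fin n → ℂ) (s' : Fin m → ℂ)
    (B : ℕ → Vac g N c →ₗ[Kh] Vac g N c →ₗ[Kh] A) :
    Matrix (Idx N n m) (Idx N n m) (MvPowerSeries (Option (α ⊕ Unit)) A) :=
  Matrix.of fun a b => specialize A π s s' (tSeries B a b)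

theorem coeff_tSpec_const {K : ℕ} (hK : algebraMap Kh A hh ^ K = 0) (s : Fin n → ℂ)
    (s' : Fin m → ℂ) (B : ℕ → Vac g N c →ₗ[Kh] Vac g N c →ₗ[Kh] A) (a b : Idx N n m)
    (e : Option (Unit ⊕ Unit) →₀ ℕ) :
    MvPowerSeries.coeff e (tSpec (fun _ => ()) s s' B a b) = B (e none)
      (tVecShift g N c s (a ∘ Sum.inl) (b ∘ Sum.inl) (e (some (.inl ()))))
      (tVecShift g N c s' (a ∘ Sum.inr) (b ∘ Sum.inr) (e (some (.inr ())))) :=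
  coeff_specialize_const hK (fun z => (B z).compl₁₂ (toVacLinear g N c) (toVacLinear g N c)) s s'
    (a ∘ Sum.inl) (b ∘ Sum.inl) (a ∘ Sum.inr) (b ∘ Sum.inr) (tSeries B a b) (fun _ => rfl) e

theorem coeff_tSpec_id {K : ℕ} (hK : algebraMap Kh A hh ^ K = 0)
    (s' : Fin m → ℂ) (B : ℕ → Vac g N c →ₗ[Kh] Vac g N c →ₗ[Kh] A) (a b : Idx N n m)
    (e : Option (Fin n ⊕ Unit) →₀ ℕ) :
    MvPowerSeries.coeff e (tSpec id 0 s' B a b) = B (e none)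
      (tVec g N c (a ∘ Sum.inl) (b ∘ Sum.inl) fun i => e (some (.inl i)))
      (tVecShift g N c s' (a ∘ Sum.inr) (b ∘ Sum.inr) (e (some (.inr ())))) :=
  coeff_specialize_id hK (fun z => (B z).compl₁₂ (toVacLinear g N c) (toVacLinear g N c)) 0 s'
    (a ∘ Sum.inl) (b ∘ Sum.inl) (a ∘ Sum.inr) (b ∘ Sum.inr) (tSeries B a b) (fun _ => rfl) e

theorem fusedGen_eq (g : ClassicalType) (N : ℕ) (c : ℂ) (n r : ℕ) : fusedGen g N c n r =
    ∑ a, ∑ b, (PowerSeries.C (fusionIdem g N n a b) : Kh) • tVecShift g N c (fusionShift g) b a r := by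
  rw [fusedGen, map_sum]
  refine (map_sum (toVacLinear g N c) _ _).trans (Finset.sum_congr rfl fun a _ => ?_)
  rw [map_sum]
  refine (map_sum (toVacLinear g N c) _ _).trans (Finset.sum_congr rfl fun b _ => ?_)
  rw [PowerSeries.coeff_smul]
  exact toVac_smul_complex g N c _ _

/-- The matrix of `𝕋` on the second group of tensor factors is fused. -/
theorem onRight_mul_fused (hN : Admissible g N) (hm : m ≤ maxFusion g N)
    (B : ℕ → Vac g N c →ₗ[Kh] Vac g N c →ₗ[Kh] A)
    (L : (Fin n → Fin N) → (Fin n → Fin N) → (α → ℕ) → Vac g N c)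
    (T : Matrix (Idx N n m) (Idx N n m) (MvPowerSeries (Option (α ⊕ Unit)) A))
    (hT : ∀ a b e, MvPowerSeries.coeff e (T a b) = B (e none)
      (L (a ∘ Sum.inl) (b ∘ Sum.inl) fun i => e (some (.inl i)))
      (tVecShift g N c (fusionShift g) (a ∘ Sum.inr) (b ∘ Sum.inr) (e (some (.inr ()))))) :
    onRight N n m _ (fusionIdem g N m) * T * onRight N n m _ (fusionIdem g N m) =
      onRight N n m _ (fusionIdem g N m) * T := by
  ext a b e
  rw [mul_onRight_apply]
  simp only [onRight_mul_apply, Finset.sum_mul, map_sum]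
  have h := congrArg (B (e none) (L (a ∘ Sum.inl) (b ∘ Sum.inl) fun i => e (some (.inl i))))
    (fusionIdem_mul_tVecShift hN hm c (a ∘ Sum.inr) (b ∘ Sum.inr) (e (some (.inr ()))))
  simp only [map_sum, map_smul, Algebra.smul_def] at h
  rw [Finset.sum_comm]
  refine Eq.trans (Finset.sum_congr rfl fun y _ => Finset.sum_congr rfl fun x _ => ?_) (h.trans
    (Finset.sum_congr rfl fun y _ => ?_))
  · rw [mul_comm, ← mul_assoc, ← map_mul, coeff_algebraMap_mul, hT, mul_comm (fusionIdem g N m x _)]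
    rfl
  · rw [coeff_algebraMap_mul, hT]
    rfl

theorem onLeft_mul_fused (hN : Admissible g N) (hn : n ≤ maxFusion g N)
    (B : ℕ → Vac g N c →ₗ[Kh] Vac g N c →ₗ[Kh] A)
    (L : (Fin m → Fin N) → (Fin m → Fin N) → ℕ → Vac g N c)
    (T : Matrix (Idx N n m) (Idx N n m) (MvPowerSeries (Option (Unit ⊕ Unit)) A))
    (hT : ∀ a b e, MvPowerSeries.coeff e (T a b) = B (e none)
      (tVecShift g N c (fusionShift g) (a ∘ Sum.inl) (b ∘ Sum.inl) (e (some (.inl ()))))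
      (L (a ∘ Sum.inr) (b ∘ Sum.inr) (e (some (.inr ()))))) :
    onLeft N n m _ (fusionIdem g N n) * T * onLeft N n m _ (fusionIdem g N n) =
      onLeft N n m _ (fusionIdem g N n) * T := by
  ext a b e
  rw [mul_onLeft_apply]
  simp only [onLeft_mul_apply, Finset.sum_mul, map_sum]
  have h := congrArg (fun x => B (e none) x (L (a ∘ Sum.inr) (b ∘ Sum.inr) (e (some (.inr ())))))
    (fusionIdem_mul_tVecShift hN hn c (a ∘ Sum.inl) (b ∘ Sum.inl) (e (some (.inl ()))))
  simp only [map_sum, map_smul, LinearMap.sum_apply, LinearMap.smul_apply, Algebra.smul_def] at h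
  rw [Finset.sum_comm]
  refine Eq.trans (Finset.sum_congr rfl fun y _ => Finset.sum_congr rfl fun x _ => ?_) (h.trans
    (Finset.sum_congr rfl fun y _ => ?_))
  · rw [mul_comm, ← mul_assoc, ← map_mul, coeff_algebraMap_mul, hT, mul_comm (fusionIdem g N n x _)]
    rfl
  · rw [coeff_algebraMap_mul, hT]
    rfl

theorem trace_idx {S : Type} [CommRing S] (X : Matrix (Idx N n m) (Idx N n m) S) :
    X.trace = ∑ x, ∑ y, X (Sum.elim x y) (Sum.elim x y) := by
  rw [Matrix.trace, sum_idx]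
  rfl

/-- The link between the matrix identities and the vectors 𝕋_[n]⁺: the trace splits over the two
groups, and bilinearity of B collects each half into a `fusedGen`. -/
theorem coeff_trace_fused (B : ℕ → Vac g N c →ₗ[Kh] Vac g N c →ₗ[Kh] A)
    (T : Matrix (Idx N n m) (Idx N n m) (MvPowerSeries (Option (Unit ⊕ Unit)) A))
    (hT : ∀ a b e, MvPowerSeries.coeff e (T a b) = B (e none)
      (tVecShift g N c (fusionShift g) (a ∘ Sum.inl) (b ∘ Sum.inl) (e (some (.inl ()))))
      (tVecShift g N c (fusionShift g) (a ∘ Sum.inr) (b ∘ Sum.inr) (e (some (.inr ())))))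
    (e : Option (Unit ⊕ Unit) →₀ ℕ) :
    MvPowerSeries.coeff e (onLeft N n m _ (fusionIdem g N n) * onRight N n m _ (fusionIdem g N m) *
      T).trace = B (e none) (fusedGen g N c n (e (some (.inl ()))))
        (fusedGen g N c m (e (some (.inr ())))) := by
  rw [trace_idx, fusedGen_eq, fusedGen_eq]
  simp only [mul_assoc, onLeft_mul_apply, onRight_mul_apply, map_sum, Finset.mul_sum,
    coeff_algebraMap_mul, LinearMap.sum_apply, map_smul, LinearMap.smul_apply, Algebra.smul_def, hT]
  rw [Finset.sum_comm]
  refine Finset.sum_congr rfl fun y _ => ?_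
  refine (Finset.sum_congr rfl fun x _ => Finset.sum_comm).trans (Finset.sum_comm.trans ?_)
  refine Finset.sum_congr rfl fun y' _ => Finset.sum_congr rfl fun x _ =>
    Finset.sum_congr rfl fun x' _ => ?_
  rw [mul_left_comm]
  rfl

end SpecHom


/-! ### Functional equations of the normalizing series -/

section Normalization

variable {τ : Type} {N : ℕ} {g : ClassicalType}

theorem hasSubst_of_constantCoeff {b : MvPowerSeries τ Kh} (hb : MvPowerSeries.constantCoeff b = 0) :
    PowerSeries.HasSubst b := PowerSeries.HasSubst.of_constantCoeff_zero hb

theorem subst_negSeries {b : MvPowerSeries τ Kh} (hb : MvPowerSeries.constantCoeff b = 0)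
    (f : PowerSeries ℂ) : PowerSeries.subst b (negSeries f) = PowerSeries.subst (-b) f := by
  have h : negSeries f = f.subst ((-1 : ℂ) • (PowerSeries.X : PowerSeries ℂ)) :=
    PowerSeries.rescale_eq_subst _ _
  rw [h, PowerSeries.subst_comp_subst_apply (PowerSeries.HasSubst.smul_X' _)
    (hasSubst_of_constantCoeff hb), PowerSeries.subst_smul (hasSubst_of_constantCoeff hb),
    PowerSeries.subst_X (hasSubst_of_constantCoeff hb), neg_one_smul]

/-- With b standing for u⁻¹, the hypothesis says that b' stands for (u + k)⁻¹. -/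
theorem subst_shiftSeries {b b' : MvPowerSeries τ Kh} (hb : MvPowerSeries.constantCoeff b = 0) {k : ℂ}
    (h : b' * (1 + algebraMap ℂ _ k * b) = b) (f : PowerSeries ℂ) :
    PowerSeries.subst b (shiftSeries k f) = PowerSeries.subst b' f := by
  have hs := hasSubst_of_constantCoeff hb
  rw [shiftSeries, PowerSeries.subst_comp_subst_apply (shiftInv_hasSubst k) hs]
  congr 1
  have h1 := congrArg (PowerSeries.subst b) (one_add_mul_shiftInv k)
  have hC : PowerSeries.C k = k • (1 : PowerSeries ℂ) := by
    rw [PowerSeries.smul_eq_C_mul, mul_one]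
  have h1' : PowerSeries.subst b (1 : PowerSeries ℂ) = (1 : MvPowerSeries τ Kh) := by
    rw [← PowerSeries.coe_substAlgHom hs, map_one]
  rw [PowerSeries.subst_mul hs, PowerSeries.subst_add hs, PowerSeries.subst_X hs, hC, smul_one_mul,
    PowerSeries.subst_smul hs, PowerSeries.subst_X hs, h1', Algebra.smul_def] at h1
  have hu : IsUnit (1 + algebraMap ℂ (MvPowerSeries τ Kh) k * b) := by
    rw [MvPowerSeries.isUnit_iff_constantCoeff]
    simp [hb]
  exact hu.mul_left_injective (h1.trans h.symm)

theorem normSeries_mul_neg (g : ClassicalType) (hN : N ≠ 0) :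
    normSeries g N * negSeries (normSeries g N) * (1 - PowerSeries.X ^ 2) = 1 := by
  have hX : PowerSeries.constantCoeff (1 - PowerSeries.X ^ 2 : PowerSeries ℂ) ≠ 0 := by simp
  have h := normSeries_spec g N hN
  rw [← PowerSeries.eq_inv_iff_mul_eq_one hX]
  cases g with
  | gl => exact h.2.2
  | o => exact h.2.2.2
  | sp => exact h.2.2.2

theorem normSeries_ne_zero (g : ClassicalType) (hN : N ≠ 0) : normSeries g N ≠ 0 := by
  intro h
  have := normSeries_mul_neg g hN
  rw [h] at this
  simp at this

/-- Cancelling f(u) between the two defining equations gives f(u + N)⁻¹ = f(-u). -/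
theorem normSeries_gl_shift (hN : N ≠ 0) :
    negSeries (normSeries .gl N) * shiftSeries N (normSeries .gl N) = 1 := by
  obtain ⟨h1, h2, h3⟩ := normSeries_spec .gl N hN
  have h4 := mul_left_cancel₀ (normSeries_ne_zero .gl hN) (h2.trans h3.symm)
  rw [← h4]
  exact PowerSeries.inv_mul_cancel _ (by rw [const_shift, h1]; exact one_ne_zero)

/-- Both sides have the same product with f(u), by the two defining equations. -/
theorem normSeries_shift {g : ClassicalType} (hg : g ≠ .gl) (hN : N ≠ 0) :
    shiftSeries (kappa g N) (normSeries g N) = negSeries (normSeries g N) := by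
  have h := normSeries_spec g N hN
  refine mul_left_cancel₀ (normSeries_ne_zero g hN) ?_
  cases g with
  | gl => exact absurd rfl hg
  | o => exact h.2.2.1.trans h.2.2.2.symm
  | sp => exact h.2.2.1.trans h.2.2.2.symm

theorem subst_normSeries_mul_neg (g : ClassicalType) (hN : N ≠ 0) {b : MvPowerSeries τ Kh}
    (hb : MvPowerSeries.constantCoeff b = 0) :
    PowerSeries.subst b (normSeries g N) * PowerSeries.subst (-b) (normSeries g N) * (1 - b * b) = 1 := by
  have hs := hasSubst_of_constantCoeff hb
  have h := congrArg (PowerSeries.subst b) (normSeries_mul_neg g hN)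
  rw [PowerSeries.subst_mul hs, PowerSeries.subst_mul hs, subst_negSeries hb,
    ← PowerSeries.coe_substAlgHom hs, map_sub, map_one, map_pow, PowerSeries.coe_substAlgHom hs,
    PowerSeries.subst_X hs, pow_two] at h
  exact h

theorem subst_normSeries_gl (hN : N ≠ 0) {a a' : MvPowerSeries τ Kh}
    (ha : MvPowerSeries.constantCoeff a = 0) (h : a' * (1 - algebraMap ℂ _ (N : ℂ) * a) = a) :
    PowerSeries.subst a (normSeries .gl N) * PowerSeries.subst (-a') (normSeries .gl N) = 1 := by
  have hb : MvPowerSeries.constantCoeff (-a) = 0 := by rw [map_neg, ha, neg_zero]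
  have hs := hasSubst_of_constantCoeff hb
  have h1 := congrArg (PowerSeries.subst (-a)) (normSeries_gl_shift hN)
  rw [PowerSeries.subst_mul hs, subst_negSeries hb, neg_neg, subst_shiftSeries (b' := -a') hb
    (by linear_combination -h), ← PowerSeries.coe_substAlgHom hs, map_one] at h1
  exact h1

/-- Let b = y⁻¹, so that a and -a' are the inverses of y + κ and -y + κ. Then f(y + κ) = f(-y) and
f(-y + κ) = f(y), and the product is known from f(y)f(-y)(1 - y⁻²) = 1. -/
theorem subst_normSeries_crossing {g : ClassicalType} (hg : g ≠ .gl) (hN : N ≠ 0)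
    {a a' b : MvPowerSeries τ Kh} (hb : MvPowerSeries.constantCoeff b = 0)
    (h : a * (1 + algebraMap ℂ _ (kappa g N) * b) = b)
    (h' : a' * (1 - algebraMap ℂ _ (kappa g N) * b) = b) :
    PowerSeries.subst a (normSeries g N) * PowerSeries.subst (-a') (normSeries g N) * (1 - b * b) = 1 := by
  have hb' : MvPowerSeries.constantCoeff (-b) = 0 := by rw [map_neg, hb, neg_zero]
  rw [← subst_shiftSeries hb h, normSeries_shift hg hN,
    subst_negSeries hb, ← subst_shiftSeries (b := -b) (b' := -a') hb' (k := kappa g N)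
    (by linear_combination -h'), normSeries_shift hg hN, subst_negSeries hb', neg_neg]
  linear_combination subst_normSeries_mul_neg g hN hb

end Normalization

/-! ### Unitarity of the `R`-matrix -/

section Unitarity

variable {N : ℕ} {S : Type} [CommRing S]

variable [Algebra ℂ S]

theorem Pmat_mul_Qop_of_algebra {g : ClassicalType} (hN : Admissible g N) :
    Pmat N S * Qop g N S = theta g • Qop g N S := by
  have h := congrArg (algebraMap ℂ S).mapMatrix (Pmat_mul_Qop hN)
  rw [map_mul, map_zsmul] at h
  have hQ : (algebraMap ℂ S).mapMatrix (Qop g N ℂ) = Qop g N S := Qop_map g (Algebra.ofId ℂ S)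
  have hP : (algebraMap ℂ S).mapMatrix (Pmat N ℂ) = Pmat N S := Pmat_map _
  rwa [hQ, hP] at h

theorem constantCoeff_hS_mul {τ : Type} {s : MvPowerSeries τ Kh} (hs : MvPowerSeries.constantCoeff s = 0) :
    MvPowerSeries.constantCoeff (hS τ * s) = 0 := by rw [map_mul, hs, mul_zero]

theorem unitarity_aux {M : Type} [Ring M] [Algebra S M] {p q : M} {θ n a b b' : S} (hp : p * p = 1)
    (hpq : p * q = θ • q) (hqp : q * p = θ • q) (hq : q * q = n • q)
    (h : b + b' + θ * a * (b - b') + n * b * b' = 0) :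
    (1 - a • p + b • q) * (1 + a • p + b' • q) = (1 - a * a) • 1 := by
  have e : (1 - a • p + b • q) * (1 + a • p + b' • q) = 1 - (a * a) • (p * p) + (b + b') • q -
      (a * b') • (p * q) + (b * a) • (q * p) + (b * b') • (q * q) := by
    simp only [sub_eq_add_neg, add_mul, mul_add, neg_mul, one_mul, mul_one, smul_mul_assoc,
      mul_smul_comm]
    module
  rw [e, hp, hpq, hqp, hq]
  linear_combination (norm := module) h • q

/-- Unitarity of the `R`-matrix. -/
theorem Rbar_mul_Rbar_neg {τ : Type} {g : ClassicalType} (hN : Admissible g N) {s : MvPowerSeries τ Kh}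
    (hs : MvPowerSeries.constantCoeff s = 0) : Rbar g N s * Rbar g N (-s) = 1 := by
  have hN0 : N ≠ 0 := by exact_mod_cast hN.cast_ne_zero
  have hs' : MvPowerSeries.constantCoeff (-s) = 0 := by rw [map_neg, hs, neg_zero]
  have hf := subst_normSeries_mul_neg g hN0 (constantCoeff_hS_mul hs)
  -- The coefficient of Q in the product. For 𝔬_N and 𝔰𝔭_N the inverses of the two Q-coefficients
  -- are u/h - κ and -u/h - κ, and the identity reduces to N = 2(θ + κ).
  have hb : Qcoeff g N s + Qcoeff g N (-s) + theta g * (hS τ * s) * (Qcoeff g N s - Qcoeff g N (-s)) +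
      N * Qcoeff g N s * Qcoeff g N (-s) = 0 := by
    by_cases hg : g = .gl
    · subst hg; simp [Qcoeff]
    · have h1 := Qcoeff_mul hg N hs
      have h2 := Qcoeff_mul hg N hs'
      have hu := isUnit_one_sub_kappa (kappa g N) hs
      have hu' := isUnit_one_sub_kappa (kappa g N) hs'
      rw [← hu.mul_left_inj, ← hu'.mul_left_inj]
      have hn := congrArg (algebraMap ℂ (MvPowerSeries τ Kh)) (two_theta_add_kappa hg N)
      rw [map_mul, map_ofNat, map_add, map_natCast, map_intCast] at hn
      linear_combination ((1 + algebraMap ℂ _ (kappa g N) * (hS τ * s)) * (1 + theta g * (hS τ * s)) +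
          N * Qcoeff g N (-s) * (1 + algebraMap ℂ _ (kappa g N) * (hS τ * s))) * h1 +
        ((1 - algebraMap ℂ _ (kappa g N) * (hS τ * s)) * (1 - theta g * (hS τ * s)) +
          N * (hS τ * s)) * h2 + (hS τ * s) ^ 2 * hn
  have hm : Rmat g N s * Rmat g N (-s) = (1 - hS τ * s * (hS τ * s)) • 1 := by
    have hQP := Qop_mul_Pmat (S := MvPowerSeries τ Kh) hN
    have hPQ := Pmat_mul_Qop_of_algebra (S := MvPowerSeries τ Kh) hN
    rw [← Int.cast_smul_eq_zsmul (MvPowerSeries τ Kh)] at hQP hPQ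
    rw [Rmat_eq, Rmat_eq, mul_neg, neg_smul, sub_neg_eq_add]
    exact unitarity_aux Pmat_mul_self hPQ hQP (Qop_mul_Qop g) hb
  rw [Rbar, Rbar, smul_mul_assoc, mul_smul_comm, hm, mul_neg, smul_smul, smul_smul, hf,
    one_smul]

end Unitarity


/-! ### Crossing symmetry at the critical level -/

section TransposeFirst

variable {N : ℕ} {S : Type} [CommRing S]

/-- The partial transposition in the first tensor factor. -/
def transposeFirst (M : Matrix (Fin N × Fin N) (Fin N × Fin N) S) :
    Matrix (Fin N × Fin N) (Fin N × Fin N) S :=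
  Matrix.of fun a b => M (b.1, a.2) (a.1, b.2)

theorem transposeFirst_add (M M' : Matrix (Fin N × Fin N) (Fin N × Fin N) S) :
    transposeFirst (M + M') = transposeFirst M + transposeFirst M' := rfl

theorem transposeFirst_sub (M M' : Matrix (Fin N × Fin N) (Fin N × Fin N) S) :
    transposeFirst (M - M') = transposeFirst M - transposeFirst M' := rfl

theorem transposeFirst_smul (k : S) (M : Matrix (Fin N × Fin N) (Fin N × Fin N) S) :
    transposeFirst (k • M) = k • transposeFirst M := rfl

theorem transposeFirst_one :
    transposeFirst (1 : Matrix (Fin N × Fin N) (Fin N × Fin N) S) = 1 := by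
  ext ⟨a1, a2⟩ ⟨b1, b2⟩
  simp only [transposeFirst, Matrix.of_apply, Matrix.one_apply, Prod.mk.injEq]
  simp only [eq_comm]

theorem transposeFirst_Pmat_apply (a b : Fin N × Fin N) :
    transposeFirst (Pmat N S) a b = if b.1 = b.2 ∧ a.2 = a.1 then 1 else 0 := rfl

/-- Partial transposition exchanges the roles of P and Q: the transpose of P is N times a projection
of rank one, while that of Q is an involution. -/
theorem transposeFirst_Pmat_mul_self : transposeFirst (Pmat N S) * transposeFirst (Pmat N S) =
    (N : S) • transposeFirst (Pmat N S) := by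
  ext ⟨a1, a2⟩ ⟨b1, b2⟩
  rw [Matrix.mul_apply, Fintype.sum_prod_type, Matrix.smul_apply]
  simp only [transposeFirst_Pmat_apply, ite_and, ite_mul, zero_mul, one_mul]
  simp only [eq_comm, Finset.sum_ite_eq, Finset.mem_univ, if_true]
  by_cases h1 : b1 = b2 <;> by_cases h2 : a1 = a2 <;> simp [h1, h2]

variable [Algebra ℂ S]

theorem transposeFirst_Qop_apply {g : ClassicalType} (hg : g ≠ .gl) (a b : Fin N × Fin N) :
    transposeFirst (Qop g N S) a b = if a.2 = b.1.rev ∧ b.2 = a.1.rev then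
      algebraMap ℂ S (sgn g b.1 * sgn g a.1) else 0 := by
  cases g with
  | gl => exact absurd rfl hg
  | o => rfl
  | sp => rfl

theorem transposeFirst_Qop_mul_self {g : ClassicalType} (hg : g ≠ .gl) :
    transposeFirst (Qop g N S) * transposeFirst (Qop g N S) = 1 := by
  ext ⟨a1, a2⟩ ⟨b1, b2⟩
  rw [Matrix.mul_apply, Finset.sum_eq_single (a2.rev, a1.rev)]
  · rw [transposeFirst_Qop_apply hg, transposeFirst_Qop_apply hg, Matrix.one_apply]
    simp only [Fin.rev_rev, true_and, if_true, Fin.rev_inj, Prod.mk.injEq]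
    by_cases h1 : a1 = b1
    · by_cases h2 : b2 = a2
      · subst h1; subst h2
        rw [if_pos ⟨rfl, rfl⟩, if_pos ⟨rfl, rfl⟩, ← map_mul]
        have e1 := sgn_mul_self g a1
        have e2 := sgn_mul_self g b2.rev
        rw [show sgn g b2.rev * sgn g a1 * (sgn g a1 * sgn g b2.rev) = 1 by
          linear_combination sgn g b2.rev * sgn g b2.rev * e1 + e2, map_one]
      · rw [if_neg fun h => h2 h.2, if_neg fun h => h2 h.2.symm, mul_zero]
    · rw [if_neg fun h => h1 h.1, if_neg fun h => h1 h.1, mul_zero]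
  · rintro ⟨x, y⟩ _ h
    rw [transposeFirst_Qop_apply hg, if_neg, zero_mul]
    rintro ⟨h1, h2⟩
    apply h
    simp only at h1 h2
    rw [h1, h2, Fin.rev_rev]
  · simp

theorem transposeFirst_Pmat_mul_Qop {g : ClassicalType} (hN : Admissible g N) (hg : g ≠ .gl) :
    transposeFirst (Pmat N S) * transposeFirst (Qop g N S) = (theta g : S) • transposeFirst (Pmat N S) := by
  ext ⟨a1, a2⟩ ⟨b1, b2⟩
  rw [Matrix.mul_apply, Finset.sum_eq_single (b1.rev, b1.rev)]
  · rw [transposeFirst_Qop_apply hg, Matrix.smul_apply, transposeFirst_Pmat_apply,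
      transposeFirst_Pmat_apply]
    simp only [Fin.rev_rev, true_and]
    rw [sgn_rev hN hg, show sgn g b1 * (theta g * sgn g b1) = theta g by
      linear_combination (theta g : ℂ) * sgn_mul_self g b1, map_intCast]
    by_cases h1 : b1 = b2 <;> by_cases h2 : a2 = a1 <;> simp [h1, h2, eq_comm]
  · rintro ⟨x, y⟩ _ h
    rw [transposeFirst_Qop_apply hg, transposeFirst_Pmat_apply]
    simp only
    by_cases h1 : x = y
    · rw [if_neg (c := y = b1.rev ∧ b2 = x.rev), mul_zero]
      rintro ⟨h2, h3⟩
      exact h (by rw [h1, h2])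
    · rw [if_neg (fun h => h1 h.1), zero_mul]
  · simp

theorem transposeFirst_Qop_mul_Pmat {g : ClassicalType} (hN : Admissible g N) (hg : g ≠ .gl) :
    transposeFirst (Qop g N S) * transposeFirst (Pmat N S) = (theta g : S) • transposeFirst (Pmat N S) := by
  ext ⟨a1, a2⟩ ⟨b1, b2⟩
  rw [Matrix.mul_apply, Finset.sum_eq_single (a1.rev, a1.rev)]
  · rw [transposeFirst_Qop_apply hg, Matrix.smul_apply, transposeFirst_Pmat_apply,
      transposeFirst_Pmat_apply]
    simp only [Fin.rev_rev, and_true]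
    rw [sgn_rev hN hg, show theta g * sgn g a1 * sgn g a1 = theta g by
      linear_combination (theta g : ℂ) * sgn_mul_self g a1, map_intCast]
    by_cases h1 : b1 = b2 <;> by_cases h2 : a2 = a1 <;> simp [h1, h2]
  · rintro ⟨x, y⟩ _ h
    rw [transposeFirst_Qop_apply hg, transposeFirst_Pmat_apply]
    simp only
    by_cases h1 : y = x
    · rw [if_neg (c := a2 = x.rev ∧ y = a1.rev), zero_mul]
      rintro ⟨h2, h3⟩
      exact h (by rw [← h1, h3])
    · rw [if_neg (c := b1 = b2 ∧ y = x) (fun h => h1 h.2), mul_zero]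
  · simp

theorem crossing_aux {M : Type} [Ring M] [Algebra S M] {p q : M} {θ n a a' b b' : S}
    (hp : p * p = n • p) (hpq : p * q = θ • p) (hqp : q * p = θ • p) (hq : q * q = 1)
    (h : a' - a - n * (a * a') + θ * (b * a' - a * b') = 0) :
    (1 - a • p + b • q) * (1 + a' • p + b' • q) = (1 + b * b') • 1 + (b + b') • q := by
  have e : (1 - a • p + b • q) * (1 + a' • p + b' • q) = 1 + (a' - a) • p - (a * a') • (p * p) +
      (b + b') • q - (a * b') • (p * q) + (b * a') • (q * p) + (b * b') • (q * q) := by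
    simp only [sub_eq_add_neg, add_mul, mul_add, neg_mul, one_mul, mul_one, smul_mul_assoc,
      mul_smul_comm]
    module
  rw [e, hp, hpq, hqp, hq]
  linear_combination (norm := module) h • p

theorem epsilon_mul_critLevel_gl (N : ℕ) : epsilon .gl * critLevel .gl N = -(N : ℂ) := by
  simp [epsilon, critLevel]

theorem epsilon_mul_critLevel {g : ClassicalType} (hg : g ≠ .gl) (N : ℕ) :
    epsilon g * critLevel g N = -2 * kappa g N := by
  cases g with
  | gl => exact absurd rfl hg
  | o => simp only [epsilon, critLevel, kappa]; ring
  | sp => simp only [epsilon, critLevel, kappa]; ring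

theorem transposeFirst_Rbar {τ : Type} (g : ClassicalType) (N : ℕ) (s : MvPowerSeries τ Kh) :
    transposeFirst (Rbar g N s) = PowerSeries.subst (hS τ * s) (normSeries g N) •
      (1 - (hS τ * s) • transposeFirst (Pmat N _) + Qcoeff g N s • transposeFirst (Qop g N _)) := by
  rw [Rbar, Rmat_eq, transposeFirst_smul, transposeFirst_add, transposeFirst_sub,
    transposeFirst_smul, transposeFirst_smul, transposeFirst_one]

/-- Crossing symmetry of the `R`-matrix at the critical level. -/
theorem transposeFirst_Rbar_mul {τ : Type} {g : ClassicalType} (hN : Admissible g N)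
    {s s' : MvPowerSeries τ Kh} (hs : MvPowerSeries.constantCoeff s = 0)
    (hs' : MvPowerSeries.constantCoeff s' = 0)
    (h : s' * (1 + algebraMap ℂ _ (epsilon g * critLevel g N) * (hS τ * s)) = s) :
    transposeFirst (Rbar g N s) * transposeFirst (Rbar g N (-s')) = 1 := by
  have hN0 : N ≠ 0 := by exact_mod_cast hN.cast_ne_zero
  rw [transposeFirst_Rbar, transposeFirst_Rbar, smul_mul_assoc, mul_smul_comm, smul_smul, mul_neg,
    neg_smul, sub_neg_eq_add]
  by_cases hg : g = .gl
  · subst hg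
    rw [epsilon_mul_critLevel_gl, map_neg] at h
    have h1 : Qop .gl N (MvPowerSeries τ Kh) = 0 := rfl
    have h2 : transposeFirst (0 : Matrix (Fin N × Fin N) (Fin N × Fin N) (MvPowerSeries τ Kh)) = 0 := rfl
    have hf := subst_normSeries_gl hN0 (a' := hS τ * s') (constantCoeff_hS_mul hs)
      (by linear_combination hS τ * h)
    rw [h1, h2, hf, one_smul, smul_zero, smul_zero, add_zero, add_zero]
    rw [map_natCast] at h
    have e : (1 - (hS τ * s) • transposeFirst (Pmat N (MvPowerSeries τ Kh))) *
        (1 + (hS τ * s') • transposeFirst (Pmat N (MvPowerSeries τ Kh))) = 1 +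
        (hS τ * s' - hS τ * s) • transposeFirst (Pmat N (MvPowerSeries τ Kh)) -
        (hS τ * s * (hS τ * s')) • (transposeFirst (Pmat N _) * transposeFirst (Pmat N _)) := by
      rw [sub_mul, one_mul, mul_add, mul_one, smul_mul_smul_comm, sub_smul]
      abel
    -- Here εc = -N, which is exactly what the square of the transposed P requires for the
    -- cancellation.
    have h3 : hS τ * s' - hS τ * s = (hS τ * s * (hS τ * s')) * N := by
      linear_combination hS τ * h
    rw [e, transposeFirst_Pmat_mul_self, h3, smul_smul, add_sub_cancel_right]
  · rw [epsilon_mul_critLevel hg, map_mul, map_neg, map_ofNat] at h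
    have h1 := Qcoeff_mul hg N hs
    have hsn : MvPowerSeries.constantCoeff (-s') = 0 := by rw [map_neg, hs', neg_zero]
    have h2 := Qcoeff_mul hg N hsn
    have hu := isUnit_one_sub_kappa (kappa g N) hs
    have hu' := isUnit_one_sub_kappa (kappa g N) hsn
    -- At εc = -2κ the inverses of the two Q-coefficients are u/h - κ and -(u/h - 2κ) - κ, which are
    -- opposite. Hence the terms with Q cancel in the product.
    have hb : Qcoeff g N (-s') = - Qcoeff g N s := by
      rw [← hu.mul_left_inj, ← hu'.mul_left_inj]
      linear_combination (1 - algebraMap ℂ _ (kappa g N) * (hS τ * s)) * h2 +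
        (1 - algebraMap ℂ _ (kappa g N) * (hS τ * -s')) * h1 - hS τ * h
    have hbc : MvPowerSeries.constantCoeff (Qcoeff g N s) = 0 := by
      have := congrArg MvPowerSeries.constantCoeff h1
      simpa [hs] using this
    have hn := congrArg (algebraMap ℂ (MvPowerSeries τ Kh)) (two_theta_add_kappa hg N)
    rw [map_mul, map_ofNat, map_add, map_natCast, map_intCast] at hn
    have hf := subst_normSeries_crossing hg hN0 (a := hS τ * s) (a' := hS τ * s') hbc
      (by linear_combination -h1) (by rw [hb] at h2; linear_combination h2)
    rw [crossing_aux transposeFirst_Pmat_mul_self (transposeFirst_Pmat_mul_Qop hN hg)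
      (transposeFirst_Qop_mul_Pmat hN hg) (transposeFirst_Qop_mul_self hg), hb, add_neg_cancel, zero_smul,
      add_zero, smul_smul, mul_neg, ← sub_eq_add_neg, hf, one_smul]
    -- What remains is the coefficient of the transposed P, which vanishes by N = 2(θ + κ).
    rw [hb, ← hu.mul_left_inj]
    linear_combination theta g * (hS τ * s' + hS τ * s) * h1 + hS τ * (1 - theta g * hS τ * s -
      algebraMap ℂ _ (kappa g N) * (hS τ * s)) * h + hS τ * hS τ * s * s' *
      (1 - algebraMap ℂ _ (kappa g N) * (hS τ * s)) * hn

end TransposeFirst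


/-! ### The crossing relation for matrices of operators -/

section Crossed

variable {N : ℕ} {M : Type} [Ring M]

/-- The crossing relation between matrices with noncommuting entries. -/
def Crossed {κ : Type} [Fintype κ] [DecidableEq κ] (L L' : Matrix κ κ M) : Prop :=
  ∀ k b, ∑ x, L x b * L' k x = if k = b then 1 else 0

/-- The second product has the opposite order. Since the entries of L₁ commute with those of L and
L', the entries of L₁ and L₁' can be brought together and summed first. -/
theorem Crossed.mul {L L' L₁ L₁' : Matrix (Fin N) (Fin N) M} (h : Crossed L L') (h₁ : Crossed L₁ L₁')
    (hc : ∀ x y z w, Commute (L₁ x y) (L z w)) (hc' : ∀ x y z w, Commute (L₁ x y) (L' z w)) :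
    Crossed (L₁ * L) (L' * L₁') := by
  intro k b
  rw [← h k b]
  have e : ∀ x, (L₁ * L) x b * (L' * L₁') k x =
      ∑ y, ∑ z, L y b * L' k z * (L₁ x y * L₁' z x) := by
    intro x
    rw [Matrix.mul_apply, Matrix.mul_apply, Finset.sum_mul_sum]
    refine Finset.sum_congr rfl fun y _ => Finset.sum_congr rfl fun z _ => ?_
    rw [mul_assoc, ← mul_assoc (L y b), ← mul_assoc, ((hc x y y b).mul_right (hc' x y k z)).eq, mul_assoc]
  simp only [e]
  rw [Finset.sum_comm]
  refine Finset.sum_congr rfl fun y _ => ?_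
  rw [Finset.sum_comm, Finset.sum_eq_single y]
  · rw [← Finset.mul_sum, h₁ y y, if_pos rfl, mul_one]
  · intro z _ hz
    rw [← Finset.mul_sum, h₁ z y, if_neg hz, mul_zero]
  · simp

theorem crossed_one : Crossed (1 : Matrix (Fin N) (Fin N) M) 1 := by
  intro k b
  rw [Finset.sum_eq_single b]
  · simp [Matrix.one_apply]
  · intro x _ hx
    rw [Matrix.one_apply_ne hx, zero_mul]
  · simp

theorem crossed_list_prod {ι : Type} (L L' : ι → Matrix (Fin N) (Fin N) M) (l : List ι) (hl : l.Nodup)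
    (h : ∀ j, Crossed (L j) (L' j))
    (hc : ∀ i j, i ≠ j → ∀ x y z w, Commute (L i x y) (L j z w))
    (hc' : ∀ i j, i ≠ j → ∀ x y z w, Commute (L i x y) (L' j z w)) :
    Crossed (l.map L).prod (l.reverse.map L').prod := by
  induction l with
  | nil => exact crossed_one
  | cons i l ih =>
    rw [List.nodup_cons] at hl
    rw [List.map_cons, List.prod_cons, List.reverse_cons, List.map_append, List.map_singleton,
      List.prod_append, List.prod_singleton]
    have hcomm : ∀ (F : ι → Matrix (Fin N) (Fin N) M) (l' : List ι),
        (∀ j ∈ l', ∀ x y z w, Commute (L i x y) (F j z w)) →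
        ∀ x y z w, Commute (L i x y) ((l'.map F).prod z w) := by
      intro F l'
      induction l' with
      | nil =>
        intro _ x y z w
        rw [List.map_nil, List.prod_nil, Matrix.one_apply]
        split_ifs
        · exact Commute.one_right _
        · exact Commute.zero_right _
      | cons j l' ih' =>
        intro hF x y z w
        rw [List.map_cons, List.prod_cons, Matrix.mul_apply]
        refine Commute.sum_right _ _ _ fun t _ => ?_
        exact (hF j List.mem_cons_self x y z t).mul_right
          (ih' (fun j' hj' => hF j' (List.mem_cons_of_mem _ hj')) x y t w)
    refine (ih hl.2).mul (h i) (hcomm L l fun j hj => ?_) (hcomm L' _ fun j hj => ?_)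
    · exact hc i j fun e => hl.1 (e ▸ hj)
    · exact hc' i j fun e => hl.1 (e ▸ List.mem_reverse.mp hj)

/-- No commutation between different tensor factors is needed. As the second product is reversed,
the factors in the middle collapse to a scalar before the outer ones are met. -/
theorem crossed_ofFn {n : ℕ} (L L' : Fin n → Matrix (Fin N) (Fin N) M)
    (h : ∀ i, Crossed (L i) (L' i)) (k b : Fin n → Fin N) :
    ∑ x : Fin n → Fin N, (List.ofFn fun i => L i (x i) (b i)).prod *
      (List.ofFn fun i => L' i (k i) (x i)).reverse.prod = if k = b then 1 else 0 := by
  induction n with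
  | zero => simp [Subsingleton.elim k b]
  | succ n ih =>
    rw [← (Fin.consEquiv fun _ : Fin (n + 1) => Fin N).sum_comp, Fintype.sum_prod_type]
    simp only [Fin.consEquiv_apply, List.ofFn_succ, Fin.cons_zero, Fin.cons_succ, List.prod_cons,
      List.reverse_cons, List.prod_append, List.prod_nil, mul_one]
    have e : ∀ x0, (∑ x : Fin n → Fin N, L 0 x0 (b 0) * (List.ofFn fun i : Fin n => L i.succ (x i) (b i.succ)).prod *
        ((List.ofFn fun i : Fin n => L' i.succ (k i.succ) (x i)).reverse.prod * L' 0 (k 0) x0)) =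
        L 0 x0 (b 0) * (if (fun i : Fin n => k i.succ) = (fun i => b i.succ) then 1 else 0) * L' 0 (k 0) x0 := by
      intro x0
      rw [← ih (fun i => L i.succ) (fun i => L' i.succ) (fun i => h i.succ), Finset.mul_sum, Finset.sum_mul]
      refine Finset.sum_congr rfl fun x _ => ?_
      simp only [mul_assoc]
    simp only [e]
    by_cases h1 : (fun i : Fin n => k i.succ) = (fun i => b i.succ)
    · simp only [h1, if_true, mul_one]
      rw [h 0 (k 0) (b 0)]
      congr 1
      apply propext
      constructor
      · intro h0
        funext i
        refine Fin.cases h0 (fun i => congrFun h1 i) i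
      · intro hkb
        rw [hkb]
    · simp only [h1, if_false, mul_zero, zero_mul, Finset.sum_const_zero]
      rw [if_neg]
      rintro rfl
      exact h1 rfl

end Crossed

/-! ### Block matrices over the first group of factors -/

section Blocks

variable {N n m : ℕ} {S : Type} [CommRing S]

/-- An operator on both groups of tensor factors, as a matrix of operators on the second group. -/
def blocks : Matrix (Idx N n m) (Idx N n m) S →+*
    Matrix (Fin n → Fin N) (Fin n → Fin N) (Matrix (Fin m → Fin N) (Fin m → Fin N) S) where
  toFun X := Matrix.of fun a b => Matrix.of fun x y => X (Sum.elim a x) (Sum.elim b y)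
  map_one' := by
    ext a b x y
    rw [Matrix.of_apply, Matrix.of_apply, Matrix.one_apply, Matrix.one_apply]
    by_cases h : a = b
    · subst h
      rw [if_pos rfl, Matrix.one_apply]
      congr 1
      apply propext
      constructor
      · intro h; simpa using congrArg (fun f => f ∘ Sum.inr) h
      · rintro rfl; rfl
    · rw [if_neg h, if_neg]
      · rfl
      · intro h'; exact h (by simpa using congrArg (fun f => f ∘ Sum.inl) h')
  map_zero' := rfl
  map_add' _ _ := rfl
  map_mul' X Y := by
    ext a b x y
    rw [Matrix.mul_apply, Matrix.sum_apply, Matrix.of_apply, Matrix.of_apply, Matrix.mul_apply, sum_idx]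
    refine Finset.sum_congr rfl fun c _ => ?_
    rw [Matrix.mul_apply]
    rfl

theorem blocks_apply (X : Matrix (Idx N n m) (Idx N n m) S) (a b : Fin n → Fin N)
    (x y : Fin m → Fin N) : blocks X a b x y = X (Sum.elim a x) (Sum.elim b y) := rfl

/-- The operator on `ℂ^N ⊗ ℂ^N`, acting on the factor `j` of the second group, as a matrix of operators. -/
def innerLeg (j : Fin m) (M : Matrix (Fin N × Fin N) (Fin N × Fin N) S) :
    Matrix (Fin N) (Fin N) (Matrix (Fin m → Fin N) (Fin m → Fin N) S) :=
  Matrix.of fun x y => oneLeg j (Matrix.of fun x' y' => M (x, x') (y, y'))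

theorem blocks_twoLeg (i : Fin n) (j : Fin m) (M : Matrix (Fin N × Fin N) (Fin N × Fin N) S) :
    blocks (twoLeg (Sum.inl i) (Sum.inr j) M) = oneLeg i (innerLeg j M) := by
  ext a b x y
  by_cases h1 : ∀ k, k ≠ i → a k = b k
  · have e : oneLeg i (innerLeg j M) a b = innerLeg j M (a i) (b i) := if_pos h1
    rw [e]
    by_cases h2 : ∀ k, k ≠ j → x k = y k
    · refine Eq.trans (if_pos ?_) (if_pos h2).symm
      rintro (k | k) hk hk'
      · exact h1 k fun h => hk (congrArg _ h)
      · exact h2 k fun h => hk' (congrArg _ h)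
    · refine Eq.trans (if_neg fun h => h2 fun k hk => ?_) (if_neg h2).symm
      exact h (Sum.inr k) (by simp) (by simpa using hk)
  · have e : oneLeg i (innerLeg j M) a b = 0 := if_neg h1
    rw [e]
    refine if_neg fun h => h1 fun k hk => ?_
    exact h (Sum.inl k) (by simpa using hk) (by simp)

theorem oneLeg_sum {κ β : Type} [Fintype κ] [DecidableEq κ] [Fintype β] (p : κ)
    (L : β → Matrix (Fin N) (Fin N) S) :
    (∑ x, oneLeg p (L x) : Matrix (κ → Fin N) (κ → Fin N) S) = oneLeg p (∑ x, L x) := by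
  ext a b
  rw [Matrix.sum_apply]
  simp only [oneLeg, Matrix.of_apply]
  split_ifs
  · rw [Matrix.sum_apply]
  · simp

theorem oneLeg_one {R κ : Type} [Semiring R] [Fintype κ] [DecidableEq κ] (p : κ) :
    oneLeg p (1 : Matrix (Fin N) (Fin N) R) = (1 : Matrix (κ → Fin N) (κ → Fin N) R) := by
  ext a b
  simp only [oneLeg, Matrix.of_apply, Matrix.one_apply]
  by_cases h : a = b
  · subst h; simp
  · rw [if_neg h]
    split_ifs with h1 h2
    · exfalso
      apply h
      funext k
      by_cases hk : k = p
      · rw [hk, h2]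
      · exact h1 k hk
    · rfl
    · rfl

theorem oneLeg_zero {R κ : Type} [Semiring R] [Fintype κ] [DecidableEq κ] (p : κ) :
    oneLeg p (0 : Matrix (Fin N) (Fin N) R) = (0 : Matrix (κ → Fin N) (κ → Fin N) R) := by
  ext a b
  simp [oneLeg]

theorem oneLeg_comm {κ : Type} [Fintype κ] [DecidableEq κ] {p q : κ} (hpq : p ≠ q)
    (L L' : Matrix (Fin N) (Fin N) S) :
    Commute (oneLeg p L : Matrix (κ → Fin N) (κ → Fin N) S) (oneLeg q L') := by
  rw [← twoLeg_leg1 hpq, ← twoLeg_leg2 hpq, Commute, SemiconjBy, twoLeg_mul hpq, twoLeg_mul hpq]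
  congr 1
  ext x y
  have h1 := leg1_mul_leg2 L L' x y
  have h2 := leg2_mul_leg1 L L' x y
  rw [mul_comm] at h2
  exact h1.trans h2.symm

/-- For one pair of factors, the crossing relation is the entrywise form of the statement that the
partial transposes are inverse to each other. -/
theorem crossed_innerLeg (j : Fin m) {M M' : Matrix (Fin N × Fin N) (Fin N × Fin N) S}
    (h : transposeFirst M * transposeFirst M' = 1) : Crossed (innerLeg j M) (innerLeg j M') := by
  intro k b
  simp only [innerLeg, Matrix.of_apply, oneLeg_mul]
  rw [oneLeg_sum]
  have e : (∑ x, (Matrix.of fun x' y' => M (x, x') (b, y')) * (Matrix.of fun x' y' => M' (k, x') (x, y'))) =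
      if k = b then (1 : Matrix (Fin N) (Fin N) S) else 0 := by
    ext x' y'
    have h2 := congrFun (congrFun h (b, x')) (k, y')
    rw [Matrix.mul_apply, Fintype.sum_prod_type] at h2
    rw [Matrix.sum_apply]
    simp only [Matrix.mul_apply, Matrix.of_apply]
    refine h2.trans ?_
    rw [Matrix.one_apply]
    by_cases hkb : k = b
    · subst hkb
      rw [if_pos rfl, Matrix.one_apply]
      simp
    · rw [if_neg hkb, if_neg (by simpa using fun h => absurd h.symm hkb)]
      rfl
  rw [e]
  split_ifs
  · exact oneLeg_one j
  · exact oneLeg_zero j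

theorem innerLeg_comm {j j' : Fin m} (h : j ≠ j') (M M' : Matrix (Fin N × Fin N) (Fin N × Fin N) S)
    (x y z w : Fin N) : Commute (innerLeg j M x y) (innerLeg j' M' z w) := oneLeg_comm h _ _

/-- Crossing symmetry for products of operators in all pairs of tensor factors. -/
theorem crossed_blocks (F F' : Fin n → Fin m → Matrix (Fin N × Fin N) (Fin N × Fin N) S)
    (h : ∀ i j, transposeFirst (F i j) * transposeFirst (F' i j) = 1) :
    Crossed (blocks (List.ofFn fun i => (List.ofFn fun j =>
        twoLeg (Sum.inl i) (Sum.inr j) (F i j)).reverse.prod).prod)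
      (blocks (List.ofFn fun i => (List.ofFn fun j =>
        twoLeg (Sum.inl i) (Sum.inr j) (F' i j)).prod).reverse.prod) := by
  have hone : ∀ (i : Fin n) (l : List (Matrix (Fin N) (Fin N) (Matrix (Fin m → Fin N) (Fin m → Fin N) S))),
      (l.map (oneLeg i)).prod = oneLeg i l.prod := by
    intro i l
    induction l with
    | nil => exact (oneLeg_one i).symm
    | cons x l ih => rw [List.map_cons, List.prod_cons, ih, oneLeg_mul, List.prod_cons]
  -- Each row is an operator on the i-th factor of the first group whose entries act on the second
  -- group, so rows multiply like operators on distinct factors.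
  have e1 : ∀ i, blocks (List.ofFn fun j => twoLeg (Sum.inl i) (Sum.inr j) (F i j)).reverse.prod =
      oneLeg i ((List.finRange m).reverse.map fun j => innerLeg j (F i j)).prod := by
    intro i
    rw [ofFn_reverse_prod, map_list_prod, List.map_map, ← hone, List.map_map]
    congr 2
    funext j
    exact blocks_twoLeg i j _
  have e2 : ∀ i, blocks (List.ofFn fun j => twoLeg (Sum.inl i) (Sum.inr j) (F' i j)).prod =
      oneLeg i ((List.finRange m).reverse.reverse.map fun j => innerLeg j (F' i j)).prod := by
    intro i
    rw [List.reverse_reverse, List.ofFn_eq_map, map_list_prod, List.map_map, ← hone, List.map_map]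
    congr 2
    funext j
    exact blocks_twoLeg i j _
  intro k b
  rw [← crossed_ofFn _ _ (fun i => crossed_list_prod (fun j => innerLeg j (F i j))
    (fun j => innerLeg j (F' i j)) (List.finRange m).reverse (List.nodup_reverse.mpr (List.nodup_finRange m))
    (fun j => crossed_innerLeg j (h i j)) (fun _ _ hij => innerLeg_comm hij _ _)
    (fun _ _ hij => innerLeg_comm hij _ _)) k b]
  refine Finset.sum_congr rfl fun x _ => ?_
  congr 1
  · rw [map_list_prod, List.map_ofFn, ← prod_oneLeg_apply]
    exact congrArg (fun f : Fin n → Matrix (Fin n → Fin N) (Fin n → Fin N)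
      (Matrix (Fin m → Fin N) (Fin m → Fin N) S) => (List.ofFn f).prod x b) (funext e1)
  · rw [ofFn_reverse_prod, map_list_prod, List.map_map]
    have := list_prod_oneLeg (fun i => ((List.finRange m).reverse.reverse.map fun j => innerLeg j (F' i j)).prod)
      (List.finRange n).reverse (List.nodup_reverse.mpr (List.nodup_finRange n)) k x
    rw [if_pos (by simp)] at this
    rw [ofFn_reverse_prod, ← this]
    exact congrArg (fun f : Fin n → Matrix (Fin n → Fin N) (Fin n → Fin N)
      (Matrix (Fin m → Fin N) (Fin m → Fin N) S) => (List.map f (List.finRange n).reverse).prod k x) (funext e2)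

end Blocks


/-! ### The inverse of `R̄_nm` -/

section RnmInverse

variable {g : ClassicalType} {N n m : ℕ}

theorem list_prod_map_mul_reverse {M ι : Type} [Ring M] (A B : ι → M) (l : List ι)
    (h : ∀ i, A i * B i = 1) : (l.map A).prod * (l.reverse.map B).prod = 1 := by
  induction l with
  | nil => simp
  | cons x l ih =>
    rw [List.map_cons, List.prod_cons, List.reverse_cons, List.map_append, List.map_singleton,
      List.prod_append, List.prod_singleton, mul_assoc, ← mul_assoc (l.map A).prod, ih, one_mul, h]

theorem constantCoeff_specInv (a : ℂ) (i : Fin n) (j : Fin m) :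
    MvPowerSeries.constantCoeff (specInv n m a i j) = 0 := constantCoeff_invSum (by simp) _

/-- The inverse of `R̄_nm`. -/
noncomputable def RnmInv (g : ClassicalType) (N n m : ℕ) (a : ℂ) :
    Matrix (Idx N n m) (Idx N n m) (MvPowerSeries (Vars n m) Kh) :=
  (List.ofFn fun i : Fin n => (List.ofFn fun j : Fin m =>
    twoLeg (Sum.inl i) (Sum.inr j) (Rbar g N (-specInv n m a i j))).prod).reverse.prod

theorem Rnm_mul_RnmInv (hN : Admissible g N) (a : ℂ) : Rnm g N n m a * RnmInv g N n m a = 1 := by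
  rw [Rnm, RnmInv, ofFn_reverse_prod, List.ofFn_eq_map]
  refine list_prod_map_mul_reverse _ _ _ fun i => ?_
  rw [ofFn_reverse_prod, List.ofFn_eq_map]
  have := list_prod_map_mul_reverse (fun j => twoLeg (Sum.inl i) (Sum.inr j) (Rbar g N (specInv n m a i j)))
    (fun j => twoLeg (Sum.inl i) (Sum.inr j) (Rbar g N (-specInv n m a i j))) (List.finRange m).reverse
    (fun j => by
      rw [twoLeg_mul (by simp), Rbar_mul_Rbar_neg hN (constantCoeff_specInv a i j), twoLeg_one])
  rw [List.reverse_reverse] at this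
  exact this

theorem Rnm_inv (hN : Admissible g N) (a : ℂ) : (Rnm g N n m a)⁻¹ = RnmInv g N n m a :=
  Matrix.inv_eq_right_inv (Rnm_mul_RnmInv hN a)

/-- Through this relation alone the value of the critical level enters the proof. It is the crossing
symmetry of one factor, with spectral parameters z + u_i - v_j and z + u_i - v_j + hεc, multiplied
over all i and j. -/
theorem crossed_Rnm (hN : Admissible g N) :
    Crossed (blocks (Rnm g N n m 0)) (blocks (RnmInv g N n m (epsilon g * critLevel g N))) := by
  refine crossed_blocks (fun i j => Rbar g N (specInv n m 0 i j))
    (fun i j => Rbar g N (-specInv n m (epsilon g * critLevel g N) i j)) fun i j => ?_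
  refine transposeFirst_Rbar_mul hN (constantCoeff_specInv _ i j) (constantCoeff_specInv _ i j) ?_
  have h1 := invSum_mul (s := (MvPowerSeries.X none : MvPowerSeries (Vars n m) Kh)) (by simp)
    (MvPowerSeries.X (some (Sum.inl i)) - MvPowerSeries.X (some (Sum.inr j)) + hSc _ 0)
  have h2 := invSum_mul (s := (MvPowerSeries.X none : MvPowerSeries (Vars n m) Kh)) (by simp)
    (MvPowerSeries.X (some (Sum.inl i)) - MvPowerSeries.X (some (Sum.inr j)) +
      hSc _ (epsilon g * critLevel g N))
  have hu := isUnit_one_add_mul (s := (MvPowerSeries.X none : MvPowerSeries (Vars n m) Kh)) (by simp)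
    (MvPowerSeries.X (some (Sum.inl i)) - MvPowerSeries.X (some (Sum.inr j)) + hSc _ 0)
  have hu' := isUnit_one_add_mul (s := (MvPowerSeries.X none : MvPowerSeries (Vars n m) Kh)) (by simp)
    (MvPowerSeries.X (some (Sum.inl i)) - MvPowerSeries.X (some (Sum.inr j)) +
      hSc _ (epsilon g * critLevel g N))
  rw [hSc_eq, map_zero, zero_mul] at h1 hu
  rw [hSc_eq] at h2 hu'
  rw [specInv, specInv, hSc_eq, hSc_eq, map_zero, zero_mul]
  rw [← hu.mul_left_inj, ← hu'.mul_left_inj]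
  -- Only the equations expressing p and q as inverses of the two spectral parameters matter from
  -- here on.
  generalize invSum _ _ = p at h1 h2 ⊢
  generalize invSum _ _ = q at h1 h2 ⊢
  generalize (MvPowerSeries.X (some (Sum.inl i)) - MvPowerSeries.X (some (Sum.inr j)) :
    MvPowerSeries (Vars n m) Kh) = y at h1 h2 ⊢
  generalize (MvPowerSeries.X none : MvPowerSeries (Vars n m) Kh) = x at h1 h2 ⊢
  generalize algebraMap ℂ (MvPowerSeries (Vars n m) Kh) (epsilon g * critLevel g N) = α at h2 ⊢
  generalize hS (Vars n m) = t at h2 ⊢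
  linear_combination (1 + x * (y + 0) + α * t * x) * h2 +
    (α * t * q * (1 + x * (y + α * t)) - (1 + x * (y + α * t))) * h1

end RnmInverse


/-! ### Absorption of the idempotents by `R̄_nm` -/

section FusedIdempotents

variable {g : ClassicalType} {N n m : ℕ} {S : Type} [CommRing S] [Algebra ℂ S]

theorem IsFusedAll.map {k : ℕ} {M : Type} [Ring M] [Algebra ℂ M]
    (φ : Matrix (Fin k → Fin N) (Fin k → Fin N) ℂ →ₐ[ℂ] M) {Y}
    (hY : IsFusedAll (AlgHom.id ℂ (Matrix (Fin k → Fin N) (Fin k → Fin N) ℂ)) g Y) :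
    IsFusedAll φ g (φ Y) := by
  intro l hl
  obtain ⟨h1, h2⟩ := hY l hl
  refine ⟨?_, ?_⟩
  · rw [← map_mul, ← map_smul]
    exact congrArg φ h1
  · rw [← map_mul]
    exact (congrArg φ h2).trans (map_zero φ)

theorem fusionIdem_mul_self (hN : Admissible g N) (hn : n ≤ maxFusion g N) :
    fusionIdem g N n * fusionIdem g N n = fusionIdem g N n :=
  (fusionIdem_isFusedAll hN hn).mul_fusionIdem hN hn

theorem onRight_mul_Rnm (hN : Admissible g N) (hm : m ≤ maxFusion g N) (a : ℂ)
    (Ψ : MvPowerSeries (Vars n m) Kh →ₐ[ℂ] S)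
    (hΨ : ∀ (k : ℕ) (hk : k + 1 < m), Ψ (MvPowerSeries.X (some (.inr ⟨k + 1, hk⟩))) =
      Ψ (MvPowerSeries.X (some (.inr ⟨k, by omega⟩))) + theta g * Ψ (hS _)) :
    onRight N n m S (fusionIdem g N m) * (Rnm g N n m a).map Ψ = onRight N n m S (fusionIdem g N m) *
      (Rnm g N n m a).map Ψ * onRight N n m S (fusionIdem g N m) :=
  ((isFusedAll_mul_Rnm_right hN a Ψ hΨ
    ((fusionIdem_isFusedAll hN hm).map (onRight N n m S))).mul_fusionIdem hN hm).symm

theorem onLeft_mul_Rnm (hN : Admissible g N) (hn : n ≤ maxFusion g N) (a : ℂ)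
    (Ψ : MvPowerSeries (Vars n m) Kh →ₐ[ℂ] S)
    (hΨ : ∀ (k : ℕ) (hk : k + 1 < n), Ψ (MvPowerSeries.X (some (.inl ⟨k + 1, hk⟩))) =
      Ψ (MvPowerSeries.X (some (.inl ⟨k, by omega⟩))) + theta g * Ψ (hS _)) :
    onLeft N n m S (fusionIdem g N n) * (Rnm g N n m a).map Ψ = onLeft N n m S (fusionIdem g N n) *
      (Rnm g N n m a).map Ψ * onLeft N n m S (fusionIdem g N n) :=
  ((isFusedAll_mul_Rnm_left hN a Ψ hΨ
    ((fusionIdem_isFusedAll hN hn).map (onLeft N n m S))).mul_fusionIdem hN hn).symm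

theorem onRight_idem (hN : Admissible g N) (hm : m ≤ maxFusion g N) :
    onRight N n m S (fusionIdem g N m) * onRight N n m S (fusionIdem g N m) =
      onRight N n m S (fusionIdem g N m) := by rw [← map_mul, fusionIdem_mul_self hN hm]

theorem onLeft_idem (hN : Admissible g N) (hn : n ≤ maxFusion g N) :
    onLeft N n m S (fusionIdem g N n) * onLeft N n m S (fusionIdem g N n) =
      onLeft N n m S (fusionIdem g N n) := by rw [← map_mul, fusionIdem_mul_self hN hn]

/-- A product of two commuting operators which are absorbed on the right is absorbed. -/
theorem mul_absorb {M : Type} [Ring M] {E F X : M} (hEF : E * F = F * E) (hE : E * X = E * X * E)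
    (hF : F * X = F * X * F) : E * F * X = E * F * X * (E * F) := by
  have h1 : E * F * X = E * F * X * F := by rw [mul_assoc E, mul_assoc E, ← hF]
  have h2 : E * F * X = E * F * X * E := by
    rw [hEF, mul_assoc F, mul_assoc F, ← hE]
  rw [← mul_assoc, ← h2, ← h1]

theorem Rnm_map_mul_RnmInv_map (hN : Admissible g N) (a : ℂ)
    (Ψ : MvPowerSeries (Vars n m) Kh →ₐ[ℂ] S) :
    (Rnm g N n m a).map Ψ * (RnmInv g N n m a).map Ψ = 1 := by
  have h := congrArg (Ψ : MvPowerSeries (Vars n m) Kh →+* S).mapMatrix (Rnm_mul_RnmInv (n := n) (m := m) hN a)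
  rw [map_mul, map_one] at h
  exact h

end FusedIdempotents

/-! ### Invariance of the fused generators under `σ` -/

section SigmaFused

variable {g : ClassicalType} {N n m : ℕ} {c : ℂ} {α A : Type} [Fintype α] [DecidableEq α] [CommRing A]
  [Algebra Kh A] [Algebra ℂ A] [IsScalarTower ℂ Kh A]

/-- Specialization is a ring homomorphism, so the defining identity of σ becomes a genuine
conjugation of matrices over a commutative ring. -/
theorem tSpec_sigma (hN : Admissible g N) {σ : VV g N c →ₗ[Kh] ZSeries (VV g N c)} (hσ : IsSigma g N c σ)
    (j : VV g N c →ₗ[Kh] A) {K : ℕ} (hK : algebraMap Kh A hh ^ K = 0) (π : Fin n → α) (s : Fin n → ℂ)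
    (s' : Fin m → ℂ) : tSpec π s s' (zForm σ j) =
      (Rnm g N n m 0).map (specScalar hK π s s') * tSpec π s s' (constForm j) *
        (RnmInv g N n m 0).map (specScalar hK π s s') := by
  ext1 a b
  rw [tSpec, Matrix.of_apply, ← specHom_apply hK, tSeries_of_isSigma hσ j a b, map_sum, Rnm_inv hN,
    Finset.sum_congr rfl fun a' _ => map_sum (specHom hK π s s') _ _]
  rw [Matrix.mul_apply, Finset.sum_comm]
  refine Finset.sum_congr rfl fun b' _ => ?_
  rw [Matrix.mul_apply, Finset.sum_mul]
  refine Finset.sum_congr rfl fun a' _ => ?_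
  rw [map_mul, ← specScalar_apply, map_mul, Matrix.map_apply, Matrix.map_apply, tSpec, Matrix.of_apply,
    specHom_apply]
  ring

/-- The product of the two idempotents absorbs, on the right, both R̄_nm and the matrix of
generators. Conjugation is thus block triangular and preserves the trace. The level is arbitrary. -/
theorem sigma_fused (hN : Admissible g N) {σ : VV g N c →ₗ[Kh] ZSeries (VV g N c)}
    (hσ : IsSigma g N c σ) (hn : n ≤ maxFusion g N) (hm : m ≤ maxFusion g N) (r s : ℕ) :
    σ (tens (fusedGen g N c n r) (fusedGen g N c m s)) =
      ZSeries.const (tens (fusedGen g N c n r) (fusedGen g N c m s)) := by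
  refine eq_const_of_forms fun A _ _ K hK j z => ?_
  let _ : Algebra ℂ A := Algebra.compHom A (algebraMap ℂ Kh)
  have _ : IsScalarTower ℂ Kh A := IsScalarTower.of_algebraMap_eq fun _ => rfl
  let Ψ := specScalar (α := Unit) hK (fun _ : Fin n => ()) (fusionShift g) (fusionShift g : Fin m → ℂ)
  have hE := onLeft_comm_onRight (n := n) (m := m)
    (S := MvPowerSeries (Option (Unit ⊕ Unit)) A) (fusionIdem g N n) (fusionIdem g N m)
  have hT := fun (B : ℕ → Vac g N c →ₗ[Kh] Vac g N c →ₗ[Kh] A) =>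
    coeff_tSpec_const hK (fusionShift g : Fin n → ℂ) (fusionShift g : Fin m → ℂ) B
  have key := trace_block_conj
    (E := onLeft N n m (MvPowerSeries (Option (Unit ⊕ Unit)) A) (fusionIdem g N n) *
      onRight N n m _ (fusionIdem g N m))
    (R := (Rnm g N n m 0).map Ψ) (R' := (RnmInv g N n m 0).map Ψ)
    (t := tSpec (fun _ => ()) (fusionShift g) (fusionShift g) (constForm j))
    (by rw [mul_assoc, ← mul_assoc (onRight _ _ _ _ _), ← hE, mul_assoc, onRight_idem hN hm, ← mul_assoc,
      onLeft_idem hN hn])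
    (mul_absorb hE (onLeft_mul_Rnm hN hn 0 Ψ (specScalar_X_left hK _))
      (onRight_mul_Rnm hN hm 0 Ψ (specScalar_X_right hK _ _)))
    (Rnm_map_mul_RnmInv_map hN 0 Ψ)
    (mul_absorb hE (onLeft_mul_fused hN hn (constForm j)
      (fun a b r => tVecShift g N c (fusionShift g) a b r) _ (hT _)).symm
      (onRight_mul_fused hN hm (constForm j) (fun a b r => tVecShift g N c (fusionShift g) a b (r ())) _
        (hT _)).symm)
  rw [← tSpec_sigma hN hσ j hK] at key
  -- The exponent picks out the power z of z⁻¹ and the coefficients of u^r and v^s.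
  have h := congrArg (MvPowerSeries.coeff (Finsupp.equivFunOnFinite.symm fun v => match v with
    | none => z
    | some (.inl _) => r
    | some (.inr _) => s)) key
  rw [coeff_trace_fused (zForm σ j) _ (hT _), coeff_trace_fused (constForm j) _ (hT _)] at h
  exact h

end SigmaFused


/-! ### Partial traces over the second group -/

section PartialTrace

variable {N n m : ℕ} {S : Type} [CommRing S]

theorem blocks_onRight [Algebra ℂ S] (X : Matrix (Fin m → Fin N) (Fin m → Fin N) ℂ) :
    blocks (onRight N n m S X) = Matrix.diagonal fun _ => X.map (algebraMap ℂ S) := by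
  ext a b x y
  rw [blocks_apply, onRight_apply]
  by_cases h : a = b
  · subst h
    rw [Matrix.diagonal_apply_eq]
    exact if_pos rfl
  · rw [Matrix.diagonal_apply_ne _ h]
    exact if_neg fun h' => h h'

theorem blocks_absorb [Algebra ℂ S] {X : Matrix (Fin m → Fin N) (Fin m → Fin N) ℂ}
    {R : Matrix (Idx N n m) (Idx N n m) S}
    (h : onRight N n m S X * R = onRight N n m S X * R * onRight N n m S X) (a b : Fin n → Fin N) :
    X.map (algebraMap ℂ S) * blocks R a b =
      X.map (algebraMap ℂ S) * blocks R a b * X.map (algebraMap ℂ S) := by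
  have h' := congrFun (congrFun (congrArg blocks h) a) b
  rwa [map_mul, map_mul, map_mul, blocks_onRight, Matrix.mul_diagonal, Matrix.diagonal_mul] at h'

/-- All three matrices may be replaced by their corners E·E, and the trace is cyclic there. -/
theorem trace_mul_mul_of_absorb {κ : Type} [Fintype κ] [DecidableEq κ] {E X t Y : Matrix κ κ S}
    (hE : E * E = E) (hX : E * X = E * X * E) (ht : E * t = E * t * E) (hY : E * Y = E * Y * E) :
    (E * (X * t * Y)).trace = (E * t * (Y * X)).trace := by
  have hE' : ∀ Z, E * (E * Z) = E * Z := fun Z => by rw [← mul_assoc, hE]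
  have absorb : ∀ {W}, E * W = E * W * E → E * (W * E) = E * W ∧ ∀ Z, E * (W * (E * Z)) = E * (W * Z) :=
    fun {W} h => ⟨by rw [← mul_assoc, ← h], fun Z => by
      rw [← mul_assoc W, ← mul_assoc E, ← mul_assoc E W E, ← h, mul_assoc]⟩
  obtain ⟨hX1, hX2⟩ := absorb hX
  obtain ⟨ht1, ht2⟩ := absorb ht
  obtain ⟨hY1, hY2⟩ := absorb hY
  have h1 : E * (X * t * Y) = (E * X * E) * (E * t * E * Y * E) := by
    simp only [mul_assoc, hE']
    rw [hY1, ht2, hX2]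
  have h2 : (E * t * E * Y * E) * (E * X * E) = E * t * (Y * X) := by
    simp only [mul_assoc, hE']
    rw [hX1, hY2, ht2]
  rw [h1, Matrix.trace_mul_comm, h2]

/-- Conjugation by crossed block matrices preserves the partial trace over a fused subspace. -/
theorem trace_sum_crossed {κ ν : Type} [Fintype κ] [DecidableEq κ] [Fintype ν] [DecidableEq ν]
    {E : Matrix κ κ S} (hE : E * E = E) {L L' t : Matrix ν ν (Matrix κ κ S)} (hL : ∀ a b, E * L a b = E * L a b * E)
    (hL' : ∀ a b, E * L' a b = E * L' a b * E) (ht : ∀ a b, E * t a b = E * t a b * E)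
    (hc : Crossed L L') (a b : ν) :
    (E * ∑ k, ∑ k', L' k k' * t a k * L k' b).trace = (E * t a b).trace := by
  simp only [Finset.mul_sum, Matrix.trace_sum, trace_mul_mul_of_absorb hE (hL' _ _) (ht _ _) (hL _ _)]
  -- After the rotation L stands to the left of L', and the sum over k' is the crossing relation,
  -- which leaves only k = b.
  simp only [← Matrix.trace_sum, ← Finset.mul_sum, hc _ b]
  congr 1
  rw [Finset.sum_eq_single b]
  · rw [if_pos rfl, mul_one]
  · intro k _ hk
    rw [if_neg hk, mul_zero]
  · simp

end PartialTrace

section RightTrace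

variable {g : ClassicalType} {N n m : ℕ} {c : ℂ} {A : Type} [CommRing A]
  [Algebra Kh A] [Algebra ℂ A] [IsScalarTower ℂ Kh A]

theorem coeff_rightTrace_fused (B : ℕ → Vac g N c →ₗ[Kh] Vac g N c →ₗ[Kh] A)
    (T : Matrix (Idx N n m) (Idx N n m) (MvPowerSeries (Option (Fin n ⊕ Unit)) A))
    (hT : ∀ a b e, MvPowerSeries.coeff e (T a b) = B (e none)
      (tVec g N c (a ∘ Sum.inl) (b ∘ Sum.inl) fun i => e (some (.inl i)))
      (tVecShift g N c (fusionShift g) (a ∘ Sum.inr) (b ∘ Sum.inr) (e (some (.inr ())))))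
    (a b : Fin n → Fin N) (e : Option (Fin n ⊕ Unit) →₀ ℕ) :
    MvPowerSeries.coeff e (((fusionIdem g N m).map (algebraMap ℂ _)) * blocks T a b).trace =
      B (e none) (tVec g N c a b fun i => e (some (.inl i)))
        (fusedGen g N c m (e (some (.inr ())))) := by
  rw [fusedGen_eq, Matrix.trace, map_sum, map_sum]
  refine Finset.sum_congr rfl fun y _ => ?_
  rw [Matrix.diag_apply, Matrix.mul_apply, map_sum, map_sum]
  refine Finset.sum_congr rfl fun x _ => ?_
  rw [Matrix.map_apply, coeff_algebraMap_mul, blocks_apply, hT, map_smul, Algebra.smul_def]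
  rfl

/-- An identity for the partial trace over the fused subspace of the second group. -/
theorem form_eq_of_rightTrace {K : ℕ} (hK : algebraMap Kh A hh ^ K = 0)
    {B B' : ℕ → Vac g N c →ₗ[Kh] Vac g N c →ₗ[Kh] A} {a b : Fin n → Fin N}
    (h : (((fusionIdem g N m).map (algebraMap ℂ _)) *
        blocks (tSpec id 0 (fusionShift g) B) a b).trace =
      (((fusionIdem g N m).map (algebraMap ℂ _)) *
        blocks (tSpec id 0 (fusionShift g) B') a b).trace) (d : Fin n → ℕ) (r z : ℕ) :
    B z (tVec g N c a b d) (fusedGen g N c m r) = B' z (tVec g N c a b d) (fusedGen g N c m r) := by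
  have h' := congrArg (MvPowerSeries.coeff (Finsupp.equivFunOnFinite.symm fun v => match v with
    | none => z
    | some (.inl i) => d i
    | some (.inr _) => r)) h
  rw [coeff_rightTrace_fused B _ (coeff_tSpec_id hK _ B),
    coeff_rightTrace_fused B' _ (coeff_tSpec_id hK _ B')] at h'
  exact h'

end RightTrace

/-! ### Invariance under `ρ` when only the second factor is fused -/

section RhoFused

variable {g : ClassicalType} {N n m : ℕ} {c : ℂ}

theorem tSpec_rho {α A : Type} [Fintype α] [DecidableEq α] [CommRing A]
    [Algebra Kh A] [Algebra ℂ A] [IsScalarTower ℂ Kh A]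
    (hN : Admissible g N) {ρ : VV g N c →ₗ[Kh] ZSeries (VV g N c)} (hρ : IsRho g N c ρ)
    (j : VV g N c →ₗ[Kh] A) {K : ℕ} (hK : algebraMap Kh A hh ^ K = 0) (π : Fin n → α) (s : Fin n → ℂ)
    (s' : Fin m → ℂ) (a b : Fin n → Fin N) : blocks (tSpec π s s' (zForm ρ j)) a b =
      ∑ k, ∑ k', blocks ((RnmInv g N n m (epsilon g * c)).map (specScalar hK π s s')) k k' *
        blocks (tSpec π s s' (constForm j)) a k *
          blocks ((Rnm g N n m 0).map (specScalar hK π s s')) k' b := by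
  ext1 x y
  rw [blocks_apply, tSpec, Matrix.of_apply, ← specHom_apply hK, tSeries_of_isRho hρ j, map_sum, Rnm_inv hN,
    Matrix.sum_apply]
  refine Finset.sum_congr rfl fun k _ => ?_
  rw [map_sum, Matrix.sum_apply]
  refine Finset.sum_congr rfl fun k' _ => ?_
  rw [Matrix.mul_apply, map_sum, Finset.sum_congr rfl fun l _ => map_sum (specHom hK π s s') _ _,
    Finset.sum_comm]
  refine Finset.sum_congr rfl fun l' _ => ?_
  rw [Matrix.mul_apply, Finset.sum_mul]
  refine Finset.sum_congr rfl fun l _ => ?_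
  rw [map_mul, ← specScalar_apply, map_mul, blocks_apply, blocks_apply, blocks_apply, Matrix.map_apply,
    Matrix.map_apply, tSpec, Matrix.of_apply, specHom_apply, Sum.elim_comp_inl, Sum.elim_comp_inr]
  ring

theorem Crossed.map_blocks {S S' : Type} [CommRing S] [CommRing S'] (f : S →+* S')
    {R R' : Matrix (Idx N n m) (Idx N n m) S} (h : Crossed (blocks R) (blocks R')) :
    Crossed (blocks (R.map f)) (blocks (R'.map f)) := by
  intro k b
  have h1 := congrArg f.mapMatrix (h k b)
  rw [map_sum] at h1
  refine Eq.trans (Finset.sum_congr rfl fun x _ => ?_) (h1.trans ?_)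
  · exact (map_mul f.mapMatrix _ _).symm
  · split_ifs
    · exact map_one _
    · exact map_zero _

/-- The inverse of the corner is the corner of the inverse, and this forces R' to be triangular as
well. -/
theorem absorb_inverse {κ S : Type} [Fintype κ] [DecidableEq κ] [CommRing S] {E R R' : Matrix κ κ S}
    (hE : E * E = E) (hR : E * R = E * R * E) (hRR : R * R' = 1) : E * R' = E * R' * E := by
  have h := corner_inverse hE hR hRR
  have h1 : E * R * R' = E := by rw [mul_assoc, hRR, mul_one]
  calc E * R' = (E * R' * E) * (E * R * E) * R' := by rw [h]
    _ = (E * R' * E) * E := by rw [← hR, mul_assoc (E * R' * E), h1]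
    _ = _ := by rw [mul_assoc (E * R'), hE]

theorem idem_map {S : Type} [CommRing S] [Algebra ℂ S] (hN : Admissible g N) (hm : m ≤ maxFusion g N) :
    (fusionIdem g N m).map (algebraMap ℂ S) * (fusionIdem g N m).map (algebraMap ℂ S) =
      (fusionIdem g N m).map (algebraMap ℂ S) := by
  rw [← Matrix.map_mul, fusionIdem_mul_self hN hm]

/-- The variables u_i remain independent and no trace is taken over the first group. The R-matrices
on the two sides of T_[m]⁺(v) cancel by crossing under the trace over the second group alone, which
leaves the first tensor factor arbitrary. -/
theorem rho_tVec_fused (hN : Admissible g N)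
    {ρ : VV g N (critLevel g N) →ₗ[Kh] ZSeries (VV g N (critLevel g N))}
    (hρ : IsRho g N (critLevel g N) ρ) (hm : m ≤ maxFusion g N) (a b : Fin n → Fin N) (d : Fin n → ℕ)
    (r : ℕ) : ρ (tens (tVec g N _ a b d) (fusedGen g N _ m r)) =
      ZSeries.const (tens (tVec g N _ a b d) (fusedGen g N _ m r)) := by
  refine eq_const_of_forms fun A _ _ K hK j z => ?_
  let _ : Algebra ℂ A := Algebra.compHom A (algebraMap ℂ Kh)
  have _ : IsScalarTower ℂ Kh A := IsScalarTower.of_algebraMap_eq fun _ => rfl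
  refine form_eq_of_rightTrace hK ?_ d r z
  rw [tSpec_rho hN hρ j hK]
  have hΨ := specScalar_X_right (g := g) (m := m) hK (id : Fin n → Fin n) 0
  have hR := fun e => onRight_mul_Rnm hN hm e (specScalar hK (id : Fin n → Fin n) 0 (fusionShift g)) hΨ
  refine trace_sum_crossed (idem_map hN hm) (blocks_absorb (hR 0)) (blocks_absorb ?_) (blocks_absorb ?_)
    ((crossed_Rnm hN).map_blocks _) a b
  · exact absorb_inverse (onRight_idem hN hm) (hR _) (Rnm_map_mul_RnmInv_map hN _ _)
  · exact (onRight_mul_fused hN hm (constForm j) (fun a b d => tVec g N _ a b d) _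
      (coeff_tSpec_id hK _ _)).symm

end RhoFused


/-! ### `R̄_nN` on the top exterior power -/

section TopExterior

/-- Telescoping. If Z is the sum of the later P_j, then Y Z P₀ = -Y Z, and multiplication by 1 -
a₀P₀ changes the coefficient a₁ of Z into a₁(1 + a₀) = a₀, the coefficient of P₀. -/
theorem mul_ladder {M S : Type} [Ring M] [CommRing S] [Algebra S M] {n : ℕ} (P A : Fin (n + 1) → M)
    (a f : Fin (n + 1) → S) {Y : M} (hA : ∀ j, A j = f j • (1 - a j • P j))
    (hP : ∀ j k, j ≠ k → Y * (P j * P k) = -(Y * P j))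
    (ha : ∀ j : Fin n, a j.castSucc = a j.succ * (1 + a j.castSucc)) :
    Y * (List.ofFn A).reverse.prod = (∏ j, f j) • (Y * (1 - a 0 • ∑ j, P j)) := by
  induction n with
  | zero => simp [hA]
  | succ n ih =>
    rw [List.ofFn_succ, List.reverse_cons, List.prod_append, List.prod_singleton, ← mul_assoc,
      ih (fun j => P j.succ) (fun j => A j.succ) (fun j => a j.succ) (fun j => f j.succ)
        (fun j => hA _) (fun j k h => hP _ _ fun h' => h (Fin.succ_injective _ h')) (fun j => ha j.succ), hA 0,
      Fin.prod_univ_succ f, Fin.sum_univ_succ P]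
    have h0 := ha 0
    rw [Fin.castSucc_zero] at h0
    have h1 : Y * ((∑ j : Fin (n + 1), P j.succ) * P 0) = -(Y * ∑ j : Fin (n + 1), P j.succ) := by
      rw [Finset.sum_mul, Finset.mul_sum, Finset.mul_sum, ← Finset.sum_neg_distrib]
      exact Finset.sum_congr rfl fun j _ => hP _ _ (Fin.succ_ne_zero j)
    generalize (∑ j : Fin (n + 1), P j.succ) = Z at h1 ⊢
    have h2 : Y * (1 - a (Fin.succ 0) • Z) * (1 - a 0 • P 0) = Y * (1 - a 0 • (P 0 + Z)) := by
      simp only [mul_sub, sub_mul, mul_one, mul_smul_comm, smul_mul_assoc, mul_assoc, smul_sub, smul_add,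
        mul_add, h1]
      have h3 := congrArg (fun x : S => x • (Y * Z)) h0
      beta_reduce at h3
      linear_combination (norm := module) h3
    rw [smul_mul_assoc, mul_smul_comm, h2, smul_smul, mul_comm]

variable {N n : ℕ}

theorem fusionIdem_gl_swap (hN : 2 ≤ N) (hn : n ≤ N) {p q : Fin n} (h : p ≠ q) (a b : Fin n → Fin N) :
    fusionIdem .gl N n a (b ∘ Equiv.swap p q) = -fusionIdem .gl N n a b := by
  have h1 := congrFun (congrFun ((fusionIdem_isFusedAll (g := .gl) hN hn).mul_permMat (Equiv.swap p q)) a) b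
  rw [thetaChar_swap _ h] at h1
  rw [AlgHom.id_apply, mul_permMat_apply] at h1
  simpa [theta] using h1

theorem fusionIdem_gl_not_injective (hN : 2 ≤ N) (hn : n ≤ N) {a b : Fin n → Fin N} {p q : Fin n} (h : p ≠ q)
    (hb : b p = b q) : fusionIdem .gl N n a b = 0 := by
  have h1 := fusionIdem_gl_swap hN hn h a b
  have h2 : b ∘ Equiv.swap p q = b := by
    funext k
    rw [Function.comp_apply, Equiv.swap_apply_def]
    split_ifs with h3 h4
    · rw [h3, hb]
    · rw [h4, hb]
    · rfl
  rw [h2] at h1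
  exact self_eq_neg.mp h1

/-- Expansion in the top exterior power: `N + 1` vectors of `ℂ^N` are linearly dependent. -/
theorem sum_fusionIdem_update (hN : 2 ≤ N) {M : Type} [AddCommGroup M] [Module ℂ M] (F : Fin N → M)
    (a b : Fin N → Fin N) (x : Fin N) :
    ∑ j, fusionIdem .gl N N a (Function.update b j x) • F (b j) = fusionIdem .gl N N a b • F x := by
  by_cases hb : Function.Injective b
  · obtain ⟨j, rfl⟩ := (Finite.injective_iff_surjective.mp hb) x
    rw [Finset.sum_eq_single j]
    · rw [Function.update_eq_self]
    · intro k _ hk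
      rw [fusionIdem_gl_not_injective hN le_rfl hk, zero_smul]
      rw [Function.update_self, Function.update_of_ne hk.symm]
    · simp
  · rw [Function.not_injective_iff] at hb
    obtain ⟨p, q, hpq, hne⟩ := hb
    rw [fusionIdem_gl_not_injective hN le_rfl hne hpq, zero_smul]
    -- If b takes the same value at p and q, these two terms cancel by antisymmetry, and every other
    -- term still has the repeated index.
    rw [← Finset.add_sum_erase _ _ (Finset.mem_univ p), ← Finset.add_sum_erase _ _
      (Finset.mem_erase.mpr ⟨hne.symm, Finset.mem_univ q⟩), Finset.sum_eq_zero, add_zero, hpq, ← add_smul]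
    · have : Function.update b q x = Function.update b p x ∘ Equiv.swap p q := by
        funext k
        rw [Function.comp_apply, Equiv.swap_apply_def]
        split_ifs with h3 h4
        · rw [h3, Function.update_of_ne hne, Function.update_of_ne hne.symm, hpq]
        · rw [h4, Function.update_self, Function.update_self]
        · rw [Function.update_of_ne h4, Function.update_of_ne h3]
      rw [this, fusionIdem_gl_swap hN le_rfl hne, add_neg_cancel, zero_smul]
    · intro k hk
      simp only [Finset.mem_erase, Finset.mem_univ, and_true, ne_eq] at hk
      rw [fusionIdem_gl_not_injective hN le_rfl hne, zero_smul]
      rw [Function.update_of_ne (Ne.symm hk.2), Function.update_of_ne (Ne.symm hk.1), hpq]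

variable {m : ℕ} {S : Type} [CommRing S] [Algebra ℂ S]

/-- P_ij exchanges the index at place i of the first group with the one at place j of the second.
The sum over j is the expansion in `sum_fusionIdem_update`, for F a delta function in the index at
place i. -/
theorem onRight_mul_sum_Pleg (hN : 2 ≤ N) (i : Fin n) :
    onRight N n N S (fusionIdem .gl N N) * ∑ j, Pleg N S (Sum.inl i) (Sum.inr j) =
      onRight N n N S (fusionIdem .gl N N) := by
  ext a b
  rw [Finset.mul_sum, Matrix.sum_apply]
  have h := sum_fusionIdem_update hN
    (fun y => if a ∘ Sum.inl = Function.update (b ∘ Sum.inl) i y then (1 : S) else 0)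
    (a ∘ Sum.inr) (b ∘ Sum.inr) (b (Sum.inl i))
  have hb : Function.update (b ∘ Sum.inl) i (b (Sum.inl i)) = b ∘ Sum.inl := Function.update_eq_self i (b ∘ Sum.inl)
  rw [hb] at h
  have e : ∀ (x : ℂ) (p : Prop) [Decidable p], x • (if p then (1 : S) else 0) = if p then algebraMap ℂ S x else 0 := by
    intro x p _
    split_ifs
    · rw [Algebra.algebraMap_eq_smul_one]
    · rw [smul_zero]
  rw [e] at h
  refine Eq.trans (Finset.sum_congr rfl fun j _ => ?_) h
  rw [e, Pleg, twoLeg_Pmat (by simp), mul_permMat_apply, onRight_apply]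
  have h1 : (b ∘ Equiv.swap (Sum.inl i) (Sum.inr j)) ∘ Sum.inl =
      Function.update (b ∘ Sum.inl) i ((b ∘ Sum.inr) j) := by
    funext k
    by_cases hk : k = i
    · subst hk
      simp
    · rw [Function.update_of_ne hk, Function.comp_apply, Function.comp_apply,
        Equiv.swap_apply_of_ne_of_ne (by simpa using hk) (by simp)]
      rfl
  have h2 : (b ∘ Equiv.swap (Sum.inl i) (Sum.inr j)) ∘ Sum.inr =
      Function.update (b ∘ Sum.inr) j (b (Sum.inl i)) := by
    funext k
    by_cases hk : k = j
    · subst hk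
      simp
    · rw [Function.update_of_ne hk, Function.comp_apply, Function.comp_apply,
        Equiv.swap_apply_of_ne_of_ne (by simp) (by simpa using hk)]
      rfl
  rw [h1, h2]

/-- P_ij P_ik = P_jk P_ij, and the anti-symmetrizer turns P_jk into -1. -/
theorem onRight_mul_Pleg_mul_Pleg (hN : 2 ≤ N) (hm : m ≤ N) (i : Fin n) {j k : Fin m} (h : j ≠ k) :
    onRight N n m S (fusionIdem .gl N m) * (Pleg N S (Sum.inl i) (Sum.inr j) * Pleg N S (Sum.inl i) (Sum.inr k)) =
      -(onRight N n m S (fusionIdem .gl N m) * Pleg N S (Sum.inl i) (Sum.inr j)) := by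
  have h1 := ((fusionIdem_isFusedAll (g := .gl) hN hm).map (onRight N n m S)).mul_Pleg h
  rw [onRight_Pleg] at h1
  have h2 : Pleg N S (Sum.inl i) (Sum.inr j) * Pleg N S (Sum.inl i) (Sum.inr k) =
      Pleg N S (Sum.inr j) (Sum.inr k) * Pleg N S (Sum.inl i : Fin n ⊕ Fin m) (Sum.inr j) := by
    rw [Pleg, Pleg, Pleg, twoLeg_Pmat (by simp), twoLeg_Pmat (by simp), twoLeg_Pmat (by simpa using h), permMat_mul,
      permMat_mul,
      Equiv.mul_swap_eq_swap_mul (Equiv.swap (Sum.inl i) (Sum.inr j)) (Sum.inr j), Equiv.swap_apply_right,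
      Equiv.swap_apply_of_ne_of_ne (by simp) (by simpa using h.symm)]
  rw [h2, ← mul_assoc, h1]
  simp [theta]

/-- The spectral parameter grows by h from j to k, so the inverses of the two coefficients h/(z +
u_i - v + ah) differ by 1. -/
theorem specInv_ladder (Ψ : MvPowerSeries (Vars n m) Kh →ₐ[ℂ] S) (a : ℂ) (i : Fin n) {j k : Fin m}
    (h : Ψ (MvPowerSeries.X (some (.inr k))) = Ψ (MvPowerSeries.X (some (.inr j))) - Ψ (hS _)) :
    Ψ (hS _ * specInv n m a i j) = Ψ (hS _ * specInv n m a i k) * (1 + Ψ (hS _ * specInv n m a i j)) := by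
  have hx : MvPowerSeries.constantCoeff (MvPowerSeries.X none : MvPowerSeries (Vars n m) Kh) = 0 := by simp
  have h1 := fun y => congrArg Ψ (invSum_mul hx y)
  have hu := fun y => (isUnit_one_add_mul hx y).map Ψ
  simp only [map_mul, map_add, map_one] at h1 hu
  set y := MvPowerSeries.X (some (Sum.inl i)) - MvPowerSeries.X (some (Sum.inr j)) + hSc (Vars n m) a with hy
  set y' := MvPowerSeries.X (some (Sum.inl i)) - MvPowerSeries.X (some (Sum.inr k)) + hSc (Vars n m) a with hy'
  have hyy : Ψ y' = Ψ y + Ψ (hS _) := by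
    rw [hy, hy', map_add, map_add, map_sub, map_sub, h]
    ring
  have e1 := h1 y
  have e2 := h1 y'
  rw [map_mul, map_mul, specInv, specInv, ← hy, ← hy']
  rw [← (hu y).mul_left_inj, ← (hu y').mul_left_inj]
  rw [hyy] at e2 ⊢
  generalize Ψ (invSum _ _) = p at e1 ⊢
  generalize Ψ (invSum _ _) = q at e2 ⊢
  generalize Ψ (hS _) = t at e2 ⊢
  generalize Ψ y = w at e1 e2 ⊢
  generalize Ψ (MvPowerSeries.X none) = x at e1 e2 ⊢
  linear_combination (t * (1 + x * (w + t)) - t * q * (1 + x * (w + t)) * t) * e1 -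
    (t * (1 + x * w + t * x)) * e2

/-- `R̄_nN` acts on the top exterior power as a scalar. -/
theorem onRight_mul_Rnm_top (hN : 2 ≤ N) (a : ℂ) (Ψ : MvPowerSeries (Vars n N) Kh →ₐ[ℂ] S)
    (hΨ : ∀ (k : ℕ) (hk : k + 1 < N), Ψ (MvPowerSeries.X (some (.inr ⟨k + 1, hk⟩))) =
      Ψ (MvPowerSeries.X (some (.inr ⟨k, by omega⟩))) - Ψ (hS _)) :
    ∃ β : S, onRight N n N S (fusionIdem .gl N N) * (Rnm .gl N n N a).map Ψ =
      β • onRight N n N S (fusionIdem .gl N N) := by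
  have hrow : ∀ i : Fin n, ∃ β : S, onRight N n N S (fusionIdem .gl N N) *
      (List.ofFn fun j => Rleg (N := N) .gl a Ψ i j).reverse.prod =
        β • onRight N n N S (fusionIdem .gl N N) := by
    intro i
    have hsum := onRight_mul_sum_Pleg (S := S) hN i
    have hP := fun j k h => onRight_mul_Pleg_mul_Pleg (S := S) (m := N) hN le_rfl i (j := j) (k := k) h
    have hR : ∀ j, Rleg (N := N) .gl a Ψ i j =
        Ψ (PowerSeries.subst (hS _ * specInv n N a i j) (normSeries .gl N)) •
          (1 - Ψ (hS _ * specInv n N a i j) • Pleg N S (Sum.inl i) (Sum.inr j)) := by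
      intro j
      have hQ : Qleg .gl N S (Sum.inl i : Fin n ⊕ Fin N) (Sum.inr j) = 0 := twoLeg_zero _ _
      rw [Rleg, twoLeg_Rbar_map, hQ, smul_zero, add_zero]
    have ha := fun (k : ℕ) (hk : k + 1 < N) => specInv_ladder Ψ a i (hΨ k hk)
    generalize hE : onRight N n N S (fusionIdem .gl N N) = E at hsum hP ⊢
    generalize hA : (fun j => Rleg (N := N) .gl a Ψ i j) = A
    generalize hp : (fun j => Pleg N S (Sum.inl i : Fin n ⊕ Fin N) (Sum.inr j)) = P
    generalize hf : (fun j => Ψ (PowerSeries.subst (hS _ * specInv n N a i j) (normSeries .gl N))) = f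
    generalize hs : (fun j => Ψ (hS _ * specInv n N a i j)) = s
    have hR' : ∀ j, A j = f j • (1 - s j • P j) := by
      intro j
      rw [← hA, ← hp, ← hf, ← hs]
      exact hR j
    have hP' : ∀ j k, j ≠ k → E * (P j * P k) = -(E * P j) := by
      rw [← hp]
      exact hP
    have hsum' : E * ∑ j, P j = E := by
      rw [← hp]
      exact hsum
    have ha' : ∀ (k : ℕ) (hk : k + 1 < N), s ⟨k, by omega⟩ = s ⟨k + 1, hk⟩ * (1 + s ⟨k, by omega⟩) := by
      rw [← hs]
      exact ha
    clear hA hp hf hs ha hsum hP hR hΨ hE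
    -- The ladder needs a number of factors of the form k + 1, but N also occurs in the type of E.
    -- The number of factors is therefore made a separate variable.
    obtain ⟨k, hk⟩ : ∃ k, N = k + 1 := ⟨N - 1, by omega⟩
    have main : ∀ (N' : ℕ) (hN' : N' = k + 1) (A P : Fin N' → Matrix (Idx N n N) (Idx N n N) S) (f s : Fin N' → S)
        (_ : ∀ j, A j = f j • (1 - s j • P j)) (_ : ∀ j k, j ≠ k → E * (P j * P k) = -(E * P j))
        (_ : E * ∑ j, P j = E)
        (_ : ∀ (k : ℕ) (hk : k + 1 < N'), s ⟨k, by omega⟩ = s ⟨k + 1, hk⟩ * (1 + s ⟨k, by omega⟩)),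
        ∃ β : S, E * (List.ofFn A).reverse.prod = β • E := by
      rintro _ rfl A P f s hR hP hsum ha
      -- The telescoped product is E(1 - s₀ΣP_j), and E ΣP_j = E.
      refine ⟨(∏ j, f j) * (1 - s 0), ?_⟩
      rw [mul_ladder P A s f hR hP fun j => ha j (by omega), mul_sub, mul_one, mul_smul_comm, hsum, mul_smul, sub_smul,
        one_smul]
    exact main N hk A P f s hR' hP' hsum' ha'
  rw [Rnm_map, List.ofFn_eq_map]
  generalize List.finRange n = l
  induction l with
  | nil => exact ⟨1, by rw [List.map_nil, List.prod_nil, mul_one, one_smul]⟩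
  | cons i l ih =>
    obtain ⟨β, hβ⟩ := hrow i
    obtain ⟨γ, hγ⟩ := ih
    refine ⟨β * γ, ?_⟩
    rw [List.map_cons, List.prod_cons, ← mul_assoc, hβ, smul_mul_assoc, hγ, smul_smul]

end TopExterior

/-! ### Invariance of the top fused generator under `σ` -/

section SigmaTop

variable {N n : ℕ} {c : ℂ}

/-- From E R = βE it follows that E = βE R', so β cancels without being inverted. The equality holds
before any trace, hence for each block of the first group. -/
theorem mul_conj_of_scalar {κ S : Type} [Fintype κ] [DecidableEq κ] [CommRing S] {E R R' t : Matrix κ κ S} {β : S}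
    (hR : E * R = β • E) (hRR : R * R' = 1) (ht : E * t = E * t * E) : E * (R * t * R') = E * t := by
  have h1 : E = β • (E * R') := by rw [← smul_mul_assoc, ← hR, mul_assoc, hRR, mul_one]
  calc E * (R * t * R') = E * R * t * R' := by simp only [mul_assoc]
    _ = β • (E * t * R') := by rw [hR, smul_mul_assoc, smul_mul_assoc]
    _ = β • (E * t * E * R') := by rw [← ht]
    _ = E * t * (β • (E * R')) := by rw [mul_smul_comm, mul_assoc (E * t)]
    _ = E * t := by rw [← h1, ← ht]

theorem sigma_tVec_top (hN : 2 ≤ N) {σ : VV .gl N c →ₗ[Kh] ZSeries (VV .gl N c)}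
    (hσ : IsSigma .gl N c σ) (a b : Fin n → Fin N) (d : Fin n → ℕ) (r : ℕ) :
    σ (tens (tVec .gl N c a b d) (fusedGen .gl N c N r)) =
      ZSeries.const (tens (tVec .gl N c a b d) (fusedGen .gl N c N r)) := by
  refine eq_const_of_forms fun A _ _ K hK j z => ?_
  let _ : Algebra ℂ A := Algebra.compHom A (algebraMap ℂ Kh)
  have _ : IsScalarTower ℂ Kh A := IsScalarTower.of_algebraMap_eq fun _ => rfl
  refine form_eq_of_rightTrace hK ?_ d r z
  have hΨ := specScalar_X_right (g := .gl) (m := N) hK (id : Fin n → Fin n) 0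
  obtain ⟨β, hβ⟩ := onRight_mul_Rnm_top hN 0 (specScalar hK (id : Fin n → Fin n) 0 (fusionShift .gl))
    (fun k hk => by rw [hΨ k hk]; simp [theta, sub_eq_add_neg])
  have h := mul_conj_of_scalar hβ (Rnm_map_mul_RnmInv_map (g := .gl) hN 0 _)
    (onRight_mul_fused (g := .gl) hN le_rfl (constForm j) (fun a b d => tVec .gl N c a b d) _
      (coeff_tSpec_id hK _ _)).symm
  have h := (congrArg _ (tSpec_sigma (g := .gl) hN hσ j hK (id : Fin n → Fin n) 0 (fusionShift .gl))).trans h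
  have h' := congrFun (congrFun ((map_mul blocks _ _).symm.trans
    ((congrArg blocks h).trans (map_mul blocks _ _))) a) b
  rw [blocks_onRight, Matrix.diagonal_mul, Matrix.diagonal_mul] at h'
  exact congrArg Matrix.trace h'

end SigmaTop


/-! ### Closed submodules -/

section HClosure

variable {M M' : Type} [AddCommGroup M] [Module Kh M] [AddCommGroup M'] [Module Kh M']

/-- The smallest `h`-closed submodule containing a given set. -/
noncomputable def hClosure (s : Set M) : Submodule Kh M :=
  sInf {W | s ⊆ W ∧ IsHClosed (W : Set M)}

theorem subset_hClosure (s : Set M) : s ⊆ hClosure s := fun x hx => by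
  rw [SetLike.mem_coe, hClosure, Submodule.mem_sInf]
  exact fun W hW => hW.1 hx

theorem isHClosed_hClosure (s : Set M) : IsHClosed (hClosure s : Set M) := by
  constructor
  · intro x hx
    rw [SetLike.mem_coe, hClosure, Submodule.mem_sInf]
    intro W hW
    refine hW.2.1 x fun n => ?_
    obtain ⟨y, hy, z, hz⟩ := hx n
    rw [SetLike.mem_coe, hClosure, Submodule.mem_sInf] at hy
    exact ⟨y, hy W hW, z, hz⟩
  · intro x hx
    rw [SetLike.mem_coe, hClosure, Submodule.mem_sInf] at hx ⊢
    exact fun W hW => hW.2.2 x (hx W hW)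

theorem hClosure_le {s : Set M} {W : Submodule Kh M} (h : s ⊆ W) (hW : IsHClosed (W : Set M)) :
    hClosure s ≤ W := sInf_le ⟨h, hW⟩

theorem IsHClosed.comap {W : Submodule Kh M'} (hW : IsHClosed (W : Set M')) (f : M →ₗ[Kh] M') :
    IsHClosed (W.comap f : Set M) := by
  constructor
  · intro x hx
    refine hW.1 (f x) fun n => ?_
    obtain ⟨y, hy, z, rfl⟩ := hx n
    exact ⟨f y, hy, f z, by rw [map_add, map_smul]⟩
  · intro x hx
    refine hW.2 (f x) ?_
    rw [← map_smul]
    exact hx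

theorem isHClosed_bot (hs : ∀ x : M, (∀ K : ℕ, ∃ y, x = hh ^ K • y) → x = 0)
    (ht : ∀ x : M, hh • x = 0 → x = 0) : IsHClosed ((⊥ : Submodule Kh M) : Set M) := by
  constructor
  · intro x hx
    refine hs x fun n => ?_
    obtain ⟨y, hy, z, rfl⟩ := hx n
    rw [SetLike.mem_coe, Submodule.mem_bot] at hy
    exact ⟨z, by rw [hy, zero_add]⟩
  · exact fun x hx => ht x hx

end HClosure

/-! ### Torsion-freeness of the completed tensor square -/

section TorsionFree

variable {M : Type} [AddCommGroup M] [Module Kh M]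

theorem pow_torsionFree (hM : ∀ x : M, hh • x = 0 → x = 0) (n : ℕ) (x : M) (h : hh ^ n • x = 0) : x = 0 := by
  induction n with
  | zero => simpa using h
  | succ n ih => exact ih (hM _ (by rw [smul_smul, ← pow_succ']; exact h))

/-- Over the discrete valuation ring ℂ[[h]] every nonzero scalar is a unit times a power of h, and
torsion-free modules are flat. -/
theorem flat_of_torsionFree (hM : ∀ x : M, hh • x = 0 → x = 0) : Module.Flat Kh M := by
  rw [IsDedekindDomain.flat_iff_torsion_eq_bot, eq_bot_iff]
  rintro x ⟨⟨k, hk⟩, hkx⟩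
  have hk0 : k ≠ 0 := nonZeroDivisors.ne_zero hk
  obtain ⟨n, u, rfl⟩ := IsDiscreteValuationRing.eq_unit_mul_pow_irreducible hk0 PowerSeries.X_prime.irreducible
  refine pow_torsionFree hM n x ?_
  have hkx' : ((u : Kh) * hh ^ n) • x = 0 := hkx
  rw [mul_smul] at hkx'
  have h := congrArg (fun y => ((u⁻¹ : Khˣ) : Kh) • y) hkx'
  beta_reduce at h
  rwa [smul_smul, Units.inv_mul, one_smul, smul_zero] at h

/-- The tensor product of flat modules is flat, and flat modules have no torsion. -/
theorem tensor_torsionFree {M' : Type} [AddCommGroup M'] [Module Kh M'] (hM : ∀ x : M, hh • x = 0 → x = 0)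
    (hM' : ∀ x : M', hh • x = 0 → x = 0) (x : TensorProduct Kh M M') (h : hh • x = 0) : x = 0 := by
  have _ := flat_of_torsionFree hM
  have _ := flat_of_torsionFree hM'
  have h0 : (Submodule.torsion Kh (TensorProduct Kh M M')) = ⊥ :=
    IsDedekindDomain.flat_iff_torsion_eq_bot.mp inferInstance
  have : x ∈ Submodule.torsion Kh (TensorProduct Kh M M') :=
    ⟨⟨hh, mem_nonZeroDivisors_of_ne_zero PowerSeries.X_ne_zero⟩, h⟩
  rwa [h0] at this

/-- If hx = 0 and m represents x modulo h^(n+1), then hm lies in h^(n+1)M, so m lies in h^n M. The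
loss of one power of h is harmless in the limit. -/
theorem adicCompletion_torsionFree (hM : ∀ x : M, hh • x = 0 → x = 0) (x : AdicCompletion hIdeal M)
    (h : hh • x = 0) : x = 0 := by
  have hmem : ∀ (n : ℕ) (m : M), m ∈ hIdeal ^ n • (⊤ : Submodule Kh M) ↔ ∃ y, hh ^ n • y = m := by
    intro n m
    rw [Ideal.span_singleton_pow, Submodule.ideal_span_singleton_smul, Submodule.mem_smul_pointwise_iff_exists]
    simp
  refine AdicCompletion.ext fun n => ?_
  obtain ⟨m, hm⟩ := Submodule.Quotient.mk_surjective _ (AdicCompletion.eval hIdeal M (n + 1) x)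
  have h1 : AdicCompletion.eval hIdeal M (n + 1) (hh • x) = 0 := by rw [h, map_zero]
  rw [map_smul, ← hm, ← Submodule.Quotient.mk_smul, Submodule.Quotient.mk_eq_zero, hmem] at h1
  obtain ⟨y, hy⟩ := h1
  have h2 : hh ^ n • y = m := by
    rw [← sub_eq_zero]
    apply hM
    rw [smul_sub, smul_smul, ← pow_succ', hy, sub_self]
  have h3 := LinearMap.congr_fun (AdicCompletion.transitionMap_comp_eval hIdeal M (Nat.le_succ n)) x
  rw [LinearMap.comp_apply, ← hm] at h3
  refine h3.symm.trans ?_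
  refine (Submodule.Quotient.mk_eq_zero _).mpr ?_
  exact (hmem n m).mpr ⟨y, h2⟩

variable (g : ClassicalType) (N : ℕ) (c : ℂ)

theorem vacuumIdeal_isHClosed : IsHClosed (vacuumIdeal g N c : Set (DY g N c)) := by
  constructor
  · intro x hx
    rw [SetLike.mem_coe, vacuumIdeal, Submodule.mem_sInf]
    intro W hW
    refine hW.2.1 x fun n => ?_
    obtain ⟨y, hy, z, hz⟩ := hx n
    rw [SetLike.mem_coe, vacuumIdeal, Submodule.mem_sInf] at hy
    exact ⟨y, hy W hW, z, hz⟩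
  · intro x hx
    rw [SetLike.mem_coe, vacuumIdeal, Submodule.mem_sInf] at hx ⊢
    exact fun W hW => hW.2.2 x (hx W hW)

theorem Vac_torsionFree (x : Vac g N c) (h : hh • x = 0) : x = 0 := by
  obtain ⟨x, rfl⟩ := Submodule.Quotient.mk_surjective _ x
  rw [← Submodule.Quotient.mk_smul, Submodule.Quotient.mk_eq_zero] at h
  rw [Submodule.Quotient.mk_eq_zero]
  exact (vacuumIdeal_isHClosed g N c).2 x h

theorem VV_torsionFree (x : VV g N c) (h : hh • x = 0) : x = 0 :=
  adicCompletion_torsionFree (tensor_torsionFree (Vac_torsionFree g N c) (Vac_torsionFree g N c)) x h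

theorem toVac_minus (r : ℕ) (i j : Fin N) :
    toVac g N c (PowerSeries.C (FreeAlgebra.ι ℂ (Gen.minus r i j))) = 0 := by
  rw [toVac, Submodule.Quotient.mk_eq_zero, vacuumIdeal, Submodule.mem_sInf]
  exact fun W hW => hW.1 r i j

end TorsionFree

/-! ### Vectors fixed by a map -/

section Extension

variable {g : ClassicalType} {N : ℕ} {c : ℂ}

/-- The vectors `w` for which a map acts on `w ⊗ y` as the identity form an `h`-closed submodule. -/
theorem exists_fixed_submodule (φ : VV g N c →ₗ[Kh] ZSeries (VV g N c)) (y : Vac g N c) :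
    ∃ W : Submodule Kh (Vac g N c), IsHClosed (W : Set (Vac g N c)) ∧
      ∀ w, w ∈ W ↔ φ (tens w y) = ZSeries.const (tens w y) := by
  let τ : Vac g N c →ₗ[Kh] VV g N c := AdicCompletion.of hIdeal _ ∘ₗ (TensorProduct.mk Kh _ _).flip y
  let D : Vac g N c →ₗ[Kh] (ℕ → VV g N c) :=
    (ZSeries (VV g N c)).subtype ∘ₗ φ ∘ₗ τ - LinearMap.single Kh (fun _ : ℕ => VV g N c) 0 ∘ₗ τ
  -- The kernel of a linear map into a separated torsion-free module is h-closed.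
  refine ⟨Submodule.comap D ⊥, (isHClosed_bot ?_ ?_).comap D, fun w => ?_⟩
  · intro x hx
    funext r
    refine VV_separated _ fun K => ?_
    obtain ⟨z, rfl⟩ := hx K
    exact ⟨z r, rfl⟩
  · intro x hx
    funext r
    exact VV_torsionFree g N c _ (congrFun hx r)
  · rw [Submodule.mem_comap, Submodule.mem_bot, LinearMap.sub_apply, sub_eq_zero, Subtype.ext_iff]
    have : (LinearMap.single Kh (fun _ : ℕ => VV g N c) 0) (τ w) = (ZSeries.const (tens w y) : ℕ → VV g N c) := by
      funext r
      rw [LinearMap.single_apply, Pi.single_apply, ZSeries.const]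
      rfl
    rw [LinearMap.comp_apply (LinearMap.single Kh (fun _ : ℕ => VV g N c) 0), this]
    rfl

end Extension


/-! ### Moving `T⁻` to the right of `T⁺` -/

section Coefficients

variable {B σ : Type} [Ring B] [Algebra Kh B] (V : Submodule Kh B)

theorem coeff_map_mul_mem (f : MvPowerSeries σ Kh) {F : MvPowerSeries σ B}
    (hF : ∀ d, MvPowerSeries.coeff d F ∈ V) (d : σ →₀ ℕ) :
    MvPowerSeries.coeff d (MvPowerSeries.map (algebraMap Kh B) f * F) ∈ V := by
  classical
  rw [MvPowerSeries.coeff_mul]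
  refine Submodule.sum_mem _ fun p _ => ?_
  rw [MvPowerSeries.coeff_map, ← Algebra.smul_def]
  exact V.smul_mem _ (hF _)

theorem coeff_mul_map_mem (f : MvPowerSeries σ Kh) {F : MvPowerSeries σ B}
    (hF : ∀ d, MvPowerSeries.coeff d F ∈ V) (d : σ →₀ ℕ) :
    MvPowerSeries.coeff d (F * MvPowerSeries.map (algebraMap Kh B) f) ∈ V := by
  classical
  rw [MvPowerSeries.coeff_mul]
  refine Submodule.sum_mem _ fun p _ => ?_
  rw [MvPowerSeries.coeff_map, ← Algebra.commutes, ← Algebra.smul_def]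
  exact V.smul_mem _ (hF _)

end Coefficients

section Exchange

variable {g : ClassicalType} {N : ℕ} (c : ℂ)

/-- By unitarity the R-matrix on the left of the mixed relation can be inverted. Both R-matrices are
power series in u⁻¹ and v, so each coefficient is a finite combination. -/
theorem relMixed_exchange (hN : Admissible g N) (a b : Fin N × Fin N) (d : Fin 2 →₀ ℕ) :
    toDY g N c (MvPowerSeries.coeff d ((T1m * T2p : Matrix _ _ (MvPowerSeries (Fin 2) (FreeTop N))) a b)) ∈
      Submodule.span Kh {x | ∃ (x' y' : Fin N × Fin N) (d' : Fin 2 →₀ ℕ), x = toDY g N c (MvPowerSeries.coeff d'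
        ((T2p * T1m : Matrix _ _ (MvPowerSeries (Fin 2) (FreeTop N))) x' y'))} := by
  set V := Submodule.span Kh {x | ∃ (x' y' : Fin N × Fin N) (d' : Fin 2 →₀ ℕ), x = toDY g N c (MvPowerSeries.coeff d'
        ((T2p * T1m : Matrix _ _ (MvPowerSeries (Fin 2) (FreeTop N))) x' y'))} with hV
  let f := MvPowerSeries.map (σ := Fin 2) (toDY g N c)
  let L : (Matrix (Fin N × Fin N) (Fin N × Fin N) (MvPowerSeries (Fin 2) Kh)) →
      Matrix (Fin N × Fin N) (Fin N × Fin N) (MvPowerSeries (Fin 2) (DY g N c)) := fun M =>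
    M.map (MvPowerSeries.map (algebraMap Kh (DY g N c)))
  have hL : ∀ M, f.mapMatrix (liftR M) = L M := by
    intro M
    ext x y d
    rfl
  set s₁ : MvPowerSeries (Fin 2) Kh := invSum (MvPowerSeries.X 0) (-MvPowerSeries.X 1 + hSc _ (epsilon g * c / 2)) with h₁
  set s₂ : MvPowerSeries (Fin 2) Kh := invSum (MvPowerSeries.X 0) (-MvPowerSeries.X 1 - hSc _ (epsilon g * c / 2)) with h₂
  have hrel : L (Rbar g N s₁) * f.mapMatrix (T1m * T2p) = f.mapMatrix (T2p * T1m) * L (Rbar g N s₂) := by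
    rw [← hL, ← hL, ← map_mul, ← map_mul, ← sub_eq_zero, ← map_sub, ← mul_assoc]
    ext x y d
    exact toDY_relator g N c (IsRelator.mixed x y d)
  have hinv : L (Rbar g N (-s₁)) * L (Rbar g N s₁) = 1 := by
    have h := Rbar_mul_Rbar_neg (g := g) (s := -s₁) hN (by rw [map_neg, h₁, constantCoeff_invSum (by simp), neg_zero])
    rw [neg_neg] at h
    have h' := congrArg (MvPowerSeries.map (algebraMap Kh (DY g N c))).mapMatrix h
    rw [map_mul, map_one] at h'
    exact h'
  have hT : f.mapMatrix (T1m * T2p) = L (Rbar g N (-s₁)) * (f.mapMatrix (T2p * T1m) * L (Rbar g N s₂)) := by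
    rw [← hrel, ← mul_assoc, hinv, one_mul]
  have h := congrArg (fun X : Matrix _ _ (MvPowerSeries (Fin 2) (DY g N c)) => MvPowerSeries.coeff d (X a b)) hT
  have e : MvPowerSeries.coeff d (f.mapMatrix (T1m * T2p) a b) = toDY g N c (MvPowerSeries.coeff d
      ((T1m * T2p : Matrix _ _ (MvPowerSeries (Fin 2) (FreeTop N))) a b)) := rfl
  rw [← e]
  beta_reduce at h
  rw [h, Matrix.mul_apply, map_sum]
  refine Submodule.sum_mem _ fun x _ => coeff_map_mul_mem V _ (fun d' => ?_) d
  rw [Matrix.mul_apply, map_sum]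
  refine Submodule.sum_mem _ fun y _ => coeff_mul_map_mem V _ (fun d' => ?_) d'
  exact Submodule.subset_span ⟨x, y, d', rfl⟩

end Exchange

/-! ### Density of the vectors generated by `T⁺` -/

section Density

variable {g : ClassicalType} {N : ℕ} {c : ℂ}

/-- The vectors `t_{i_1 j_1}^+ ⋯ t_{i_n j_n}^+ 𝟏`. -/
def plusVectors (g : ClassicalType) (N : ℕ) (c : ℂ) : Set (Vac g N c) :=
  {v | ∃ (n : ℕ) (a b : Fin n → Fin N) (d : Fin n → ℕ), v = tVec g N c a b d}

theorem toDY_smul_toVac (x y : FreeTop N) : toDY g N c x • toVac g N c y = toVac g N c (x * y) := by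
  rw [toVac, toVac, map_mul]
  rfl

theorem tPlus_smul_mem {v : Vac g N c} (hv : v ∈ plusVectors g N c) (r : ℕ) (i j : Fin N) :
    toDY g N c (PowerSeries.coeff r (tPlus 0 i j)) • v ∈ plusVectors g N c := by
  obtain ⟨n, a, b, d, rfl⟩ := hv
  refine ⟨n + 1, Fin.cons i a, Fin.cons j b, Fin.cons r d, ?_⟩
  rw [tVec, tVec, toDY_smul_toVac, List.ofFn_succ, List.prod_cons]
  simp only [Fin.cons_zero, Fin.cons_succ]

theorem coeff_tMinus_zero (r : ℕ) (i j : Fin N) : PowerSeries.coeff (r + 1) (tMinus 0 i j) =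
    hh • PowerSeries.C (FreeAlgebra.ι ℂ (Gen.minus r i j)) := by
  rw [tMinus, PowerSeries.coeff_mk, if_neg (by simp), zero_add, Finset.sum_eq_single_of_mem 0 (by simp)]
  · rw [← pow_one hh, hh_pow_smul]
    ext k
    rw [pow_one]
    rcases k with _ | k
    · simp [PowerSeries.coeff_monomial]
    · simp [PowerSeries.coeff_monomial, PowerSeries.coeff_X]
  · intro k _ hk
    simp [hk]

theorem coeff_tPlus_zero (r : ℕ) (i j : Fin N) : hh • PowerSeries.C (FreeAlgebra.ι ℂ (Gen.plus r i j)) =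
    (if r = 0 ∧ i = j then (1 : FreeTop N) else 0) - PowerSeries.coeff r (tPlus 0 i j) := by
  rw [tPlus, PowerSeries.coeff_mk, sub_sub_cancel, ← pow_one hh, hh_pow_smul, pow_one]
  ext k
  rcases k with _ | k
  · simp
  · rw [PowerSeries.coeff_succ_X_mul, PowerSeries.coeff_mk, PowerSeries.coeff_C, if_neg (Nat.succ_ne_zero k)]
    rcases k with _ | k
    · simp
    · simp

/-- Induction on the number of factors t⁺: the exchange relation moves t⁻ past the first of them,
and on the vacuum only the constant term of t⁻ survives. -/
theorem tMinus_smul_mem (hN : Admissible g N) {v : Vac g N c} (hv : v ∈ plusVectors g N c) (r : ℕ) (i j : Fin N) :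
    toDY g N c (PowerSeries.coeff r (tMinus 0 i j)) • v ∈ Submodule.span Kh (plusVectors g N c) := by
  obtain ⟨n, a, b, d, rfl⟩ := hv
  induction n generalizing r i j with
  | zero =>
    have h1 : tVec g N c a b d ∈ plusVectors g N c := ⟨0, a, b, d, rfl⟩
    rcases r with _ | r
    · have e : PowerSeries.coeff 0 (tMinus 0 i j) = if i = j then (1 : FreeTop N) else 0 := by
        simp [tMinus]
      rw [e]
      split_ifs
      · rw [map_one, one_smul]
        exact Submodule.subset_span h1
      · rw [map_zero, zero_smul]
        exact Submodule.zero_mem _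
    · have e : tVec g N c a b d = toVac g N c 1 := by
        rw [tVec, List.ofFn_zero, List.prod_nil]
      rw [e, toDY_smul_toVac, mul_one, coeff_tMinus_zero]
      have h2 := (toVacLinear g N c).map_smul hh (PowerSeries.C (FreeAlgebra.ι ℂ (Gen.minus r i j)))
      have h3 : toVacLinear g N c (PowerSeries.C (FreeAlgebra.ι ℂ (Gen.minus r i j))) = 0 := toVac_minus g N c r i j
      rw [h3, smul_zero] at h2
      refine Set.mem_of_eq_of_mem h2 ?_
      exact Submodule.zero_mem (Submodule.span Kh (plusVectors g N c))
  | succ n ih =>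
    have e : tVec g N c a b d = toDY g N c (PowerSeries.coeff (d 0) (tPlus 0 (a 0) (b 0))) •
        tVec g N c (fun k => a k.succ) (fun k => b k.succ) (fun k => d k.succ) := by
      rw [tVec, tVec, toDY_smul_toVac, List.ofFn_succ, List.prod_cons]
    rw [e, smul_smul, ← map_mul]
    set w := tVec g N c (fun k => a k.succ) (fun k => b k.succ) (fun k => d k.succ) with hw
    have h := relMixed_exchange (g := g) c hN (i, a 0) (j, b 0) (Finsupp.equivFunOnFinite.symm ![r, d 0])
    rw [T1m, T2p, leg1_mul_leg2, coeff_inVar_mul] at h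
    have hx : ∀ x ∈ Submodule.span Kh {x | ∃ (x' y' : Fin N × Fin N) (d' : Fin 2 →₀ ℕ), x = toDY g N c
        (MvPowerSeries.coeff d' ((T2p * T1m : Matrix _ _ (MvPowerSeries (Fin 2) (FreeTop N))) x' y'))},
        x • w ∈ Submodule.span Kh (plusVectors g N c) := by
      intro x hx
      induction hx using Submodule.span_induction with
      | mem x hx =>
        obtain ⟨x', y', d', rfl⟩ := hx
        rw [T2p, T1m, leg2_mul_leg1, coeff_inVar_mul', map_mul, mul_smul]
        have h4 := ih (d' 0) x'.1 y'.1 (fun k => a k.succ) (fun k => b k.succ) (fun k => d k.succ)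
        rw [← hw] at h4
        generalize toDY g N c (PowerSeries.coeff (d' 0) (tMinus 0 x'.1 y'.1)) • w = u at h4
        induction h4 using Submodule.span_induction with
        | mem v hv => exact Submodule.subset_span (tPlus_smul_mem hv _ _ _)
        | zero => rw [smul_zero]; exact Submodule.zero_mem _
        | add v v' _ _ h h' => rw [smul_add]; exact Submodule.add_mem _ h h'
        | smul k v _ h => rw [smul_comm]; exact Submodule.smul_mem _ k h
      | zero => rw [zero_smul]; exact Submodule.zero_mem _
      | add x x' _ _ h h' => rw [add_smul]; exact Submodule.add_mem _ h h'
      | smul k x _ h => rw [smul_assoc]; exact Submodule.smul_mem _ k h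
    exact hx _ h

/-- The closure is stable under the coefficients of T⁺ and T⁻, hence under the generators, hence
under polynomials in them. It contains the vacuum, and every element of the double Yangian is an
h-adic limit of such polynomials. -/
theorem hClosure_plusVectors (hN : Admissible g N) : hClosure (plusVectors g N c) = ⊤ := by
  set U := hClosure (plusVectors g N c) with hU
  have hUc : IsHClosed (U : Set (Vac g N c)) := isHClosed_hClosure _
  have hspan : Submodule.span Kh (plusVectors g N c) ≤ U := Submodule.span_le.mpr (subset_hClosure _)
  have hstab : ∀ x : DY g N c, (∀ v ∈ plusVectors g N c, x • v ∈ U) → ∀ v ∈ U, x • v ∈ U := by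
    intro x hx v hv
    let f : Vac g N c →ₗ[Kh] Vac g N c :=
      { toFun := fun v => x • v, map_add' := smul_add x, map_smul' := fun k v => smul_comm x k v }
    exact hClosure_le (W := U.comap f) hx (hUc.comap f) hv
  have hplus : ∀ r i j, ∀ v ∈ U, toDY g N c (PowerSeries.coeff r (tPlus 0 i j)) • v ∈ U := fun r i j =>
    hstab _ fun v hv => subset_hClosure _ (tPlus_smul_mem hv r i j)
  have hminus : ∀ r i j, ∀ v ∈ U, toDY g N c (PowerSeries.coeff r (tMinus 0 i j)) • v ∈ U := fun r i j =>
    hstab _ fun v hv => hspan (tMinus_smul_mem hN hv r i j)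
  have hgen : ∀ (γ : Gen N), ∀ v ∈ U, toDY g N c (PowerSeries.C (FreeAlgebra.ι ℂ γ)) • v ∈ U := by
    intro γ v hv
    -- The coefficients of T⁺ and T⁻ involve the generators only multiplied by h, so closedness
    -- under division by h is essential.
    refine hUc.2 _ ?_
    rw [← smul_assoc, ← toDY_smul]
    cases γ with
    | plus r i j =>
      rw [coeff_tPlus_zero, map_sub, sub_smul]
      refine Submodule.sub_mem _ ?_ (hplus r i j v hv)
      split_ifs
      · rwa [map_one, one_smul]
      · rw [map_zero, zero_smul]
        exact Submodule.zero_mem _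
    | minus r i j =>
      rw [← coeff_tMinus_zero]
      exact hminus _ _ _ v hv
  have halg : ∀ (x : FreeAlgebra ℂ (Gen N)), ∀ v ∈ U, toDY g N c (PowerSeries.C x) • v ∈ U := by
    intro x
    induction x using FreeAlgebra.induction with
    | grade0 k =>
      intro v hv
      have e : (PowerSeries.C (algebraMap ℂ (FreeAlgebra ℂ (Gen N)) k) : FreeTop N) = (PowerSeries.C k : Kh) • 1 := by
        rw [algebraMap_FreeTop_mul, PowerSeries.map_C, mul_one]
      rw [e, toDY_smul, map_one, smul_assoc, one_smul]
      exact U.smul_mem _ hv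
    | grade1 γ => exact hgen γ
    | mul x y hx hy =>
      intro v hv
      rw [map_mul, map_mul, mul_smul]
      exact hx _ (hy v hv)
    | add x y hx hy =>
      intro v hv
      rw [map_add, map_add, add_smul]
      exact Submodule.add_mem _ (hx v hv) (hy v hv)
  have hone : toVac g N c 1 ∈ U := subset_hClosure _ ⟨0, Fin.elim0, Fin.elim0, Fin.elim0, by
    rw [tVec, List.ofFn_zero, List.prod_nil]⟩
  rw [eq_top_iff]
  rintro v -
  obtain ⟨v, rfl⟩ := Submodule.Quotient.mk_surjective _ v
  obtain ⟨x, rfl⟩ := toDY_surjective g N c v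
  -- Truncation at h^K: the polynomial part acts within the closure, and the tail is divisible by
  -- h^K.
  refine hUc.1 _ fun K => ?_
  refine ⟨toVacLinear g N c (∑ k ∈ Finset.range K, hh ^ k • PowerSeries.C (PowerSeries.coeff k x)), ?_,
    toVacLinear g N c (PowerSeries.mk fun k => PowerSeries.coeff (k + K) x), ?_⟩
  · rw [SetLike.mem_coe, map_sum]
    refine Submodule.sum_mem _ fun k _ => ?_
    rw [map_smul]
    refine Submodule.smul_mem _ _ ?_
    have h := halg (PowerSeries.coeff k x) _ hone
    rw [toDY_smul_toVac, mul_one] at h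
    exact h
  · rw [← map_smul, ← map_add]
    refine congrArg (toVac g N c) ?_
    ext k
    rw [map_add, map_sum, hh_pow_smul, PowerSeries.coeff_X_pow_mul']
    simp only [hh_pow_smul, PowerSeries.coeff_X_pow_mul', PowerSeries.coeff_C, PowerSeries.coeff_mk]
    by_cases hk : K ≤ k
    · rw [if_pos hk, Nat.sub_add_cancel hk, Finset.sum_eq_zero, zero_add]
      intro l hl
      rw [Finset.mem_range] at hl
      rw [if_pos (by omega), if_neg (by omega)]
    · rw [if_neg hk, add_zero, Finset.sum_eq_single_of_mem k (by simpa using hk)]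
      · simp
      · intro l _ hl
        split_ifs
        · omega
        · rfl
        · rfl

end Density


/-! ### Passage to arbitrary vectors and conclusion -/

section Main

variable {g : ClassicalType} {N : ℕ}

/-- A map which acts as the identity on `t^+ ⋯ t^+ 𝟏 ⊗ y` acts as the identity on `w ⊗ y` for all `w`. -/
theorem fixed_of_plusVectors {c : ℂ} (hN : Admissible g N) {φ : VV g N c →ₗ[Kh] ZSeries (VV g N c)}
    {y : Vac g N c} (h : ∀ (n : ℕ) (a b : Fin n → Fin N) (d : Fin n → ℕ),
      φ (tens (tVec g N c a b d) y) = ZSeries.const (tens (tVec g N c a b d) y)) (w : Vac g N c) :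
    φ (tens w y) = ZSeries.const (tens w y) := by
  obtain ⟨W, hW, hWφ⟩ := exists_fixed_submodule φ y
  rw [← hWφ]
  have h1 : hClosure (plusVectors g N c) ≤ W := by
    refine hClosure_le ?_ hW
    rintro _ ⟨n, a, b, d, rfl⟩
    exact (hWφ _).mpr (h n a b d)
  exact h1 (by rw [hClosure_plusVectors hN]; trivial)

/-- This covers ρ in both parts: part (a) with w = 𝕋_[n]⁺, part (b) with m = N. -/
theorem rho_fused (hN : Admissible g N)
    {ρ : VV g N (critLevel g N) →ₗ[Kh] ZSeries (VV g N (critLevel g N))}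
    (hρ : IsRho g N (critLevel g N) ρ) {m : ℕ} (hm : m ≤ maxFusion g N) (w : Vac g N (critLevel g N)) (r : ℕ) :
    ρ (tens w (fusedGen g N _ m r)) = ZSeries.const (tens w (fusedGen g N _ m r)) :=
  fixed_of_plusVectors hN (fun _ a b d => rho_tVec_fused hN hρ hm a b d r) w

end Main
end DYang

theorem lemma3p9 :
    (∀ (g : DYang.ClassicalType) (N : ℕ), DYang.Admissible g N →
      ∀ n m : ℕ, 1 ≤ n → n ≤ DYang.maxFusion g N → 1 ≤ m → m ≤ DYang.maxFusion g N →
      ∀ r s : ℕ,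
        (∀ σ, DYang.IsSigma g N (DYang.critLevel g N) σ →
          σ (DYang.tens (DYang.fusedGen g N _ n r) (DYang.fusedGen g N _ m s)) =
            DYang.ZSeries.const
              (DYang.tens (DYang.fusedGen g N _ n r) (DYang.fusedGen g N _ m s))) ∧
        (∀ ρ, DYang.IsRho g N (DYang.critLevel g N) ρ →
          ρ (DYang.tens (DYang.fusedGen g N _ n r) (DYang.fusedGen g N _ m s)) =
            DYang.ZSeries.const
              (DYang.tens (DYang.fusedGen g N _ n r) (DYang.fusedGen g N _ m s)))) ∧
    (∀ N : ℕ, 2 ≤ N → ∀ (w : DYang.Vac .gl N (DYang.critLevel .gl N)) (r : ℕ),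
        (∀ σ, DYang.IsSigma .gl N (DYang.critLevel .gl N) σ →
          σ (DYang.tens w (DYang.fusedGen .gl N _ N r)) =
            DYang.ZSeries.const (DYang.tens w (DYang.fusedGen .gl N _ N r))) ∧
        (∀ ρ, DYang.IsRho .gl N (DYang.critLevel .gl N) ρ →
          ρ (DYang.tens w (DYang.fusedGen .gl N _ N r)) =
            DYang.ZSeries.const (DYang.tens w (DYang.fusedGen .gl N _ N r)))) := by
  refine ⟨fun g N hN n m _ hn _ hm r s => ⟨fun σ hσ => ?_, fun ρ hρ => ?_⟩, fun N hN w r => ⟨fun σ hσ => ?_, fun ρ hρ => ?_⟩⟩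
  · exact DYang.sigma_fused hN hσ hn hm r s
  · exact DYang.rho_fused hN hρ hm _ s
  · exact DYang.fixed_of_plusVectors (g := .gl) hN (fun _ a b d => DYang.sigma_tVec_top hN hσ a b d r) w
  · exact DYang.rho_fused (g := .gl) hN hρ le_rfl w r
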